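/- Fix $p>9/2$, $a\ge 0$ and a finite set $\mathcal J\subset\mathbb Z$ with $\#\mathcal J\ge 3$. For $c>0$ put $h=c^{-2}$, $\langle j\rangle=\max(1,|j|)$, $\mathtt w_j=\sqrt{1+j^2/c^2}$, $\lambda_j=c\sqrt{c^2+j^2}$, $\nu_j=\nu_j(h)=\frac{j^2}{1+\sqrt{1+hj^2}}$. For $q\ge0$, $\beta\in[0,1]$ let $\mathcal P^{a,q,\beta}$ be the space of pairs $(z,\bar z)$ of complex sequences indexed by $\mathbb Z$ ($\bar z$ being a variable independent of $z$) with $$\|(z,\bar z)\|_{a,q,\beta}^2=\sum_{j\in\mathbb Z}e^{2a|j|}\langle j\rangle^{2q}\mathtt w_j^{2\beta}\big(|z_j|^2+|\bar z_j|^2\big)<\infty ,$$ let $B_{a,q,\beta}(R)$ be its open ball of radius $R$ centred at $0$, and omit the index $\beta$ when $\beta=0$ (then nothing depends on $c$). Write $\psi(x)=\frac1{\sqrt{2\pi}}\sum_j z_je^{ijx}$, $\bar\psi(x)=\frac1{\sqrt{2\pi}}\sum_j\bar z_je^{-ijx}$, and let $\langle\nabla\rangle_c$ be the Fourier multiplier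 with symbol $\sqrt{c^2+j^2}$. Consider the Klein--Gordon and NLS Hamiltonians $$H=\Lambda+\frac1{16}\int_{-\pi}^{\pi}\Big[\big(\tfrac{\langle\nabla\rangle_c}{c}\big)^{-1/2}(\psi+\bar\psi)\Big]^4dx,\qquad \Lambda=\sum_j\lambda_jz_j\bar z_j,$$ $$H^{\mathtt{NLS}}=\Lambda^{\mathtt{NLS}}+\frac38\int_{-\pi}^{\pi}\psi^2\bar\psi^2dx,\qquad \Lambda^{\mathtt{NLS}}=\sum_j\frac{j^2}{2}z_j\bar z_j .$$ A Hamiltonian is a complex-valued analytic function on a ball $B_{a,q}(R)$; its vector field is $X_F=\big((-i\,\partial F/\partial\bar z_j)_j,(i\,\partial F/\partial z_j)_j\big)$. $F$ is Gauge (resp. translation) invariant if it is invariant under $(z_j,\bar z_j)\mapsto(e^{-i\alpha}z_j,e^{i\alpha}\bar z_j)$ (resp. $(z_j,\bar z_j)\mapsto(e^{-ij\alpha}z_j,e^{ij\alpha}\bar z_j)$) for all $\alpha\in\mathbb R$, and $\Pi_{\mathcal G}F$ is the average of $F$ over the Gauge action, $\alpha\in[0,2\pi]$. $\Pi^\perp_{\mathcal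 J}$ sets to zero the components with index in $\mathcal J$. A real analytic canonical transformation is an analytic diffeomorphism onto an open image that preserves the symplectic form (proportional to $\sum_j dz_j\wedge d\bar z_j$) and maps points where $\bar z$ is the complex conjugate of $z$ to points with the same property. Finally let $$N_{ij}=\frac{3}{8\pi}(2-\delta_{ij}),\qquad \Lambda_+=\frac12\sum_{i\text{ or }j\in\mathcal J}\frac{N_{ij}}{(1+h\nu_j)(1+h\nu_i)}z_i\bar z_iz_j\bar z_j,\qquad \Lambda_+^{\mathtt{NLS}}=\frac12\sum_{i\text{ or }j\in\mathcal J}N_{ij}z_i\bar z_iz_j\bar z_j .$$ **Theorem.** There exist $h_*\in(0,1)$, $R_*>0$ and $C>0$ such that for every $R\in(0,R_*)$ there are a map $\mathcal T_0^{\mathtt{NLS}}$ and Hamiltonians $\hat P^{\mathtt{NLS}},P_0^{\mathtt{NLS}}$, independent of $h$, and for every $h\in(0,h_*)$ there are a map $\mathcal T_0$ and Hamiltonians $\hat P,P_0,\hat P^{\mathcal{NG}},P_0^{\mathcal{NG}},\hat P^R,P_0^R$, with the following properties for both $q=p$ and $q=p-4$. All these Hamiltonians, and $\Lambda_+,\Lambda_+^{\mathtt{NLS}}$,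 are analytic on $B_{a,q}(R)$; $\Lambda_+,\hat P,P_0,\Lambda_+^{\mathtt{NLS}},\hat P^{\mathtt{NLS}},P_0^{\mathtt{NLS}}$ are translation invariant, and the last three are also Gauge invariant. The maps $$\mathcal T_0:B_{a,q,\beta}(R)\to B_{a,q,\beta}(2R)\quad(\text{every }\beta\in[0,1]),\qquad \mathcal T_0^{\mathtt{NLS}}:B_{a,q}(R)\to B_{a,q}(2R)$$ are real analytic canonical transformations. On $B_{a,q}(R)$ $$H\circ\mathcal T_0=\Lambda+\Lambda_++\hat P+P_0,\qquad H^{\mathtt{NLS}}\circ\mathcal T_0^{\mathtt{NLS}}=\Lambda^{\mathtt{NLS}}+\Lambda_+^{\mathtt{NLS}}+\hat P^{\mathtt{NLS}}+P_0^{\mathtt{NLS}},$$ where the second identity holds at every point of $B_{a,q}(R)$ such that the series $\Lambda^{\mathtt{NLS}}$ converges absolutely at that point and at its image under $\mathcal T_0^{\mathtt{NLS}}$; this is so at all points of $B_{a,p}(R)$. Moreover: (a) $\displaystyle\sup_{B_{a,q}(R)}\|\mathcal T_0-\mathrm{id}\|_{a,q,1}\le CR^3$, $\displaystyle\sup_{B_{a,q}(R)}\|\mathcal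 T_0^{\mathtt{NLS}}-\mathrm{id}\|_{a,q}\le CR^3$, $\displaystyle\sup_{B_{a,p}(R)}\|\mathcal T_0-\mathcal T_0^{\mathtt{NLS}}\|_{a,p-4}\le ChR^3$. (b) $\displaystyle\sup_{B_{a,q}(R)}\|X_{\Lambda_+}\|_{a,q,1}\le CR^3$, $\displaystyle\sup_{B_{a,q}(R)}\|X_{\Lambda_+^{\mathtt{NLS}}}\|_{a,q}\le CR^3$, $\displaystyle\sup_{B_{a,p}(R)}\|X_{\Lambda_+-\Lambda_+^{\mathtt{NLS}}}\|_{a,p-2}\le ChR^3$. (c) On $B_{a,q}(R)$: $|\hat P(z,\bar z)|\le C\|\Pi^\perp_{\mathcal J}(z,\bar z)\|_{a,q}^4$ and $|P_0(z,\bar z)|\le C\|(z,\bar z)\|_{a,q}^6$; $\hat P=\hat P^{\mathtt{NLS}}+\hat P^{\mathcal{NG}}+\hat P^R$ and $P_0=P_0^{\mathtt{NLS}}+P_0^{\mathcal{NG}}+P_0^R$; $\Pi_{\mathcal G}\hat P^{\mathcal{NG}}=0$ and $\Pi_{\mathcal G}P_0^{\mathcal{NG}}=0$; and $$\sup_{B_{a,q}(R)}\|X_{P_0}\|_{a,q,1}\le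 CR^5,\quad \sup_{B_{a,q}(R)}\|X_{P_0^{\mathcal{NG}}}\|_{a,q}\le CR^5,\quad \sup_{B_{a,q}(R)}\|X_{P_0^{\mathtt{NLS}}}\|_{a,q}\le CR^5,$$ $$\sup_{B_{a,q}(R)}\|X_{\hat P}\|_{a,q,1}\le CR^3,\quad \sup_{B_{a,q}(R)}\|X_{\hat P^{\mathcal{NG}}}\|_{a,q}\le CR^3,\quad \sup_{B_{a,q}(R)}\|X_{\hat P^{\mathtt{NLS}}}\|_{a,q}\le CR^3,$$ $$\sup_{B_{a,p}(R)}\|X_{P_0^R}\|_{a,p-4}\le ChR^5,\qquad \sup_{B_{a,p}(R)}\|X_{\hat P^R}\|_{a,p-4}\le ChR^3 .$$ The constant $C$ depends only on $a,p,\mathcal J$ (not on $h$, $R$, $\beta$). -/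

import Mathlib

noncomputable section

namespace KGNormalForm

/-! ### Phase space -/

/-- A pair of sequences `(z, z̄)`; the second component is an independent variable. -/
abbrev Pt : Type := (ℤ → ℂ) × (ℤ → ℂ)

/-- `𝚠_j = √(1 + j²/c²)`. -/
def ww (c : ℝ) (j : ℤ) : ℝ := √(1 + (j : ℝ) ^ 2 / c ^ 2)

/-- `⟨j⟩ = max (1, |j|)`. -/
def jap (j : ℤ) : ℝ := max 1 |(j : ℝ)|

/-- The weight `e^{a|j|} ⟨j⟩^q 𝚠_j^β`. -/
def wt (a q β c : ℝ) (j : ℤ) : ℝ :=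
  Real.exp (a * |(j : ℝ)|) * jap j ^ q * ww c j ^ β

theorem wt_pos (a q β c : ℝ) (j : ℤ) : 0 < wt a q β c j := by
  have h1 : 0 < jap j := lt_of_lt_of_le one_pos (le_max_left _ _)
  have h2 : 0 < ww c j := Real.sqrt_pos.mpr (by positivity)
  unfold wt
  positivity

/-- For `β = 0` the weights do not depend on `c`. -/
theorem wt_zero (a q c c' : ℝ) (j : ℤ) : wt a q 0 c j = wt a q 0 c' j := by
  simp [wt]

theorem memlp_iff (ω : ℤ → ℝ) (z : ℤ → ℂ) :
    Memℓp (fun j => (ω j : ℂ) * z j) 2 ↔ Summable (fun j => ω j ^ 2 * ‖z j‖ ^ 2) := by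
  rw [memℓp_gen_iff (by norm_num)]
  simp [mul_pow]

/-- The phase space `𝒫^{a,q,β} = ℓ^{a,q,β} × ℓ^{a,q,β}` as a space of pairs of sequences.
For `β = 0` it does not depend on `c`. -/
def phaseSub (a q β c : ℝ) : Submodule ℂ Pt where
  carrier := {x | Summable (fun j => wt a q β c j ^ 2 * ‖x.1 j‖ ^ 2) ∧
    Summable (fun j => wt a q β c j ^ 2 * ‖x.2 j‖ ^ 2)}
  zero_mem' := by simp [summable_zero]
  add_mem' := by
    rintro x y ⟨h1, h2⟩ ⟨h3, h4⟩
    simp only [← memlp_iff] at h1 h2 h3 h4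
    simp only [Set.mem_ofPred_eq, ← memlp_iff]
    refine ⟨?_, ?_⟩
    · convert h1.add h3 using 1
      funext j
      simp [mul_add]
    · convert h2.add h4 using 1
      funext j
      simp [mul_add]
  smul_mem' := by
    rintro k x ⟨h1, h2⟩
    simp only [← memlp_iff] at h1 h2
    simp only [Set.mem_ofPred_eq, ← memlp_iff]
    refine ⟨?_, ?_⟩
    · convert h1.const_smul k using 1
      funext j
      simp [mul_left_comm]
    · convert h2.const_smul k using 1
      funext j
      simp [mul_left_comm]

/-- The norm `‖(z, z̄)‖_{a,q,β}` (meaningful on `phaseSub a q β c`). -/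
def phaseNorm (a q β c : ℝ) (x : Pt) : ℝ :=
  √(∑' j, wt a q β c j ^ 2 * ‖x.1 j‖ ^ 2 + ∑' j, wt a q β c j ^ 2 * ‖x.2 j‖ ^ 2)

/-- The phase space as a type of its own, carrying the norm `phaseNorm` (see
`Phase.norm_eq`) instead of the topology of pointwise convergence. -/
def Phase (a q β c : ℝ) : Type := ↥(phaseSub a q β c)

instance (a q β c : ℝ) : AddCommGroup (Phase a q β c) :=
  inferInstanceAs (AddCommGroup ↥(phaseSub a q β c))

instance (a q β c : ℝ) : Module ℂ (Phase a q β c) :=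
  inferInstanceAs (Module ℂ ↥(phaseSub a q β c))

/-- The underlying pair of sequences. -/
def Phase.val {a q β c : ℝ} (x : Phase a q β c) : Pt := Subtype.val x

/-- A pair of sequences that lies in the phase space, as a point of it. -/
def Phase.mk {a q β c : ℝ} (x : Pt) (hx : x ∈ phaseSub a q β c) : Phase a q β c := ⟨x, hx⟩

/-- Multiplication by the weights, into the unweighted `ℓ² × ℓ²`. -/
def toL2 (a q β c : ℝ) : Phase a q β c →ₗ[ℂ]
    WithLp 2 (lp (fun _ : ℤ => ℂ) 2 × lp (fun _ : ℤ => ℂ) 2) where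
  toFun x := WithLp.toLp 2
    (⟨fun j => (wt a q β c j : ℂ) * x.val.1 j, (memlp_iff _ _).2 x.2.1⟩,
      ⟨fun j => (wt a q β c j : ℂ) * x.val.2 j, (memlp_iff _ _).2 x.2.2⟩)
  map_add' x y := by
    apply (WithLp.equiv 2 _).injective
    refine Prod.ext (Subtype.ext (funext fun j => ?_)) (Subtype.ext (funext fun j => ?_))
    · exact mul_add _ _ _
    · exact mul_add _ _ _
  map_smul' k x := by
    apply (WithLp.equiv 2 _).injective
    refine Prod.ext (Subtype.ext (funext fun j => ?_)) (Subtype.ext (funext fun j => ?_))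
    · exact mul_left_comm _ _ _
    · exact mul_left_comm _ _ _

theorem toL2_injective (a q β c : ℝ) : Function.Injective (toL2 a q β c) := by
  intro x y hxy
  have h0 : ∀ j, (wt a q β c j : ℂ) ≠ 0 := fun j => by
    exact_mod_cast (wt_pos a q β c j).ne'
  have h1 := congrArg (fun u => (u.fst : ℤ → ℂ)) hxy
  have h2 := congrArg (fun u => (u.snd : ℤ → ℂ)) hxy
  refine Subtype.ext (Prod.ext (funext fun j => ?_) (funext fun j => ?_))
  · exact mul_left_cancel₀ (h0 j) (congrFun h1 j)
  · exact mul_left_cancel₀ (h0 j) (congrFun h2 j)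

instance (a q β c : ℝ) : NormedAddCommGroup (Phase a q β c) :=
  NormedAddCommGroup.induced _ _ (toL2 a q β c) (toL2_injective a q β c)

instance (a q β c : ℝ) : NormedSpace ℂ (Phase a q β c) :=
  NormedSpace.induced ℂ _ _ (toL2 a q β c)

theorem Phase.norm_eq {a q β c : ℝ} (x : Phase a q β c) :
    ‖x‖ = phaseNorm a q β c x.val := by
  have key : ∀ f : lp (fun _ : ℤ => ℂ) 2, ‖f‖ ^ 2 = ∑' j, ‖f j‖ ^ 2 := fun f => by
    have := lp.norm_rpow_eq_tsum (p := 2) (by norm_num) f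
    simpa using this
  have h : ‖x‖ = ‖toL2 a q β c x‖ := rfl
  rw [h, WithLp.prod_norm_eq_of_L2, key, key]
  simp [phaseNorm, toL2, mul_pow]

/-- The open ball `B_{a,q,β}(R)` centred at the origin. -/
def Ball (a q β c R : ℝ) : Set Pt := {x | x ∈ phaseSub a q β c ∧ phaseNorm a q β c x < R}

/-- `y` lies in `𝒫^{a,q,β}` and `‖y‖_{a,q,β} ≤ r`. -/
def NormLE (a q β c : ℝ) (y : Pt) (r : ℝ) : Prop :=
  y ∈ phaseSub a q β c ∧ phaseNorm a q β c y ≤ r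

/-- The norm `‖·‖_{a,q} = ‖·‖_{a,q,0}`; it does not depend on `c`, which is set to `1`. -/
abbrev phaseNorm₀ (a q : ℝ) (x : Pt) : ℝ := phaseNorm a q 0 1 x

/-- The ball `B_{a,q}(R) = B_{a,q,0}(R)`. -/
abbrev Ball₀ (a q R : ℝ) : Set Pt := Ball a q 0 1 R

/-- `y` lies in `𝒫^{a,q}` and `‖y‖_{a,q} ≤ r`. -/
abbrev NormLE₀ (a q : ℝ) (y : Pt) (r : ℝ) : Prop := NormLE a q 0 1 y r

/-- The projector `Π_𝒥^⊥`. -/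
def projPerp (J : Finset ℤ) (x : Pt) : Pt :=
  (fun j => if j ∈ J then 0 else x.1 j, fun j => if j ∈ J then 0 else x.2 j)

/-! ### Hamiltonian formalism -/

/-- `∂F/∂z_j`. -/
def dz (F : Pt → ℂ) (j : ℤ) (x : Pt) : ℂ :=
  deriv (fun t : ℂ => F (x.1 + Pi.single j t, x.2)) 0

/-- `∂F/∂z̄_j`. -/
def dzbar (F : Pt → ℂ) (j : ℤ) (x : Pt) : ℂ :=
  deriv (fun t : ℂ => F (x.1, x.2 + Pi.single j t)) 0

/-- The Hamiltonian vector field `X_F = (-i ∂F/∂z̄_j, i ∂F/∂z_j)_j`. -/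
def hamVF (F : Pt → ℂ) (x : Pt) : Pt :=
  (fun j => -Complex.I * dzbar F j x, fun j => Complex.I * dz F j x)

/-- `F` is an analytic function on `B_{a,q}(R) ⊆ 𝒫^{a,q}`. -/
def IsHamiltonian (a q R : ℝ) (F : Pt → ℂ) : Prop :=
  AnalyticOnNhd ℂ (fun x : Phase a q 0 1 => F x.val) (Metric.ball 0 R)

/-- The Gauge flow `φ_𝒩^α`. -/
def gaugeFlow (α : ℝ) (x : Pt) : Pt :=
  (fun j => Complex.exp (-(Complex.I * α)) * x.1 j, fun j => Complex.exp (Complex.I * α) * x.2 j)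

/-- The translation flow `φ_ℳ^α`. -/
def translFlow (α : ℝ) (x : Pt) : Pt :=
  (fun j => Complex.exp (-(Complex.I * j * α)) * x.1 j,
    fun j => Complex.exp (Complex.I * j * α) * x.2 j)

def GaugeInvariantOn (U : Set Pt) (F : Pt → ℂ) : Prop :=
  ∀ α : ℝ, ∀ x ∈ U, F (gaugeFlow α x) = F x

def TranslInvariantOn (U : Set Pt) (F : Pt → ℂ) : Prop :=
  ∀ α : ℝ, ∀ x ∈ U, F (translFlow α x) = F x

/-- The Gauge invariant part `Π_𝒢 F`. -/
def gaugePart (F : Pt → ℂ) (x : Pt) : ℂ :=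
  (1 / (2 * Real.pi) : ℝ) * ∫ α in (0 : ℝ)..(2 * Real.pi), F (gaugeFlow α x)

/-- The symplectic form, up to the constant factor that plays no role in its invariance. -/
def sympl (u v : Pt) : ℂ := ∑' j, (u.1 j * v.2 j - u.2 j * v.1 j)

open Classical in
/-- A map of pairs of sequences, read as a map of `𝒫^{a,q,β}` to itself. -/
def lift (a q β c : ℝ) (T : Pt → Pt) (x : Phase a q β c) : Phase a q β c :=
  if hx : T x.val ∈ phaseSub a q β c then Phase.mk (T x.val) hx else 0

/-- `T` is a real analytic canonical transformation `B_{a,q,β}(R) → B_{a,q,β}(2R)`: an analytic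
diffeomorphism onto an open image, which preserves the symplectic form, and preserves the
real subspace where `z̄` is the complex conjugate of `z`. -/
structure IsCanonicalMap (a q β c R : ℝ) (T : Pt → Pt) : Prop where
  mapsTo : Set.MapsTo T (Ball a q β c R) (Ball a q β c (2 * R))
  analytic : AnalyticOnNhd ℂ (lift a q β c T) (Metric.ball 0 R)
  isOpen_image : IsOpen (lift a q β c T '' Metric.ball 0 R)
  inverse : ∃ S : Phase a q β c → Phase a q β c,
    AnalyticOnNhd ℂ S (lift a q β c T '' Metric.ball 0 R) ∧
    ∀ x ∈ Metric.ball (0 : Phase a q β c) R, S (lift a q β c T x) = x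
  symplectic : ∀ x ∈ Metric.ball (0 : Phase a q β c) R, ∀ u v : Phase a q β c,
    sympl (fderiv ℂ (lift a q β c T) x u).val (fderiv ℂ (lift a q β c T) x v).val =
      sympl u.val v.val
  real : ∀ x ∈ Ball a q β c R, (∀ j, x.2 j = star (x.1 j)) → ∀ j, (T x).2 j = star ((T x).1 j)

/-! ### The Hamiltonians -/

/-- `ψ(θ) = ∑ z_j e^{ijθ} / √(2π)`. -/
def psi (x : Pt) (θ : ℝ) : ℂ :=
  ∑' j : ℤ, x.1 j * Complex.exp (Complex.I * j * θ) / (√(2 * Real.pi) : ℝ)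

/-- `ψ̄(θ) = ∑ z̄_j e^{-ijθ} / √(2π)`. -/
def psibar (x : Pt) (θ : ℝ) : ℂ :=
  ∑' j : ℤ, x.2 j * Complex.exp (-(Complex.I * j * θ)) / (√(2 * Real.pi) : ℝ)

/-- The Fourier multiplier `(⟨∇⟩_c / c)^{-1/2}`, whose symbol is `𝚠_j^{-1/2}`. -/
def smoothing (c : ℝ) (x : Pt) : Pt :=
  (fun j => (ww c j ^ (-(1 / 2) : ℝ) : ℝ) * x.1 j, fun j => (ww c j ^ (-(1 / 2) : ℝ) : ℝ) * x.2 j)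

/-- `λ_j = c √(j² + c²)`. -/
def lam (c : ℝ) (j : ℤ) : ℝ := c * √((j : ℝ) ^ 2 + c ^ 2)

/-- `λ_j^NLS = j²/2`. -/
def lamNLS (j : ℤ) : ℝ := (j : ℝ) ^ 2 / 2

/-- `Λ = ∫ ψ̄ c⟨∇⟩_c ψ = ∑ λ_j z_j z̄_j`. -/
def Lam (c : ℝ) (x : Pt) : ℂ := ∑' j, (lam c j : ℂ) * (x.1 j * x.2 j)

/-- `Λ^NLS = ½ ∫ ψ_x ψ̄_x = ∑ λ_j^NLS z_j z̄_j`. -/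
def LamNLS (x : Pt) : ℂ := ∑' j, (lamNLS j : ℂ) * (x.1 j * x.2 j)

/-- The Klein-Gordon Hamiltonian
`∫ ψ̄ c⟨∇⟩_c ψ + 1/16 ∫ [(⟨∇⟩_c / c)^{-1/2} (ψ + ψ̄)]⁴`. -/
def HKG (c : ℝ) (x : Pt) : ℂ :=
  Lam c x + 1 / 16 * ∫ θ in (-Real.pi)..Real.pi,
    (psi (smoothing c x) θ + psibar (smoothing c x) θ) ^ 4

/-- The NLS Hamiltonian `½ ∫ ψ_x ψ̄_x + 3/8 ∫ ψ² ψ̄²`. -/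
def HNLS (x : Pt) : ℂ :=
  LamNLS x + 3 / 8 * ∫ θ in (-Real.pi)..Real.pi, psi x θ ^ 2 * psibar x θ ^ 2

/-- The series that defines `Λ^NLS` converges absolutely at `x`. -/
def NLSDefined (x : Pt) : Prop := Summable (fun j => (lamNLS j : ℂ) * (x.1 j * x.2 j))

/-- `ν_j(h) = j² / (1 + √(1 + h j²))`. -/
def nu (h : ℝ) (j : ℤ) : ℝ := (j : ℝ) ^ 2 / (1 + √(1 + h * (j : ℝ) ^ 2))

/-- `N_{ij} = 3/(8π) (2 - δ_{ij})`. -/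
def Ncoef (i j : ℤ) : ℝ := 3 / (8 * Real.pi) * (2 - if i = j then 1 else 0)

/-- `Λ₊ = ½ ∑_{i or j ∈ 𝒥} N_{ij} / ((1 + hν_j)(1 + hν_i)) z_i z̄_i z_j z̄_j`. -/
def LamPlus (J : Finset ℤ) (h : ℝ) (x : Pt) : ℂ :=
  1 / 2 * ∑' ij : ℤ × ℤ, if ij.1 ∈ J ∨ ij.2 ∈ J then
    ((Ncoef ij.1 ij.2 / ((1 + h * nu h ij.2) * (1 + h * nu h ij.1)) : ℝ) : ℂ) *
      (x.1 ij.1 * x.2 ij.1 * x.1 ij.2 * x.2 ij.2) else 0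

/-- `Λ₊^NLS = ½ ∑_{i or j ∈ 𝒥} N_{ij} z_i z̄_i z_j z̄_j`. -/
def LamPlusNLS (J : Finset ℤ) (x : Pt) : ℂ :=
  1 / 2 * ∑' ij : ℤ × ℤ, if ij.1 ∈ J ∨ ij.2 ∈ J then
    (Ncoef ij.1 ij.2 : ℂ) * (x.1 ij.1 * x.2 ij.1 * x.1 ij.2 * x.2 ij.2) else 0

end KGNormalForm

end

open KGNormalForm

/-! ### Implicit midpoint maps of cubic Hamiltonian fields on a Banach space -/

noncomputable section
namespace KGNormalForm
open scoped ENNReal NNReal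

/-! Both normal forms are one Birkhoff step, but the transformation is not the time-one flow of the
generating Hamiltonian `χ`. It is the implicit midpoint rule: with `X` the cubic Hamiltonian field
of `χ`, solve `m - X(m)/2 = x` and put `T(x) = m + X(m)/2`. For small radius, `m ↦ m ± X(m)/2` are
small Lipschitz perturbations of the identity, so `T` is an analytic diffeomorphism onto an open
image. Its derivative is the Cayley transform `(1 + A)(1 - A)⁻¹` of `A = DX(m)/2`, which is
infinitesimally symplectic, so `T` is canonical (`symplectic_midpoint`).

The gain is that the homological equation holds without a series. For a quadratic `Λ`, the
difference `Λ(m + X/2) - Λ(m - X/2)` equals `dΛ(m)[X(m)]` exactly. Let `P` be the quartic part of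
the Hamiltonian and `Q` its nonresonant part, made of the monomials which have an index in `𝒥` and
are not of the form `z_i z̄_i z_j z̄_j`. Taking for `χ` the coefficients of `Q` times `i` over the
divisors gives `Λ(T x) = Λ(x) - Q(m)` (`diagHam_midpoint`). Hence `H ∘ T = Λ + (P - Q) + [(P ∘ T -
P) - (Q ∘ m - Q)]`. The resonant part of `P - Q` is `Λ₊` (`poly_res`), the rest avoids `𝒥` and is
`P̂`, and the bracket `remd` is `P₀`, of order six because `T` and `m` differ from the identity by
cubic terms. Invariances and reality pass to `T` because the midpoint equation has a unique solution
in the ball (`midPt_equivariant`).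

Divisors. At zero charge, vanishing momentum makes the divisor a difference of values of a convex
function over two pairs of integers with the same midpoint. It is bounded below by one second
difference near `𝒥` (`convex_divisor`), and for NLS it is the product `(a - b)(a - e)` of nonzero
integers. At nonzero charge the Klein-Gordon divisor is at least `c²/2`, provided that `c` is large
compared with `𝒥` (`divisor_lam_of_charge`).

Estimates. Polynomials are given by kernels supported on vanishing momentum. The exponential weights
are submultiplicative there, one factor carries `⟨j⟩^q` in `ℓ²`, and the two others lie in `ℓ¹` when
`q > 1/2`. A Young inequality then bounds the cubic fields (`tsum_absTri_le`). The four factors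
`𝚠^{-1/2}` of Klein-Gordon gain one power of `𝚠` in the output (`vc_prod_le`), which gives the range
`β ∈ [0, 1]`.

Comparison. The factors `𝚠^{-1/2}` are `1 + O(h j²)`, and `λ_j = c² + j²/2 + O(h j⁴)`, where `c²`
cancels at zero charge. At nonzero charge the Klein-Gordon generator is itself `O(h)`. So the two
generators differ by `O(h)` with a loss of four derivatives (`kernelBound_chi_sub`). As `p - 4 >
1/2`, the linear equations for differences of maps and of fields can be solved at regularity `p -
4`. -/

theorem analyticAt_clm_apply {E F G : Type*} [NormedAddCommGroup E] [NormedSpace ℂ E]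
    [NormedAddCommGroup F] [NormedSpace ℂ F] [NormedAddCommGroup G] [NormedSpace ℂ G]
    {f : E → F →L[ℂ] G} {g : E → F} {x : E} (hf : AnalyticAt ℂ f x) (hg : AnalyticAt ℂ g x) :
    AnalyticAt ℂ (fun y => f y (g y)) x :=
  ((ContinuousLinearMap.id ℂ (F →L[ℂ] G)).analyticAt_bilinear (f x, g x)).comp₂ hf hg

/-- A symmetric trilinear map which is skew-symmetric for a bilinear form, that is, the
polarization of a cubic Hamiltonian vector field. -/
structure SymplField (E : Type*) [NormedAddCommGroup E] [NormedSpace ℂ E] where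
  τ : E →L[ℂ] E →L[ℂ] E →L[ℂ] E
  ω : E →L[ℂ] E →L[ℂ] ℂ
  B : ℝ
  B_nonneg : 0 ≤ B
  bound : ∀ x y z, ‖τ x y z‖ ≤ B * (‖x‖ * ‖y‖ * ‖z‖)
  symm₁ : ∀ x y z, τ x y z = τ y x z
  symm₂ : ∀ x y z, τ x y z = τ x z y
  anti : ∀ u v, ω u v = -ω v u
  -- For `x = y` this says that the derivative `3 τ(x, x, ·)` of the cubic field is infinitesimally
  -- symplectic.
  skew : ∀ x y u v, ω (τ x y u) v = -ω u (τ x y v)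

namespace SymplField

variable {E : Type*} [NormedAddCommGroup E] [NormedSpace ℂ E] (S : SymplField E)

/-- The map `m ↦ m + s X(m)`. -/
def G (s : ℂ) (m : E) : E := m + s • S.τ m m m

theorem analyticAt_cubic (x : E) : AnalyticAt ℂ (fun y => S.τ y y y) x := by
  have h : AnalyticAt ℂ (fun y => S.τ y) x :=
    ContinuousLinearMap.analyticAt (𝕜 := ℂ) (E := E) (F := E →L[ℂ] E →L[ℂ] E) S.τ x
  exact analyticAt_clm_apply (analyticAt_clm_apply h analyticAt_id) analyticAt_id

theorem hasFDerivAt_cubic (x : E) :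
    HasFDerivAt (fun y => S.τ y y y) ((3 : ℂ) • S.τ x x) x := by
  have h1 : HasFDerivAt (fun y => S.τ y) S.τ x := S.τ.hasFDerivAt
  have h := (h1.clm_apply (hasFDerivAt_id x)).clm_apply (hasFDerivAt_id x)
  refine h.congr_fderiv ?_
  ext v
  simp only [id_eq, add_apply, ContinuousLinearMap.comp_apply,
    ContinuousLinearMap.flip_apply, ContinuousLinearMap.id_apply, smul_apply]
  have e1 : S.τ x v x = S.τ x x v := S.symm₂ _ _ _
  have e2 : S.τ v x x = S.τ x x v := by rw [S.symm₁, e1]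
  rw [e1, e2]
  module

theorem analyticAt_G (s : ℂ) (x : E) : AnalyticAt ℂ (S.G s) x :=
  analyticAt_id.add (analyticAt_const.smul (S.analyticAt_cubic x))

theorem hasFDerivAt_G (s : ℂ) (x : E) :
    HasFDerivAt (S.G s) (ContinuousLinearMap.id ℂ E + (s * 3) • S.τ x x) x := by
  have h := (hasFDerivAt_id (𝕜 := ℂ) x).add ((S.hasFDerivAt_cubic x).const_smul s)
  rw [smul_smul] at h
  exact h

theorem norm_cubic_sub_le {r : ℝ} {x y : E} (hx : ‖x‖ ≤ r) (hy : ‖y‖ ≤ r) :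
    ‖S.τ x x x - S.τ y y y‖ ≤ 3 * S.B * r ^ 2 * ‖x - y‖ := by
  have h : S.τ x x x - S.τ y y y = S.τ (x - y) x x + S.τ y (x - y) x + S.τ y y (x - y) := by
    simp only [map_sub, sub_apply]; abel
  have hB := S.B_nonneg
  have hr : 0 ≤ r := (norm_nonneg _).trans hx
  calc _ ≤ ‖S.τ (x - y) x x‖ + ‖S.τ y (x - y) x‖ + ‖S.τ y y (x - y)‖ := by
        rw [h]; exact norm_add₃_le
    _ ≤ S.B * (‖x - y‖ * r * r) + S.B * (r * ‖x - y‖ * r) + S.B * (r * r * ‖x - y‖) := by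
        gcongr
        · exact (S.bound _ _ _).trans (by gcongr)
        · exact (S.bound _ _ _).trans (by gcongr)
        · exact (S.bound _ _ _).trans (by gcongr)
    _ = _ := by ring

/-- On the ball of radius `2R` the cubic field has Lipschitz constant `12 B R²`. With `‖s‖ ≤ 1/2`
this leaves `6 B R² ≤ 6/64`, below `1/4`. -/
theorem approximatesLinearOn_G {R : ℝ} (hR : S.B * R ^ 2 ≤ 1 / 64) {s : ℂ} (hs : ‖s‖ ≤ 1 / 2) :
    ApproximatesLinearOn (S.G s) (ContinuousLinearEquiv.refl ℂ E : E →L[ℂ] E)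
      (Metric.ball 0 (2 * R)) (1 / 4) := by
  intro x hx y hy
  rw [mem_ball_zero_iff] at hx hy
  have h : S.G s x - S.G s y - (ContinuousLinearEquiv.refl ℂ E : E →L[ℂ] E) (x - y) =
      s • (S.τ x x x - S.τ y y y) := by
    simp only [G, ContinuousLinearEquiv.coe_refl, ContinuousLinearMap.id_apply, smul_sub]; abel
  rw [h, norm_smul]
  have h1 := S.norm_cubic_sub_le hx.le hy.le
  have hB := S.B_nonneg
  calc _ ≤ 1 / 2 * (3 * S.B * (2 * R) ^ 2 * ‖x - y‖) := by gcongr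
    _ = 6 * (S.B * R ^ 2) * ‖x - y‖ := by ring
    _ ≤ 6 * (1 / 64) * ‖x - y‖ := by gcongr
    _ ≤ _ := by
      push_cast
      nlinarith [norm_nonneg (x - y)]

theorem norm_smul_tau_lt {R : ℝ} (hR : S.B * R ^ 2 ≤ 1 / 64) {s : ℂ} (hs : ‖s‖ ≤ 1 / 2) {m : E}
    (hm : ‖m‖ < 2 * R) : ‖(s * 3) • S.τ m m‖ < 1 := by
  have hB := S.B_nonneg
  rw [norm_smul]
  have hR0 : 0 ≤ R := by linarith [norm_nonneg m]
  have h : ‖S.τ m m‖ ≤ S.B * (2 * R) ^ 2 := by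
    refine ContinuousLinearMap.opNorm_le_bound _ (by positivity) fun z => ?_
    calc _ ≤ _ := S.bound m m z
      _ ≤ S.B * (2 * R * (2 * R) * ‖z‖) := by gcongr
      _ = _ := by ring
  calc _ ≤ (1 / 2 * 3) * (S.B * (2 * R) ^ 2) := by
        gcongr
        rw [norm_mul]
        norm_num
        linarith
    _ < 1 := by nlinarith

/-- `id + (s * 3) τ(m, m, ·)` is invertible for small `m`. -/
theorem exists_equiv [CompleteSpace E] {R : ℝ} (hR : S.B * R ^ 2 ≤ 1 / 64) {s : ℂ}
    (hs : ‖s‖ ≤ 1 / 2) {m : E} (hm : ‖m‖ < 2 * R) :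
    ∃ i : E ≃L[ℂ] E, (i : E →L[ℂ] E) = ContinuousLinearMap.id ℂ E + (s * 3) • S.τ m m := by
  let u := Units.oneSub (-((s * 3) • S.τ m m)) (by
    rw [norm_neg]; exact S.norm_smul_tau_lt hR hs hm)
  refine ⟨ContinuousLinearEquiv.ofUnit u, ?_⟩
  have : (u : E →L[ℂ] E) = 1 - -((s * 3) • S.τ m m) := rfl
  ext v
  change (u : E →L[ℂ] E) v = _
  rw [this]
  simp

variable [CompleteSpace E]

/-- `G s` as an open partial homeomorphism on a small ball. -/
theorem exists_openPartialHomeomorph {R : ℝ} (hR : S.B * R ^ 2 ≤ 1 / 64)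
    {s : ℂ} (hs : ‖s‖ ≤ 1 / 2) :
    ∃ e : OpenPartialHomeomorph E E, e.source = Metric.ball 0 (2 * R) ∧ (e : E → E) = S.G s ∧
      (∀ x, ‖x‖ < R → x ∈ e.target) ∧ ∀ y ∈ e.target, AnalyticAt ℂ e.symm y := by
  have happ := S.approximatesLinearOn_G hR hs
  -- The quantitative inverse function theorem needs the Lipschitz constant `1/4` to lie below
  -- `‖id‖⁻¹`, which equals one only in a nontrivial space.
  have hc : Subsingleton E ∨
      (1 / 4 : ℝ≥0) < ‖((ContinuousLinearEquiv.refl ℂ E).symm : E →L[ℂ] E)‖₊⁻¹ := by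
    rcases subsingleton_or_nontrivial E with h | h
    · exact Or.inl h
    · right
      have : ‖((ContinuousLinearEquiv.refl ℂ E).symm : E →L[ℂ] E)‖₊ = 1 := by
        rw [← NNReal.coe_inj]
        exact ContinuousLinearMap.norm_id
      rw [this, inv_one, ← NNReal.coe_lt_coe]
      push_cast; norm_num
  let e := happ.toOpenPartialHomeomorph (S.G s) (Metric.ball 0 (2 * R)) hc Metric.isOpen_ball
  have hsrc : e.source = Metric.ball 0 (2 * R) := rfl
  have he : (e : E → E) = S.G s := rfl
  refine ⟨e, hsrc, he, fun x hx => ?_, fun y hy => ?_⟩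
  · rcases subsingleton_or_nontrivial E with h | h
    · have h0 : (0 : E) ∈ e.source := by
        rw [hsrc, Metric.mem_ball, dist_self]
        linarith [norm_nonneg x]
      have := e.map_source h0
      rwa [Subsingleton.elim (e 0) x] at this
    · have hx0 := norm_nonneg x
      -- The image of the ball of radius `2‖x‖` contains the ball of radius `(1 - 1/4) · 2‖x‖ ≥ ‖x‖`
      -- about `G s 0 = 0`.
      have := happ.closedBall_subset_target hc Metric.isOpen_ball (b := 0) (ε := 2 * ‖x‖)
        (by positivity) (by
          intro z hz
          rw [Metric.mem_closedBall] at hz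
          rw [Metric.mem_ball]; linarith)
      apply this
      have hn : ‖((ContinuousLinearEquiv.refl ℂ E).symm : E →L[ℂ] E)‖₊ = 1 := by
        rw [← NNReal.coe_inj]
        exact ContinuousLinearMap.norm_id
      rw [hn]
      simp [G]
      linarith
  · have hx : e.symm y ∈ e.source := e.map_target hy
    set m := e.symm y with hmdef
    have hm : ‖m‖ < 2 * R := by rwa [hsrc, mem_ball_zero_iff] at hx
    obtain ⟨i, hi⟩ := S.exists_equiv hR hs hm
    -- The local inverse is analytic because the power series of `G s` at `m` has an invertible
    -- linear term, by `exists_equiv`.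
    have hym : e m = y := e.right_inv hy
    obtain ⟨P, hP⟩ := S.analyticAt_G s m
    have h1 := hP.hasFDerivAt.unique (S.hasFDerivAt_G s m)
    have := e.hasFPowerSeriesAt_symm (i := i) hx (p := P) (by rw [he]; exact hP) (by
      rw [hi, ← h1]; simp)
    rw [hym] at this
    exact this.analyticAt

theorem injOn_G {R : ℝ} (hR : S.B * R ^ 2 ≤ 1 / 64) {s : ℂ} (hs : ‖s‖ ≤ 1 / 2) :
    Set.InjOn (S.G s) (Metric.ball 0 (2 * R)) := by
  obtain ⟨e, h1, h2, -, -⟩ := S.exists_openPartialHomeomorph hR hs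
  rw [← h1, ← h2]; exact e.injOn

/-- The implicit midpoint map `x ↦ m`, where `x = m - X(m) / 2`, and the map `x ↦ m + X(m) / 2`. -/
theorem exists_midpoint {R : ℝ} (hR : S.B * R ^ 2 ≤ 1 / 64) :
    ∃ μ : E → E, (∀ x ∈ Metric.ball 0 R, ‖μ x‖ < 2 * R ∧ S.G (-(1 / 2)) (μ x) = x) ∧
      AnalyticOnNhd ℂ μ (Metric.ball 0 R) ∧
      IsOpen ((fun x => S.G (1 / 2) (μ x)) '' Metric.ball 0 R) ∧
      ∃ σ : E → E, AnalyticOnNhd ℂ σ ((fun x => S.G (1 / 2) (μ x)) '' Metric.ball 0 R) ∧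
        ∀ x ∈ Metric.ball (0 : E) R, σ (S.G (1 / 2) (μ x)) = x := by
  have hs : ‖(-(1 / 2) : ℂ)‖ ≤ 1 / 2 := by norm_num
  have hs' : ‖((1 / 2) : ℂ)‖ ≤ 1 / 2 := by norm_num
  obtain ⟨e, h1, h2, h3, h4⟩ := S.exists_openPartialHomeomorph hR hs
  obtain ⟨f, g1, g2, g3, g4⟩ := S.exists_openPartialHomeomorph hR hs'
  have htar : ∀ x ∈ Metric.ball (0 : E) R, x ∈ e.target := fun x hx =>
    h3 x (mem_ball_zero_iff.1 hx)
  have hmem : ∀ x ∈ Metric.ball (0 : E) R, e.symm x ∈ Metric.ball (0 : E) (2 * R) := fun x hx => by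
    rw [← h1]; exact e.map_target (htar x hx)
  -- The map is `G (1/2) ∘ G (-1/2)⁻¹`, so its inverse is `G (-1/2) ∘ G (1/2)⁻¹`.
  refine ⟨e.symm, fun x hx => ⟨mem_ball_zero_iff.1 (hmem x hx), ?_⟩,
    fun x hx => h4 x (htar x hx), ?_, S.G (-(1 / 2)) ∘ f.symm, ?_, ?_⟩
  · rw [← h2]; exact e.right_inv (htar x hx)
  · have ho : IsOpen (e.symm '' Metric.ball 0 R) :=
      e.symm.isOpen_image_of_subset_source Metric.isOpen_ball htar
    have : (fun x => S.G (1 / 2) (e.symm x)) '' Metric.ball 0 R =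
        f '' (e.symm '' Metric.ball 0 R) := by
      rw [Set.image_image, g2]
    rw [this]
    refine f.isOpen_image_of_subset_source ho ?_
    rw [g1]
    rintro _ ⟨x, hx, rfl⟩
    exact hmem x hx
  · rintro _ ⟨x, hx, rfl⟩
    have : S.G (1 / 2) (e.symm x) ∈ f.target := by
      rw [← g2]; apply f.map_source; rw [g1]; exact hmem x hx
    exact (S.analyticAt_G _ _).comp (g4 _ this)
  · intro x hx
    have hx' := hmem x hx
    rw [← g1] at hx'
    simp only [Function.comp]
    rw [← g2, f.left_inv hx', ← h2]
    exact e.right_inv (htar x hx)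

omit [CompleteSpace E] in
theorem fderiv_midpoint {μ : E → E} {x : E} (h : ∀ᶠ y in nhds x, S.G (-(1 / 2)) (μ y) = y)
    (hμ : DifferentiableAt ℂ μ x) (v : E) :
    fderiv ℂ μ x v - (3 / 2 : ℂ) • S.τ (μ x) (μ x) (fderiv ℂ μ x v) = v := by
  have h1 := (S.hasFDerivAt_G (-(1 / 2)) (μ x)).comp x hμ.hasFDerivAt
  have h2 : HasFDerivAt (S.G (-(1 / 2)) ∘ μ) (ContinuousLinearMap.id ℂ E) x :=
    (hasFDerivAt_id x).congr_of_eventuallyEq h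
  have h3 := congrArg (fun f : E →L[ℂ] E => f v) (h1.unique h2)
  simp only [ContinuousLinearMap.comp_apply, add_apply, ContinuousLinearMap.id_apply,
    smul_apply] at h3
  rw [sub_eq_add_neg, ← neg_smul]
  convert h3 using 3
  norm_num

omit [CompleteSpace E] in
theorem fderiv_comp_midpoint {μ : E → E} {x : E} (hμ : DifferentiableAt ℂ μ x) (s : ℂ) (v : E) :
    fderiv ℂ (fun y => S.G s (μ y)) x v =
      fderiv ℂ μ x v + (s * 3) • S.τ (μ x) (μ x) (fderiv ℂ μ x v) := by
  have h1 := (S.hasFDerivAt_G s (μ x)).comp x hμ.hasFDerivAt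
  rw [show (fun y => S.G s (μ y)) = S.G s ∘ μ from rfl, h1.fderiv]
  simp

omit [CompleteSpace E] in
/-- The implicit midpoint map is symplectic. -/
theorem symplectic_midpoint {μ : E → E} {x : E} (h : ∀ᶠ y in nhds x, S.G (-(1 / 2)) (μ y) = y)
    (hμ : DifferentiableAt ℂ μ x) (u v : E) :
    S.ω (fderiv ℂ (fun y => S.G (1 / 2) (μ y)) x u) (fderiv ℂ (fun y => S.G (1 / 2) (μ y)) x v) =
      S.ω u v := by
  rw [S.fderiv_comp_midpoint hμ, S.fderiv_comp_midpoint hμ]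
  have hu := S.fderiv_midpoint h hμ u
  have hv := S.fderiv_midpoint h hμ v
  -- Let `A = (3/2) τ(m, m, ·)` and let `u'`, `v'` be the images of `u`, `v` under `dμ`, so that `u
  -- = (1 - A)u'` and `v = (1 - A)v'`. Since `A` is skew, the cross terms in `ω((1 ± A)u', (1 ±
  -- A)v')` cancel, and the value does not depend on the sign.
  conv_rhs => rw [← hu, ← hv]
  have := S.skew (μ x) (μ x) (fderiv ℂ μ x u) (fderiv ℂ μ x v)
  simp only [map_add, map_sub, map_smul, add_apply, sub_apply, smul_apply, smul_eq_mul, this]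
  ring

/-- The Hamiltonian vector field `Z` of `F ∘ G s ∘ μ`, if `F` has the vector field `Y`. -/
theorem hasFDerivAt_comp_midpoint {R : ℝ} (hR : S.B * R ^ 2 ≤ 1 / 64) {μ : E → E} {x : E}
    (h : ∀ᶠ y in nhds x, S.G (-(1 / 2)) (μ y) = y) (hμ : DifferentiableAt ℂ μ x)
    (hx : ‖μ x‖ < 2 * R) (s : ℂ) {F : E → ℂ} {Y : E}
    (hF : HasFDerivAt F (Complex.I • S.ω Y) (S.G s (μ x))) :
    ∃ Z, Z + (3 / 2 : ℂ) • S.τ (μ x) (μ x) Z = Y - (s * 3) • S.τ (μ x) (μ x) Y ∧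
      HasFDerivAt (fun y => F (S.G s (μ y))) (Complex.I • S.ω Z) x := by
  obtain ⟨i, hi⟩ := S.exists_equiv hR (s := 1 / 2) (by norm_num) hx
  have hZ : ∀ y, i.symm y + (3 / 2 : ℂ) • S.τ (μ x) (μ x) (i.symm y) = y := by
    intro y
    have := congrArg (fun f : E →L[ℂ] E => f (i.symm y)) hi
    simp only [ContinuousLinearEquiv.coe_coe, ContinuousLinearEquiv.apply_symm_apply, add_apply,
      ContinuousLinearMap.id_apply, smul_apply] at this
    conv_rhs => rw [this]
    norm_num
  refine ⟨i.symm (Y - (s * 3) • S.τ (μ x) (μ x) Y), hZ _, ?_⟩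
  have hZ' := hZ (Y - (s * 3) • S.τ (μ x) (μ x) Y)
  set Z := i.symm (Y - (s * 3) • S.τ (μ x) (μ x) Y)
  have h1 : HasFDerivAt (fun y => S.G s (μ y)) _ x :=
    (S.hasFDerivAt_G s (μ x)).comp x hμ.hasFDerivAt
  refine (hF.comp x h1).congr_fderiv ?_
  ext v
  have hv := S.fderiv_midpoint h hμ v
  simp only [ContinuousLinearMap.comp_apply, smul_apply, add_apply, ContinuousLinearMap.id_apply,
    smul_eq_mul]
  congr 1
  set w := fderiv ℂ μ x v
  have e1 := S.skew (μ x) (μ x) Y w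
  have e2 := S.skew (μ x) (μ x) Z w
  -- Skewness moves the derivative of `G s` from `w` to `Y`. The equation that defines `Z` then
  -- trades it for `1 - A` on `w`, and `(1 - A)w = v`.
  calc S.ω Y (w + (s * 3) • S.τ (μ x) (μ x) w)
      = S.ω (Y - (s * 3) • S.τ (μ x) (μ x) Y) w := by
        simp only [map_add, map_sub, map_smul, sub_apply, smul_apply, smul_eq_mul, e1]; ring
    _ = S.ω Z (w - (3 / 2 : ℂ) • S.τ (μ x) (μ x) w) := by
        rw [← hZ']
        simp only [map_add, map_sub, map_smul, add_apply, smul_apply, smul_eq_mul, e2]; ring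
    _ = S.ω Z v := by rw [hv]

/-- The quartic Hamiltonian of a cubic vector field. -/
def ham (x : E) : ℂ := Complex.I / 4 * S.ω (S.τ x x x) x

-- Euler's identity in degree four: by `skew` and `anti`, the term `3 ω(τ(x, x, v), x)` equals `3
-- ω(τ(x, x, x), v)`. With the remaining term this makes four, which cancels the factor `1/4`.
omit [CompleteSpace E] in
theorem hasFDerivAt_ham (x : E) : HasFDerivAt S.ham (Complex.I • S.ω (S.τ x x x)) x := by
  have h1 : HasFDerivAt (fun y => S.ω (S.τ y y y)) (S.ω.comp ((3 : ℂ) • S.τ x x)) x :=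
    S.ω.hasFDerivAt.comp x (S.hasFDerivAt_cubic x)
  have h2 := (h1.clm_apply (hasFDerivAt_id x)).const_mul (Complex.I / 4)
  refine h2.congr_fderiv ?_
  ext v
  have e1 := S.skew x x v x
  have e2 := S.anti v (S.τ x x x)
  simp only [id_eq, ContinuousLinearMap.comp_apply, smul_apply, add_apply,
    ContinuousLinearMap.flip_apply, ContinuousLinearMap.id_apply, map_smul, smul_eq_mul, e1, e2]
  ring

omit [CompleteSpace E] in
theorem analyticAt_ham (x : E) : AnalyticAt ℂ S.ham x := by
  have h : AnalyticAt ℂ (fun y => S.ω (S.τ y y y)) x :=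
    (S.ω.analyticAt _).comp (S.analyticAt_cubic x)
  exact analyticAt_const.mul (analyticAt_clm_apply h analyticAt_id)

end SymplField
end KGNormalForm
end

/-! ### Young inequalities on quadruples with vanishing momentum -/

noncomputable section
namespace KGNormalForm
open scoped ENNReal

/-- Indices of the variables: `(j, true)` stands for `z_j` and `(j, false)` for `z̄_j`. -/
abbrev Idx : Type := ℤ × Bool

/-- The sign of a variable. -/
def sg (k : Idx) : ℤ := if k.2 then 1 else -1

/-- The coordinates of a point, indexed by `Idx`. -/
def co (x : Pt) (k : Idx) : ℂ := if k.2 then x.1 k.1 else x.2 k.1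

/-- The momentum of a quadruple of variables. -/
def mom (k₁ k₂ k₃ k₄ : Idx) : ℤ := sg k₁ * k₁.1 + sg k₂ * k₂.1 + sg k₃ * k₃.1 + sg k₄ * k₄.1

theorem ennreal_cauchy_schwarz {ι : Type*} (f g : ι → ℝ≥0∞) :
    (∑' i, f i * g i) ^ 2 ≤ (∑' i, f i ^ 2) * ∑' i, g i ^ 2 := by
  let _ : MeasurableSpace ι := ⊤
  have h := ENNReal.lintegral_mul_le_Lp_mul_Lq (μ := MeasureTheory.Measure.count)
    Real.HolderConjugate.two_two (f := f) (g := g) measurable_from_top.aemeasurable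
    measurable_from_top.aemeasurable
  simp only [Pi.mul_apply, MeasureTheory.lintegral_count, ENNReal.rpow_ofNat] at h
  have h2 : ∀ a : ℝ≥0∞, (a ^ (1 / 2 : ℝ)) ^ 2 = a := fun a => by
    rw [← ENNReal.rpow_natCast, ← ENNReal.rpow_mul]; norm_num
  calc _ ≤ _ := pow_le_pow_left' h 2
    _ = _ := by rw [mul_pow, h2, h2]

theorem ennreal_tsum_prod {α β : Type*} (f : α × β → ℝ≥0∞) :
    ∑' p, f p = ∑' a, ∑' b, f (a, b) :=
  ENNReal.tsum_prod (f := fun a b => f (a, b))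

/-- Indicator of the quadruples with vanishing momentum. -/
def momInd (k₁ k₂ k₃ k₄ : Idx) : ℝ≥0∞ := if mom k₁ k₂ k₃ k₄ = 0 then 1 else 0

theorem momInd_sq (k₁ k₂ k₃ k₄ : Idx) : momInd k₁ k₂ k₃ k₄ ^ 2 = momInd k₁ k₂ k₃ k₄ := by
  unfold momInd; split_ifs <;> simp

theorem momInd_comm (k₁ k₂ k₃ k₄ : Idx) : momInd k₁ k₂ k₃ k₄ = momInd k₂ k₁ k₃ k₄ := by
  unfold momInd mom
  congr 2; ring

/-- Three variables determine the index of the fourth for each of its two types. -/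
theorem tsum_momInd_le (k₂ k₃ k₄ : Idx) : ∑' k₁, momInd k₁ k₂ k₃ k₄ ≤ 2 := by
  rw [ennreal_tsum_prod, ENNReal.tsum_comm, tsum_bool]
  have h : ∀ b : Bool, ∑' j : ℤ, momInd (j, b) k₂ k₃ k₄ ≤ 1 := by
    intro b
    set s := sg k₂ * k₂.1 + sg k₃ * k₃.1 + sg k₄ * k₄.1 with hs
    rw [tsum_eq_single (if b then -s else s)]
    · unfold momInd; split_ifs <;> simp
    · intro j hj
      unfold momInd mom sg at *
      cases b <;> simp at * <;> omega
  calc _ ≤ (1 : ℝ≥0∞) + 1 := add_le_add (h _) (h _)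
    _ = 2 := by norm_num

/-- Young's inequality for convolutions over the quadruples with vanishing momentum. -/
theorem young_conv (f g h : Idx → ℝ≥0∞) :
    ∑' k, (∑' l : Idx × Idx × Idx,
      momInd k l.1 l.2.1 l.2.2 * (f l.1 * g l.2.1 * h l.2.2)) ^ 2 ≤
      4 * (∑' l, f l ^ 2) * (∑' l, g l) ^ 2 * (∑' l, h l) ^ 2 := by
  have hsq : ∀ a : ℝ≥0∞, (a ^ (1 / 2 : ℝ)) ^ 2 = a := fun a => by
    rw [← ENNReal.rpow_natCast, ← ENNReal.rpow_mul]; norm_num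
  have key : ∀ k, (∑' l : Idx × Idx × Idx,
      momInd k l.1 l.2.1 l.2.2 * (f l.1 * g l.2.1 * h l.2.2)) ^ 2 ≤
      (2 * (∑' l, g l) * (∑' l, h l)) * ∑' l : Idx × Idx × Idx,
        momInd k l.1 l.2.1 l.2.2 * (f l.1 ^ 2 * g l.2.1 * h l.2.2) := by
    intro k
    -- Split the summand as `√(gh) · f√(gh)`, keeping the indicator in both factors. Summing the
    -- first factor squared costs `2 ‖g‖₁ ‖h‖₁` by `tsum_momInd_le`. The second keeps `f²`, and the
    -- sum over `k` costs another factor two.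
    have h1 := ennreal_cauchy_schwarz
      (fun l : Idx × Idx × Idx => momInd k l.1 l.2.1 l.2.2 * ((g l.2.1 * h l.2.2) ^ (1 / 2 : ℝ)))
      (fun l : Idx × Idx × Idx => momInd k l.1 l.2.1 l.2.2 *
        (f l.1 * (g l.2.1 * h l.2.2) ^ (1 / 2 : ℝ)))
    have h2 : ∀ l : Idx × Idx × Idx,
        momInd k l.1 l.2.1 l.2.2 * ((g l.2.1 * h l.2.2) ^ (1 / 2 : ℝ)) *
        (momInd k l.1 l.2.1 l.2.2 * (f l.1 * (g l.2.1 * h l.2.2) ^ (1 / 2 : ℝ))) =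
        momInd k l.1 l.2.1 l.2.2 * (f l.1 * g l.2.1 * h l.2.2) := by
      intro l
      rw [← momInd_sq]
      generalize hy : (g l.2.1 * h l.2.2) ^ (1 / 2 : ℝ) = y
      have := hsq (g l.2.1 * h l.2.2)
      rw [hy] at this
      rw [mul_assoc (f l.1), ← this]
      simp only [momInd_sq]
      calc _ = momInd k l.1 l.2.1 l.2.2 ^ 2 * (f l.1 * y ^ 2) := by ring
        _ = _ := by rw [momInd_sq]
    simp only [h2, mul_pow, hsq, momInd_sq] at h1
    refine h1.trans (mul_le_mul' ?_ (le_of_eq (tsum_congr fun l => by ring)))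
    rw [ennreal_tsum_prod, ENNReal.tsum_comm]
    calc _ = ∑' (l : Idx × Idx), (∑' a, momInd k a l.1 l.2) * (g l.1 * h l.2) :=
          tsum_congr fun l => ENNReal.tsum_mul_right
      _ ≤ ∑' (l : Idx × Idx), 2 * (g l.1 * h l.2) := ENNReal.tsum_le_tsum fun l => by
          gcongr
          simp only [momInd_comm k]
          exact tsum_momInd_le _ _ _
      _ = 2 * (∑' l, g l) * (∑' l, h l) := by
          rw [ENNReal.tsum_mul_left, ennreal_tsum_prod, mul_assoc]
          simp only [ENNReal.tsum_mul_left, ENNReal.tsum_mul_right]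
  calc _ ≤ ∑' k, (2 * (∑' l, g l) * (∑' l, h l)) * ∑' l : Idx × Idx × Idx,
        momInd k l.1 l.2.1 l.2.2 * (f l.1 ^ 2 * g l.2.1 * h l.2.2) := ENNReal.tsum_le_tsum key
    _ = (2 * (∑' l, g l) * (∑' l, h l)) * ∑' l : Idx × Idx × Idx,
        (∑' k, momInd k l.1 l.2.1 l.2.2) * (f l.1 ^ 2 * g l.2.1 * h l.2.2) := by
        rw [ENNReal.tsum_mul_left, ENNReal.tsum_comm]
        simp only [ENNReal.tsum_mul_right]
    _ ≤ (2 * (∑' l, g l) * (∑' l, h l)) * ∑' l : Idx × Idx × Idx,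
        2 * (f l.1 ^ 2 * g l.2.1 * h l.2.2) := by
        gcongr
        exact tsum_momInd_le _ _ _
    _ = (2 * (∑' l, g l) * (∑' l, h l)) *
        (2 * ((∑' l, f l ^ 2) * (∑' l, g l) * (∑' l, h l))) := by
        congr 1
        rw [ENNReal.tsum_mul_left, ennreal_tsum_prod]
        congr 1
        calc _ = ∑' a, f a ^ 2 * ∑' l : Idx × Idx, g l.1 * h l.2 :=
              tsum_congr fun a => by
                rw [← ENNReal.tsum_mul_left]; exact tsum_congr fun l => by ring
          _ = _ := by
              rw [ENNReal.tsum_mul_right, ennreal_tsum_prod (fun l : Idx × Idx => g l.1 * h l.2),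
                mul_assoc]
              simp only [ENNReal.tsum_mul_left, ENNReal.tsum_mul_right]
    _ = _ := by ring

theorem momInd_comm₂ (k₁ k₂ k₃ k₄ : Idx) : momInd k₁ k₂ k₃ k₄ = momInd k₁ k₃ k₂ k₄ := by
  unfold momInd mom
  congr 2; ring

theorem momInd_comm₃ (k₁ k₂ k₃ k₄ : Idx) : momInd k₁ k₂ k₃ k₄ = momInd k₁ k₄ k₃ k₂ := by
  unfold momInd mom
  congr 2; ring

/-- Exchange of the first two components of a triple. -/
def swapTwo : Idx × Idx × Idx ≃ Idx × Idx × Idx where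
  toFun l := (l.2.1, l.1, l.2.2)
  invFun l := (l.2.1, l.1, l.2.2)
  left_inv _ := rfl
  right_inv _ := rfl

/-- Exchange of the outer two components of a triple. -/
def swapThree : Idx × Idx × Idx ≃ Idx × Idx × Idx where
  toFun l := (l.2.2, l.2.1, l.1)
  invFun l := (l.2.2, l.2.1, l.1)
  left_inv _ := rfl
  right_inv _ := rfl

theorem young_conv₂ (f g h : Idx → ℝ≥0∞) :
    ∑' k, (∑' l : Idx × Idx × Idx,
      momInd k l.1 l.2.1 l.2.2 * (g l.1 * f l.2.1 * h l.2.2)) ^ 2 ≤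
      4 * (∑' l, f l ^ 2) * (∑' l, g l) ^ 2 * (∑' l, h l) ^ 2 := by
  refine le_trans (le_of_eq (tsum_congr fun k => ?_)) (young_conv f g h)
  rw [← swapTwo.tsum_eq]
  congr 1
  exact tsum_congr fun l => by simp only [swapTwo, Equiv.coe_fn_mk]; rw [momInd_comm₂]; ring

theorem young_conv₃ (f g h : Idx → ℝ≥0∞) :
    ∑' k, (∑' l : Idx × Idx × Idx,
      momInd k l.1 l.2.1 l.2.2 * (g l.1 * h l.2.1 * f l.2.2)) ^ 2 ≤
      4 * (∑' l, f l ^ 2) * (∑' l, g l) ^ 2 * (∑' l, h l) ^ 2 := by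
  refine le_trans (le_of_eq (tsum_congr fun k => ?_))
    ((young_conv f h g).trans (le_of_eq (by ring)))
  rw [← swapThree.tsum_eq]
  congr 1
  exact tsum_congr fun l => by simp only [swapThree, Equiv.coe_fn_mk]; rw [momInd_comm₃]; ring

theorem add_three_sq_le (x y z : ℝ≥0∞) : (x + y + z) ^ 2 ≤ 3 * (x ^ 2 + y ^ 2 + z ^ 2) := by
  by_cases hx : x = ⊤
  · simp [hx]
  by_cases hy : y = ⊤
  · simp [hy]
  by_cases hz : z = ⊤
  · simp [hz]
  lift x to NNReal using hx
  lift y to NNReal using hy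
  lift z to NNReal using hz
  norm_cast
  rw [← NNReal.coe_le_coe]
  push_cast
  nlinarith [sq_nonneg ((x : ℝ) - y), sq_nonneg ((y : ℝ) - z), sq_nonneg ((x : ℝ) - z)]

/-- A trilinear estimate: one factor in `ℓ²`, the two others in `ℓ¹`. -/
theorem young_conv_sum (U₁ U₂ U₃ b₁ b₂ b₃ : Idx → ℝ≥0∞) (S : ℝ≥0∞)
    (h₁ : (∑' k, b₁ k) ^ 2 ≤ S * ∑' k, U₁ k ^ 2) (h₂ : (∑' k, b₂ k) ^ 2 ≤ S * ∑' k, U₂ k ^ 2)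
    (h₃ : (∑' k, b₃ k) ^ 2 ≤ S * ∑' k, U₃ k ^ 2) :
    ∑' k, (∑' l : Idx × Idx × Idx, momInd k l.1 l.2.1 l.2.2 *
      (U₁ l.1 * b₂ l.2.1 * b₃ l.2.2 + b₁ l.1 * U₂ l.2.1 * b₃ l.2.2 +
        b₁ l.1 * b₂ l.2.1 * U₃ l.2.2)) ^ 2 ≤
      36 * S ^ 2 * ((∑' k, U₁ k ^ 2) * (∑' k, U₂ k ^ 2) * (∑' k, U₃ k ^ 2)) := by
  simp only [mul_add, ENNReal.tsum_add]
  -- The square of a sum of three terms costs a factor 3, and each of the three terms costs the 4 of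
  -- `young_conv`, whence 36.
  calc _ ≤ ∑' k, 3 * (_ + _ + _) := ENNReal.tsum_le_tsum fun k => add_three_sq_le _ _ _
    _ ≤ 3 * (4 * (∑' l, U₁ l ^ 2) * (S * ∑' k, U₂ k ^ 2) * (S * ∑' k, U₃ k ^ 2) +
        4 * (∑' l, U₂ l ^ 2) * (S * ∑' k, U₁ k ^ 2) * (S * ∑' k, U₃ k ^ 2) +
        4 * (∑' l, U₃ l ^ 2) * (S * ∑' k, U₁ k ^ 2) * (S * ∑' k, U₂ k ^ 2)) := by
      rw [ENNReal.tsum_mul_left]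
      simp only [ENNReal.tsum_add]
      gcongr
      · exact (young_conv U₁ b₂ b₃).trans (by gcongr)
      · exact (young_conv₂ U₂ b₁ b₃).trans (by gcongr)
      · exact (young_conv₃ U₃ b₁ b₂).trans (by gcongr)
    _ = _ := by ring

end KGNormalForm
end

noncomputable section
namespace KGNormalForm
open scoped ENNReal

/-! ### Weighted norms as extended nonnegative reals -/

theorem one_le_jap (j : ℤ) : 1 ≤ jap j := le_max_left _ _

theorem abs_le_jap (j : ℤ) : |(j : ℝ)| ≤ jap j := le_max_right _ _

theorem jap_pos (j : ℤ) : 0 < jap j := one_pos.trans_le (one_le_jap j)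

theorem one_le_ww (c : ℝ) (j : ℤ) : 1 ≤ ww c j := by
  unfold ww
  rw [Real.one_le_sqrt]
  have : 0 ≤ (j : ℝ) ^ 2 / c ^ 2 := by positivity
  linarith

theorem ww_pos (c : ℝ) (j : ℤ) : 0 < ww c j := one_pos.trans_le (one_le_ww c j)

theorem tsum_idx (f : Idx → ℝ≥0∞) :
    ∑' k, f k = ∑' j, f (j, true) + ∑' j, f (j, false) := by
  rw [ennreal_tsum_prod, ENNReal.tsum_comm, tsum_bool, add_comm]

/-- The square of the norm of `x` with weight `W`. -/
def sqNorm (W : ℤ → ℝ) (x : Pt) : ℝ≥0∞ := ∑' k : Idx, (ENNReal.ofReal (W k.1) * ‖co x k‖ₑ) ^ 2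

theorem weight_mul_enorm_sq {w : ℝ} (hw : 0 ≤ w) (z : ℂ) :
    (ENNReal.ofReal w * ‖z‖ₑ) ^ 2 = ENNReal.ofReal (w ^ 2 * ‖z‖ ^ 2) := by
  rw [← ofReal_norm, ← ENNReal.ofReal_mul hw, ← ENNReal.ofReal_pow (by positivity),
    mul_pow]

theorem sqNorm_eq {W : ℤ → ℝ} (hW : ∀ j, 0 ≤ W j) (x : Pt) :
    sqNorm W x = ∑' j, ENNReal.ofReal (W j ^ 2 * ‖x.1 j‖ ^ 2) +
      ∑' j, ENNReal.ofReal (W j ^ 2 * ‖x.2 j‖ ^ 2) := by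
  rw [sqNorm, tsum_idx]
  simp only [weight_mul_enorm_sq (hW _), co, if_true, Bool.false_eq_true, if_false]

theorem summable_iff_tsum_ofReal_ne_top {ι : Type*} {f : ι → ℝ} (hf : ∀ i, 0 ≤ f i) :
    Summable f ↔ ∑' i, ENNReal.ofReal (f i) ≠ ⊤ := by
  constructor
  · intro h
    rw [← ENNReal.ofReal_tsum_of_nonneg hf h]
    exact ENNReal.ofReal_ne_top
  · intro h
    have := ENNReal.summable_toReal h
    simpa [ENNReal.toReal_ofReal (hf _)] using this

theorem mem_phaseSub_iff {a q β c : ℝ} {x : Pt} :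
    x ∈ phaseSub a q β c ↔ sqNorm (wt a q β c) x ≠ ⊤ := by
  rw [sqNorm_eq (fun j => (wt_pos a q β c j).le), ENNReal.add_ne_top,
    ← summable_iff_tsum_ofReal_ne_top (fun j => by positivity),
    ← summable_iff_tsum_ofReal_ne_top (fun j => by positivity)]
  rfl

theorem phaseNorm_nonneg (a q β c : ℝ) (x : Pt) : 0 ≤ phaseNorm a q β c x := Real.sqrt_nonneg _

theorem sqNorm_eq_phaseNorm {a q β c : ℝ} {x : Pt} (hx : x ∈ phaseSub a q β c) :
    sqNorm (wt a q β c) x = ENNReal.ofReal (phaseNorm a q β c x) ^ 2 := by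
  rw [sqNorm_eq (fun j => (wt_pos a q β c j).le), ← ENNReal.ofReal_pow (phaseNorm_nonneg _ _ _ _ _),
    phaseNorm, Real.sq_sqrt (by positivity), ENNReal.ofReal_add (by positivity) (by positivity),
    ENNReal.ofReal_tsum_of_nonneg (fun j => by positivity) hx.1,
    ENNReal.ofReal_tsum_of_nonneg (fun j => by positivity) hx.2]

/-- Membership and norm bound become one inequality in `[0, ∞]`, so that the estimates need no
separate bookkeeping of summability. -/
theorem normLE_iff {a q β c r : ℝ} (hr : 0 ≤ r) {x : Pt} :
    NormLE a q β c x r ↔ sqNorm (wt a q β c) x ≤ ENNReal.ofReal r ^ 2 := by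
  constructor
  · rintro ⟨h1, h2⟩
    rw [sqNorm_eq_phaseNorm h1]
    gcongr
  · intro h
    have h1 : x ∈ phaseSub a q β c := by
      rw [mem_phaseSub_iff]
      exact ne_top_of_le_ne_top (by finiteness) h
    refine ⟨h1, ?_⟩
    rw [sqNorm_eq_phaseNorm h1, ← ENNReal.ofReal_pow hr,
      ← ENNReal.ofReal_pow (phaseNorm_nonneg _ _ _ _ _),
      ENNReal.ofReal_le_ofReal_iff (by positivity)] at h
    exact le_of_sq_le_sq h hr

/-! ### Closure properties of `NormLE` -/

theorem NormLE.nonneg {a q β c r : ℝ} {x : Pt} (h : NormLE a q β c x r) : 0 ≤ r :=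
  (phaseNorm_nonneg _ _ _ _ _).trans h.2

theorem normLE_self {a q β c : ℝ} {x : Pt} (h : x ∈ phaseSub a q β c) :
    NormLE a q β c x (phaseNorm a q β c x) := ⟨h, le_rfl⟩

theorem NormLE.mono {a q β c r r' : ℝ} {x : Pt} (h : NormLE a q β c x r) (hr : r ≤ r') :
    NormLE a q β c x r' := ⟨h.1, h.2.trans hr⟩

theorem phaseNorm_eq_norm {a q β c : ℝ} {x : Pt} (h : x ∈ phaseSub a q β c) :
    phaseNorm a q β c x = ‖Phase.mk x h‖ := (Phase.norm_eq (Phase.mk x h)).symm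

theorem NormLE.add {a q β c r r' : ℝ} {x y : Pt} (h : NormLE a q β c x r)
    (h' : NormLE a q β c y r') : NormLE a q β c (x + y) (r + r') := by
  refine ⟨add_mem h.1 h'.1, ?_⟩
  have h1 := h.2
  have h2 := h'.2
  rw [phaseNorm_eq_norm h.1] at h1
  rw [phaseNorm_eq_norm h'.1] at h2
  rw [phaseNorm_eq_norm (add_mem h.1 h'.1)]
  exact (norm_add_le (Phase.mk x h.1) (Phase.mk y h'.1)).trans (add_le_add h1 h2)

theorem NormLE.smul {a q β c r : ℝ} {x : Pt} (k : ℂ) (h : NormLE a q β c x r) :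
    NormLE a q β c (k • x) (‖k‖ * r) := by
  refine ⟨Submodule.smul_mem _ k h.1, ?_⟩
  have h1 := h.2
  rw [phaseNorm_eq_norm h.1] at h1
  rw [phaseNorm_eq_norm (Submodule.smul_mem _ k h.1)]
  exact (norm_smul_le k (Phase.mk x h.1)).trans (by gcongr)

theorem NormLE.neg {a q β c r : ℝ} {x : Pt} (h : NormLE a q β c x r) :
    NormLE a q β c (-x) r := by
  simpa using h.smul (-1)

theorem NormLE.sub {a q β c r r' : ℝ} {x y : Pt} (h : NormLE a q β c x r)
    (h' : NormLE a q β c y r') : NormLE a q β c (x - y) (r + r') := by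
  rw [sub_eq_add_neg]; exact h.add h'.neg

theorem sqNorm_mono {W W' : ℤ → ℝ} (h : ∀ j, W j ≤ W' j) (x : Pt) : sqNorm W x ≤ sqNorm W' x := by
  unfold sqNorm
  gcongr with k
  exact h _

theorem NormLE.weight_mono {a q β c q' β' c' r : ℝ} {x : Pt} (h : NormLE a q β c x r)
    (hw : ∀ j, wt a q' β' c' j ≤ wt a q β c j) : NormLE a q' β' c' x r := by
  rw [normLE_iff h.nonneg] at *
  exact (sqNorm_mono hw x).trans h

theorem wt_mono {a q β q' β' : ℝ} (c : ℝ) (hq : q' ≤ q) (hβ : β' ≤ β) (j : ℤ) :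
    wt a q' β' c j ≤ wt a q β c j := by
  unfold wt
  have h1 := Real.rpow_le_rpow_of_exponent_le (one_le_jap j) hq
  have h2 := Real.rpow_le_rpow_of_exponent_le (one_le_ww c j) hβ
  have h3 := jap_pos j
  have h4 := ww_pos c j
  gcongr

theorem NormLE.q_mono {a q β c q' r : ℝ} {x : Pt} (h : NormLE a q β c x r) (hq : q' ≤ q) :
    NormLE a q' β c x r := h.weight_mono (wt_mono c hq le_rfl)

theorem NormLE.beta_mono {a q β β' c r : ℝ} {x : Pt} (h : NormLE a q β c x r) (hq : β' ≤ β) :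
    NormLE a q β' c x r := h.weight_mono (wt_mono c le_rfl hq)

theorem NormLE.beta_zero {a q β c r : ℝ} {x : Pt} (c' : ℝ) (h : NormLE a q β c x r) (hq : 0 ≤ β) :
    NormLE a q 0 c' x r :=
  (h.beta_mono hq).weight_mono (fun j => (wt_zero a q c' c j).le)

/-! ### Trilinear vector fields given by kernels -/

/-- Coefficients of a homogeneous polynomial of degree four. -/
abbrev Kernel : Type := Idx → Idx → Idx → Idx → ℂ

/-- The trilinear map with kernel `K`. -/
def tri (K : Kernel) (x y z : Pt) (k : Idx) : ℂ :=
  ∑' l : Idx × Idx × Idx, K k l.1 l.2.1 l.2.2 * co x l.1 * co y l.2.1 * co z l.2.2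

/-- The trilinear map which is on the diagonal the Hamiltonian vector field of the polynomial with
symmetric kernel `K`. -/
def vf (K : Kernel) (x y z : Pt) : Pt :=
  (fun j => -4 * Complex.I * tri K x y z (j, false),
    fun j => 4 * Complex.I * tri K x y z (j, true))

/-- The sum of the absolute values of the terms of `tri`. -/
def absTri (K : Kernel) (x y z : Pt) (k : Idx) : ℝ≥0∞ :=
  ∑' l : Idx × Idx × Idx,
    ‖K k l.1 l.2.1 l.2.2‖ₑ * ‖co x l.1‖ₑ * ‖co y l.2.1‖ₑ * ‖co z l.2.2‖ₑ

/-- The largest of the `⟨j⟩` in a quadruple. -/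
def mx (k₁ k₂ k₃ k₄ : Idx) : ℝ :=
  max (max (jap k₁.1) (jap k₂.1)) (max (jap k₃.1) (jap k₄.1))

/-- `K` is supported on vanishing momentum, and `|K| g(j₁)` is bounded by `M max ⟨j_i⟩ ^ s`. -/
structure KernelBound (g : ℤ → ℝ) (s M : ℝ) (K : Kernel) : Prop where
  supp : ∀ k₁ k₂ k₃ k₄, K k₁ k₂ k₃ k₄ ≠ 0 → mom k₁ k₂ k₃ k₄ = 0
  -- The first variable is the output: `g` is a weight gained there, and `s` counts lost
  -- derivatives.
  bound : ∀ k₁ k₂ k₃ k₄, ‖K k₁ k₂ k₃ k₄‖ * g k₁.1 ≤ M * mx k₁ k₂ k₃ k₄ ^ s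

theorem abs_le_of_mom {k₁ k₂ k₃ k₄ : Idx} (h : mom k₁ k₂ k₃ k₄ = 0) :
    |(k₁.1 : ℝ)| ≤ |(k₂.1 : ℝ)| + |(k₃.1 : ℝ)| + |(k₄.1 : ℝ)| := by
  have : |k₁.1| ≤ |k₂.1| + |k₃.1| + |k₄.1| := by
    unfold mom sg at h
    have h1 := abs_le.1 (le_refl |k₂.1|)
    have h2 := abs_le.1 (le_refl |k₃.1|)
    have h3 := abs_le.1 (le_refl |k₄.1|)
    rw [abs_le]
    split_ifs at h <;> constructor <;> linarith
  exact_mod_cast this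

/-- Vanishing momentum gives `|j₁| ≤ |j₂| + |j₃| + |j₄|`. So the exponential weight splits into a
product, and every bracket in the quadruple is at most three times the largest input bracket. That
one input then carries the whole power `q`. -/
theorem weight_le_of_mom {a q s : ℝ} (ha : 0 ≤ a) (hs : 0 ≤ s) (hq : s ≤ q) {k₁ k₂ k₃ k₄ : Idx}
    (h : mom k₁ k₂ k₃ k₄ = 0) :
    Real.exp (a * |(k₁.1 : ℝ)|) * jap k₁.1 ^ (q - s) * mx k₁ k₂ k₃ k₄ ^ s ≤
      3 ^ q * ((Real.exp (a * |(k₂.1 : ℝ)|) * Real.exp (a * |(k₃.1 : ℝ)|) *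
        Real.exp (a * |(k₄.1 : ℝ)|)) * (jap k₂.1 ^ q + jap k₃.1 ^ q + jap k₄.1 ^ q)) := by
  have h0 := abs_le_of_mom h
  have hexp : Real.exp (a * |(k₁.1 : ℝ)|) ≤ Real.exp (a * |(k₂.1 : ℝ)|) *
      Real.exp (a * |(k₃.1 : ℝ)|) * Real.exp (a * |(k₄.1 : ℝ)|) := by
    rw [← Real.exp_add, ← Real.exp_add, Real.exp_le_exp, ← mul_add, ← mul_add]
    gcongr
  obtain ⟨t, ht, h2, h3, h4, htq⟩ : ∃ t : ℝ, 1 ≤ t ∧ jap k₂.1 ≤ t ∧ jap k₃.1 ≤ t ∧ jap k₄.1 ≤ t ∧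
      t ^ q ≤ jap k₂.1 ^ q + jap k₃.1 ^ q + jap k₄.1 ^ q := by
    have e2 := Real.rpow_nonneg (jap_pos k₂.1).le q
    have e3 := Real.rpow_nonneg (jap_pos k₃.1).le q
    have e4 := Real.rpow_nonneg (jap_pos k₄.1).le q
    refine ⟨max (jap k₂.1) (max (jap k₃.1) (jap k₄.1)), ?_, by simp, by simp, by simp, ?_⟩
    · exact le_max_of_le_left (one_le_jap _)
    · rcases max_choice (jap k₂.1) (max (jap k₃.1) (jap k₄.1)) with h | h
      · rw [h]; linarith
      · rw [h]
        rcases max_choice (jap k₃.1) (jap k₄.1) with h | h <;> rw [h] <;> linarith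
  have h1 : jap k₁.1 ≤ 3 * t := by
    have := abs_le_jap k₂.1
    have := abs_le_jap k₃.1
    have := abs_le_jap k₄.1
    exact max_le (by linarith) (by linarith)
  have hm : mx k₁ k₂ k₃ k₄ ≤ 3 * t :=
    max_le (max_le h1 (by linarith)) (max_le (by linarith) (by linarith))
  have hm0 : 0 ≤ mx k₁ k₂ k₃ k₄ := le_max_of_le_left (le_max_of_le_left (jap_pos _).le)
  have hj := jap_pos k₁.1
  calc _ ≤ (Real.exp (a * |(k₂.1 : ℝ)|) * Real.exp (a * |(k₃.1 : ℝ)|) *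
        Real.exp (a * |(k₄.1 : ℝ)|)) * (3 * t) ^ (q - s) * (3 * t) ^ s := by
        gcongr
    _ = 3 ^ q * ((Real.exp (a * |(k₂.1 : ℝ)|) * Real.exp (a * |(k₃.1 : ℝ)|) *
        Real.exp (a * |(k₄.1 : ℝ)|)) * t ^ q) := by
        rw [mul_assoc _ ((3 * t) ^ (q - s)), ← Real.rpow_add (by linarith), sub_add_cancel,
          Real.mul_rpow (by norm_num) (by linarith)]
        ring
    _ ≤ _ := by gcongr

/-- `∑ ⟨j⟩^{-2q}`. -/
def japSum (q : ℝ) : ℝ≥0∞ := ∑' k : Idx, (ENNReal.ofReal (jap k.1 ^ (-q))) ^ 2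

theorem japSum_ne_top {q : ℝ} (hq : 1 / 2 < q) : japSum q ≠ ⊤ := by
  have key : ∑' j : ℤ, (ENNReal.ofReal (jap j ^ (-q))) ^ 2 ≠ ⊤ := by
    have h1 : ∀ j : ℤ, (ENNReal.ofReal (jap j ^ (-q))) ^ 2 = ENNReal.ofReal (jap j ^ (-(2 * q))) := by
      intro j
      have := jap_pos j
      rw [← ENNReal.ofReal_pow (by positivity), ← Real.rpow_natCast, ← Real.rpow_mul this.le]
      congr 2
      push_cast; ring
    simp only [h1]
    rw [← summable_iff_tsum_ofReal_ne_top (fun j => by have := jap_pos j; positivity)]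
    have h2 : Summable fun j : ℤ => |(j : ℝ)| ^ (-(2 * q)) :=
      Real.summable_abs_int_rpow (by linarith)
    have h3 := h2.add (summable_of_ne_finset_zero (f := fun j : ℤ => if j = 0 then (1 : ℝ) else 0)
      (s := {0}) (by simp +contextual))
    refine h3.of_nonneg_of_le (fun j => by have := jap_pos j; positivity) (fun j => ?_)
    by_cases hj : j = 0
    · subst hj
      have : (0 : ℝ) ≤ |((0 : ℤ) : ℝ)| ^ (-(2 * q)) := by positivity
      simp [jap] at *
      exact this
    · have : jap j = |(j : ℝ)| := max_eq_right (by exact_mod_cast Int.one_le_abs hj)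
      simp [this, hj]
  unfold japSum
  rw [tsum_idx]
  exact ENNReal.add_ne_top.2 ⟨key, key⟩

/-- Cauchy-Schwarz after inserting `⟨j⟩^{-q} ⟨j⟩^q`. This is the embedding of weighted `ℓ²` into
`ℓ¹`, which has content when `japSum q` is finite, that is for `q > 1/2`. -/
theorem sq_tsum_exp_le {a q : ℝ} (x : Pt) :
    (∑' k : Idx, ENNReal.ofReal (Real.exp (a * |(k.1 : ℝ)|)) * ‖co x k‖ₑ) ^ 2 ≤
      japSum q * ∑' k : Idx, (ENNReal.ofReal (Real.exp (a * |(k.1 : ℝ)|)) *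
        ENNReal.ofReal (jap k.1 ^ q) * ‖co x k‖ₑ) ^ 2 := by
  refine le_trans (le_of_eq ?_) (ennreal_cauchy_schwarz _ _)
  congr 1
  refine tsum_congr fun k => ?_
  have hj := jap_pos k.1
  have : ENNReal.ofReal (jap k.1 ^ (-q)) * ENNReal.ofReal (jap k.1 ^ q) = 1 := by
    rw [← ENNReal.ofReal_mul (by positivity), ← Real.rpow_add hj]; simp
  calc _ = (ENNReal.ofReal (jap k.1 ^ (-q)) * ENNReal.ofReal (jap k.1 ^ q)) *
      (ENNReal.ofReal (Real.exp (a * |(k.1 : ℝ)|)) * ‖co x k‖ₑ) := by rw [this, one_mul]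
    _ = _ := by ring

theorem sqNorm_wt_zero (a q : ℝ) (x : Pt) : sqNorm (wt a q 0 1) x =
    ∑' k : Idx, (ENNReal.ofReal (Real.exp (a * |(k.1 : ℝ)|)) *
        ENNReal.ofReal (jap k.1 ^ q) * ‖co x k‖ₑ) ^ 2 := by
  unfold sqNorm wt
  refine tsum_congr fun k => ?_
  rw [Real.rpow_zero, mul_one, ENNReal.ofReal_mul (by positivity)]

/-- Termwise, `weight_le_of_mom` gives three products in which one factor carries `⟨j⟩^q` and the
two others only the exponential weight. The former is controlled in `ℓ²`, the latter in `ℓ¹` by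
`sq_tsum_exp_le`, and `young_conv_sum` applies. The 6 in the constant is the root of 36. -/
theorem tsum_absTri_le {g : ℤ → ℝ} {s M a q : ℝ} {K : Kernel} (hK : KernelBound g s M K)
    (hg : ∀ j, 0 ≤ g j) (hM : 0 ≤ M) (ha : 0 ≤ a) (hs : 0 ≤ s) (hq : s ≤ q) (x y z : Pt) :
    ∑' k : Idx, (ENNReal.ofReal (Real.exp (a * |(k.1 : ℝ)|) * jap k.1 ^ (q - s) * g k.1) *
      absTri K x y z k) ^ 2 ≤
    ENNReal.ofReal (6 * 3 ^ q * M) ^ 2 * japSum q ^ 2 * (sqNorm (wt a q 0 1) x *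
      sqNorm (wt a q 0 1) y * sqNorm (wt a q 0 1) z) := by
  set E : Idx → ℝ≥0∞ := fun k => ENNReal.ofReal (Real.exp (a * |(k.1 : ℝ)|)) with hE
  set Y : Idx → ℝ≥0∞ := fun k => ENNReal.ofReal (jap k.1 ^ q) with hY
  have key : ∀ k, ENNReal.ofReal (Real.exp (a * |(k.1 : ℝ)|) * jap k.1 ^ (q - s) * g k.1) *
      absTri K x y z k ≤ ENNReal.ofReal (3 ^ q * M) * ∑' l : Idx × Idx × Idx,
      momInd k l.1 l.2.1 l.2.2 *
      (E l.1 * Y l.1 * ‖co x l.1‖ₑ * (E l.2.1 * ‖co y l.2.1‖ₑ) * (E l.2.2 * ‖co z l.2.2‖ₑ) +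
       E l.1 * ‖co x l.1‖ₑ * (E l.2.1 * Y l.2.1 * ‖co y l.2.1‖ₑ) * (E l.2.2 * ‖co z l.2.2‖ₑ) +
       E l.1 * ‖co x l.1‖ₑ * (E l.2.1 * ‖co y l.2.1‖ₑ) * (E l.2.2 * Y l.2.2 * ‖co z l.2.2‖ₑ)) := by
    intro k
    unfold absTri
    rw [← ENNReal.tsum_mul_left, ← ENNReal.tsum_mul_left]
    refine ENNReal.tsum_le_tsum fun l => ?_
    by_cases hm : mom k l.1 l.2.1 l.2.2 = 0
    · have h1 : Real.exp (a * |(k.1 : ℝ)|) * jap k.1 ^ (q - s) * g k.1 * ‖K k l.1 l.2.1 l.2.2‖ ≤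
          (3 ^ q * M) * ((Real.exp (a * |(l.1.1 : ℝ)|) * Real.exp (a * |(l.2.1.1 : ℝ)|) *
        Real.exp (a * |(l.2.2.1 : ℝ)|)) * (jap l.1.1 ^ q + jap l.2.1.1 ^ q + jap l.2.2.1 ^ q)) := by
        have h2 := weight_le_of_mom ha hs hq hm
        have h3 := hK.bound k l.1 l.2.1 l.2.2
        have := jap_pos k.1
        calc _ = Real.exp (a * |(k.1 : ℝ)|) * jap k.1 ^ (q - s) *
              (‖K k l.1 l.2.1 l.2.2‖ * g k.1) := by ring
          _ ≤ Real.exp (a * |(k.1 : ℝ)|) * jap k.1 ^ (q - s) *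
              (M * mx k l.1 l.2.1 l.2.2 ^ s) := by gcongr
          _ = M * (Real.exp (a * |(k.1 : ℝ)|) * jap k.1 ^ (q - s) *
              mx k l.1 l.2.1 l.2.2 ^ s) := by ring
          _ ≤ _ := mul_le_mul_of_nonneg_left h2 hM
          _ = _ := by ring
      have j1 := jap_pos l.1.1
      have j2 := jap_pos l.2.1.1
      have j3 := jap_pos l.2.2.1
      have h4 := ENNReal.ofReal_le_ofReal h1
      have h5 := hg k.1
      have h6 := jap_pos k.1
      rw [ENNReal.ofReal_mul (by positivity), ofReal_norm,
        ENNReal.ofReal_mul (p := 3 ^ q * M) (by positivity),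
        ENNReal.ofReal_mul (p := Real.exp _ * Real.exp _ * Real.exp _) (by positivity),
        ENNReal.ofReal_mul (p := Real.exp _ * Real.exp _) (by positivity),
        ENNReal.ofReal_mul (p := Real.exp (a * |(l.1.1 : ℝ)|)) (by positivity),
        ENNReal.ofReal_add (by positivity) (by positivity),
        ENNReal.ofReal_add (by positivity) (by positivity)] at h4
      rw [momInd, if_pos hm]
      calc _ = ENNReal.ofReal (Real.exp (a * |(k.1 : ℝ)|) * jap k.1 ^ (q - s) * g k.1) *
            ‖K k l.1 l.2.1 l.2.2‖ₑ * (‖co x l.1‖ₑ * ‖co y l.2.1‖ₑ * ‖co z l.2.2‖ₑ) := by ring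
        _ ≤ _ := mul_le_mul_left h4 _
        _ = _ := by simp only [hE, hY]; ring
    · have : K k l.1 l.2.1 l.2.2 = 0 := by
        by_contra h
        exact hm (hK.supp _ _ _ _ h)
      simp [this]
  calc _ ≤ ∑' k : Idx, (ENNReal.ofReal (3 ^ q * M) * _) ^ 2 :=
        ENNReal.tsum_le_tsum fun k => pow_le_pow_left' (key k) 2
    _ = ENNReal.ofReal (3 ^ q * M) ^ 2 * _ := by
        simp only [mul_pow (ENNReal.ofReal (3 ^ q * M))]
        rw [ENNReal.tsum_mul_left]
    _ ≤ ENNReal.ofReal (3 ^ q * M) ^ 2 * _ :=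
        mul_le_mul_right (young_conv_sum _ _ _ _ _ _ (japSum q) (sq_tsum_exp_le x)
          (sq_tsum_exp_le y) (sq_tsum_exp_le z)) _
    _ = _ := by
        simp only [sqNorm_wt_zero]
        rw [mul_assoc 6, ENNReal.ofReal_mul (p := 6) (by norm_num)]
        have : ENNReal.ofReal 6 ^ 2 = 36 := by
          rw [← ENNReal.ofReal_pow (by norm_num)]; norm_num
        rw [mul_pow, this]
        ring

theorem enorm_tri_le (K : Kernel) (x y z : Pt) (k : Idx) : ‖tri K x y z k‖ₑ ≤ absTri K x y z k := by
  refine (enorm_tsum_le_tsum_enorm).trans (le_of_eq ?_)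
  simp only [enorm_mul, absTri]

theorem sqNorm_vf_le (W : ℤ → ℝ) (K : Kernel) (x y z : Pt) :
    sqNorm W (vf K x y z) ≤ 16 * ∑' k : Idx, (ENNReal.ofReal (W k.1) * absTri K x y z k) ^ 2 := by
  have h4 : ‖(4 : ℂ)‖ₑ = 4 := by
    rw [← ofReal_norm]; norm_num
  -- The first component of `vf` is built from `tri` at `(j, false)` and the second from `tri` at
  -- `(j, true)`, hence the exchange of the two sums. The 16 is the square of the factor 4 in `vf`.
  rw [sqNorm, tsum_idx, tsum_idx, add_comm, mul_add, ← ENNReal.tsum_mul_left,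
    ← ENNReal.tsum_mul_left]
  have hI : ‖Complex.I‖ₑ = 1 := by rw [← ofReal_norm]; simp
  gcongr with j j
  · calc _ = 16 * (ENNReal.ofReal (W j) * ‖tri K x y z (j, true)‖ₑ) ^ 2 := by
          simp [co, vf, h4, hI]; ring
      _ ≤ _ := by gcongr; exact enorm_tri_le _ _ _ _ _
  · calc _ = 16 * (ENNReal.ofReal (W j) * ‖tri K x y z (j, false)‖ₑ) ^ 2 := by
          simp [co, vf, h4, hI]; ring
      _ ≤ _ := by gcongr; exact enorm_tri_le _ _ _ _ _

/-- The constant in the estimate `vf_normLE`. -/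
def triConst (q : ℝ) : ℝ := 24 * 3 ^ q * (japSum q).toReal

theorem triConst_nonneg (q : ℝ) : 0 ≤ triConst q := by unfold triConst; positivity

theorem vf_normLE {b c s M a q r₁ r₂ r₃ : ℝ} {K : Kernel}
    (hK : KernelBound (fun j => ww c j ^ b) s M K)
    (hM : 0 ≤ M) (ha : 0 ≤ a) (hs : 0 ≤ s) (hq : s ≤ q) (hq' : 1 / 2 < q) {x y z : Pt}
    (hx : NormLE₀ a q x r₁) (hy : NormLE₀ a q y r₂) (hz : NormLE₀ a q z r₃) :
    NormLE a (q - s) b c (vf K x y z) (triConst q * M * (r₁ * r₂ * r₃)) := by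
  have h1 := hx.nonneg
  have h2 := hy.nonneg
  have h3 := hz.nonneg
  rw [normLE_iff (by have := triConst_nonneg q; positivity)]
  have hx' := (normLE_iff h1).1 hx
  have hy' := (normLE_iff h2).1 hy
  have hz' := (normLE_iff h3).1 hz
  have key := tsum_absTri_le hK (fun j => Real.rpow_nonneg (ww_pos c j).le _) hM ha hs hq x y z
  calc sqNorm (wt a (q - s) b c) (vf K x y z)
    _ ≤ 16 * _ := (sqNorm_vf_le _ _ _ _ _).trans (mul_le_mul_right key _)
    _ ≤ 16 * (ENNReal.ofReal (6 * 3 ^ q * M) ^ 2 * japSum q ^ 2 * (ENNReal.ofReal r₁ ^ 2 *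
        ENNReal.ofReal r₂ ^ 2 * ENNReal.ofReal r₃ ^ 2)) := by
        refine mul_le_mul_right (mul_le_mul_right ?_ _) _
        exact mul_le_mul' (mul_le_mul' hx' hy') hz'
    _ = _ := by
        unfold triConst
        have hD : 0 ≤ 6 * 3 ^ q * M := by positivity
        -- `24 = 4 · 6`, with 4 from `vf` and 6 from the convolution estimate.
        rw [show 24 * 3 ^ q * (japSum q).toReal * M * (r₁ * r₂ * r₃) =
          4 * ((6 * 3 ^ q * M) * (japSum q).toReal * (r₁ * r₂ * r₃)) by ring]
        generalize 6 * 3 ^ q * M = D at hD ⊢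
        rw [ENNReal.ofReal_mul (p := 4) (by norm_num),
          ENNReal.ofReal_mul (p := D * _) (by positivity), ENNReal.ofReal_mul hD,
          ENNReal.ofReal_mul (p := r₁ * r₂) (by positivity), ENNReal.ofReal_mul h1,
          ENNReal.ofReal_toReal (japSum_ne_top hq')]
        have : ENNReal.ofReal 4 ^ 2 = 16 := by
          rw [← ENNReal.ofReal_pow (by norm_num)]; norm_num
        simp only [mul_pow]
        rw [this]

theorem absTri_ne_top {g : ℤ → ℝ} {s M a q : ℝ} {K : Kernel} (hK : KernelBound g s M K)
    (hg : ∀ j, 0 < g j) (hM : 0 ≤ M) (ha : 0 ≤ a) (hs : 0 ≤ s) (hq : s ≤ q) (hq' : 1 / 2 < q)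
    {x y z : Pt} (hx : x ∈ phaseSub a q 0 1) (hy : y ∈ phaseSub a q 0 1)
    (hz : z ∈ phaseSub a q 0 1) (k : Idx) : absTri K x y z k ≠ ⊤ := by
  have h := tsum_absTri_le hK (fun j => (hg j).le) hM ha hs hq x y z
  rw [mem_phaseSub_iff] at hx hy hz
  have h1 := japSum_ne_top hq'
  have h2 := (ENNReal.le_tsum k).trans h
  intro h3
  have h4 : ENNReal.ofReal (Real.exp (a * |(k.1 : ℝ)|) * jap k.1 ^ (q - s) * g k.1) ≠ 0 := by
    have := hg k.1
    have := jap_pos k.1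
    rw [ne_eq, ENNReal.ofReal_eq_zero, not_le]
    positivity
  rw [h3, ENNReal.mul_top h4] at h2
  have h5 : ENNReal.ofReal (6 * 3 ^ q * M) ^ 2 * japSum q ^ 2 * (sqNorm (wt a q 0 1) x *
      sqNorm (wt a q 0 1) y * sqNorm (wt a q 0 1) z) ≠ ⊤ := by finiteness
  simp only [ne_eq, OfNat.ofNat_ne_zero, not_false_eq_true, ENNReal.top_pow, top_le_iff] at h2
  exact h5 h2

end KGNormalForm
end

noncomputable section
namespace KGNormalForm
open scoped ENNReal

/-! ### The phase space as a Banach space -/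

theorem Phase.val_injective {a q β c : ℝ} : Function.Injective (Phase.val (a := a) (q := q)
    (β := β) (c := c)) := Subtype.val_injective

theorem Phase.val_mem {a q β c : ℝ} (x : Phase a q β c) : x.val ∈ phaseSub a q β c := x.2

@[simp] theorem Phase.val_mk {a q β c : ℝ} (x : Pt) (h : x ∈ phaseSub a q β c) :
    (Phase.mk x h).val = x := rfl

@[simp] theorem Phase.val_add {a q β c : ℝ} (x y : Phase a q β c) :
    (x + y).val = x.val + y.val := rfl

@[simp] theorem Phase.val_sub {a q β c : ℝ} (x y : Phase a q β c) :
    (x - y).val = x.val - y.val := rfl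

@[simp] theorem Phase.val_zero {a q β c : ℝ} : (0 : Phase a q β c).val = 0 := rfl

@[simp] theorem Phase.val_smul {a q β c : ℝ} (k : ℂ) (x : Phase a q β c) :
    (k • x).val = k • x.val := rfl

theorem Phase.normLE {a q β c : ℝ} (x : Phase a q β c) : NormLE a q β c x.val ‖x‖ :=
  ⟨x.val_mem, (Phase.norm_eq x).ge⟩

theorem NormLE.norm_mk_le {a q β c r : ℝ} {x : Pt} (h : NormLE a q β c x r) :
    ‖Phase.mk x h.1‖ ≤ r := (Phase.norm_eq _).le.trans h.2

theorem mem_Ball_iff {a q β c R : ℝ} (x : Phase a q β c) :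
    x.val ∈ Ball a q β c R ↔ x ∈ Metric.ball 0 R := by
  rw [mem_ball_zero_iff, Phase.norm_eq]
  exact ⟨fun h => h.2, fun h => ⟨x.val_mem, h⟩⟩

theorem toL2_surjective (a q β c : ℝ) : Function.Surjective (toL2 a q β c) := by
  intro y
  have h0 : ∀ j, (wt a q β c j : ℂ) ≠ 0 := fun j => by
    exact_mod_cast (wt_pos a q β c j).ne'
  have key : ∀ f : lp (fun _ : ℤ => ℂ) 2,
      Summable (fun j => wt a q β c j ^ 2 * ‖(wt a q β c j : ℂ)⁻¹ * f j‖ ^ 2) := by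
    intro f
    rw [← memlp_iff]
    simp only [mul_inv_cancel_left₀ (h0 _)]
    exact f.2
  refine ⟨⟨(fun j => (wt a q β c j : ℂ)⁻¹ * y.fst j, fun j => (wt a q β c j : ℂ)⁻¹ * y.snd j),
    key _, key _⟩, ?_⟩
  apply (WithLp.equiv 2 _).injective
  refine Prod.ext (Subtype.ext (funext fun j => ?_)) (Subtype.ext (funext fun j => ?_))
  · exact mul_inv_cancel_left₀ (h0 j) _
  · exact mul_inv_cancel_left₀ (h0 j) _

instance (a q β c : ℝ) : CompleteSpace (Phase a q β c) := by
  let e : Phase a q β c ≃ᵢ WithLp 2 (lp (fun _ : ℤ => ℂ) 2 × lp (fun _ : ℤ => ℂ) 2) :=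
    IsometryEquiv.mk (Equiv.ofBijective _ ⟨toL2_injective a q β c, toL2_surjective a q β c⟩)
      (Isometry.of_dist_eq fun x y => rfl)
  exact e.completeSpace

/-! ### Trilinearity of the vector fields -/

@[simp] theorem co_add (x y : Pt) (k : Idx) : co (x + y) k = co x k + co y k := by
  unfold co; split_ifs <;> rfl

@[simp] theorem co_smul (r : ℂ) (x : Pt) (k : Idx) : co (r • x) k = r * co x k := by
  unfold co; split_ifs <;> rfl

/-- Symmetry of a kernel under permutations of its arguments. -/
structure SymmKernel (K : Kernel) : Prop where
  s₁₂ : ∀ k₁ k₂ k₃ k₄, K k₁ k₂ k₃ k₄ = K k₂ k₁ k₃ k₄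
  s₂₃ : ∀ k₁ k₂ k₃ k₄, K k₁ k₂ k₃ k₄ = K k₁ k₃ k₂ k₄
  s₃₄ : ∀ k₁ k₂ k₃ k₄, K k₁ k₂ k₃ k₄ = K k₁ k₂ k₄ k₃

/-- Exchange of the last two components of a triple. -/
def swapLast : Idx × Idx × Idx ≃ Idx × Idx × Idx where
  toFun l := (l.1, l.2.2, l.2.1)
  invFun l := (l.1, l.2.2, l.2.1)
  left_inv _ := rfl
  right_inv _ := rfl

theorem tri_symm₁ {K : Kernel} (hK : SymmKernel K) (x y z : Pt) (k : Idx) :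
    tri K x y z k = tri K y x z k := by
  unfold tri
  rw [← swapTwo.tsum_eq]
  refine tsum_congr fun l => ?_
  simp only [swapTwo, Equiv.coe_fn_mk]
  rw [hK.s₂₃]; ring

theorem tri_symm₂ {K : Kernel} (hK : SymmKernel K) (x y z : Pt) (k : Idx) :
    tri K x y z k = tri K x z y k := by
  unfold tri
  rw [← swapLast.tsum_eq]
  refine tsum_congr fun l => ?_
  simp only [swapLast, Equiv.coe_fn_mk]
  rw [hK.s₃₄]; ring

theorem vf_symm₁ {K : Kernel} (hK : SymmKernel K) (x y z : Pt) : vf K x y z = vf K y x z := by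
  simp only [vf, tri_symm₁ hK x y z]

theorem vf_symm₂ {K : Kernel} (hK : SymmKernel K) (x y z : Pt) : vf K x y z = vf K x z y := by
  simp only [vf, tri_symm₂ hK x y z]

/-- Symmetric kernels whose cubic vector field gains the weight `𝚠_j ^ b`. -/
structure GoodKernel (c b M : ℝ) (K : Kernel) : Prop where
  symm : SymmKernel K
  bound : KernelBound (fun j => ww c j ^ b) 0 M K
  M_nonneg : 0 ≤ M

theorem summable_of_tsum_enorm_ne_top {ι : Type*} {f : ι → ℂ} (h : ∑' i, ‖f i‖ₑ ≠ ⊤) :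
    Summable f := by
  have := (summable_iff_tsum_ofReal_ne_top (f := fun i => ‖f i‖) fun i => norm_nonneg _).2
    (by simpa only [ofReal_norm] using h)
  exact this.of_norm

section
variable {c b s M a q : ℝ} {K : Kernel}

theorem summable_tri {g : ℤ → ℝ} (hK : KernelBound g s M K) (hg : ∀ j, 0 < g j) (hM : 0 ≤ M)
    (ha : 0 ≤ a) (hs : 0 ≤ s) (hsq : s ≤ q) (hq : 1 / 2 < q) {x y z : Pt}
    (hx : x ∈ phaseSub a q 0 1) (hy : y ∈ phaseSub a q 0 1) (hz : z ∈ phaseSub a q 0 1)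
    (k : Idx) : Summable fun l : Idx × Idx × Idx =>
      K k l.1 l.2.1 l.2.2 * co x l.1 * co y l.2.1 * co z l.2.2 := by
  apply summable_of_tsum_enorm_ne_top
  simpa only [enorm_mul, absTri] using absTri_ne_top hK hg hM ha hs hsq hq hx hy hz k

theorem GoodKernel.summable_tri (hK : GoodKernel c b M K) (ha : 0 ≤ a) (hq : 1 / 2 < q) {x y z : Pt}
    (hx : x ∈ phaseSub a q 0 1) (hy : y ∈ phaseSub a q 0 1) (hz : z ∈ phaseSub a q 0 1)
    (k : Idx) : Summable fun l : Idx × Idx × Idx =>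
      K k l.1 l.2.1 l.2.2 * co x l.1 * co y l.2.1 * co z l.2.2 :=
  KGNormalForm.summable_tri hK.bound (fun j => Real.rpow_pos_of_pos (ww_pos c j) _) hK.M_nonneg ha
    le_rfl (by linarith) hq hx hy hz k

theorem GoodKernel.vf_add (hK : GoodKernel c b M K) (ha : 0 ≤ a) (hq : 1 / 2 < q) {x y z z' : Pt}
    (hx : x ∈ phaseSub a q 0 1) (hy : y ∈ phaseSub a q 0 1) (hz : z ∈ phaseSub a q 0 1)
    (hz' : z' ∈ phaseSub a q 0 1) : vf K x y (z + z') = vf K x y z + vf K x y z' := by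
  have h : ∀ k, tri K x y (z + z') k = tri K x y z k + tri K x y z' k := fun k => by
    unfold tri
    rw [← (hK.summable_tri ha hq hx hy hz k).tsum_add (hK.summable_tri ha hq hx hy hz' k)]
    exact tsum_congr fun l => by rw [co_add]; ring
  refine Prod.ext (funext fun j => ?_) (funext fun j => ?_)
  · simp only [vf, h, Prod.fst_add, Pi.add_apply]; ring
  · simp only [vf, h, Prod.snd_add, Pi.add_apply]; ring

theorem vf_smul (K : Kernel) (x y z : Pt) (r : ℂ) : vf K x y (r • z) = r • vf K x y z := by
  have h : ∀ k, tri K x y (r • z) k = r * tri K x y z k := fun k => by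
    unfold tri
    rw [← tsum_mul_left]
    exact tsum_congr fun l => by rw [co_smul]; ring
  refine Prod.ext (funext fun j => ?_) (funext fun j => ?_)
  · simp only [vf, h, Prod.smul_fst, Pi.smul_apply, smul_eq_mul]; ring
  · simp only [vf, h, Prod.smul_snd, Pi.smul_apply, smul_eq_mul]; ring

theorem GoodKernel.vf_normLE (hK : GoodKernel c b M K) (ha : 0 ≤ a) (hq : 1 / 2 < q) {x y z : Pt}
    {r₁ r₂ r₃ : ℝ} (hx : NormLE₀ a q x r₁) (hy : NormLE₀ a q y r₂) (hz : NormLE₀ a q z r₃) :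
    NormLE a q b c (vf K x y z) (triConst q * M * (r₁ * r₂ * r₃)) := by
  simpa using KGNormalForm.vf_normLE hK.bound hK.M_nonneg ha le_rfl (by linarith) hq hx hy hz

end

/-! ### Quadrilinear forms -/

/-- The quadrilinear form with kernel `K`. -/
def quad (K : Kernel) (x y z w : Pt) : ℂ :=
  ∑' l : Idx × Idx × Idx × Idx, K l.1 l.2.1 l.2.2.1 l.2.2.2 *
    (co x l.1 * co y l.2.1 * co z l.2.2.1 * co w l.2.2.2)

/-- The homogeneous polynomial of degree four with kernel `K`. -/
def poly (K : Kernel) (x : Pt) : ℂ := quad K x x x x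

/-- Exchange of the first two components of a quadruple. -/
def swapFirst₄ : Idx × Idx × Idx × Idx ≃ Idx × Idx × Idx × Idx where
  toFun l := (l.2.1, l.1, l.2.2)
  invFun l := (l.2.1, l.1, l.2.2)
  left_inv _ := rfl
  right_inv _ := rfl

theorem quad_symm₁ {K : Kernel} (hK : SymmKernel K) (x y z w : Pt) :
    quad K x y z w = quad K y x z w := by
  unfold quad
  rw [← swapFirst₄.tsum_eq]
  refine tsum_congr fun l => ?_
  simp only [swapFirst₄, Equiv.coe_fn_mk]
  rw [hK.s₁₂]; ring

/-- Exchange of the middle components of a quadruple. -/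
def swapMiddle₄ : Idx × Idx × Idx × Idx ≃ Idx × Idx × Idx × Idx where
  toFun l := (l.1, l.2.2.1, l.2.1, l.2.2.2)
  invFun l := (l.1, l.2.2.1, l.2.1, l.2.2.2)
  left_inv _ := rfl
  right_inv _ := rfl

theorem quad_symm₂ {K : Kernel} (hK : SymmKernel K) (x y z w : Pt) :
    quad K x y z w = quad K x z y w := by
  unfold quad
  rw [← swapMiddle₄.tsum_eq]
  refine tsum_congr fun l => ?_
  simp only [swapMiddle₄, Equiv.coe_fn_mk]
  rw [hK.s₂₃]; ring

/-- Exchange of the last two components of a quadruple. -/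
def swapLast₄ : Idx × Idx × Idx × Idx ≃ Idx × Idx × Idx × Idx where
  toFun l := (l.1, l.2.1, l.2.2.2, l.2.2.1)
  invFun l := (l.1, l.2.1, l.2.2.2, l.2.2.1)
  left_inv _ := rfl
  right_inv _ := rfl

theorem quad_symm₃ {K : Kernel} (hK : SymmKernel K) (x y z w : Pt) :
    quad K x y z w = quad K x y w z := by
  unfold quad
  rw [← swapLast₄.tsum_eq]
  refine tsum_congr fun l => ?_
  simp only [swapLast₄, Equiv.coe_fn_mk]
  rw [hK.s₃₄]; ring

/-- Duality: by `hgq` the weight of `w` times the weight in which `tri` is controlled is at least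
one, so Cauchy-Schwarz bounds the pairing. This leaves room for kernels that lose derivatives, as
those of `mulFst` do. -/
theorem tsum_enorm_mul_absTri_ne_top {g : ℤ → ℝ} {s M a q : ℝ} {K : Kernel}
    (hK : KernelBound g s M K) (hg : ∀ j, 0 < g j) (hM : 0 ≤ M) (ha : 0 ≤ a) (hs : 0 ≤ s)
    (hsq : s ≤ q) (hq : 1 / 2 < q) (hgq : ∀ j, 1 ≤ jap j ^ (q - s) * g j * jap j ^ q)
    {x y z w : Pt} (hx : x ∈ phaseSub a q 0 1) (hy : y ∈ phaseSub a q 0 1)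
    (hz : z ∈ phaseSub a q 0 1) (hw : w ∈ phaseSub a q 0 1) :
    ∑' k, ‖co w k‖ₑ * absTri K x y z k ≠ ⊤ := by
  have h := tsum_absTri_le hK (fun j => (hg j).le) hM ha hs hsq x y z
  rw [mem_phaseSub_iff] at hx hy hz hw
  have h1 := japSum_ne_top hq
  have h2 : ∑' k : Idx, (ENNReal.ofReal (Real.exp (a * |(k.1 : ℝ)|) * jap k.1 ^ (q - s) * g k.1) *
      absTri K x y z k) ^ 2 ≠ ⊤ := ne_top_of_le_ne_top (by finiteness) h
  have h3 := ennreal_cauchy_schwarz (fun k : Idx => ENNReal.ofReal (wt a q 0 1 k.1) * ‖co w k‖ₑ)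
    (fun k : Idx => ENNReal.ofReal (Real.exp (a * |(k.1 : ℝ)|) * jap k.1 ^ (q - s) * g k.1) *
      absTri K x y z k)
  have h4 : ∑' k, ‖co w k‖ₑ * absTri K x y z k ≤ ∑' k : Idx,
      ENNReal.ofReal (wt a q 0 1 k.1) * ‖co w k‖ₑ *
      (ENNReal.ofReal (Real.exp (a * |(k.1 : ℝ)|) * jap k.1 ^ (q - s) * g k.1) *
      absTri K x y z k) := by
    refine ENNReal.tsum_le_tsum fun k => ?_
    have h5 : 1 ≤ ENNReal.ofReal (wt a q 0 1 k.1) *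
        ENNReal.ofReal (Real.exp (a * |(k.1 : ℝ)|) * jap k.1 ^ (q - s) * g k.1) := by
      rw [← ENNReal.ofReal_mul (wt_pos _ _ _ _ _).le, ENNReal.one_le_ofReal]
      have h6 : 1 ≤ Real.exp (a * |(k.1 : ℝ)|) := Real.one_le_exp (by positivity)
      have h7 := hgq k.1
      unfold wt
      rw [Real.rpow_zero]
      have h8 := one_le_mul_of_one_le_of_one_le (one_le_mul_of_one_le_of_one_le h6 h6) h7
      linarith
    calc _ = 1 * (‖co w k‖ₑ * absTri K x y z k) := (one_mul _).symm
      _ ≤ _ * (‖co w k‖ₑ * absTri K x y z k) := mul_le_mul_left h5 _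
      _ = _ := by ring
  intro h9
  rw [h9, top_le_iff] at h4
  rw [h4, ENNReal.top_pow (by norm_num), top_le_iff] at h3
  exact ENNReal.mul_ne_top hw h2 h3

theorem summable_quad {g : ℤ → ℝ} {s M a q : ℝ} {K : Kernel}
    (hK : KernelBound g s M K) (hg : ∀ j, 0 < g j) (hM : 0 ≤ M) (ha : 0 ≤ a) (hs : 0 ≤ s)
    (hsq : s ≤ q) (hq : 1 / 2 < q) (hgq : ∀ j, 1 ≤ jap j ^ (q - s) * g j * jap j ^ q)
    {x y z w : Pt} (hx : x ∈ phaseSub a q 0 1) (hy : y ∈ phaseSub a q 0 1)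
    (hz : z ∈ phaseSub a q 0 1) (hw : w ∈ phaseSub a q 0 1) :
    Summable fun l : Idx × Idx × Idx × Idx => K l.1 l.2.1 l.2.2.1 l.2.2.2 *
      (co w l.1 * co x l.2.1 * co y l.2.2.1 * co z l.2.2.2) := by
  apply summable_of_tsum_enorm_ne_top
  have h := tsum_enorm_mul_absTri_ne_top hK hg hM ha hs hsq hq hgq hx hy hz hw
  rw [ennreal_tsum_prod]
  convert h using 3 with k
  rw [absTri, ← ENNReal.tsum_mul_left]
  refine tsum_congr fun l => ?_
  simp only [enorm_mul]; ring

theorem quad_eq_tsum {g : ℤ → ℝ} {s M a q : ℝ} {K : Kernel}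
    (hK : KernelBound g s M K) (hg : ∀ j, 0 < g j) (hM : 0 ≤ M) (ha : 0 ≤ a) (hs : 0 ≤ s)
    (hsq : s ≤ q) (hq : 1 / 2 < q) (hgq : ∀ j, 1 ≤ jap j ^ (q - s) * g j * jap j ^ q)
    {x y z w : Pt} (hx : x ∈ phaseSub a q 0 1) (hy : y ∈ phaseSub a q 0 1)
    (hz : z ∈ phaseSub a q 0 1) (hw : w ∈ phaseSub a q 0 1) :
    Summable (fun k => co w k * tri K x y z k) ∧
      quad K w x y z = ∑' k, co w k * tri K x y z k := by
  have h := summable_quad hK hg hM ha hs hsq hq hgq hx hy hz hw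
  have h1 : ∀ k, co w k * tri K x y z k = ∑' l : Idx × Idx × Idx, K k l.1 l.2.1 l.2.2 *
      (co w k * co x l.1 * co y l.2.1 * co z l.2.2) := fun k => by
    rw [tri, ← tsum_mul_left]
    exact tsum_congr fun l => by ring
  simp only [h1]
  exact ⟨h.prod, h.tsum_prod⟩

section
variable {c b M a q : ℝ} {K : Kernel}

theorem one_le_weights (hb : 0 ≤ b) (hq : 1 / 2 < q) (j : ℤ) :
    1 ≤ jap j ^ (q - 0) * ww c j ^ b * jap j ^ q :=
  one_le_mul_of_one_le_of_one_le (one_le_mul_of_one_le_of_one_le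
    (Real.one_le_rpow (one_le_jap j) (by linarith)) (Real.one_le_rpow (one_le_ww c j) hb))
    (Real.one_le_rpow (one_le_jap j) (by linarith))

theorem GoodKernel.summable_quad (hK : GoodKernel c b M K) (hb : 0 ≤ b) (ha : 0 ≤ a)
    (hq : 1 / 2 < q) {x y z w : Pt}
    (hx : x ∈ phaseSub a q 0 1) (hy : y ∈ phaseSub a q 0 1)
    (hz : z ∈ phaseSub a q 0 1) (hw : w ∈ phaseSub a q 0 1) :
    Summable fun l : Idx × Idx × Idx × Idx => K l.1 l.2.1 l.2.2.1 l.2.2.2 *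
      (co w l.1 * co x l.2.1 * co y l.2.2.1 * co z l.2.2.2) :=
  KGNormalForm.summable_quad hK.bound (fun j => Real.rpow_pos_of_pos (ww_pos c j) _) hK.M_nonneg ha
    le_rfl (by linarith) hq (one_le_weights hb hq) hx hy hz hw

/-- The factors `∓4i` in the two components of `vf` and the sign in `sympl` combine so that pairing
with `w` closes the trilinear sum to the full quadrilinear form. Skewness of the field then becomes
symmetry of that form. -/
theorem GoodKernel.sympl_vf (hK : GoodKernel c b M K) (hb : 0 ≤ b) (ha : 0 ≤ a) (hq : 1 / 2 < q)
    {x y z w : Pt} (hx : x ∈ phaseSub a q 0 1) (hy : y ∈ phaseSub a q 0 1)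
    (hz : z ∈ phaseSub a q 0 1) (hw : w ∈ phaseSub a q 0 1) :
    sympl (vf K x y z) w = -4 * Complex.I * quad K w x y z := by
  obtain ⟨h1, h2⟩ := quad_eq_tsum hK.bound (fun j => Real.rpow_pos_of_pos (ww_pos c j) _)
    hK.M_nonneg ha le_rfl (by linarith) hq (one_le_weights hb hq) hx hy hz hw
  rw [h2, h1.tsum_prod, ← tsum_mul_left, sympl]
  refine tsum_congr fun j => ?_
  rw [tsum_bool]
  simp only [vf, co, Bool.false_eq_true, if_true, if_false]
  ring

theorem sympl_anti (u v : Pt) : sympl u v = -sympl v u := by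
  unfold sympl
  rw [← tsum_neg]
  exact tsum_congr fun j => by ring

theorem GoodKernel.sympl_skew (hK : GoodKernel c b M K) (hb : 0 ≤ b) (ha : 0 ≤ a) (hq : 1 / 2 < q)
    {x y z w : Pt} (hx : x ∈ phaseSub a q 0 1) (hy : y ∈ phaseSub a q 0 1)
    (hz : z ∈ phaseSub a q 0 1) (hw : w ∈ phaseSub a q 0 1) :
    sympl (vf K x y z) w = -sympl z (vf K x y w) := by
  rw [sympl_anti z, neg_neg, hK.sympl_vf hb ha hq hx hy hz hw, hK.sympl_vf hb ha hq hx hy hw hz]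
  congr 1
  rw [quad_symm₁ hK.symm, quad_symm₂ hK.symm, quad_symm₃ hK.symm, quad_symm₂ hK.symm,
    quad_symm₁ hK.symm]

end

/-! ### The structure on the phase space -/

theorem one_le_wt {a q β : ℝ} (ha : 0 ≤ a) (hq : 0 ≤ q) (hβ : 0 ≤ β) (c : ℝ) (j : ℤ) :
    1 ≤ wt a q β c j :=
  one_le_mul_of_one_le_of_one_le (one_le_mul_of_one_le_of_one_le
    (Real.one_le_exp (by positivity)) (Real.one_le_rpow (one_le_jap j) hq))
    (Real.one_le_rpow (one_le_ww c j) hβ)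

theorem exists_sympl {a q β : ℝ} (ha : 0 ≤ a) (hq : 0 ≤ q) (hβ : 0 ≤ β) (c : ℝ) :
    ∃ ω : Phase a q β c →L[ℂ] Phase a q β c →L[ℂ] ℂ, (∀ u v, ω u v = sympl u.val v.val) ∧
      ∀ u v, ‖ω u v‖ ≤ ‖u‖ * ‖v‖ := by
  have h1 : ∀ (u : Phase a q β c) (j : ℤ), ‖u.val.1 j‖ ≤ wt a q β c j * ‖u.val.1 j‖ ∧
      ‖u.val.2 j‖ ≤ wt a q β c j * ‖u.val.2 j‖ := fun u j =>
    ⟨le_mul_of_one_le_left (norm_nonneg _) (one_le_wt ha hq hβ c j),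
      le_mul_of_one_le_left (norm_nonneg _) (one_le_wt ha hq hβ c j)⟩
  have hs : ∀ u : Phase a q β c, HasSum (fun j => (wt a q β c j * ‖u.val.1 j‖) ^ 2 +
      (wt a q β c j * ‖u.val.2 j‖) ^ 2) (‖u‖ ^ 2) := by
    intro u
    rw [Phase.norm_eq, phaseNorm, Real.sq_sqrt (by positivity)]
    simp only [mul_pow]
    exact u.val_mem.1.hasSum.add u.val_mem.2.hasSum
  have hle : ∀ (u v : Phase a q β c) (r : ℝ), 0 < r → ∀ j,
      ‖u.val.1 j * v.val.2 j - u.val.2 j * v.val.1 j‖ ≤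
      (r * ((wt a q β c j * ‖u.val.1 j‖) ^ 2 + (wt a q β c j * ‖u.val.2 j‖) ^ 2) +
      r⁻¹ * ((wt a q β c j * ‖v.val.1 j‖) ^ 2 + (wt a q β c j * ‖v.val.2 j‖) ^ 2)) / 2 := by
    intro u v r hr j
    have hamgm : ∀ s t : ℝ, s * t ≤ (r * s ^ 2 + r⁻¹ * t ^ 2) / 2 := by
      intro s t
      have := sq_nonneg (r * s - t)
      have h3 : (r * s ^ 2 + r⁻¹ * t ^ 2) / 2 - s * t = r⁻¹ * (r * s - t) ^ 2 / 2 := by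
        field_simp; ring
      have : 0 ≤ r⁻¹ * (r * s - t) ^ 2 / 2 := by positivity
      linarith
    calc _ ≤ ‖u.val.1 j * v.val.2 j‖ + ‖u.val.2 j * v.val.1 j‖ := norm_sub_le _ _
      _ ≤ (wt a q β c j * ‖u.val.1 j‖) * (wt a q β c j * ‖v.val.2 j‖) +
          (wt a q β c j * ‖u.val.2 j‖) * (wt a q β c j * ‖v.val.1 j‖) := by
          rw [norm_mul, norm_mul]
          have := h1 u j
          have := h1 v j
          have := wt_pos a q β c j
          gcongr <;> tauto
      _ ≤ _ := by
          have e1 := hamgm (wt a q β c j * ‖u.val.1 j‖) (wt a q β c j * ‖v.val.2 j‖)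
          have e2 := hamgm (wt a q β c j * ‖u.val.2 j‖) (wt a q β c j * ‖v.val.1 j‖)
          linarith
  have hmaj : ∀ (u v : Phase a q β c) (r : ℝ), HasSum (fun j =>
      (r * ((wt a q β c j * ‖u.val.1 j‖) ^ 2 + (wt a q β c j * ‖u.val.2 j‖) ^ 2) +
      r⁻¹ * ((wt a q β c j * ‖v.val.1 j‖) ^ 2 + (wt a q β c j * ‖v.val.2 j‖) ^ 2)) / 2)
      ((r * ‖u‖ ^ 2 + r⁻¹ * ‖v‖ ^ 2) / 2) := fun u v r =>
    (((hs u).mul_left r).add ((hs v).mul_left r⁻¹)).div_const 2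
  have hsum : ∀ u v : Phase a q β c,
      Summable fun j => u.val.1 j * v.val.2 j - u.val.2 j * v.val.1 j := fun u v =>
    Summable.of_norm_bounded (hmaj u v 1).summable (hle u v 1 one_pos)
  have hbd : ∀ u v : Phase a q β c, ‖sympl u.val v.val‖ ≤ 1 * ‖u‖ * ‖v‖ := by
    intro u v
    have hr : ∀ r : ℝ, 0 < r → ‖sympl u.val v.val‖ ≤ (r * ‖u‖ ^ 2 + r⁻¹ * ‖v‖ ^ 2) / 2 := fun r hr =>
      tsum_of_norm_bounded (hmaj u v r) (hle u v r hr)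
    rcases eq_or_ne u 0 with rfl | hu
    · simp [sympl]
    rcases eq_or_ne v 0 with rfl | hv
    · simp [sympl]
    have hu' := norm_pos_iff.2 hu
    have hv' := norm_pos_iff.2 hv
    -- This `r` is optimal in the weighted arithmetic-geometric inequality and gives the constant
    -- one.
    refine (hr (‖v‖ / ‖u‖) (by positivity)).trans (le_of_eq ?_)
    field_simp; ring
  refine ⟨LinearMap.mkContinuous₂ (LinearMap.mk₂ ℂ (fun u v => sympl u.val v.val) ?_ ?_ ?_ ?_) 1 hbd,
    fun u v => rfl, fun u v => (hbd u v).trans (by rw [one_mul])⟩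
  · intro u u' v
    unfold sympl
    rw [← (hsum u v).tsum_add (hsum u' v)]
    exact tsum_congr fun j => by simp; ring
  · intro k u v
    unfold sympl
    rw [smul_eq_mul, ← tsum_mul_left]
    exact tsum_congr fun j => by simp; ring
  · intro u v v'
    unfold sympl
    rw [← (hsum u v).tsum_add (hsum u v')]
    exact tsum_congr fun j => by simp; ring
  · intro k u v
    unfold sympl
    rw [smul_eq_mul, ← tsum_mul_left]
    exact tsum_congr fun j => by simp; ring

theorem Phase.normLE₀ {a q β c : ℝ} (hβ : 0 ≤ β) (x : Phase a q β c) :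
    NormLE₀ a q x.val ‖x‖ := x.normLE.beta_zero 1 hβ

/-- Symmetry carries linearity in the last argument over to the two others. -/
theorem exists_trilinear_of_bound {E : Type*} [NormedAddCommGroup E] [NormedSpace ℂ E]
    (f : E → E → E → E) {C : ℝ} (hC : 0 ≤ C)
    (hf : ∀ x y z, ‖f x y z‖ ≤ C * (‖x‖ * ‖y‖ * ‖z‖))
    (add₃ : ∀ x y z z', f x y (z + z') = f x y z + f x y z')
    (smul₃ : ∀ (k : ℂ) x y z, f x y (k • z) = k • f x y z)
    (symm₁ : ∀ x y z, f x y z = f y x z) (symm₂ : ∀ x y z, f x y z = f x z y) :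
    ∃ τ : E →L[ℂ] E →L[ℂ] E →L[ℂ] E, ∀ x y z, τ x y z = f x y z := by
  have add₂ : ∀ x y y' z, f x (y + y') z = f x y z + f x y' z := fun x y y' z => by
    rw [symm₂, add₃, symm₂, symm₂ x z y']
  have smul₂ : ∀ (k : ℂ) x y z, f x (k • y) z = k • f x y z := fun k x y z => by
    rw [symm₂, smul₃, symm₂]
  let g : E → E →L[ℂ] E →L[ℂ] E := fun x =>
    LinearMap.mkContinuous₂ (LinearMap.mk₂ ℂ (f x) (add₂ x) (fun k => smul₂ k x) (add₃ x)
      (fun k => smul₃ k x)) (C * ‖x‖) (fun y z => (hf x y z).trans (le_of_eq (by ring)))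
  have hg : ∀ x y z, g x y z = f x y z := fun _ _ _ => rfl
  let τ : E →ₗ[ℂ] E →L[ℂ] E →L[ℂ] E :=
    { toFun := g
      map_add' := fun x x' => by
        ext y z
        rw [add_apply, add_apply, hg, hg, hg, symm₁, add₂, symm₁, symm₁ y x']
      map_smul' := fun k x => by
        ext y z
        rw [smul_apply, smul_apply, hg, RingHom.id_apply, hg, symm₁, smul₂, symm₁] }
  have hτ : ∀ x, ‖τ x‖ ≤ C * ‖x‖ := fun x =>
    ContinuousLinearMap.opNorm_le_bound₂ _ (by positivity) fun y z => by
      change ‖f x y z‖ ≤ _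
      exact (hf x y z).trans (le_of_eq (by ring))
  exact ⟨LinearMap.mkContinuous (F := E →L[ℂ] E →L[ℂ] E) τ C hτ, fun x y z => by rw [LinearMap.mkContinuous_apply]; exact hg x y z⟩

/-- Since `0 ≤ β`, the arguments may be measured without the weight `𝚠`. The value gains `𝚠^b`, and
`β ≤ b`, so the trilinear map acts inside `𝒫^{a,q,β}` with a bound independent of `β` and `c`. -/
theorem exists_trilinear {a q β b c M : ℝ} {K : Kernel} (ha : 0 ≤ a) (hq : 1 / 2 < q) (hβ : 0 ≤ β)
    (hβb : β ≤ b) (hK : GoodKernel c b M K) :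
    ∃ τ : Phase a q β c →L[ℂ] Phase a q β c →L[ℂ] Phase a q β c →L[ℂ] Phase a q β c,
      (∀ x y z, (τ x y z).val = vf K x.val y.val z.val) ∧
      ∀ x y z, ‖τ x y z‖ ≤ triConst q * M * (‖x‖ * ‖y‖ * ‖z‖) := by
  have hC : 0 ≤ triConst q * M := mul_nonneg (triConst_nonneg q) hK.M_nonneg
  have hv : ∀ x y z : Phase a q β c, NormLE a q β c (vf K x.val y.val z.val)
      (triConst q * M * (‖x‖ * ‖y‖ * ‖z‖)) := fun x y z =>
    (hK.vf_normLE ha hq (x.normLE₀ hβ) (y.normLE₀ hβ) (z.normLE₀ hβ)).beta_mono hβb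
  have hf : ∀ x y z : Phase a q β c, ‖Phase.mk (a := a) (q := q) (β := β) (c := c)
      (vf K x.val y.val z.val) (hv x y z).1‖ ≤ triConst q * M * (‖x‖ * ‖y‖ * ‖z‖) :=
    fun x y z => (hv x y z).norm_mk_le
  have m : ∀ x : Phase a q β c, x.val ∈ phaseSub a q 0 1 := fun x => (x.normLE₀ hβ).1
  obtain ⟨τ, hτ⟩ := exists_trilinear_of_bound (E := Phase a q β c)
    (fun x y z => Phase.mk (vf K x.val y.val z.val) (hv x y z).1) hC hf
    (fun x y z z' => Phase.val_injective (hK.vf_add ha hq (m x) (m y) (m z) (m z')))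
    (fun k x y z => Phase.val_injective (vf_smul K _ _ _ k))
    (fun x y z => Phase.val_injective (vf_symm₁ hK.symm _ _ _))
    (fun x y z => Phase.val_injective (vf_symm₂ hK.symm _ _ _))
  exact ⟨τ, fun x y z => by rw [hτ]; rfl, fun x y z => by rw [hτ]; exact hf x y z⟩

/-- The Hamiltonian structure on `𝒫^{a,q,β}` given by a kernel. -/
theorem exists_symplField {a q β b c M : ℝ} {K : Kernel} (ha : 0 ≤ a) (hq : 1 / 2 < q) (hβ : 0 ≤ β)
    (hβb : β ≤ b) (hK : GoodKernel c b M K) :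
    ∃ S : SymplField (Phase a q β c), S.B = triConst q * M ∧
      (∀ x y z, (S.τ x y z).val = vf K x.val y.val z.val) ∧
      ∀ u v, S.ω u v = sympl u.val v.val := by
  obtain ⟨τ, h1, h2⟩ := exists_trilinear ha hq hβ hβb hK
  obtain ⟨ω, h3, -⟩ := exists_sympl ha (by linarith : 0 ≤ q) hβ c
  have m : ∀ x : Phase a q β c, x.val ∈ phaseSub a q 0 1 := fun x => (x.normLE₀ hβ).1
  exact ⟨{  τ := τ
            ω := ω
            B := triConst q * M
            B_nonneg := mul_nonneg (triConst_nonneg q) hK.M_nonneg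
            bound := h2
            symm₁ := fun x y z => Phase.val_injective (by rw [h1, h1, vf_symm₁ hK.symm])
            symm₂ := fun x y z => Phase.val_injective (by rw [h1, h1, vf_symm₂ hK.symm])
            anti := fun u v => by rw [h3, h3, sympl_anti]
            skew := fun x y u v => by
              rw [h3, h3, h1, h1]
              exact hK.sympl_skew (hβ.trans hβb) ha hq (m x) (m y) (m u) (m v) }, rfl, h1, h3⟩

end KGNormalForm
end

noncomputable section
namespace KGNormalForm
open scoped ENNReal

/-- As `𝚠_j ≥ 1`, the gain may be forgotten. The kernel then acts on the unweighted spaces, which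
are common to all `c`. -/
theorem GoodKernel.weaken {c b M : ℝ} {K : Kernel} (hK : GoodKernel c b M K) (hb : 0 ≤ b) :
    GoodKernel 1 0 M K where
  symm := hK.symm
  M_nonneg := hK.M_nonneg
  bound :=
    { supp := hK.bound.supp
      bound := fun k₁ k₂ k₃ k₄ => by
        refine le_trans ?_ (hK.bound.bound k₁ k₂ k₃ k₄)
        rw [Real.rpow_zero]
        gcongr
        exact Real.one_le_rpow (one_le_ww c _) hb }

/-! ### The implicit midpoint map -/

open Classical in
/-- The solution `m` of `m - X(m) / 2 = x`, where `X` is the Hamiltonian vector field of the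
polynomial with kernel `K`. -/
def midPt (a q R : ℝ) (K : Kernel) (x : Pt) : Pt :=
  -- The choice is made in one unweighted space, later that of lowest regularity. Uniqueness
  -- identifies it with the solutions in the smaller spaces, so that a single map serves all of
  -- them. The default `x` is not used where the equation is solvable.
  if h : ∃ m ∈ Ball₀ a q (2 * R), m - (1 / 2 : ℂ) • vf K m m m = x then h.choose else x

/-- The implicit midpoint map `x ↦ m + X(m) / 2`. -/
def midMap (a q R : ℝ) (K : Kernel) (x : Pt) : Pt :=
  midPt a q R K x + (1 / 2 : ℂ) • vf K (midPt a q R K x) (midPt a q R K x) (midPt a q R K x)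

theorem Ball_subset {a q q' β c R R' : ℝ} (hq : q' ≤ q) (hβ : 0 ≤ β) (hR : R ≤ R') {x : Pt}
    (hx : x ∈ Ball a q β c R) : x ∈ Ball₀ a q' R' := by
  have := ((normLE_self hx.1).q_mono hq).beta_zero 1 hβ
  exact ⟨this.1, (this.2.trans_lt hx.2).trans_le hR⟩

theorem midPt_eq {a q R c b M : ℝ} {K : Kernel} (hK : GoodKernel c b M K) (hb : 0 ≤ b) (ha : 0 ≤ a)
    (hq : 1 / 2 < q) (hR : triConst q * M * R ^ 2 ≤ 1 / 64) {m x : Pt}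
    (hm : m ∈ Ball₀ a q (2 * R)) (hx : m - (1 / 2 : ℂ) • vf K m m m = x) :
    midPt a q R K x = m := by
  obtain ⟨S, hB, hτ, -⟩ := exists_symplField ha hq le_rfl le_rfl (hK.weaken hb)
  have h : ∃ m ∈ Ball₀ a q (2 * R), m - (1 / 2 : ℂ) • vf K m m m = x := ⟨m, hm, hx⟩
  rw [midPt, dif_pos h]
  obtain ⟨h1, h2⟩ := h.choose_spec
  set m' := h.choose
  have hinj := S.injOn_G (R := R) (by rw [hB]; exact hR) (s := -(1 / 2)) (by norm_num)
  have hG : ∀ u : Phase a q 0 1, (S.G (-(1 / 2)) u).val =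
      u.val - (1 / 2 : ℂ) • vf K u.val u.val u.val := fun u => by
    rw [SymplField.G, Phase.val_add, Phase.val_smul, hτ, neg_smul, sub_eq_add_neg]
  have := @hinj (Phase.mk m' h1.1) ((mem_Ball_iff _).1 h1) (Phase.mk m hm.1) ((mem_Ball_iff _).1 hm)
    (Phase.val_injective (by rw [hG, hG]; exact h2.trans hx.symm))
  exact congrArg Phase.val this

section
variable {a q₀ q β c b M R R₁ : ℝ} {K : Kernel}

/-- The implicit midpoint map on each of the phase spaces. -/
theorem exists_midPt_lift (hK : GoodKernel c b M K) (hb : 0 ≤ b) (ha : 0 ≤ a)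
    (hq₀ : 1 / 2 < q₀) (hq : q₀ ≤ q) (hβ : 0 ≤ β) (hβb : β ≤ b) (hR : 0 < R) (hRR : R ≤ R₁)
    (hR₀ : triConst q₀ * M * R₁ ^ 2 ≤ 1 / 64) (hRq : triConst q * M * R₁ ^ 2 ≤ 1 / 64) :
    ∃ S : SymplField (Phase a q β c), S.B * R ^ 2 ≤ 1 / 64 ∧
      (∀ x y z, (S.τ x y z).val = vf K x.val y.val z.val) ∧
      (∀ u v, S.ω u v = sympl u.val v.val) ∧
      ∃ μ : Phase a q β c → Phase a q β c,
        (∀ x ∈ Metric.ball 0 R, ‖μ x‖ < 2 * R ∧ S.G (-(1 / 2)) (μ x) = x) ∧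
        AnalyticOnNhd ℂ μ (Metric.ball 0 R) ∧
        IsOpen ((fun x => S.G (1 / 2) (μ x)) '' Metric.ball 0 R) ∧
        (∃ σ : Phase a q β c → Phase a q β c,
          AnalyticOnNhd ℂ σ ((fun x => S.G (1 / 2) (μ x)) '' Metric.ball 0 R) ∧
          ∀ x ∈ Metric.ball (0 : Phase a q β c) R, σ (S.G (1 / 2) (μ x)) = x) ∧
        ∀ x ∈ Metric.ball (0 : Phase a q β c) R, midPt a q₀ R₁ K x.val = (μ x).val ∧
          midMap a q₀ R₁ K x.val = (S.G (1 / 2) (μ x)).val := by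
  obtain ⟨S, hB, hτ, hω⟩ := exists_symplField ha (hq₀.trans_le hq) hβ hβb hK
  have hBR : S.B * R ^ 2 ≤ 1 / 64 := by
    refine le_trans ?_ hRq
    rw [← hB]
    have := S.B_nonneg
    gcongr
  obtain ⟨μ, h1, h2, h3, h4⟩ := S.exists_midpoint hBR
  have hmid : ∀ x ∈ Metric.ball (0 : Phase a q β c) R, midPt a q₀ R₁ K x.val = (μ x).val := by
    intro x hx
    -- The solution found at regularity `q` with weight `β` also solves the equation in the larger
    -- space at `q₀`, where it is unique.
    refine midPt_eq hK hb ha hq₀ hR₀ ?_ ?_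
    · refine Ball_subset hq hβ (by linarith) ((mem_Ball_iff (R := 2 * R) _).2 ?_)
      rw [mem_ball_zero_iff]
      exact (h1 x hx).1
    · conv_rhs => rw [← (h1 x hx).2]
      rw [SymplField.G, Phase.val_add, Phase.val_smul, hτ, neg_smul, sub_eq_add_neg]
  refine ⟨S, hBR, hτ, hω, μ, h1, h2, h3, h4, fun x hx => ⟨hmid x hx, ?_⟩⟩
  rw [midMap, hmid x hx, SymplField.G, Phase.val_add, Phase.val_smul, hτ]

theorem midPt_mem (hK : GoodKernel c b M K) (hb : 0 ≤ b) (ha : 0 ≤ a)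
    (hq₀ : 1 / 2 < q₀) (hq : q₀ ≤ q) (hβ : 0 ≤ β) (hβb : β ≤ b) (hRR : R ≤ R₁)
    (hR₀ : triConst q₀ * M * R₁ ^ 2 ≤ 1 / 64) (hRq : triConst q * M * R₁ ^ 2 ≤ 1 / 64) {x : Pt}
    (hx : x ∈ Ball a q β c R) : midPt a q₀ R₁ K x ∈ Ball a q β c (2 * R) ∧
      midPt a q₀ R₁ K x - (1 / 2 : ℂ) • vf K (midPt a q₀ R₁ K x) (midPt a q₀ R₁ K x)
        (midPt a q₀ R₁ K x) = x := by
  have hR : 0 < R := (phaseNorm_nonneg _ _ _ _ _).trans_lt hx.2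
  obtain ⟨S, hBR, hτ, hω, μ, h1, -, -, -, h5⟩ :=
    exists_midPt_lift hK hb ha hq₀ hq hβ hβb hR hRR hR₀ hRq
  have hx' := (mem_Ball_iff (Phase.mk x hx.1)).1 hx
  have e := (h5 _ hx').1
  rw [Phase.val_mk] at e
  obtain ⟨e1, e2⟩ := h1 _ hx'
  rw [e]
  constructor
  · rw [mem_Ball_iff, mem_ball_zero_iff]; exact e1
  · have := congrArg Phase.val e2
    rwa [SymplField.G, Phase.val_add, Phase.val_smul, hτ, neg_smul, ← sub_eq_add_neg] at this

/-- `midPt_mem` on the ball of radius `r/2` applies for every `r/2` above the norm of `x`, and `r/2`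
decreases to that norm. Radii beyond `R₁` add nothing, since the bound `2 R₁` is already known. -/
theorem midPt_normLE (hK : GoodKernel c b M K) (hb : 0 ≤ b) (ha : 0 ≤ a)
    (hq₀ : 1 / 2 < q₀) (hq : q₀ ≤ q) (hβ : 0 ≤ β) (hβb : β ≤ b)
    (hR₀ : triConst q₀ * M * R₁ ^ 2 ≤ 1 / 64) (hRq : triConst q * M * R₁ ^ 2 ≤ 1 / 64) {x : Pt}
    (hx : x ∈ Ball a q β c R₁) :
    NormLE a q β c (midPt a q₀ R₁ K x) (2 * phaseNorm a q β c x) := by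
  refine ⟨(midPt_mem hK hb ha hq₀ hq hβ hβb le_rfl hR₀ hRq hx).1.1, ?_⟩
  refine le_of_forall_gt_imp_ge_of_dense fun r hr => ?_
  rcases lt_or_ge (r / 2) R₁ with h | h
  · have hx' : x ∈ Ball a q β c (r / 2) := ⟨hx.1, by linarith⟩
    have := (midPt_mem hK hb ha hq₀ hq hβ hβb h.le hR₀ hRq hx').1.2
    linarith
  · have := (midPt_mem hK hb ha hq₀ hq hβ hβb le_rfl hR₀ hRq hx).1.2
    linarith

/-! ### Equivariance and reality of the midpoint map -/

/-- The antilinear involution whose fixed points are the real points. -/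
def conjPt (x : Pt) : Pt := (fun j => star (x.2 j), fun j => star (x.1 j))

/-- A symmetry `Θ` of the cubic field maps a solution of the midpoint equation for `x` to one for `Θ
x`, and solutions are unique. Only real homogeneity is required, so that complex conjugation is
covered as well as the Gauge and translation flows. -/
theorem midPt_equivariant (hK : GoodKernel c b M K) (hb : 0 ≤ b) (ha : 0 ≤ a)
    (hq₀ : 1 / 2 < q₀) (hR₀ : triConst q₀ * M * R₁ ^ 2 ≤ 1 / 64) {Θ : Pt → Pt}
    (hΘ : ∀ x ∈ Ball₀ a q₀ (2 * R₁), Θ x ∈ Ball₀ a q₀ (2 * R₁))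
    (hadd : ∀ x y, Θ (x + y) = Θ x + Θ y) (hsmul : ∀ (r : ℝ) x, Θ ((r : ℂ) • x) = (r : ℂ) • Θ x)
    (hvf : ∀ x, Θ (vf K x x x) = vf K (Θ x) (Θ x) (Θ x)) {x : Pt} (hx : x ∈ Ball₀ a q₀ R₁) :
    midPt a q₀ R₁ K (Θ x) = Θ (midPt a q₀ R₁ K x) ∧
      midMap a q₀ R₁ K (Θ x) = Θ (midMap a q₀ R₁ K x) := by
  obtain ⟨h1, h2⟩ := midPt_mem (hK.weaken hb) le_rfl ha hq₀ le_rfl le_rfl le_rfl le_rfl hR₀ hR₀ hx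
  have e : ∀ y, Θ ((1 / 2 : ℂ) • vf K y y y) = (1 / 2 : ℂ) • vf K (Θ y) (Θ y) (Θ y) := fun y => by
    have := hsmul (1 / 2) (vf K y y y)
    rw [hvf] at this
    have e2 : ((1 / 2 : ℝ) : ℂ) = 1 / 2 := by push_cast; rfl
    rwa [e2] at this
  have h3 : midPt a q₀ R₁ K (Θ x) = Θ (midPt a q₀ R₁ K x) := by
    refine midPt_eq hK hb ha hq₀ hR₀ (hΘ _ h1) ?_
    conv_rhs => rw [← h2]
    rw [eq_comm, eq_sub_iff_add_eq, ← e, ← hadd, sub_add_cancel]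
  refine ⟨h3, ?_⟩
  rw [midMap, midMap, h3, hadd, e]

/-- The kernel of a real polynomial, multiplied by the imaginary unit where it occurs. -/
def RealKernel (K : Kernel) : Prop := ∀ k₁ k₂ k₃ k₄ : Idx,
  K (k₁.1, !k₁.2) (k₂.1, !k₂.2) (k₃.1, !k₃.2) (k₄.1, !k₄.2) = star (K k₁ k₂ k₃ k₄)

theorem co_conjPt (x : Pt) (k : Idx) : co (conjPt x) k = star (co x (k.1, !k.2)) := by
  unfold co conjPt
  cases k.2 <;> simp

/-- Exchange of `z` and `z̄` in a triple of variables. -/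
def flipTriple : Idx × Idx × Idx ≃ Idx × Idx × Idx where
  toFun l := ((l.1.1, !l.1.2), (l.2.1.1, !l.2.1.2), (l.2.2.1, !l.2.2.2))
  invFun l := ((l.1.1, !l.1.2), (l.2.1.1, !l.2.1.2), (l.2.2.1, !l.2.2.2))
  left_inv l := by simp
  right_inv l := by simp

theorem tri_conjPt (hK : RealKernel K) (x y z : Pt) (k : Idx) :
    tri K (conjPt x) (conjPt y) (conjPt z) k = star (tri K x y z (k.1, !k.2)) := by
  unfold tri
  rw [tsum_star, ← flipTriple.tsum_eq]
  refine tsum_congr fun l => ?_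
  simp only [co_conjPt, flipTriple, Equiv.coe_fn_mk, Bool.not_not, star_mul']
  have := hK (k.1, !k.2) l.1 l.2.1 l.2.2
  simp only [Bool.not_not] at this
  rw [← this]

theorem vf_conjPt (hK : RealKernel K) (x y z : Pt) :
    vf K (conjPt x) (conjPt y) (conjPt z) = conjPt (vf K x y z) := by
  refine Prod.ext (funext fun j => ?_) (funext fun j => ?_)
  · change -4 * Complex.I * tri K (conjPt x) (conjPt y) (conjPt z) (j, false) =
      star (4 * Complex.I * tri K x y z (j, true))
    rw [tri_conjPt hK]; simp
  · change 4 * Complex.I * tri K (conjPt x) (conjPt y) (conjPt z) (j, true) =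
      star (-4 * Complex.I * tri K x y z (j, false))
    rw [tri_conjPt hK]; simp

theorem conjPt_mem_Ball {x : Pt} (hx : x ∈ Ball a q β c R) : conjPt x ∈ Ball a q β c R := by
  have h : phaseNorm a q β c (conjPt x) = phaseNorm a q β c x := by
    simp only [phaseNorm, conjPt, norm_star]
    rw [add_comm]
  refine ⟨⟨?_, ?_⟩, h ▸ hx.2⟩
  · simpa [conjPt] using hx.1.2
  · simpa [conjPt] using hx.1.1

theorem isCanonicalMap_midMap (hK : GoodKernel c b M K) (hreal : RealKernel K) (hb : 0 ≤ b)
    (ha : 0 ≤ a) (hq₀ : 1 / 2 < q₀) (hq : q₀ ≤ q) (hβ : 0 ≤ β) (hβb : β ≤ b) (hR : 0 < R)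
    (hRR : R ≤ R₁) (hR₀ : triConst q₀ * M * R₁ ^ 2 ≤ 1 / 64)
    (hRq : triConst q * M * R₁ ^ 2 ≤ 1 / 64) :
    IsCanonicalMap a q β c R (midMap a q₀ R₁ K) := by
  obtain ⟨S, hBR, hτ, hω, μ, h1, h2, h3, ⟨σ, h4, h4'⟩, h5⟩ :=
    exists_midPt_lift hK hb ha hq₀ hq hβ hβb hR hRR hR₀ hRq
  have hlift : Set.EqOn (KGNormalForm.lift a q β c (midMap a q₀ R₁ K))
      (fun x => S.G (1 / 2) (μ x)) (Metric.ball 0 R) := by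
    intro x hx
    have hmem : midMap a q₀ R₁ K x.val ∈ phaseSub a q β c := by
      rw [(h5 x hx).2]; exact Phase.val_mem _
    rw [KGNormalForm.lift, dif_pos hmem]
    exact Phase.val_injective (h5 x hx).2
  have hanal : AnalyticOnNhd ℂ (fun x => S.G (1 / 2) (μ x)) (Metric.ball 0 R) := fun x hx =>
    (S.analyticAt_G _ _).comp (h2 x hx)
  have himg := hlift.image_eq
  refine ⟨?_, ?_, ?_, ⟨σ, ?_, ?_⟩, ?_, ?_⟩
  · intro x hx
    have hx' := (mem_Ball_iff (Phase.mk x hx.1)).1 hx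
    have e : midMap a q₀ R₁ K x = _ := (h5 _ hx').2
    obtain ⟨e1, e2⟩ := h1 _ hx'
    rw [e, mem_Ball_iff, mem_ball_zero_iff]
    set m := μ (Phase.mk x hx.1)
    -- The two half steps add up: `T x - x = X(m)`.
    have e3 : S.G (1 / 2) m = Phase.mk x hx.1 + S.τ m m m := by
      rw [← e2, SymplField.G, SymplField.G]; module
    rw [e3]
    have e4 := S.bound m m m
    have hB := S.B_nonneg
    rw [mem_ball_zero_iff] at hx'
    -- `‖X(m)‖ ≤ 8 B R³ ≤ R/8`, so the image stays within `2R`.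
    have e5 : S.B * (‖m‖ * ‖m‖ * ‖m‖) ≤ S.B * (2 * R * (2 * R) * (2 * R)) := by gcongr
    have e6 : S.B * R ^ 2 * R ≤ 1 / 64 * R := by gcongr
    calc _ ≤ ‖Phase.mk x hx.1‖ + ‖S.τ m m m‖ := norm_add_le _ _
      _ < 2 * R := by nlinarith
  · exact fun x hx => (hanal x hx).congr
      (hlift.symm.eventuallyEq_of_mem (Metric.isOpen_ball.mem_nhds hx))
  · rw [himg]; exact h3
  · rw [himg]; exact h4
  · intro x hx
    rw [hlift hx]; exact h4' x hx
  · intro x hx u v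
    have e1 : fderiv ℂ (KGNormalForm.lift a q β c (midMap a q₀ R₁ K)) x =
        fderiv ℂ (fun x => S.G (1 / 2) (μ x)) x :=
      (hlift.eventuallyEq_of_mem (Metric.isOpen_ball.mem_nhds hx)).fderiv_eq
    have h6 : ∀ᶠ y in nhds x, S.G (-(1 / 2)) (μ y) = y := by
      filter_upwards [Metric.isOpen_ball.mem_nhds hx] with y hy using (h1 y hy).2
    rw [e1, ← hω, ← hω]
    exact S.symplectic_midpoint h6 (h2 x hx).differentiableAt u v
  · intro x hx hxr
    have hx0 : x ∈ Ball₀ a q₀ R₁ := Ball_subset hq hβ hRR hx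
    -- The real points are the fixed points of `conjPt`, and the map commutes with `conjPt`.
    have hcx : conjPt x = x := by
      refine Prod.ext (funext fun j => ?_) (funext fun j => ?_)
      · simp [conjPt, hxr j]
      · simp [conjPt, hxr j]
    have := (midPt_equivariant hK hb ha hq₀ hR₀ (Θ := conjPt) (fun x hx => conjPt_mem_Ball hx)
      (fun x y => by simp [conjPt, Prod.ext_iff, funext_iff])
      (fun r x => by simp [conjPt, Prod.ext_iff, funext_iff])
      (fun x => (vf_conjPt hreal x x x).symm) hx0).2
    rw [hcx] at this
    intro j
    have h6 := congrArg (fun y : Pt => y.2 j) this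
    exact h6

end

end KGNormalForm
end

noncomputable section
namespace KGNormalForm
open scoped ENNReal

/-! ### Hamiltonian vector fields -/

/-- `F` is differentiable at `x` in `𝒫^{a,q}`, with Hamiltonian vector field `Y`. -/
def HasHVF (a q : ℝ) (F : Pt → ℂ) (x Y : Pt) : Prop :=
  ∃ (hx : x ∈ phaseSub a q 0 1) (_ : Y ∈ phaseSub a q 0 1) (L : Phase a q 0 1 →L[ℂ] ℂ),
    (∀ v, L v = Complex.I * sympl Y v.val) ∧
    HasFDerivAt (fun u : Phase a q 0 1 => F u.val) L (Phase.mk x hx)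

theorem single_mem_phaseSub (a q β c : ℝ) (j : ℤ) (t : ℂ) :
    ((Pi.single j t, 0) : Pt) ∈ phaseSub a q β c ∧ ((0, Pi.single j t) : Pt) ∈ phaseSub a q β c := by
  have h : Summable fun i : ℤ => wt a q β c i ^ 2 * ‖(Pi.single j t : ℤ → ℂ) i‖ ^ 2 :=
    summable_of_ne_finset_zero (s := {j}) fun i hi => by
      rw [Finset.mem_singleton] at hi
      simp [hi]
  have h0 : Summable fun i : ℤ => wt a q β c i ^ 2 * ‖(0 : ℤ → ℂ) i‖ ^ 2 := by
    simp
  exact ⟨⟨h, h0⟩, ⟨h0, h⟩⟩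

section
variable {a q : ℝ} {F F' : Pt → ℂ} {x Y Y' : Pt}

theorem HasHVF.mem (h : HasHVF a q F x Y) : Y ∈ phaseSub a q 0 1 := h.2.1

theorem deriv_along {L : Phase a q 0 1 →L[ℂ] ℂ} {hx : x ∈ phaseSub a q 0 1}
    (h : HasFDerivAt (fun u : Phase a q 0 1 => F u.val) L (Phase.mk x hx)) (v : Phase a q 0 1) :
    deriv (fun t : ℂ => F (x + t • v.val)) 0 = L v := by
  have h1 : HasDerivAt (fun t : ℂ => Phase.mk x hx + t • v) v 0 := by
    have := ((hasDerivAt_id (0 : ℂ)).smul_const v).const_add (Phase.mk x hx)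
    simpa using this
  have h2 : HasFDerivAt (fun u : Phase a q 0 1 => F u.val) L (Phase.mk x hx + (0 : ℂ) • v) := by
    simpa using h
  exact (h2.comp_hasDerivAt (0 : ℂ) h1).deriv

/-- Partial derivatives are Fréchet derivatives along unit vectors. Every vector field below is
computed from the Fréchet derivative and read off here. -/
theorem HasHVF.hamVF_eq (h : HasHVF a q F x Y) : hamVF F x = Y := by
  obtain ⟨hx, hY, L, hL, hF⟩ := h
  refine Prod.ext (funext fun j => ?_) (funext fun j => ?_)
  · have h1 := deriv_along hF (Phase.mk _ (single_mem_phaseSub a q 0 1 j 1).2)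
    have h2 : dzbar F j x = L (Phase.mk _ (single_mem_phaseSub a q 0 1 j 1).2) := by
      rw [← h1, dzbar]
      congr 1
      funext t
      congr 1
      refine Prod.ext (by simp) (funext fun i => ?_)
      by_cases hi : i = j
      · subst hi; simp
      · simp [hi]
    change -Complex.I * dzbar F j x = _
    rw [h2, hL, sympl, tsum_eq_single j]
    · simp [← mul_assoc]
    · intro i hi; simp [hi]
  · have h1 := deriv_along hF (Phase.mk _ (single_mem_phaseSub a q 0 1 j 1).1)
    have h2 : dz F j x = L (Phase.mk _ (single_mem_phaseSub a q 0 1 j 1).1) := by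
      rw [← h1, dz]
      congr 1
      funext t
      congr 1
      refine Prod.ext (funext fun i => ?_) (by simp)
      by_cases hi : i = j
      · subst hi; simp
      · simp [hi]
    change Complex.I * dz F j x = _
    rw [h2, hL, sympl, tsum_eq_single j]
    · simp [← mul_assoc]
    · intro i hi; simp [hi]

theorem sympl_lin (ha : 0 ≤ a) (hq : 0 ≤ q) {v : Pt} (hv : v ∈ phaseSub a q 0 1)
    (hY : Y ∈ phaseSub a q 0 1) (hY' : Y' ∈ phaseSub a q 0 1) :
    sympl (Y + Y') v = sympl Y v + sympl Y' v ∧ sympl (Y - Y') v = sympl Y v - sympl Y' v := by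
  obtain ⟨ω, hω, -⟩ := exists_sympl ha hq le_rfl 1
  have h : ∀ (U : Pt) (hU : U ∈ phaseSub a q 0 1), sympl U v = ω (Phase.mk U hU) (Phase.mk v hv) :=
    fun U hU => (hω (Phase.mk U hU) (Phase.mk v hv)).symm
  constructor
  · rw [h _ (add_mem hY hY'), h _ hY, h _ hY', ← add_apply, ← map_add]; rfl
  · rw [h _ (sub_mem hY hY'), h _ hY, h _ hY', ← sub_apply, ← map_sub]; rfl

theorem HasHVF.add (ha : 0 ≤ a) (hq : 0 ≤ q) (h : HasHVF a q F x Y) (h' : HasHVF a q F' x Y') :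
    HasHVF a q (fun u => F u + F' u) x (Y + Y') := by
  obtain ⟨hx, hY, L, hL, hF⟩ := h
  obtain ⟨_, hY', L', hL', hF'⟩ := h'
  refine ⟨hx, add_mem hY hY', L + L', fun v => ?_, hF.add hF'⟩
  rw [add_apply, hL, hL', (sympl_lin ha hq v.val_mem hY hY').1]; ring

theorem HasHVF.sub (ha : 0 ≤ a) (hq : 0 ≤ q) (h : HasHVF a q F x Y) (h' : HasHVF a q F' x Y') :
    HasHVF a q (fun u => F u - F' u) x (Y - Y') := by
  obtain ⟨hx, hY, L, hL, hF⟩ := h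
  obtain ⟨_, hY', L', hL', hF'⟩ := h'
  refine ⟨hx, sub_mem hY hY', L - L', fun v => ?_, hF.sub hF'⟩
  rw [sub_apply, hL, hL', (sympl_lin ha hq v.val_mem hY hY').2]; ring

theorem HasHVF.congr_ball {R : ℝ} (h : HasHVF a q F x Y) (hx : x ∈ Ball₀ a q R)
    (hF : ∀ u ∈ Ball₀ a q R, F' u = F u) : HasHVF a q F' x Y := by
  obtain ⟨hx', hY, L, hL, hd⟩ := h
  refine ⟨hx', hY, L, hL, hd.congr_of_eventuallyEq ?_⟩
  filter_upwards [Metric.isOpen_ball.mem_nhds ((mem_Ball_iff (Phase.mk x hx')).1 hx)] with u hu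
  exact hF _ ((mem_Ball_iff u).2 hu)

end

section
variable {a q₀ q β c b M R R₁ : ℝ} {K : Kernel}

theorem poly_eq_ham (hK : GoodKernel c b M K) (hb : 0 ≤ b) (ha : 0 ≤ a) (hq : 1 / 2 < q) {x : Pt}
    (hx : x ∈ phaseSub a q 0 1) : poly K x = Complex.I / 4 * sympl (vf K x x x) x := by
  rw [hK.sympl_vf hb ha hq hx hx hx hx, poly]
  linear_combination quad K x x x x * Complex.I_sq

theorem hasHVF_poly (hK : GoodKernel c b M K) (hb : 0 ≤ b) (ha : 0 ≤ a) (hq : 1 / 2 < q) {x : Pt}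
    (hx : x ∈ phaseSub a q 0 1) : HasHVF a q (poly K) x (vf K x x x) := by
  obtain ⟨S, hB, hτ, hω⟩ := exists_symplField ha hq le_rfl le_rfl (hK.weaken hb)
  have h1 : (fun u : Phase a q 0 1 => poly K u.val) = S.ham := by
    funext u
    rw [SymplField.ham, hω, hτ]
    exact poly_eq_ham hK hb ha hq u.val_mem
  refine ⟨hx, (hK.weaken hb).vf_normLE ha hq (normLE_self hx) (normLE_self hx) (normLE_self hx) |>.1,
    _, fun v => ?_, h1 ▸ S.hasFDerivAt_ham (Phase.mk x hx)⟩
  rw [smul_apply, hω, hτ]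
  rfl

theorem analyticAt_poly (hK : GoodKernel c b M K) (hb : 0 ≤ b) (ha : 0 ≤ a) (hq : 1 / 2 < q)
    (x : Phase a q 0 1) : AnalyticAt ℂ (fun u : Phase a q 0 1 => poly K u.val) x := by
  obtain ⟨S, hB, hτ, hω⟩ := exists_symplField ha hq le_rfl le_rfl (hK.weaken hb)
  have h1 : (fun u : Phase a q 0 1 => poly K u.val) = S.ham := by
    funext u
    rw [SymplField.ham, hω, hτ]
    exact poly_eq_ham hK hb ha hq u.val_mem
  rw [h1]
  exact S.analyticAt_ham x

theorem isHamiltonian_poly (hK : GoodKernel c b M K) (hb : 0 ≤ b) (ha : 0 ≤ a) (hq : 1 / 2 < q)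
    (R : ℝ) : IsHamiltonian a q R (poly K) := fun x _ => analyticAt_poly hK hb ha hq x

theorem norm_sympl_le (ha : 0 ≤ a) (hq : 0 ≤ q) {u v : Pt} {r r' : ℝ} (hu : NormLE₀ a q u r)
    (hv : NormLE₀ a q v r') : ‖sympl u v‖ ≤ r * r' := by
  obtain ⟨ω, hω, h⟩ := exists_sympl ha hq le_rfl 1
  have h1 := h (Phase.mk u hu.1) (Phase.mk v hv.1)
  rw [hω] at h1
  refine h1.trans ?_
  have := hu.norm_mk_le
  have := hv.norm_mk_le
  have := hu.nonneg
  gcongr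

theorem norm_poly_le (hK : GoodKernel c b M K) (hb : 0 ≤ b) (ha : 0 ≤ a) (hq : 1 / 2 < q) {x : Pt}
    {r : ℝ} (hx : NormLE₀ a q x r) : ‖poly K x‖ ≤ triConst q * M * r ^ 4 := by
  have h1 := norm_sympl_le ha (by linarith) ((hK.weaken hb).vf_normLE ha hq hx hx hx) hx
  rw [poly_eq_ham hK hb ha hq hx.1, norm_mul]
  have h2 : ‖Complex.I / 4‖ = 1 / 4 := by simp
  have h3 := norm_nonneg (sympl (vf K x x x) x)
  rw [h2]
  calc _ ≤ ‖sympl (vf K x x x) x‖ := by linarith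
    _ ≤ _ := h1.trans (le_of_eq (by ring))

theorem vf_sub_left (hK : GoodKernel c b M K) (ha : 0 ≤ a) (hq : 1 / 2 < q)
    {x y z z' : Pt} (hx : x ∈ phaseSub a q 0 1) (hy : y ∈ phaseSub a q 0 1)
    (hz : z ∈ phaseSub a q 0 1) (hz' : z' ∈ phaseSub a q 0 1) :
    vf K x y (z - z') = vf K x y z - vf K x y z' := by
  rw [sub_eq_add_neg, ← neg_one_smul ℂ, hK.vf_add ha hq hx hy hz (Submodule.smul_mem _ _ hz'),
    vf_smul, neg_one_smul, ← sub_eq_add_neg]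

/-- Difference of a cubic vector field at two points. -/
theorem vf_diff (hK : GoodKernel c b M K) (ha : 0 ≤ a) (hq : 1 / 2 < q) {x y : Pt}
    (hx : x ∈ phaseSub a q 0 1) (hy : y ∈ phaseSub a q 0 1) :
    vf K x x x - vf K y y y = vf K x x (x - y) + vf K x y (x - y) + vf K y y (x - y) := by
  rw [vf_sub_left hK ha hq hx hx hx hy, vf_sub_left hK ha hq hx hy hx hy,
    vf_sub_left hK ha hq hy hy hx hy]
  have e1 : vf K x y x = vf K x x y := vf_symm₂ hK.symm _ _ _
  have e2 : vf K y y x = vf K x y y := by rw [vf_symm₂ hK.symm, vf_symm₁ hK.symm]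
  rw [e1, e2]; abel

theorem norm_poly_sub_le (hK : GoodKernel c b M K) (hb : 0 ≤ b) (ha : 0 ≤ a) (hq : 1 / 2 < q)
    {x y : Pt} {r d : ℝ} (hx : NormLE₀ a q x r) (hy : NormLE₀ a q y r) (hd : NormLE₀ a q (x - y) d) :
    ‖poly K x - poly K y‖ ≤ triConst q * M * r ^ 3 * d := by
  obtain ⟨ω, hω, h⟩ := exists_sympl ha (by linarith : 0 ≤ q) le_rfl 1
  have e : poly K x - poly K y = Complex.I / 4 *
      (sympl (vf K x x x - vf K y y y) x + sympl (vf K y y y) (x - y)) := by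
    have m1 := ((hK.weaken hb).vf_normLE ha hq hx hx hx).1
    have m2 := ((hK.weaken hb).vf_normLE ha hq hy hy hy).1
    rw [poly_eq_ham hK hb ha hq hx.1, poly_eq_ham hK hb ha hq hy.1,
      (sympl_lin ha (by linarith) hx.1 m1 m2).2, sympl_anti _ (x - y),
      (sympl_lin ha (by linarith) m2 hx.1 hy.1).2, sympl_anti x, sympl_anti y]
    ring
  have hw := hK.weaken hb
  have h1 := norm_sympl_le ha (by linarith) (((hw.vf_normLE ha hq hx hx hd).add
    (hw.vf_normLE ha hq hx hy hd)).add (hw.vf_normLE ha hq hy hy hd)) hx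
  rw [← vf_diff hK ha hq hx.1 hy.1] at h1
  have h2 := norm_sympl_le ha (by linarith) (hw.vf_normLE ha hq hy hy hy) hd
  rw [e, norm_mul]
  have h4 : ‖Complex.I / 4‖ = 1 / 4 := by simp
  rw [h4]
  calc _ ≤ 1 / 4 * (_ + _) := mul_le_mul_of_nonneg_left
        ((norm_add_le _ _).trans (add_le_add h1 h2)) (by norm_num)
    _ = _ := by ring

/-- The Hamiltonian vector fields of `F ∘ T` and of `F ∘ m`. -/
theorem hasHVF_comp (hK : GoodKernel c b M K) (hb : 0 ≤ b) (ha : 0 ≤ a)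
    (hq₀ : 1 / 2 < q₀) (hq : q₀ ≤ q) (hRR : R ≤ R₁)
    (hR₀ : triConst q₀ * M * R₁ ^ 2 ≤ 1 / 64) (hRq : triConst q * M * R₁ ^ 2 ≤ 1 / 64) {x : Pt}
    (hx : x ∈ Ball₀ a q R) (F : Pt → ℂ) (Y : Pt) :
    (HasHVF a q F (midMap a q₀ R₁ K x) Y →
      ∃ Z, HasHVF a q (fun u => F (midMap a q₀ R₁ K u)) x Z ∧
      Z + (3 / 2 : ℂ) • vf K (midPt a q₀ R₁ K x) (midPt a q₀ R₁ K x) Z =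
        Y - (3 / 2 : ℂ) • vf K (midPt a q₀ R₁ K x) (midPt a q₀ R₁ K x) Y) ∧
    (HasHVF a q F (midPt a q₀ R₁ K x) Y →
      ∃ Z, HasHVF a q (fun u => F (midPt a q₀ R₁ K u)) x Z ∧
      Z + (3 / 2 : ℂ) • vf K (midPt a q₀ R₁ K x) (midPt a q₀ R₁ K x) Z = Y) := by
  have hR : 0 < R := (phaseNorm_nonneg _ _ _ _ _).trans_lt hx.2
  obtain ⟨S, hBR, hτ, hω, μ, h1, h2, -, -, h5⟩ :=
    exists_midPt_lift (hK.weaken hb) le_rfl ha hq₀ hq le_rfl le_rfl hR hRR hR₀ hRq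
  have hx' := (mem_Ball_iff (Phase.mk x hx.1)).1 hx
  set X := Phase.mk x hx.1 with hX
  have h6 : ∀ᶠ y in nhds X, S.G (-(1 / 2)) (μ y) = y := by
    filter_upwards [Metric.isOpen_ball.mem_nhds hx'] with y hy using (h1 y hy).2
  have em : midPt a q₀ R₁ K x = (μ X).val := (h5 X hx').1
  have eT : midMap a q₀ R₁ K x = (S.G (1 / 2) (μ X)).val := (h5 X hx').2
  -- `s = 1/2` is used for the map itself. `s = 0` is used for the midpoint, because `G 0` is the
  -- identity.
  have key := fun (s : ℂ) (hY : Y ∈ phaseSub a q 0 1)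
      (hF : HasFDerivAt (fun u : Phase a q 0 1 => F u.val)
      (Complex.I • S.ω (Phase.mk Y hY)) (S.G s (μ X))) =>
    S.hasFDerivAt_comp_midpoint hBR h6 (h2 _ hx').differentiableAt (h1 _ hx').1 s hF
  constructor
  · rintro ⟨hy, hY, L, hL, hd⟩
    have e1 : L = Complex.I • S.ω (Phase.mk Y hY) := by
      ext v; rw [hL, smul_apply, hω]; rfl
    have e2 : Phase.mk _ hy = S.G (1 / 2) (μ X) := Phase.val_injective eT
    rw [e1, e2] at hd
    obtain ⟨Z, hZ, hZd⟩ := key _ hY hd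
    refine ⟨Z.val, ⟨hx.1, Z.val_mem, _, fun v => ?_, hZd.congr_of_eventuallyEq ?_⟩, ?_⟩
    · rw [smul_apply, hω]; rfl
    · filter_upwards [Metric.isOpen_ball.mem_nhds hx'] with u hu
      rw [(h5 u hu).2]
    · have := congrArg Phase.val hZ
      simp only [Phase.val_add, Phase.val_sub, Phase.val_smul, hτ, ← em, Phase.val_mk] at this
      rw [this]
      norm_num
  · rintro ⟨hy, hY, L, hL, hd⟩
    have e1 : L = Complex.I • S.ω (Phase.mk Y hY) := by
      ext v; rw [hL, smul_apply, hω]; rfl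
    have e0 : ∀ u, S.G 0 u = u := fun u => by simp [SymplField.G]
    have e2 : Phase.mk _ hy = S.G 0 (μ X) := Phase.val_injective (by rw [e0, ← em]; rfl)
    rw [e1, e2] at hd
    obtain ⟨Z, hZ, hZd⟩ := key _ hY hd
    refine ⟨Z.val, ⟨hx.1, Z.val_mem, _, fun v => ?_, hZd.congr_of_eventuallyEq ?_⟩, ?_⟩
    · rw [smul_apply, hω]; rfl
    · filter_upwards [Metric.isOpen_ball.mem_nhds hx'] with u hu
      rw [(h5 u hu).1, e0]
    · have := congrArg Phase.val hZ
      simp only [Phase.val_add, Phase.val_sub, Phase.val_smul, hτ, ← em, Phase.val_mk] at this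
      rw [this]
      simp

theorem isHamiltonian_comp (hK : GoodKernel c b M K) (hb : 0 ≤ b) (ha : 0 ≤ a)
    (hq₀ : 1 / 2 < q₀) (hq : q₀ ≤ q) (hR : 0 < R) (hRR : R ≤ R₁)
    (hR₀ : triConst q₀ * M * R₁ ^ 2 ≤ 1 / 64) (hRq : triConst q * M * R₁ ^ 2 ≤ 1 / 64)
    {F : Pt → ℂ} (hF : ∀ x, AnalyticAt ℂ (fun u : Phase a q 0 1 => F u.val) x) :
    IsHamiltonian a q R (fun u => F (midMap a q₀ R₁ K u)) ∧
    IsHamiltonian a q R (fun u => F (midPt a q₀ R₁ K u)) := by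
  obtain ⟨S, hBR, hτ, hω, μ, h1, h2, -, -, h5⟩ :=
    exists_midPt_lift (hK.weaken hb) le_rfl ha hq₀ hq le_rfl le_rfl hR hRR hR₀ hRq
  constructor
  · intro x hx
    have h3 : AnalyticAt ℂ (fun y => S.G (1 / 2) (μ y)) x := (S.analyticAt_G _ _).comp (h2 x hx)
    have h4 : AnalyticAt ℂ ((fun u : Phase a q 0 1 => F u.val) ∘ fun y => S.G (1 / 2) (μ y)) x :=
      (hF _).comp h3
    refine h4.congr ?_
    filter_upwards [Metric.isOpen_ball.mem_nhds hx] with u hu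
    simp only [Function.comp]
    rw [(h5 u hu).2]
  · intro x hx
    have h4 : AnalyticAt ℂ ((fun u : Phase a q 0 1 => F u.val) ∘ μ) x := (hF _).comp (h2 x hx)
    refine h4.congr ?_
    filter_upwards [Metric.isOpen_ball.mem_nhds hx] with u hu
    simp only [Function.comp]
    rw [(h5 u hu).1]

end

end KGNormalForm
end

noncomputable section
namespace KGNormalForm
open scoped ENNReal

/-! ### The kernels of the problem -/

/-- Predicates on quadruples of variables. -/
abbrev QuadPred : Type := Idx → Idx → Idx → Idx → Prop

/-- Predicates that are invariant under permutations and under the exchange of `z` and `z̄`. -/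
structure SymmPred (P : QuadPred) : Prop where
  s₁₂ : ∀ k₁ k₂ k₃ k₄, P k₁ k₂ k₃ k₄ ↔ P k₂ k₁ k₃ k₄
  s₂₃ : ∀ k₁ k₂ k₃ k₄, P k₁ k₂ k₃ k₄ ↔ P k₁ k₃ k₂ k₄
  s₃₄ : ∀ k₁ k₂ k₃ k₄, P k₁ k₂ k₃ k₄ ↔ P k₁ k₂ k₄ k₃
  flip : ∀ k₁ k₂ k₃ k₄, P (k₁.1, !k₁.2) (k₂.1, !k₂.2) (k₃.1, !k₃.2) (k₄.1, !k₄.2) ↔ P k₁ k₂ k₃ k₄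

/-- The signed sum of `φ` over a quadruple. -/
def divisor (φ : ℤ → ℝ) (k₁ k₂ k₃ k₄ : Idx) : ℝ :=
  sg k₁ * φ k₁.1 + sg k₂ * φ k₂.1 + sg k₃ * φ k₃.1 + sg k₄ * φ k₄.1

/-- The charge of a quadruple under the Gauge action. -/
def charge (k₁ k₂ k₃ k₄ : Idx) : ℤ := sg k₁ + sg k₂ + sg k₃ + sg k₄

/-- One of the indices lies in `J`. -/
def meets (J : Finset ℤ) : QuadPred := fun k₁ k₂ k₃ k₄ => k₁.1 ∈ J ∨ k₂.1 ∈ J ∨ k₃.1 ∈ J ∨ k₄.1 ∈ J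

/-- `k` and `l` are `z_j` and `z̄_j`, in some order. -/
def opp (k l : Idx) : Prop := k.1 = l.1 ∧ k.2 = !l.2

/-- The four variables form two pairs of type `z_j z̄_j`. -/
def paired : QuadPred := fun k₁ k₂ k₃ k₄ =>
  (opp k₁ k₂ ∧ opp k₃ k₄) ∨ (opp k₁ k₃ ∧ opp k₂ k₄) ∨ (opp k₁ k₄ ∧ opp k₂ k₃)

theorem opp_comm (k l : Idx) : opp k l ↔ opp l k := by
  unfold opp
  constructor <;> rintro ⟨h1, h2⟩ <;> simp [h1, h2]

theorem opp_flip (k l : Idx) : opp (k.1, !k.2) (l.1, !l.2) ↔ opp k l := by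
  unfold opp; simp

theorem sg_flip (k : Idx) : sg (k.1, !k.2) = -sg k := by
  unfold sg; cases k.2 <;> simp

theorem symmPred_true : SymmPred fun _ _ _ _ => True := ⟨by simp, by simp, by simp, by simp⟩

theorem SymmPred.and {P Q : QuadPred} (hP : SymmPred P) (hQ : SymmPred Q) :
    SymmPred fun k₁ k₂ k₃ k₄ => P k₁ k₂ k₃ k₄ ∧ Q k₁ k₂ k₃ k₄ :=
  ⟨fun _ _ _ _ => and_congr (hP.s₁₂ _ _ _ _) (hQ.s₁₂ _ _ _ _),
    fun _ _ _ _ => and_congr (hP.s₂₃ _ _ _ _) (hQ.s₂₃ _ _ _ _),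
    fun _ _ _ _ => and_congr (hP.s₃₄ _ _ _ _) (hQ.s₃₄ _ _ _ _),
    fun _ _ _ _ => and_congr (hP.flip _ _ _ _) (hQ.flip _ _ _ _)⟩

theorem SymmPred.not {P : QuadPred} (hP : SymmPred P) :
    SymmPred fun k₁ k₂ k₃ k₄ => ¬P k₁ k₂ k₃ k₄ :=
  ⟨fun _ _ _ _ => not_congr (hP.s₁₂ _ _ _ _), fun _ _ _ _ => not_congr (hP.s₂₃ _ _ _ _),
    fun _ _ _ _ => not_congr (hP.s₃₄ _ _ _ _), fun _ _ _ _ => not_congr (hP.flip _ _ _ _)⟩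

theorem symmPred_meets (J : Finset ℤ) : SymmPred (meets J) := by
  constructor <;> intro k₁ k₂ k₃ k₄ <;> unfold meets <;> tauto

theorem symmPred_paired : SymmPred paired := by
  constructor <;> intro k₁ k₂ k₃ k₄ <;> unfold paired
  · rw [opp_comm k₁ k₂]; tauto
  · rw [opp_comm k₂ k₃]; tauto
  · rw [opp_comm k₃ k₄]; tauto
  · simp only [opp_flip]

theorem symmPred_charge : SymmPred fun k₁ k₂ k₃ k₄ => charge k₁ k₂ k₃ k₄ = 0 := by
  constructor <;> intro k₁ k₂ k₃ k₄ <;> simp only [charge, sg_flip] <;> constructor <;> intro h <;>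
    linarith

theorem symmPred_mom : SymmPred fun k₁ k₂ k₃ k₄ => mom k₁ k₂ k₃ k₄ = 0 := by
  constructor <;> intro k₁ k₂ k₃ k₄ <;> simp only [mom, sg_flip] <;> constructor <;> intro h <;>
    linarith

open Classical in
/-- The kernel with coefficients `∏ v(j_i) / (32 π)` on the quadruples with vanishing momentum that
satisfy `P`. -/
def ker (v : ℤ → ℝ) (P : QuadPred) : Kernel := fun k₁ k₂ k₃ k₄ =>
  -- `1/(32π) = (1/16) · (2π)⁻² · 2π`: the constant in the Hamiltonian, the normalization of the
  -- four Fourier series, and the length of the interval.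
  if mom k₁ k₂ k₃ k₄ = 0 ∧ P k₁ k₂ k₃ k₄ then
    ((1 / (32 * Real.pi) * (v k₁.1 * v k₂.1 * v k₃.1 * v k₄.1) : ℝ) : ℂ) else 0

/-- The solution of the homological equation. -/
def chi (v : ℤ → ℝ) (P : QuadPred) (φ : ℤ → ℝ) : Kernel := fun k₁ k₂ k₃ k₄ =>
  Complex.I * ker v P k₁ k₂ k₃ k₄ / (divisor φ k₁ k₂ k₃ k₄ : ℝ)

theorem divisor_flip (φ : ℤ → ℝ) (k₁ k₂ k₃ k₄ : Idx) :
    divisor φ (k₁.1, !k₁.2) (k₂.1, !k₂.2) (k₃.1, !k₃.2) (k₄.1, !k₄.2) =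
      -divisor φ k₁ k₂ k₃ k₄ := by
  simp only [divisor, sg_flip]; push_cast; ring

variable {v v' : ℤ → ℝ} {P P' : QuadPred} {φ φ' : ℤ → ℝ}

theorem ker_of {k₁ k₂ k₃ k₄ : Idx} (h : mom k₁ k₂ k₃ k₄ = 0) (h' : P k₁ k₂ k₃ k₄) :
    ker v P k₁ k₂ k₃ k₄ =
      ((1 / (32 * Real.pi) * (v k₁.1 * v k₂.1 * v k₃.1 * v k₄.1) : ℝ) : ℂ) := if_pos ⟨h, h'⟩

theorem ker_of_not {k₁ k₂ k₃ k₄ : Idx} (h : ¬(mom k₁ k₂ k₃ k₄ = 0 ∧ P k₁ k₂ k₃ k₄)) :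
    ker v P k₁ k₂ k₃ k₄ = 0 := if_neg h

theorem ker_congr {k₁ k₂ k₃ k₄ l₁ l₂ l₃ l₄ : Idx}
    (h : (mom k₁ k₂ k₃ k₄ = 0 ∧ P k₁ k₂ k₃ k₄) ↔ (mom l₁ l₂ l₃ l₄ = 0 ∧ P l₁ l₂ l₃ l₄))
    (hv : v k₁.1 * v k₂.1 * v k₃.1 * v k₄.1 = v l₁.1 * v l₂.1 * v l₃.1 * v l₄.1) :
    ker v P k₁ k₂ k₃ k₄ = ker v P l₁ l₂ l₃ l₄ := by
  by_cases h1 : mom l₁ l₂ l₃ l₄ = 0 ∧ P l₁ l₂ l₃ l₄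
  · have h2 := h.2 h1
    rw [ker_of h1.1 h1.2, ker_of h2.1 h2.2, hv]
  · rw [ker_of_not h1, ker_of_not (mt h.1 h1)]

theorem symmKernel_ker (hP : SymmPred P) : SymmKernel (ker v P) := by
  have h := symmPred_mom.and hP
  refine ⟨fun k₁ k₂ k₃ k₄ => ?_, fun k₁ k₂ k₃ k₄ => ?_, fun k₁ k₂ k₃ k₄ => ?_⟩
  · have := h.s₁₂ k₁ k₂ k₃ k₄
    exact ker_congr this (by ring)
  · have := h.s₂₃ k₁ k₂ k₃ k₄
    exact ker_congr this (by ring)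
  · have := h.s₃₄ k₁ k₂ k₃ k₄
    exact ker_congr this (by ring)

theorem symmKernel_chi (hP : SymmPred P) : SymmKernel (chi v P φ) := by
  have h := symmKernel_ker (v := v) hP
  refine ⟨fun k₁ k₂ k₃ k₄ => ?_, fun k₁ k₂ k₃ k₄ => ?_, fun k₁ k₂ k₃ k₄ => ?_⟩
  · simp only [chi, h.s₁₂ k₁ k₂ k₃ k₄]
    congr 2; unfold divisor; ring
  · simp only [chi, h.s₂₃ k₁ k₂ k₃ k₄]
    congr 2; unfold divisor; ring
  · simp only [chi, h.s₃₄ k₁ k₂ k₃ k₄]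
    congr 2; unfold divisor; ring

theorem ker_flip (hP : SymmPred P) (k₁ k₂ k₃ k₄ : Idx) :
    ker v P (k₁.1, !k₁.2) (k₂.1, !k₂.2) (k₃.1, !k₃.2) (k₄.1, !k₄.2) = ker v P k₁ k₂ k₃ k₄ := by
  exact ker_congr ((symmPred_mom.and hP).flip k₁ k₂ k₃ k₄) rfl

theorem star_ker (k₁ k₂ k₃ k₄ : Idx) : star (ker v P k₁ k₂ k₃ k₄) = ker v P k₁ k₂ k₃ k₄ := by
  unfold ker
  split_ifs
  · exact Complex.conj_ofReal _
  · simp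

/-- Exchanging `z` and `z̄` changes the sign of the divisor, and complex conjugation changes the
sign of `i`. The two signs match. -/
theorem realKernel_chi (hP : SymmPred P) : RealKernel (chi v P φ) := by
  intro k₁ k₂ k₃ k₄
  simp only [chi, ker_flip hP, divisor_flip, star_div₀, star_mul', star_ker]
  have h : star ((divisor φ k₁ k₂ k₃ k₄ : ℝ) : ℂ) = (divisor φ k₁ k₂ k₃ k₄ : ℝ) :=
    Complex.conj_ofReal _
  have h' : star Complex.I = -Complex.I := Complex.conj_I
  rw [h, h']
  push_cast
  rw [div_neg, neg_mul, neg_div]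

theorem k0_nonneg : 0 ≤ 1 / (32 * Real.pi) := by positivity

theorem k0_le : 1 / (32 * Real.pi) ≤ 1 / 90 := by
  have := Real.pi_gt_three
  apply one_div_le_one_div_of_le <;> linarith

/-! ### Size of the coefficients -/

/-- The coefficients `𝚠_j^{-1/2}`. -/
def vc (c : ℝ) (j : ℤ) : ℝ := ww c j ^ (-(1 / 2) : ℝ)

theorem vc_pos (c : ℝ) (j : ℤ) : 0 < vc c j := Real.rpow_pos_of_pos (ww_pos c j) _

theorem vc_le_one (c : ℝ) (j : ℤ) : vc c j ≤ 1 :=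
  Real.rpow_le_one_of_one_le_of_nonpos (one_le_ww c j) (by norm_num)

theorem vc_sq (c : ℝ) (j : ℤ) : vc c j ^ 2 = (ww c j)⁻¹ := by
  rw [vc, ← Real.rpow_natCast, ← Real.rpow_mul (ww_pos c j).le]
  norm_num
  rw [Real.rpow_neg_one]

theorem ww_sq (c : ℝ) (j : ℤ) : ww c j ^ 2 = 1 + (c ^ 2)⁻¹ * (j : ℝ) ^ 2 := by
  rw [ww, Real.sq_sqrt (by positivity)]; ring

theorem ww_le (c : ℝ) (j : ℤ) : ww c j ≤ 1 + (c ^ 2)⁻¹ * (j : ℝ) ^ 2 / 2 := by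
  have h := ww_sq c j
  have h1 : 0 ≤ (c ^ 2)⁻¹ * (j : ℝ) ^ 2 := by positivity
  nlinarith [ww_pos c j]

theorem one_sub_vc_le (c : ℝ) (j : ℤ) : 1 - vc c j ≤ (c ^ 2)⁻¹ * (j : ℝ) ^ 2 / 2 := by
  have h1 := vc_sq c j
  have h2 := vc_pos c j
  have h3 := vc_le_one c j
  have h4 := ww_le c j
  have h5 : (ww c j)⁻¹ * ww c j = 1 := inv_mul_cancel₀ (ww_pos c j).ne'
  have h6 : (ww c j)⁻¹ ≤ vc c j := by rw [← h1]; nlinarith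
  have h7 := inv_pos.2 (ww_pos c j)
  nlinarith [ww_pos c j, one_le_ww c j]

/-- With `t = c⁻²` and squares taken, vanishing momentum gives `1 + t j₁² ≤ 1 + 4t(j₂² + j₃² +
j₄²)`, which is dominated by `4 ∏ (1 + t j_i²)` over the three inputs, uniformly in `c`. -/
theorem ww_le_of_mom {c : ℝ} {k₁ k₂ k₃ k₄ : Idx} (h : mom k₁ k₂ k₃ k₄ = 0) :
    ww c k₁.1 ≤ 2 * (ww c k₂.1 * ww c k₃.1 * ww c k₄.1) := by
  have h1 := abs_le_of_mom h
  set t := (c ^ 2)⁻¹ with ht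
  have ht0 : 0 ≤ t := by positivity
  have p2 := ww_pos c k₂.1
  have p3 := ww_pos c k₃.1
  have p4 := ww_pos c k₄.1
  refine le_of_sq_le_sq ?_ (by positivity)
  have e : (2 * (ww c k₂.1 * ww c k₃.1 * ww c k₄.1)) ^ 2 = 4 *
      (ww c k₂.1 ^ 2 * ww c k₃.1 ^ 2 * ww c k₄.1 ^ 2) := by ring
  rw [e, ww_sq, ww_sq, ww_sq, ww_sq, ← ht, ← sq_abs (k₁.1 : ℝ), ← sq_abs (k₂.1 : ℝ),
    ← sq_abs (k₃.1 : ℝ), ← sq_abs (k₄.1 : ℝ)]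
  set x := |(k₂.1 : ℝ)|
  set y := |(k₃.1 : ℝ)|
  set z := |(k₄.1 : ℝ)|
  have hsq : |(k₁.1 : ℝ)| ^ 2 ≤ 4 * (x ^ 2 + y ^ 2 + z ^ 2) := by
    have : |(k₁.1 : ℝ)| ^ 2 ≤ (x + y + z) ^ 2 := by gcongr
    nlinarith [sq_nonneg (x - y), sq_nonneg (y - z), sq_nonneg (x - z)]
  have h2 : t * |(k₁.1 : ℝ)| ^ 2 ≤ t * (4 * (x ^ 2 + y ^ 2 + z ^ 2)) := by gcongr
  have h3 : 0 ≤ (t * x ^ 2) * (t * y ^ 2) := by positivity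
  have h4 : 0 ≤ (t * x ^ 2) * (t * z ^ 2) := by positivity
  have h5 : 0 ≤ (t * y ^ 2) * (t * z ^ 2) := by positivity
  have h6 : 0 ≤ (t * x ^ 2) * (t * y ^ 2) * (t * z ^ 2) := by positivity
  nlinarith

/-- The square of the left side is `𝚠_{j₁} / (𝚠_{j₂} 𝚠_{j₃} 𝚠_{j₄}) ≤ 2`. This is the gain of one
power of `𝚠` in the Klein-Gordon nonlinearity. -/
theorem vc_prod_le {c : ℝ} {k₁ k₂ k₃ k₄ : Idx} (h : mom k₁ k₂ k₃ k₄ = 0) :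
    vc c k₁.1 * vc c k₂.1 * vc c k₃.1 * vc c k₄.1 * ww c k₁.1 ≤ 2 := by
  have p1 := ww_pos c k₁.1
  have p2 := ww_pos c k₂.1
  have p3 := ww_pos c k₃.1
  have p4 := ww_pos c k₄.1
  refine le_of_sq_le_sq ?_ (by norm_num)
  simp only [mul_pow, vc_sq]
  have := ww_le_of_mom (c := c) h
  field_simp
  nlinarith [mul_pos (mul_pos p2 p3) p4]

theorem vc_prod_pos (c : ℝ) (i j k l : ℤ) : 0 < vc c i * vc c j * vc c k * vc c l := by
  have := vc_pos c i
  have := vc_pos c j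
  have := vc_pos c k
  have := vc_pos c l
  positivity

theorem vc_prod_le_one (c : ℝ) (i j k l : ℤ) : vc c i * vc c j * vc c k * vc c l ≤ 1 := by
  have h1 := vc_le_one c i
  have h2 := vc_le_one c j
  have h3 := vc_le_one c k
  have h4 := vc_le_one c l
  have p1 := (vc_pos c i).le
  have p2 := (vc_pos c j).le
  have p3 := (vc_pos c k).le
  have p4 := (vc_pos c l).le
  exact mul_le_one₀ (mul_le_one₀ (mul_le_one₀ h1 p2 h2) p3 h3) p4 h4

theorem jap_le_mx (k₁ k₂ k₃ k₄ : Idx) : jap k₁.1 ≤ mx k₁ k₂ k₃ k₄ ∧ jap k₂.1 ≤ mx k₁ k₂ k₃ k₄ ∧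
    jap k₃.1 ≤ mx k₁ k₂ k₃ k₄ ∧ jap k₄.1 ≤ mx k₁ k₂ k₃ k₄ := by
  simp [mx]

theorem one_le_mx (k₁ k₂ k₃ k₄ : Idx) : 1 ≤ mx k₁ k₂ k₃ k₄ :=
  (one_le_jap k₁.1).trans (jap_le_mx _ _ _ _).1

theorem sq_le_jap_sq (j : ℤ) : (j : ℝ) ^ 2 ≤ jap j ^ 2 := by
  rw [← sq_abs]
  have := abs_le_jap j
  gcongr

theorem one_sub_vc_prod_le (c : ℝ) (k₁ k₂ k₃ k₄ : Idx) :
    1 - vc c k₁.1 * vc c k₂.1 * vc c k₃.1 * vc c k₄.1 ≤ 2 * (c ^ 2)⁻¹ * mx k₁ k₂ k₃ k₄ ^ 2 := by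
  obtain ⟨j1, j2, j3, j4⟩ := jap_le_mx k₁ k₂ k₃ k₄
  set m := mx k₁ k₂ k₃ k₄
  have hc : 0 ≤ (c ^ 2)⁻¹ := by positivity
  have key : ∀ j : ℤ, jap j ≤ m → 1 - vc c j ≤ (c ^ 2)⁻¹ * m ^ 2 / 2 := by
    intro j hj
    refine (one_sub_vc_le c j).trans ?_
    have h1 := sq_le_jap_sq j
    have h2 : jap j ^ 2 ≤ m ^ 2 := by
      have := jap_pos j
      gcongr
    have := h1.trans h2
    gcongr
  have h1 := key _ j1
  have h2 := key _ j2
  have h3 := key _ j3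
  have h4 := key _ j4
  have a1 := vc_le_one c k₁.1
  have a2 := vc_le_one c k₂.1
  have a3 := vc_le_one c k₃.1
  have a4 := vc_le_one c k₄.1
  have p1 := vc_pos c k₁.1
  have p2 := vc_pos c k₂.1
  have p3 := vc_pos c k₃.1
  have p4 := vc_pos c k₄.1
  set x := vc c k₁.1
  set y := vc c k₂.1
  set z := vc c k₃.1
  set w := vc c k₄.1
  have e1 : 1 - x * y ≤ (1 - x) + (1 - y) := by nlinarith
  have e2 : 1 - x * y * z ≤ (1 - x * y) + (1 - z) := by nlinarith [mul_le_one₀ a1 p2.le a2]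
  have e3 : 1 - x * y * z * w ≤ (1 - x * y * z) + (1 - w) := by
    nlinarith [mul_le_one₀ (mul_le_one₀ a1 p2.le a2) p3.le a3]
  linarith

theorem norm_ker_le {v : ℤ → ℝ} {P : QuadPred} {k₁ k₂ k₃ k₄ : Idx} :
    ‖ker v P k₁ k₂ k₃ k₄‖ ≤ 1 / (32 * Real.pi) * |v k₁.1 * v k₂.1 * v k₃.1 * v k₄.1| := by
  unfold ker
  split_ifs
  · rw [Complex.norm_real, norm_mul, Real.norm_of_nonneg k0_nonneg, Real.norm_eq_abs]
  · rw [norm_zero]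
    have := k0_nonneg
    positivity

theorem goodKernel_ker_vc (c : ℝ) (hP : SymmPred P) : GoodKernel c 1 1 (ker (vc c) P) where
  symm := symmKernel_ker hP
  M_nonneg := zero_le_one
  bound :=
    { supp := fun k₁ k₂ k₃ k₄ h => by
        by_contra h'
        exact h (ker_of_not fun h'' => h' h''.1)
      bound := fun k₁ k₂ k₃ k₄ => by
        simp only [Real.rpow_one, Real.rpow_zero, mul_one]
        by_cases h : mom k₁ k₂ k₃ k₄ = 0
        · have h1 := norm_ker_le (v := vc c) (P := P) (k₁ := k₁) (k₂ := k₂) (k₃ := k₃) (k₄ := k₄)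
          rw [abs_of_pos (vc_prod_pos _ _ _ _ _)] at h1
          have h2 := vc_prod_le (c := c) h
          have h3 := k0_le
          have h4 := k0_nonneg
          have := ww_pos c k₁.1
          calc _ ≤ 1 / (32 * Real.pi) * (vc c k₁.1 * vc c k₂.1 * vc c k₃.1 * vc c k₄.1) *
                ww c k₁.1 := by gcongr
            _ = 1 / (32 * Real.pi) * (vc c k₁.1 * vc c k₂.1 * vc c k₃.1 * vc c k₄.1 *
                ww c k₁.1) := by ring
            _ ≤ 1 / 90 * 2 := by
                have := vc_prod_pos c k₁.1 k₂.1 k₃.1 k₄.1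
                gcongr
            _ ≤ 1 := by norm_num
        · rw [ker_of_not (fun h' => h h'.1)]; simp }

theorem goodKernel_ker_one (hP : SymmPred P) : GoodKernel 1 0 1 (ker (fun _ => 1) P) where
  symm := symmKernel_ker hP
  M_nonneg := zero_le_one
  bound :=
    { supp := fun k₁ k₂ k₃ k₄ h => by
        by_contra h'
        exact h (ker_of_not fun h'' => h' h''.1)
      bound := fun k₁ k₂ k₃ k₄ => by
        simp only [Real.rpow_zero, mul_one]
        refine norm_ker_le.trans ?_
        have := k0_le
        norm_num at this ⊢
        linarith }

theorem norm_chi (k₁ k₂ k₃ k₄ : Idx) : ‖chi v P φ k₁ k₂ k₃ k₄‖ =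
    ‖ker v P k₁ k₂ k₃ k₄‖ / |divisor φ k₁ k₂ k₃ k₄| := by
  rw [chi, norm_div, norm_mul, Complex.norm_I, one_mul, Complex.norm_real, Real.norm_eq_abs]

/-- Kernels of solutions of the homological equation, if the divisors are bounded from below. -/
theorem goodKernel_chi {c b M γ : ℝ} (hK : GoodKernel c b M (ker v P)) (hP : SymmPred P)
    (hγ : 0 < γ) (hd : ∀ k₁ k₂ k₃ k₄, mom k₁ k₂ k₃ k₄ = 0 → P k₁ k₂ k₃ k₄ →
      γ ≤ |divisor φ k₁ k₂ k₃ k₄|) : GoodKernel c b (M / γ) (chi v P φ) where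
  symm := symmKernel_chi hP
  M_nonneg := div_nonneg hK.M_nonneg hγ.le
  bound :=
    { supp := fun k₁ k₂ k₃ k₄ h => hK.bound.supp _ _ _ _ fun h' => h (by simp [chi, h'])
      bound := fun k₁ k₂ k₃ k₄ => by
        by_cases h : mom k₁ k₂ k₃ k₄ = 0 ∧ P k₁ k₂ k₃ k₄
        · have h1 := hd _ _ _ _ h.1 h.2
          have h2 := hK.bound.bound k₁ k₂ k₃ k₄
          rw [norm_chi]
          have h3 := ww_pos c k₁.1
          calc _ ≤ ‖ker v P k₁ k₂ k₃ k₄‖ / γ * ww c k₁.1 ^ b := by gcongr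
            _ = ‖ker v P k₁ k₂ k₃ k₄‖ * ww c k₁.1 ^ b / γ := by ring
            _ ≤ M * mx k₁ k₂ k₃ k₄ ^ (0 : ℝ) / γ := by gcongr
            _ = _ := by ring
        · rw [norm_chi, ker_of_not h]
          simp only [norm_zero, zero_div, zero_mul, Real.rpow_zero, mul_one]
          exact div_nonneg hK.M_nonneg hγ.le }

end KGNormalForm
end

noncomputable section
namespace KGNormalForm
open scoped ENNReal

/-! ### Small divisors -/

theorem divisor_swap₁ (φ : ℤ → ℝ) (k₁ k₂ k₃ k₄ : Idx) :
    divisor φ k₂ k₁ k₃ k₄ = divisor φ k₁ k₂ k₃ k₄ := by unfold divisor; ring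

theorem divisor_swap₂ (φ : ℤ → ℝ) (k₁ k₂ k₃ k₄ : Idx) :
    divisor φ k₁ k₃ k₂ k₄ = divisor φ k₁ k₂ k₃ k₄ := by unfold divisor; ring

theorem divisor_swap₃ (φ : ℤ → ℝ) (k₁ k₂ k₃ k₄ : Idx) :
    divisor φ k₁ k₂ k₄ k₃ = divisor φ k₁ k₂ k₃ k₄ := by unfold divisor; ring

theorem mx_swap₁ (k₁ k₂ k₃ k₄ : Idx) : mx k₂ k₁ k₃ k₄ = mx k₁ k₂ k₃ k₄ := by
  unfold mx; rw [max_comm (jap k₂.1)]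

theorem mx_swap₂ (k₁ k₂ k₃ k₄ : Idx) : mx k₁ k₃ k₂ k₄ = mx k₁ k₂ k₃ k₄ := by
  unfold mx; ac_rfl

theorem mx_swap₃ (k₁ k₂ k₃ k₄ : Idx) : mx k₁ k₂ k₄ k₃ = mx k₁ k₂ k₃ k₄ := by
  unfold mx; rw [max_comm (jap k₄.1)]

/-- To prove a property of the quadruples that meet `J` and satisfy a symmetric condition, we may
assume that the first index lies in `J`. -/
theorem quad_induction {J : Finset ℤ} {P Q : QuadPred} (hP : SymmPred P)
    (h₁₂ : ∀ k₁ k₂ k₃ k₄, Q k₁ k₂ k₃ k₄ → Q k₂ k₁ k₃ k₄)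
    (h₂₃ : ∀ k₁ k₂ k₃ k₄, Q k₁ k₂ k₃ k₄ → Q k₁ k₃ k₂ k₄)
    (h₃₄ : ∀ k₁ k₂ k₃ k₄, Q k₁ k₂ k₃ k₄ → Q k₁ k₂ k₄ k₃)
    (h : ∀ k₁ k₂ k₃ k₄, P k₁ k₂ k₃ k₄ → k₁.1 ∈ J → Q k₁ k₂ k₃ k₄)
    {k₁ k₂ k₃ k₄ : Idx} (hk : P k₁ k₂ k₃ k₄) (hJ : meets J k₁ k₂ k₃ k₄) : Q k₁ k₂ k₃ k₄ := by
  have a : ∀ {k₁ k₂ k₃ k₄}, P k₁ k₂ k₃ k₄ → k₂.1 ∈ J → Q k₁ k₂ k₃ k₄ := fun hk hj =>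
    h₁₂ _ _ _ _ (h _ _ _ _ ((hP.s₁₂ _ _ _ _).1 hk) hj)
  have b : ∀ {k₁ k₂ k₃ k₄}, P k₁ k₂ k₃ k₄ → k₃.1 ∈ J → Q k₁ k₂ k₃ k₄ := fun hk hj =>
    h₂₃ _ _ _ _ (a ((hP.s₂₃ _ _ _ _).1 hk) hj)
  have c : ∀ {k₁ k₂ k₃ k₄}, P k₁ k₂ k₃ k₄ → k₄.1 ∈ J → Q k₁ k₂ k₃ k₄ := fun hk hj =>
    h₃₄ _ _ _ _ (b ((hP.s₃₄ _ _ _ _).1 hk) hj)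
  rcases hJ with hj | hj | hj | hj
  · exact h _ _ _ _ hk hj
  · exact a hk hj
  · exact b hk hj
  · exact c hk hj

/-- The combinatorial form of a non-resonant quadruple of charge zero. -/
def Neutral (J : Finset ℤ) : QuadPred := fun k₁ k₂ k₃ k₄ =>
  ∃ (a b d e : ℤ) (s : ℝ), |s| = 1 ∧ a ∈ J ∧ a + d = b + e ∧ a ≠ b ∧ a ≠ e ∧
      (∀ φ : ℤ → ℝ, divisor φ k₁ k₂ k₃ k₄ = s * (φ a + φ d - φ b - φ e)) ∧
      ∀ B, jap a ≤ B → jap b ≤ B → jap d ≤ B → jap e ≤ B → mx k₁ k₂ k₃ k₄ ≤ B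

theorem abs_sg (k : Idx) : |(sg k : ℝ)| = 1 := by
  unfold sg; split_ifs <;> simp

/-- Zero charge means two variables `z` and two `z̄`. Let `a ∈ J` and `d` be the indices of one
type, `b` and `e` those of the other. Momentum reads `a + d = b + e`, so `a = b` or `a = e` would
force the two pairs to coincide and the quadruple to be paired. -/
theorem neutral_of {J : Finset ℤ} {k₁ k₂ k₃ k₄ : Idx} (hm : mom k₁ k₂ k₃ k₄ = 0)
    (hc : charge k₁ k₂ k₃ k₄ = 0) (hJ : meets J k₁ k₂ k₃ k₄) (hp : ¬paired k₁ k₂ k₃ k₄) :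
    Neutral J k₁ k₂ k₃ k₄ := by
  have h₁₂ : ∀ k₁ k₂ k₃ k₄, Neutral J k₁ k₂ k₃ k₄ → Neutral J k₂ k₁ k₃ k₄ := by
    intro k₁ k₂ k₃ k₄ h
    simpa only [Neutral, divisor_swap₁ _ k₁, mx_swap₁ k₁] using h
  have h₂₃ : ∀ k₁ k₂ k₃ k₄, Neutral J k₁ k₂ k₃ k₄ → Neutral J k₁ k₃ k₂ k₄ := by
    intro k₁ k₂ k₃ k₄ h
    simpa only [Neutral, divisor_swap₂ _ k₁ k₂, mx_swap₂ k₁ k₂] using h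
  have h₃₄ : ∀ k₁ k₂ k₃ k₄, Neutral J k₁ k₂ k₃ k₄ → Neutral J k₁ k₂ k₄ k₃ := by
    intro k₁ k₂ k₃ k₄ h
    simpa only [Neutral, divisor_swap₃ _ k₁ k₂ k₃, mx_swap₃ k₁ k₂ k₃] using h
  have hP := (symmPred_mom.and symmPred_charge).and symmPred_paired.not
  refine quad_induction (J := J) hP h₁₂ h₂₃ h₃₄ ?_ ⟨⟨hm, hc⟩, hp⟩ hJ
  have core : ∀ k₁ k₂ k₃ k₄, (mom k₁ k₂ k₃ k₄ = 0 ∧ charge k₁ k₂ k₃ k₄ = 0) ∧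
      ¬paired k₁ k₂ k₃ k₄ → k₁.1 ∈ J → k₂.2 = k₁.2 → Neutral J k₁ k₂ k₃ k₄ := by
    rintro ⟨j₁, b₁⟩ ⟨j₂, b₂⟩ ⟨j₃, b₃⟩ ⟨j₄, b₄⟩ ⟨⟨hm, hc⟩, hp⟩ hJ hb
    simp only at hb hJ
    subst hb
    -- In the order `a, b, d, e`: the first two variables have the same type, so `d` is `j₂`.
    refine ⟨j₁, j₃, j₂, j₄, sg (j₁, b₂), abs_sg _, hJ, ?_, ?_, ?_, ?_, ?_⟩
    · cases b₂ <;> cases b₃ <;> cases b₄ <;> simp [charge, mom, sg] at hc hm ⊢ <;> omega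
    · rintro rfl
      apply hp
      cases b₂ <;> cases b₃ <;> cases b₄ <;>
        simp [charge, mom, sg, paired, opp] at hc hm ⊢ <;> omega
    · rintro rfl
      apply hp
      cases b₂ <;> cases b₃ <;> cases b₄ <;>
        simp [charge, mom, sg, paired, opp] at hc hm ⊢ <;> omega
    · intro φ
      cases b₂ <;> cases b₃ <;> cases b₄ <;> simp [charge, sg, divisor] at hc ⊢ <;> ring
    · intro B h1 h2 h3 h4
      exact max_le (max_le h1 h3) (max_le h2 h4)
  intro k₁ k₂ k₃ k₄ h hJ
  by_cases e2 : k₂.2 = k₁.2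
  · exact core _ _ _ _ h hJ e2
  by_cases e3 : k₃.2 = k₁.2
  · exact h₂₃ _ _ _ _ (core _ _ _ _ ((hP.s₂₃ _ _ _ _).1 h) hJ e3)
  by_cases e4 : k₄.2 = k₁.2
  · exact h₃₄ _ _ _ _ (h₂₃ _ _ _ _ (core _ _ _ _ ((hP.s₂₃ _ _ _ _).1
      ((hP.s₃₄ _ _ _ _).1 h)) hJ e4))
  · exfalso
    have := h.1.2
    unfold charge sg at this
    rw [Bool.eq_not_of_ne e2, Bool.eq_not_of_ne e3, Bool.eq_not_of_ne e4] at this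
    cases h1 : k₁.2 <;> simp [h1] at this

/-- The second difference of `φ`. -/
def secondDiff (φ : ℤ → ℝ) (j : ℤ) : ℝ := φ (j + 1) + φ (j - 1) - 2 * φ j

/-- Convexity bound for non-resonant divisors. -/
theorem convex_divisor {φ : ℤ → ℝ} {γ : ℝ} {N : ℝ} (hpos : ∀ j, 0 ≤ secondDiff φ j)
    (hγ : ∀ j : ℤ, |(j : ℝ)| ≤ N + 1 → γ ≤ secondDiff φ j) {a b d e : ℤ} (ha : |(a : ℝ)| ≤ N)
    (h : a + d = b + e) (hab : a ≠ b) (hae : a ≠ e) : γ ≤ |φ a + φ d - φ b - φ e| := by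
  -- Convexity means that the first differences increase. The pairs `{a, d}` and `{b, e}` have the
  -- same midpoint, so one interval lies strictly inside the other, and `φ` has the larger sum at
  -- the outer pair.
  set δ : ℤ → ℝ := fun j => φ (j + 1) - φ j with hδ
  have hδm : Monotone δ := by
    refine monotone_int_of_le_succ fun j => ?_
    have := hpos (j + 1)
    simp only [secondDiff, hδ] at *
    rw [show j + 1 - 1 = j by ring] at this
    linarith
  -- outer pair `o, o'`, inner pair `i, i'` with `i = o + n + 1`, `o' = i' + n + 1`
  have key : ∀ (n : ℕ) (o i' : ℤ), o + n + 1 ≤ i' →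
      0 ≤ φ (i' + n) - φ i' - (φ (o + n) - φ o) := by
    intro n
    induction n with
    | zero => intro o i' _; simp
    | succ n ih =>
      intro o i' hoi
      have h1 := ih o i' (by push_cast at hoi; omega)
      have h2 := hδm (show o + n ≤ i' + n by push_cast at hoi; omega)
      simp only [hδ] at h2
      push_cast
      rw [← add_assoc, ← add_assoc]
      linarith
  -- The expression is the sum of `δ (i' + k) - δ (o + k)` over `0 ≤ k ≤ n`, all nonnegative. The
  -- first or the last summand contains a second difference at `t` (inner points) or at its
  -- neighbour towards the interior (outer points), which is why `γ` is required up to `N + 1`.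
  have key2 : ∀ (n : ℕ) (o i' : ℤ), o + n + 1 ≤ i' →
      (∃ t ∈ ({o, o + n + 1, i', i' + n + 1} : Set ℤ), |(t : ℝ)| ≤ N) →
      γ ≤ φ (i' + n + 1) - φ i' - (φ (o + n + 1) - φ o) := by
    rintro n o i' hoi ⟨t, ht, htN⟩
    have hstep := abs_le.1 htN
    have e1 := key n o i' hoi
    have e2 := key n (o + 1) (i' + 1) (by omega)
    rw [add_right_comm i', add_right_comm o] at e2
    have f1 : φ (i' + n + 1) - φ (i' + n) = δ (i' + n) := rfl
    have f2 : φ (o + n + 1) - φ (o + n) = δ (o + n) := rfl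
    have f3 : φ (i' + 1) - φ i' = δ i' := rfl
    have f4 : φ (o + 1) - φ o = δ o := rfl
    have g : ∀ j : ℤ, secondDiff φ (j + 1) = δ (j + 1) - δ j := fun j => by
      simp only [secondDiff, hδ]; rw [show j + 1 - 1 = j by ring]; ring
    simp only [Set.mem_insert_iff, Set.mem_singleton_iff] at ht
    rcases ht with rfl | rfl | rfl | rfl
    · have h1 := hγ (t + 1) (by push_cast; rw [abs_le]; constructor <;> linarith)
      rw [g] at h1
      have h2 := hδm (show t + 1 ≤ i' by omega)
      linarith
    · have h1 := hγ (o + n + 1) (by rw [abs_le]; constructor <;> linarith)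
      rw [g] at h1
      have h2 := hδm (show o + n + 1 ≤ i' + n by omega)
      linarith
    · have h1 := hγ t (by rw [abs_le]; constructor <;> linarith)
      have h3 := g (t - 1)
      rw [sub_add_cancel] at h3
      rw [h3] at h1
      have h2 := hδm (show o ≤ t - 1 by omega)
      linarith
    · have h1 := hγ (i' + n) (by
        push_cast at hstep ⊢; rw [abs_le]; constructor <;> linarith)
      have h3 := g (i' + n - 1)
      rw [sub_add_cancel] at h3
      rw [h3] at h1
      have h2 := hδm (show o + n ≤ i' + n - 1 by omega)
      linarith
  have key3 : ∀ o i i' o' : ℤ, o < i → i ≤ i' → o + o' = i + i' →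
      (∃ t ∈ ({o, i, i', o'} : Set ℤ), |(t : ℝ)| ≤ N) → γ ≤ φ o + φ o' - φ i - φ i' := by
    intro o i i' o' h1 h2 h3 h4
    obtain ⟨n, hn⟩ := Int.eq_ofNat_of_zero_le (show 0 ≤ i - o - 1 by omega)
    obtain rfl : i = o + n + 1 := by omega
    obtain rfl : o' = i' + n + 1 := by omega
    have := key2 n o i' h2 h4
    linarith
  -- Which of the two pairs is the outer one decides the sign of the divisor.
  rcases lt_or_ge (min a d) (min b e) with hlt | hge
  · have := key3 (min a d) (min b e) (max b e) (max a d) hlt min_le_max (by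
      rw [min_add_max, min_add_max, h]) ⟨a, by
        rcases min_choice a d with h | h <;> rcases max_choice a d with h' | h' <;> simp [h, h'] <;>
          omega, ha⟩
    refine this.trans (le_trans (le_of_eq ?_) (le_abs_self _))
    rcases le_total a d with h1 | h1 <;> rcases le_total b e with h2 | h2 <;> simp [h1, h2] <;> ring
  · have hlt : min b e < min a d := by
      refine lt_of_le_of_ne hge fun h' => ?_
      rcases le_total a d with h1 | h1 <;> rcases le_total b e with h2 | h2 <;>
        simp [h1, h2] at h' <;> omega
    have := key3 (min b e) (min a d) (max a d) (max b e) hlt min_le_max (by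
      rw [min_add_max, min_add_max, h]) ⟨a, by
        rcases min_choice a d with h | h <;> rcases max_choice a d with h' | h' <;> simp [h, h'] <;>
          omega, ha⟩
    refine this.trans (le_trans (le_of_eq ?_) (neg_le_abs _))
    rcases le_total a d with h1 | h1 <;> rcases le_total b e with h2 | h2 <;> simp [h1, h2] <;> ring

end KGNormalForm
end

/-! ### Divisors of Klein-Gordon and NLS: lower bounds and comparison -/

noncomputable section
namespace KGNormalForm
open scoped ENNReal

theorem sqrt_add_sq_ge (c t : ℝ) : c ≤ √(t ^ 2 + c ^ 2) :=
  Real.le_sqrt_of_sq_le (by nlinarith [sq_nonneg t])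

theorem sqrt_add_sq_le {c t : ℝ} (hc : 0 ≤ c) (ht : |t| ≤ c / 2) : √(t ^ 2 + c ^ 2) ≤ 9 / 8 * c := by
  rw [Real.sqrt_le_left (by positivity)]
  have : t ^ 2 ≤ (c / 2) ^ 2 := by
    rw [← sq_abs]; gcongr
  nlinarith

/-- Convexity of `√(x² + c²)` for unit steps. Since `s₁² + s₂² = 2s² + 2`, the bound `s₁ s₂ ≥ s² -
1` gives `(s₁ + s₂)² ≥ 4s²`. -/
theorem secondDiff_lam_nonneg {c : ℝ} (hc : 0 ≤ c) (j : ℤ) : 0 ≤ secondDiff (lam c) j := by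
  unfold secondDiff lam
  push_cast
  set x : ℝ := (j : ℝ)
  have e0 := Real.sq_sqrt (show 0 ≤ x ^ 2 + c ^ 2 by positivity)
  have e1 := Real.sq_sqrt (show 0 ≤ (x + 1) ^ 2 + c ^ 2 by positivity)
  have e2 := Real.sq_sqrt (show 0 ≤ (x - 1) ^ 2 + c ^ 2 by positivity)
  have p0 := Real.sqrt_nonneg (x ^ 2 + c ^ 2)
  have p1 := Real.sqrt_nonneg ((x + 1) ^ 2 + c ^ 2)
  have p2 := Real.sqrt_nonneg ((x - 1) ^ 2 + c ^ 2)
  set s := √(x ^ 2 + c ^ 2)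
  set s₁ := √((x + 1) ^ 2 + c ^ 2)
  set s₂ := √((x - 1) ^ 2 + c ^ 2)
  have h1 : s ^ 2 - 1 ≤ s₁ * s₂ := by
    refine le_of_sq_le_sq ?_ (by positivity)
    rw [mul_pow, e1, e2, e0]
    nlinarith [sq_nonneg c]
  have h2 : 2 * s ≤ s₁ + s₂ := by
    refine le_of_sq_le_sq ?_ (by positivity)
    nlinarith
  nlinarith

/-- For `|x| ≤ c` one has the better bound `s₁ s₂ ≥ s²`, so `(s₁ + s₂)² ≥ 4s² + 2`. As `s ≤ 9c/8`,
this makes `s₁ + s₂` exceed `2s` by at least `1/(4c)`, and `lam` carries a factor `c`. -/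
theorem secondDiff_lam_ge {c N : ℝ} (hN : 0 ≤ N) (hc : 2 * (N + 2) ≤ c) {j : ℤ}
    (hj : |(j : ℝ)| ≤ N + 1) : 1 / 4 ≤ secondDiff (lam c) j := by
  have hc0 : 0 < c := by linarith
  unfold secondDiff lam
  push_cast
  set x : ℝ := (j : ℝ)
  have b0 := sqrt_add_sq_le (t := x) hc0.le (by linarith)
  have e0 := Real.sq_sqrt (show 0 ≤ x ^ 2 + c ^ 2 by positivity)
  have e1 := Real.sq_sqrt (show 0 ≤ (x + 1) ^ 2 + c ^ 2 by positivity)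
  have e2 := Real.sq_sqrt (show 0 ≤ (x - 1) ^ 2 + c ^ 2 by positivity)
  have p0 := Real.sqrt_nonneg (x ^ 2 + c ^ 2)
  have p1 := Real.sqrt_nonneg ((x + 1) ^ 2 + c ^ 2)
  have p2 := Real.sqrt_nonneg ((x - 1) ^ 2 + c ^ 2)
  set s := √(x ^ 2 + c ^ 2)
  set s₁ := √((x + 1) ^ 2 + c ^ 2)
  set s₂ := √((x - 1) ^ 2 + c ^ 2)
  have hx : x ^ 2 ≤ c ^ 2 := by
    rw [← sq_abs]
    have : |x| ≤ c := by linarith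
    gcongr
  have h1 : s ^ 2 ≤ s₁ * s₂ := by
    refine le_of_sq_le_sq ?_ (by positivity)
    rw [mul_pow, e1, e2, e0]
    nlinarith [sq_nonneg c]
  have h2 : 2 * s + 1 / (4 * c) ≤ s₁ + s₂ := by
    refine le_of_sq_le_sq ?_ (by positivity)
    have h3 : s * (1 / (4 * c)) ≤ 9 / 32 := by
      rw [mul_one_div, div_le_iff₀ (by positivity)]; linarith
    have h4 : 1 / (4 * c) ≤ 1 / 2 := by
      rw [div_le_div_iff₀ (by positivity) (by norm_num)]; linarith
    have h5 : 0 < 1 / (4 * c) := by positivity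
    nlinarith
  have h6 : c * (1 / (4 * c)) = 1 / 4 := by field_simp
  nlinarith

theorem quarter_le_divisor_lam {J : Finset ℤ} {c N : ℝ} (hN : 0 ≤ N) (hJ : ∀ j ∈ J, |(j : ℝ)| ≤ N)
    (hc : 2 * (N + 2) ≤ c) {k₁ k₂ k₃ k₄ : Idx} (h : Neutral J k₁ k₂ k₃ k₄) :
    1 / 4 ≤ |divisor (lam c) k₁ k₂ k₃ k₄| := by
  obtain ⟨a, b, d, e, s, hs, ha, h1, h2, h3, h4, -⟩ := h
  rw [h4, abs_mul, hs, one_mul]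
  exact convex_divisor (secondDiff_lam_nonneg (by linarith))
    (fun j hj => secondDiff_lam_ge hN hc hj) (hJ a ha) h1 h2 h3

/-- The function `⟨t⟩ = √(t² + c²)` satisfies `⟨x + t⟩ ≤ |x| + ⟨t⟩` and `⟨b + d⟩ ≤ ⟨b⟩ + ⟨d⟩`.
Together with `|x| ≤ c/2` and `⟨x⟩ ≥ c` this leaves a surplus `c/2`. -/
theorem sqrt_triple {c x b d : ℝ} (hc : 0 ≤ c) (hx : |x| ≤ c / 2) :
    √((x + b + d) ^ 2 + c ^ 2) + c / 2 ≤
      √(x ^ 2 + c ^ 2) + √(b ^ 2 + c ^ 2) + √(d ^ 2 + c ^ 2) := by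
  have e := Real.sq_sqrt (show 0 ≤ (b + d) ^ 2 + c ^ 2 by positivity)
  have eb := Real.sq_sqrt (show 0 ≤ b ^ 2 + c ^ 2 by positivity)
  have ed := Real.sq_sqrt (show 0 ≤ d ^ 2 + c ^ 2 by positivity)
  have p := Real.sqrt_nonneg ((b + d) ^ 2 + c ^ 2)
  have pb := Real.sqrt_nonneg (b ^ 2 + c ^ 2)
  have pd := Real.sqrt_nonneg (d ^ 2 + c ^ 2)
  have hs := Real.abs_le_sqrt (show (b + d) ^ 2 ≤ (b + d) ^ 2 + c ^ 2 by nlinarith)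
  have hb := Real.abs_le_sqrt (show b ^ 2 ≤ b ^ 2 + c ^ 2 by nlinarith)
  have hd := Real.abs_le_sqrt (show d ^ 2 ≤ d ^ 2 + c ^ 2 by nlinarith)
  set s := √((b + d) ^ 2 + c ^ 2)
  set sb := √(b ^ 2 + c ^ 2)
  set sd := √(d ^ 2 + c ^ 2)
  have h1 : √((x + b + d) ^ 2 + c ^ 2) ≤ |x| + s := by
    rw [Real.sqrt_le_left (by positivity)]
    have h3 : x * (b + d) ≤ |x| * s := (le_abs_self _).trans (by rw [abs_mul]; gcongr)
    nlinarith [sq_abs x]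
  have h2 : s ≤ sb + sd := by
    refine le_of_sq_le_sq ?_ (by positivity)
    have h3 : b * d ≤ sb * sd := (le_abs_self _).trans (by rw [abs_mul]; gcongr)
    nlinarith
  have h3 := sqrt_add_sq_ge c x
  linarith

/-- At charge `±4` all frequencies, each at least `c²`, add up. At charge `±2` three stand against
one. If the single one has its index in `J`, it is at most `9c²/8` while the others sum to at least
`3c²`. Otherwise momentum makes its index the sum of the three others up to signs, and `sqrt_triple`
applies with the index of `J` as the small one. -/
theorem divisor_lam_of_charge {J : Finset ℤ} {c N : ℝ} (hN : 0 ≤ N) (hJ : ∀ j ∈ J, |(j : ℝ)| ≤ N)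
    (hc : 2 * (N + 2) ≤ c) {k₁ k₂ k₃ k₄ : Idx} (hm : mom k₁ k₂ k₃ k₄ = 0)
    (hch : charge k₁ k₂ k₃ k₄ ≠ 0) (hmeet : meets J k₁ k₂ k₃ k₄) :
    c ^ 2 / 2 ≤ |divisor (lam c) k₁ k₂ k₃ k₄| := by
  have hc0 : 0 < c := by linarith
  refine quad_induction (J := J) (Q := fun k₁ k₂ k₃ k₄ => c ^ 2 / 2 ≤ |divisor (lam c) k₁ k₂ k₃ k₄|)
    (symmPred_mom.and symmPred_charge.not) ?_ ?_ ?_ ?_ ⟨hm, hch⟩ hmeet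
  · intro k₁ k₂ k₃ k₄ h; rwa [divisor_swap₁]
  · intro k₁ k₂ k₃ k₄ h; rwa [divisor_swap₂]
  · intro k₁ k₂ k₃ k₄ h; rwa [divisor_swap₃]
  rintro ⟨j₁, b₁⟩ ⟨j₂, b₂⟩ ⟨j₃, b₃⟩ ⟨j₄, b₄⟩ ⟨hm, hch⟩ hj
  have hx : |(j₁ : ℝ)| ≤ c / 2 := (hJ _ hj).trans (by linarith)
  have hge := fun j : ℤ => sqrt_add_sq_ge c (j : ℝ)
  have hle := sqrt_add_sq_le hc0.le hx
  have key : ∀ b d e : ℤ, e = j₁ + b + d → c ^ 2 / 2 ≤ lam c j₁ + lam c b + lam c d - lam c e := by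
    rintro b d e rfl
    have := sqrt_triple (b := b) (d := d) hc0.le hx
    unfold lam
    push_cast
    nlinarith
  have key2 : ∀ b d e : ℤ, c ^ 2 / 2 ≤ lam c b + lam c d + lam c e - lam c j₁ := by
    intro b d e
    have h1 := hge b
    have h2 := hge d
    have h3 := hge e
    unfold lam
    nlinarith
  have key3 : ∀ b : ℤ, c ^ 2 / 2 ≤ lam c b := by
    intro b
    have := hge b
    unfold lam
    nlinarith
  have hc2 : 0 < c ^ 2 := by positivity
  have k1 := key3 j₁
  have k2 := key3 j₂
  have k3 := key3 j₃
  have k4 := key3 j₄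
  have q1 := key2 j₂ j₃ j₄
  cases b₁ <;> cases b₂ <;> cases b₃ <;> cases b₄ <;>
    simp only [charge, mom, sg, divisor, if_true, if_false, Bool.false_eq_true] at hm hch ⊢ <;>
    push_cast <;> rw [le_abs] <;> first
    | (exfalso; omega)
    | (left; linarith)
    | (right; linarith)
    | (left; have := key j₂ j₃ j₄ (by omega); linarith)
    | (right; have := key j₂ j₃ j₄ (by omega); linarith)
    | (left; have := key j₂ j₄ j₃ (by omega); linarith)
    | (right; have := key j₂ j₄ j₃ (by omega); linarith)
    | (left; have := key j₃ j₄ j₂ (by omega); linarith)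
    | (right; have := key j₃ j₄ j₂ (by omega); linarith)

/-- On `a + d = b + e` the divisor factors as `(a - b)(a - e)` up to sign, with nonzero integer
factors. All indices are within `|a - b| + |a - e|` of `a`, hence within twice the divisor, and `|a|
≤ N`. So the divisor controls the largest index. -/
theorem divisor_lamNLS {J : Finset ℤ} {N : ℝ} (hN : 0 ≤ N) (hJ : ∀ j ∈ J, |(j : ℝ)| ≤ N)
    {k₁ k₂ k₃ k₄ : Idx} (h : Neutral J k₁ k₂ k₃ k₄) :
    1 ≤ |divisor lamNLS k₁ k₂ k₃ k₄| ∧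
      mx k₁ k₂ k₃ k₄ ≤ (N + 3) * |divisor lamNLS k₁ k₂ k₃ k₄| := by
  obtain ⟨a, b, d, e, s, hs, ha, h1, h2, h3, h4, h5⟩ := h
  have hd : |divisor lamNLS k₁ k₂ k₃ k₄| = |((a - b : ℤ) : ℝ)| * |((a - e : ℤ) : ℝ)| := by
    rw [h4, abs_mul, hs, one_mul, ← abs_mul]
    congr 1
    obtain rfl : d = b + e - a := by omega
    unfold lamNLS
    push_cast; ring
  have i1 : (1 : ℝ) ≤ |((a - b : ℤ) : ℝ)| := by
    rw [← Int.cast_abs]; exact_mod_cast Int.one_le_abs (sub_ne_zero.2 h2)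
  have i2 : (1 : ℝ) ≤ |((a - e : ℤ) : ℝ)| := by
    rw [← Int.cast_abs]; exact_mod_cast Int.one_le_abs (sub_ne_zero.2 h3)
  rw [hd]
  have haN := hJ a ha
  set u := |((a - b : ℤ) : ℝ)| with hu
  set w := |((a - e : ℤ) : ℝ)| with hw
  have i3 : u ≤ u * w := by nlinarith
  have i4 : w ≤ u * w := by nlinarith
  have i5 : N + 1 + 2 * (u * w) ≤ (N + 3) * (u * w) := by nlinarith
  have haN' := abs_le.1 haN
  have hu' := abs_le.1 (le_of_eq hu.symm)
  have hw' := abs_le.1 (le_of_eq hw.symm)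
  push_cast at hu' hw'
  obtain ⟨u1, u2⟩ := hu'
  obtain ⟨w1, w2⟩ := hw'
  refine ⟨by nlinarith, h5 _ ?_ ?_ ?_ ?_⟩ <;> refine max_le (by nlinarith) ?_
  · nlinarith
  · rw [abs_le]; constructor <;> linarith
  · obtain rfl : d = b + e - a := by omega
    push_cast
    rw [abs_le]; constructor <;> linarith
  · rw [abs_le]; constructor <;> linarith

/-- With `t = √(j² + c²)` the error is exactly `-(t - c)²/2`, and `2c(t - c) ≤ t² - c² = j²`. -/
theorem lam_expansion {c : ℝ} (hc : 0 < c) (j : ℤ) :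
    |lam c j - c ^ 2 - lamNLS j| ≤ (c ^ 2)⁻¹ * (j : ℝ) ^ 4 / 8 := by
  unfold lam lamNLS
  set x : ℝ := (j : ℝ)
  have e := Real.sq_sqrt (show 0 ≤ x ^ 2 + c ^ 2 by positivity)
  have h := sqrt_add_sq_ge c x
  set t := √(x ^ 2 + c ^ 2)
  have e1 : c * t - c ^ 2 - x ^ 2 / 2 = -((t - c) ^ 2 / 2) := by nlinarith
  rw [e1, abs_neg, abs_of_nonneg (by positivity)]
  have h2 : 2 * c * (t - c) ≤ x ^ 2 := by nlinarith
  have h3 : (2 * c * (t - c)) ^ 2 ≤ (x ^ 2) ^ 2 := by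
    have : 0 ≤ 2 * c * (t - c) := by
      have := sub_nonneg.2 h
      positivity
    gcongr
  have h4 : (c ^ 2)⁻¹ * x ^ 4 / 8 = x ^ 4 / (8 * c ^ 2) := by field_simp
  rw [h4, le_div_iff₀ (by positivity)]
  nlinarith

/-- At zero charge the rest energies `c²` cancel, and only the errors of `lam_expansion` remain. -/
theorem divisor_diff {c : ℝ} (hc : 0 < c) {k₁ k₂ k₃ k₄ : Idx} (hch : charge k₁ k₂ k₃ k₄ = 0) :
    |divisor (lam c) k₁ k₂ k₃ k₄ - divisor lamNLS k₁ k₂ k₃ k₄| ≤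
      (c ^ 2)⁻¹ * mx k₁ k₂ k₃ k₄ ^ 4 / 2 := by
  obtain ⟨j1, j2, j3, j4⟩ := jap_le_mx k₁ k₂ k₃ k₄
  set m := mx k₁ k₂ k₃ k₄
  have hci : 0 ≤ (c ^ 2)⁻¹ := by positivity
  set δ : ℤ → ℝ := fun j => lam c j - c ^ 2 - lamNLS j with hδ
  have key : ∀ k : Idx, jap k.1 ≤ m → |sg k * δ k.1| ≤ (c ^ 2)⁻¹ * m ^ 4 / 8 := by
    intro k hk
    rw [abs_mul, abs_sg, one_mul]
    refine (lam_expansion hc k.1).trans ?_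
    have h1 := sq_le_jap_sq k.1
    have h2 : (k.1 : ℝ) ^ 4 ≤ m ^ 4 := by
      calc (k.1 : ℝ) ^ 4 = ((k.1 : ℝ) ^ 2) ^ 2 := by ring
        _ ≤ (jap k.1 ^ 2) ^ 2 := by gcongr
        _ = jap k.1 ^ 4 := by ring
        _ ≤ m ^ 4 := by
          have := jap_pos k.1
          gcongr
    gcongr
  have e : divisor (lam c) k₁ k₂ k₃ k₄ - divisor lamNLS k₁ k₂ k₃ k₄ =
      sg k₁ * δ k₁.1 + sg k₂ * δ k₂.1 + sg k₃ * δ k₃.1 + sg k₄ * δ k₄.1 := by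
    have hc' : (sg k₁ + sg k₂ + sg k₃ + sg k₄ : ℝ) = 0 := by
      exact_mod_cast hch
    simp only [divisor, hδ]
    linear_combination c ^ 2 * hc'
  rw [e]
  have a1 := abs_le.1 (key _ j1)
  have a2 := abs_le.1 (key _ j2)
  have a3 := abs_le.1 (key _ j3)
  have a4 := abs_le.1 (key _ j4)
  rw [abs_le]
  constructor <;> linarith

end KGNormalForm
end

noncomputable section
namespace KGNormalForm
open scoped ENNReal

/-! ### The kernels of the generating functions -/

/-- The non-resonant quadruples that meet `J`. -/
def nonres (J : Finset ℤ) : QuadPred := fun k₁ k₂ k₃ k₄ =>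
  meets J k₁ k₂ k₃ k₄ ∧ ¬paired k₁ k₂ k₃ k₄

/-- The quadruples of charge zero that satisfy `P`. -/
def neutral (P : QuadPred) : QuadPred := fun k₁ k₂ k₃ k₄ =>
  charge k₁ k₂ k₃ k₄ = 0 ∧ P k₁ k₂ k₃ k₄

/-- The quadruples of nonzero charge that satisfy `P`. -/
def charged (P : QuadPred) : QuadPred := fun k₁ k₂ k₃ k₄ =>
  ¬charge k₁ k₂ k₃ k₄ = 0 ∧ P k₁ k₂ k₃ k₄

variable {P : QuadPred} {J : Finset ℤ} {c N : ℝ}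

theorem symmPred_nonres (J : Finset ℤ) : SymmPred (nonres J) :=
  (symmPred_meets J).and symmPred_paired.not

theorem SymmPred.neutral (hP : SymmPred P) : SymmPred (neutral P) := symmPred_charge.and hP

theorem SymmPred.charged (hP : SymmPred P) : SymmPred (charged P) := symmPred_charge.not.and hP

/-- The coefficients of the NLS Hamiltonian. -/
abbrev v₁ : ℤ → ℝ := fun _ => 1

/-- The generating kernel for Klein-Gordon. -/
def chiKG (J : Finset ℤ) (c : ℝ) : Kernel := chi (vc c) (nonres J) (lam c)

/-- The generating kernel for NLS. -/
def chiNLS (J : Finset ℤ) : Kernel := chi v₁ (neutral (nonres J)) lamNLS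

theorem quarter_le_divisor (hN : 0 ≤ N) (hJ : ∀ j ∈ J, |(j : ℝ)| ≤ N)
    (hc : 2 * (N + 2) ≤ c) {k₁ k₂ k₃ k₄ : Idx} (hm : mom k₁ k₂ k₃ k₄ = 0)
    (h : nonres J k₁ k₂ k₃ k₄) : 1 / 4 ≤ |divisor (lam c) k₁ k₂ k₃ k₄| := by
  by_cases hch : charge k₁ k₂ k₃ k₄ = 0
  · exact quarter_le_divisor_lam hN hJ hc (neutral_of hm hch h.1 h.2)
  · have := divisor_lam_of_charge hN hJ hc hm hch h.1
    nlinarith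

theorem goodKernel_chiKG (hN : 0 ≤ N) (hJ : ∀ j ∈ J, |(j : ℝ)| ≤ N) (hc : 2 * (N + 2) ≤ c) :
    GoodKernel c 1 4 (chiKG J c) := by
  have := goodKernel_chi (φ := lam c) (goodKernel_ker_vc c (symmPred_nonres J)) (symmPred_nonres J)
    (γ := 1 / 4) (by norm_num) fun k₁ k₂ k₃ k₄ hm h => quarter_le_divisor hN hJ hc hm h
  norm_num at this
  exact this

theorem GoodKernel.mono {b M M' : ℝ} {K : Kernel} (h : GoodKernel c b M K) (hM : M ≤ M') :
    GoodKernel c b M' K where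
  symm := h.symm
  M_nonneg := h.M_nonneg.trans hM
  bound :=
    { supp := h.bound.supp
      bound := fun k₁ k₂ k₃ k₄ => (h.bound.bound k₁ k₂ k₃ k₄).trans (by gcongr) }

theorem goodKernel_chiNLS (hN : 0 ≤ N) (hJ : ∀ j ∈ J, |(j : ℝ)| ≤ N) :
    GoodKernel 1 0 4 (chiNLS J) := by
  have := goodKernel_chi (φ := lamNLS) (goodKernel_ker_one (symmPred_nonres J).neutral)
    (symmPred_nonres J).neutral (γ := 1) one_pos fun k₁ k₂ k₃ k₄ hm h =>
      (divisor_lamNLS hN hJ (neutral_of hm h.1 h.2.1 h.2.2)).1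
  exact this.mono (by norm_num)

theorem KernelBound.of_le {g : ℤ → ℝ} {s M : ℝ} {K : Kernel}
    (hs : ∀ k₁ k₂ k₃ k₄, ¬mom k₁ k₂ k₃ k₄ = 0 → K k₁ k₂ k₃ k₄ = 0) (hM : 0 ≤ M)
    (h : ∀ k₁ k₂ k₃ k₄, mom k₁ k₂ k₃ k₄ = 0 →
      ‖K k₁ k₂ k₃ k₄‖ * g k₁.1 ≤ M * mx k₁ k₂ k₃ k₄ ^ s) : KernelBound g s M K where
  supp k₁ k₂ k₃ k₄ hk := by_contra fun h' => hk (hs _ _ _ _ h')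
  bound k₁ k₂ k₃ k₄ := by
    by_cases hm : mom k₁ k₂ k₃ k₄ = 0
    · exact h _ _ _ _ hm
    · rw [hs _ _ _ _ hm, norm_zero, zero_mul]
      have := one_le_mx k₁ k₂ k₃ k₄
      positivity

theorem ker_of_mom {v : ℤ → ℝ} {k₁ k₂ k₃ k₄ : Idx} (h : ¬mom k₁ k₂ k₃ k₄ = 0) :
    ker v P k₁ k₂ k₃ k₄ = 0 := ker_of_not fun h' => h h'.1

/-- The coefficients of Klein-Gordon are close to those of NLS. -/
theorem kernelBound_ker_sub (c : ℝ) (P : QuadPred) {s : ℝ} (hs : 2 ≤ s) :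
    KernelBound (fun j => ww 1 j ^ (0 : ℝ)) s (c ^ 2)⁻¹ (ker (vc c) P - ker v₁ P) := by
  refine .of_le (fun k₁ k₂ k₃ k₄ h => ?_) (by positivity) fun k₁ k₂ k₃ k₄ h => ?_
  · simp [ker_of_mom h]
  have h1 := one_le_mx k₁ k₂ k₃ k₄
  have h2 : mx k₁ k₂ k₃ k₄ ^ 2 ≤ mx k₁ k₂ k₃ k₄ ^ s := by
    rw [← Real.rpow_natCast]
    exact Real.rpow_le_rpow_of_exponent_le h1 (by exact_mod_cast hs)
  have hci : 0 ≤ (c ^ 2)⁻¹ := by positivity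
  simp only [Real.rpow_zero, mul_one, Pi.sub_apply]
  by_cases hP : P k₁ k₂ k₃ k₄
  · rw [ker_of h hP, ker_of h hP, ← Complex.ofReal_sub, Complex.norm_real, ← mul_sub, norm_mul,
      Real.norm_of_nonneg k0_nonneg, norm_sub_rev, Real.norm_eq_abs]
    have h3 := one_sub_vc_prod_le c k₁ k₂ k₃ k₄
    have h4 := vc_prod_le_one c k₁.1 k₂.1 k₃.1 k₄.1
    rw [abs_of_nonneg (by simpa using h4)]
    simp only [mul_one]
    have h5 := k0_le
    have h6 := k0_nonneg
    calc _ ≤ 1 / 90 * (2 * (c ^ 2)⁻¹ * mx k₁ k₂ k₃ k₄ ^ 2) := by gcongr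
      _ ≤ (c ^ 2)⁻¹ * mx k₁ k₂ k₃ k₄ ^ 2 := by nlinarith [mul_nonneg hci (sq_nonneg (mx k₁ k₂ k₃ k₄))]
      _ ≤ _ := by gcongr
  · rw [ker_of_not (fun h' => hP h'.2), ker_of_not (fun h' => hP h'.2), sub_zero, norm_zero]
    positivity

theorem norm_ker_le_of_abs {v : ℤ → ℝ} {k₁ k₂ k₃ k₄ : Idx}
    (hv : |v k₁.1 * v k₂.1 * v k₃.1 * v k₄.1| ≤ 1) : ‖ker v P k₁ k₂ k₃ k₄‖ ≤ 1 / 90 := by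
  refine norm_ker_le.trans ?_
  have h1 := k0_le
  have h2 := k0_nonneg
  calc _ ≤ 1 / 90 * (1 : ℝ) := by gcongr
    _ = _ := by norm_num

theorem norm_ker_vc_le (c : ℝ) (k₁ k₂ k₃ k₄ : Idx) : ‖ker (vc c) P k₁ k₂ k₃ k₄‖ ≤ 1 / 90 :=
  norm_ker_le_of_abs (by
    rw [abs_of_pos (vc_prod_pos _ _ _ _ _)]; exact vc_prod_le_one _ _ _ _ _)

theorem norm_ker_one_le (k₁ k₂ k₃ k₄ : Idx) : ‖ker v₁ P k₁ k₂ k₃ k₄‖ ≤ 1 / 90 :=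
  norm_ker_le_of_abs (by simp)

/-- The generating kernels of Klein-Gordon and NLS are close. -/
theorem kernelBound_chi_sub (hN : 0 ≤ N) (hJ : ∀ j ∈ J, |(j : ℝ)| ≤ N) (hc : 2 * (N + 2) ≤ c) :
    KernelBound (fun j => ww 1 j ^ (0 : ℝ)) 4 (c ^ 2)⁻¹ (chiKG J c - chiNLS J) := by
  have hc0 : 0 < c := by linarith
  have hci : 0 ≤ (c ^ 2)⁻¹ := by positivity
  refine .of_le (fun k₁ k₂ k₃ k₄ h => ?_) hci fun k₁ k₂ k₃ k₄ h => ?_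
  · simp [chiKG, chiNLS, chi, ker_of_mom h]
  have h1 := one_le_mx k₁ k₂ k₃ k₄
  have e4 : mx k₁ k₂ k₃ k₄ ^ (4 : ℝ) = mx k₁ k₂ k₃ k₄ ^ 4 := by
    rw [← Real.rpow_natCast]; norm_num
  simp only [Real.rpow_zero, mul_one, Pi.sub_apply, e4]
  have h2 : 1 ≤ mx k₁ k₂ k₃ k₄ ^ 4 := one_le_pow₀ h1
  have h24 : mx k₁ k₂ k₃ k₄ ^ 2 ≤ mx k₁ k₂ k₃ k₄ ^ 4 := pow_le_pow_right₀ h1 (by norm_num)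
  by_cases hP : nonres J k₁ k₂ k₃ k₄
  · by_cases hch : charge k₁ k₂ k₃ k₄ = 0
    · have hn := neutral_of h hch hP.1 hP.2
      have d1 := quarter_le_divisor_lam hN hJ hc hn
      have d2 := (divisor_lamNLS hN hJ hn).1
      have d3 := divisor_diff hc0 hch
      have v1 := one_sub_vc_prod_le c k₁ k₂ k₃ k₄
      have v2 := vc_prod_le_one c k₁.1 k₂.1 k₃.1 k₄.1
      rw [chiKG, chiNLS, chi, chi, ker_of h hP, ker_of h ⟨hch, hP⟩]
      set D := divisor (lam c) k₁ k₂ k₃ k₄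
      set D' := divisor lamNLS k₁ k₂ k₃ k₄
      set V := vc c k₁.1 * vc c k₂.1 * vc c k₃.1 * vc c k₄.1
      set m := mx k₁ k₂ k₃ k₄
      have hD : D ≠ 0 := fun h0 => by rw [h0, abs_zero] at d1; norm_num at d1
      have hD' : D' ≠ 0 := fun h0 => by rw [h0, abs_zero] at d2; norm_num at d2
      -- The difference of quotients is split into a change of the coefficient, which loses two
      -- derivatives, and a change of the divisor, which loses four.
      have e : Complex.I * ((1 / (32 * Real.pi) * V : ℝ) : ℂ) / (D : ℝ) - Complex.I *
          ((1 / (32 * Real.pi) * (1 * 1 * 1 * 1) : ℝ) : ℂ) / (D' : ℝ) =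
          Complex.I * ((1 / (32 * Real.pi) * ((V - 1) / D - (D - D') / (D * D')) : ℝ) : ℂ) := by
        have hDc : (D : ℂ) ≠ 0 := by exact_mod_cast hD
        have hDc' : (D' : ℂ) ≠ 0 := by exact_mod_cast hD'
        push_cast
        field_simp
        ring
      rw [e, norm_mul, Complex.norm_I, one_mul, Complex.norm_real, norm_mul,
        Real.norm_of_nonneg k0_nonneg, Real.norm_eq_abs]
      have b1 : |(V - 1) / D| ≤ 8 * (c ^ 2)⁻¹ * m ^ 4 := by
        rw [abs_div, div_le_iff₀ (abs_pos.2 hD), abs_sub_comm, abs_of_nonneg (by linarith)]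
        have : 0 ≤ (c ^ 2)⁻¹ * m ^ 4 := by positivity
        nlinarith
      have b2 : |(D - D') / (D * D')| ≤ 2 * (c ^ 2)⁻¹ * m ^ 4 := by
        rw [abs_div, div_le_iff₀ (abs_pos.2 (mul_ne_zero hD hD')), abs_mul]
        have : 0 ≤ (c ^ 2)⁻¹ * m ^ 4 := by positivity
        have h3 : 1 / 4 ≤ |D| * |D'| := by nlinarith
        nlinarith
      have b3 := (abs_sub ((V - 1) / D) ((D - D') / (D * D'))).trans (add_le_add b1 b2)
      have h5 := k0_le
      have h6 := k0_nonneg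
      have : 0 ≤ (c ^ 2)⁻¹ * m ^ 4 := by positivity
      calc _ ≤ 1 / 90 * (8 * (c ^ 2)⁻¹ * m ^ 4 + 2 * (c ^ 2)⁻¹ * m ^ 4) := by gcongr
        _ ≤ _ := by nlinarith
    -- At nonzero charge there is no NLS term, and the divisor `c²/2` makes the Klein-Gordon
    -- coefficient itself `O(h)`.
    · have d1 := divisor_lam_of_charge hN hJ hc h hch hP.1
      have e : chiNLS J k₁ k₂ k₃ k₄ = 0 := by
        rw [chiNLS, chi, ker_of_not fun h' => hch h'.2.1]; simp
      rw [e, sub_zero, chiKG, norm_chi]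
      have h3 := norm_ker_vc_le (P := nonres J) c k₁ k₂ k₃ k₄
      have h4 : (0 : ℝ) < c ^ 2 / 2 := by positivity
      calc _ ≤ (1 / 90) / (c ^ 2 / 2) := by gcongr
        _ = 1 / 45 * ((c ^ 2)⁻¹ * 1) := by ring
        _ ≤ 1 * ((c ^ 2)⁻¹ * mx k₁ k₂ k₃ k₄ ^ 4) := by gcongr; norm_num
        _ = _ := one_mul _
  · have e : chiNLS J k₁ k₂ k₃ k₄ = 0 := by
      rw [chiNLS, chi, ker_of_not fun h' => hP h'.2.2]; simp
    have e' : chiKG J c k₁ k₂ k₃ k₄ = 0 := by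
      rw [chiKG, chi, ker_of_not fun h' => hP h'.2]; simp
    rw [e, e', sub_zero, norm_zero]
    positivity

/-- The kernel obtained by multiplication with `±φ` in the first variable. -/
def mulFst (φ : ℤ → ℝ) (K : Kernel) : Kernel := fun k₁ k₂ k₃ k₄ =>
  ((sg k₁ * φ k₁.1 : ℝ) : ℂ) * K k₁ k₂ k₃ k₄

/-- For fixed `c` the frequencies grow linearly, so one derivative is lost. Half of it is taken from
the output weight and half from the largest bracket. The constant depends on `c`, but it is only
used to make series converge. -/
theorem kernelBound_mulFst_chiKG (hN : 0 ≤ N) (hJ : ∀ j ∈ J, |(j : ℝ)| ≤ N)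
    (hc : 2 * (N + 2) ≤ c) :
    KernelBound (fun j => jap j ^ (-(1 / 2) : ℝ)) (1 / 2) (c * (c + 1))
      (mulFst (lam c) (chiKG J c)) := by
  have hc0 : 0 < c := by linarith
  refine .of_le (fun k₁ k₂ k₃ k₄ h => ?_) (by positivity) fun k₁ k₂ k₃ k₄ h => ?_
  · simp [mulFst, chiKG, chi, ker_of_mom h]
  have h0 := jap_pos k₁.1
  have h1 : |lam c k₁.1| ≤ c * (c + 1) * jap k₁.1 := by
    rw [lam, abs_of_nonneg (by positivity), mul_assoc]
    refine mul_le_mul_of_nonneg_left ?_ hc0.le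
    rw [Real.sqrt_le_left (by positivity)]
    have h2 := sq_le_jap_sq k₁.1
    have h3 : 1 ≤ jap k₁.1 ^ 2 := one_le_pow₀ (one_le_jap _)
    nlinarith
  have h2 : ‖chiKG J c k₁ k₂ k₃ k₄‖ ≤ 1 := by
    rw [chiKG, norm_chi]
    by_cases hP : nonres J k₁ k₂ k₃ k₄
    · have := quarter_le_divisor hN hJ hc h hP
      calc _ ≤ (1 / 90) / (1 / 4 : ℝ) := by gcongr; exact norm_ker_vc_le _ _ _ _ _
        _ ≤ 1 := by norm_num
    · rw [ker_of_not fun h' => hP h'.2]; simp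
  have h3 : jap k₁.1 ^ (1 / 2 : ℝ) ≤ mx k₁ k₂ k₃ k₄ ^ (1 / 2 : ℝ) :=
    Real.rpow_le_rpow h0.le (jap_le_mx _ _ _ _).1 (by norm_num)
  have h4 : jap k₁.1 * jap k₁.1 ^ (-(1 / 2) : ℝ) = jap k₁.1 ^ (1 / 2 : ℝ) := by
    nth_rw 1 [← Real.rpow_one (jap k₁.1)]
    rw [← Real.rpow_add h0]; norm_num
  simp only [mulFst, norm_mul, Complex.norm_real, Real.norm_eq_abs, abs_sg, one_mul]
  calc _ ≤ c * (c + 1) * jap k₁.1 * 1 * jap k₁.1 ^ (-(1 / 2) : ℝ) := by gcongr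
    _ = c * (c + 1) * jap k₁.1 ^ (1 / 2 : ℝ) := by rw [← h4]; ring
    _ ≤ _ := by gcongr

/-- The frequency `j²/2` would cost two derivatives, but the divisor dominates the largest index and
regains one. Thus the homological sum converges for every `q > 1/2`, including regularities at which
`Λ^NLS` need not converge. -/
theorem kernelBound_mulFst_chiNLS (hN : 0 ≤ N) (hJ : ∀ j ∈ J, |(j : ℝ)| ≤ N) :
    KernelBound (fun j => jap j ^ (-(1 / 2) : ℝ)) (1 / 2) (N + 3)
      (mulFst lamNLS (chiNLS J)) := by
  refine .of_le (fun k₁ k₂ k₃ k₄ h => ?_) (by positivity) fun k₁ k₂ k₃ k₄ h => ?_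
  · simp [mulFst, chiNLS, chi, ker_of_mom h]
  have h0 := jap_pos k₁.1
  have hm0 : 0 < mx k₁ k₂ k₃ k₄ := one_pos.trans_le (one_le_mx _ _ _ _)
  have hj := (jap_le_mx k₁ k₂ k₃ k₄).1
  by_cases hP : neutral (nonres J) k₁ k₂ k₃ k₄
  swap
  · simp only [mulFst, chiNLS, chi, ker_of_not fun h' => hP h'.2]
    simp only [mul_zero, zero_div, norm_zero, zero_mul]
    positivity
  obtain ⟨d1, d2⟩ := divisor_lamNLS hN hJ (neutral_of h hP.1 hP.2.1 hP.2.2)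
  have h1 : |lamNLS k₁.1| ≤ jap k₁.1 * mx k₁ k₂ k₃ k₄ := by
    rw [lamNLS, abs_of_nonneg (by positivity)]
    have h2 := sq_le_jap_sq k₁.1
    nlinarith
  have h2 : ‖chiNLS J k₁ k₂ k₃ k₄‖ * mx k₁ k₂ k₃ k₄ ≤ N + 3 := by
    rw [chiNLS, norm_chi, div_mul_eq_mul_div, div_le_iff₀ (by linarith)]
    have := norm_ker_one_le (P := neutral (nonres J)) k₁ k₂ k₃ k₄
    nlinarith [norm_nonneg (ker v₁ (neutral (nonres J)) k₁ k₂ k₃ k₄)]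
  have h3 : jap k₁.1 ^ (1 / 2 : ℝ) ≤ mx k₁ k₂ k₃ k₄ ^ (1 / 2 : ℝ) :=
    Real.rpow_le_rpow h0.le hj (by norm_num)
  have h4 : jap k₁.1 * jap k₁.1 ^ (-(1 / 2) : ℝ) = jap k₁.1 ^ (1 / 2 : ℝ) := by
    nth_rw 1 [← Real.rpow_one (jap k₁.1)]
    rw [← Real.rpow_add h0]; norm_num
  simp only [mulFst, norm_mul, Complex.norm_real, Real.norm_eq_abs, abs_sg, one_mul]
  calc _ ≤ jap k₁.1 * mx k₁ k₂ k₃ k₄ * ‖chiNLS J k₁ k₂ k₃ k₄‖ * jap k₁.1 ^ (-(1 / 2) : ℝ) := by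
        gcongr
    _ = ‖chiNLS J k₁ k₂ k₃ k₄‖ * mx k₁ k₂ k₃ k₄ * jap k₁.1 ^ (1 / 2 : ℝ) := by rw [← h4]; ring
    _ ≤ _ := by gcongr

end KGNormalForm
end

noncomputable section
namespace KGNormalForm
open scoped ENNReal

/-! ### Fourier series -/

variable {a q : ℝ}

theorem summable_norm_co (ha : 0 ≤ a) (hq : 1 / 2 < q) {x : Pt} (hx : x ∈ phaseSub a q 0 1) :
    Summable fun k => ‖co x k‖ := by
  have h := sq_tsum_exp_le (a := a) (q := q) x
  rw [← sqNorm_wt_zero] at h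
  rw [mem_phaseSub_iff] at hx
  have h1 : ∑' k : Idx, ENNReal.ofReal (Real.exp (a * |(k.1 : ℝ)|)) * ‖co x k‖ₑ ≠ ⊤ := by
    intro h'
    rw [h', ENNReal.top_pow two_ne_zero, top_le_iff] at h
    exact ENNReal.mul_ne_top (japSum_ne_top hq) hx h
  rw [summable_iff_tsum_ofReal_ne_top fun _ => norm_nonneg _]
  simp only [ofReal_norm]
  refine ne_top_of_le_ne_top h1 (ENNReal.tsum_le_tsum fun k => ?_)
  refine le_mul_of_one_le_left zero_le ?_
  rw [ENNReal.one_le_ofReal]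
  exact Real.one_le_exp (by positivity)

/-- The function with Fourier coefficients `x`. -/
def fourier (x : Pt) (θ : ℝ) : ℂ := ∑' k, co x k * Complex.exp (Complex.I * (sg k * k.1 : ℤ) * θ)

theorem norm_exp_I (n : ℤ) (θ : ℝ) : ‖Complex.exp (Complex.I * n * θ)‖ = 1 := by
  rw [show Complex.I * n * θ = ((n * θ : ℝ) : ℂ) * Complex.I by push_cast; ring]
  exact Complex.norm_exp_ofReal_mul_I _

theorem summable_fourier (ha : 0 ≤ a) (hq : 1 / 2 < q) {x : Pt} (hx : x ∈ phaseSub a q 0 1)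
    (θ : ℝ) : Summable fun k => ‖co x k * Complex.exp (Complex.I * (sg k * k.1 : ℤ) * θ)‖ := by
  simp only [norm_mul, norm_exp_I, mul_one]
  exact summable_norm_co ha hq hx

theorem fourier_add (ha : 0 ≤ a) (hq : 1 / 2 < q) {x y : Pt} (hx : x ∈ phaseSub a q 0 1)
    (hy : y ∈ phaseSub a q 0 1) (θ : ℝ) : fourier (x + y) θ = fourier x θ + fourier y θ := by
  rw [fourier, fourier, fourier, ← (summable_fourier ha hq hx θ).of_norm.tsum_add
    (summable_fourier ha hq hy θ).of_norm]
  exact tsum_congr fun k => by rw [co_add, add_mul]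

/-- The part of `x` of positive charge. -/
def posPart (x : Pt) : Pt := (x.1, 0)

/-- The part of `x` of negative charge. -/
def negPart (x : Pt) : Pt := (0, x.2)

theorem posPart_mem {β c : ℝ} {x : Pt} (hx : x ∈ phaseSub a q β c) : posPart x ∈ phaseSub a q β c :=
  ⟨hx.1, by simp [posPart]⟩

theorem negPart_mem {β c : ℝ} {x : Pt} (hx : x ∈ phaseSub a q β c) : negPart x ∈ phaseSub a q β c :=
  ⟨by simp [negPart], hx.2⟩

theorem tsum_co_pos (f : Idx → ℂ) (x : Pt) :
    ∑' k, co (posPart x) k * f k = ∑' j, x.1 j * f (j, true) := by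
  have hinj : Function.Injective fun j : ℤ => ((j, true) : Idx) := fun i j h => (Prod.ext_iff.1 h).1
  rw [← hinj.tsum_eq]
  · simp [co, posPart]
  · rintro ⟨j, b⟩ h
    cases b
    · simp [co, posPart] at h
    · exact ⟨j, rfl⟩

theorem tsum_co_neg (f : Idx → ℂ) (x : Pt) :
    ∑' k, co (negPart x) k * f k = ∑' j, x.2 j * f (j, false) := by
  have hinj : Function.Injective fun j : ℤ => ((j, false) : Idx) := fun i j h => (Prod.ext_iff.1 h).1
  rw [← hinj.tsum_eq]
  · simp [co, negPart]
  · rintro ⟨j, b⟩ h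
    cases b
    · exact ⟨j, rfl⟩
    · simp [co, negPart] at h

theorem psi_eq (x : Pt) (θ : ℝ) : psi x θ = fourier (posPart x) θ / (√(2 * Real.pi) : ℝ) := by
  rw [psi, fourier, tsum_co_pos, ← tsum_div_const]
  exact tsum_congr fun j => by simp [sg]

theorem psibar_eq (x : Pt) (θ : ℝ) : psibar x θ = fourier (negPart x) θ / (√(2 * Real.pi) : ℝ) := by
  rw [psibar, fourier, tsum_co_neg, ← tsum_div_const]
  exact tsum_congr fun j => by simp [sg]

theorem posPart_add_negPart (x : Pt) : posPart x + negPart x = x := by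
  simp [posPart, negPart]

theorem integral_exp_I (n : ℤ) :
    ∫ θ in (-Real.pi)..Real.pi, Complex.exp (Complex.I * n * θ) =
      if n = 0 then (2 * Real.pi : ℂ) else 0 := by
  split_ifs with h
  · simp [h]; ring
  · have hc : Complex.I * n ≠ 0 := mul_ne_zero Complex.I_ne_zero (by exact_mod_cast h)
    rw [integral_exp_mul_complex hc, div_eq_zero_iff]
    left
    rw [sub_eq_zero, Complex.exp_eq_exp_iff_exists_int]
    exact ⟨n, by push_cast; ring⟩

/-- A term of a product of four Fourier series. -/
def fourierTerm (x y z w : Pt) (l : Idx × Idx × Idx × Idx) (θ : ℝ) : ℂ :=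
  co x l.1 * Complex.exp (Complex.I * (sg l.1 * l.1.1 : ℤ) * θ) *
    (co y l.2.1 * Complex.exp (Complex.I * (sg l.2.1 * l.2.1.1 : ℤ) * θ) *
      (co z l.2.2.1 * Complex.exp (Complex.I * (sg l.2.2.1 * l.2.2.1.1 : ℤ) * θ) *
        (co w l.2.2.2 * Complex.exp (Complex.I * (sg l.2.2.2 * l.2.2.2.1 : ℤ) * θ))))

theorem norm_fourierTerm (x y z w : Pt) (l : Idx × Idx × Idx × Idx) (θ : ℝ) :
    ‖fourierTerm x y z w l θ‖ =
      ‖co x l.1‖ * (‖co y l.2.1‖ * (‖co z l.2.2.1‖ * ‖co w l.2.2.2‖)) := by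
  simp only [fourierTerm, norm_mul, norm_exp_I, mul_one]

theorem summable_norm_fourierTerm (ha : 0 ≤ a) (hq : 1 / 2 < q) {x y z w : Pt}
    (hx : x ∈ phaseSub a q 0 1) (hy : y ∈ phaseSub a q 0 1) (hz : z ∈ phaseSub a q 0 1)
    (hw : w ∈ phaseSub a q 0 1) :
    Summable fun l : Idx × Idx × Idx × Idx =>
      ‖co x l.1‖ * (‖co y l.2.1‖ * (‖co z l.2.2.1‖ * ‖co w l.2.2.2‖)) := by
  have h1 := summable_norm_co ha hq hx
  have h2 := summable_norm_co ha hq hy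
  have h3 := summable_norm_co ha hq hz
  have h4 := summable_norm_co ha hq hw
  have h34 := h3.mul_of_nonneg h4 (fun _ => norm_nonneg _) fun _ => norm_nonneg _
  have h234 := h2.mul_of_nonneg h34 (fun _ => norm_nonneg _) fun _ => by
    simp only [Pi.zero_apply]; positivity
  exact h1.mul_of_nonneg h234 (fun _ => norm_nonneg _) fun _ => by
    simp only [Pi.zero_apply]; positivity

theorem fourier_mul (ha : 0 ≤ a) (hq : 1 / 2 < q) {x y z w : Pt}
    (hx : x ∈ phaseSub a q 0 1) (hy : y ∈ phaseSub a q 0 1) (hz : z ∈ phaseSub a q 0 1)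
    (hw : w ∈ phaseSub a q 0 1) (θ : ℝ) :
    fourier x θ * (fourier y θ * (fourier z θ * fourier w θ)) = ∑' l, fourierTerm x y z w l θ := by
  have s1 := summable_fourier ha hq hx θ
  have s2 := summable_fourier ha hq hy θ
  have s3 := summable_fourier ha hq hz θ
  have s4 := summable_fourier ha hq hw θ
  have s34 := s3.mul_norm s4
  have s234 := s2.mul_norm s34
  unfold fourier
  rw [tsum_mul_tsum_of_summable_norm s3 s4, tsum_mul_tsum_of_summable_norm s2 s34,
    tsum_mul_tsum_of_summable_norm s1 s234]
  rfl

/-- Only vanishing momentum survives, with integral `2π`, and `64π² = 2π · 32π` undoes the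
normalization in `ker`. -/
theorem integral_fourierTerm (x y z w : Pt) (l : Idx × Idx × Idx × Idx) :
    ∫ θ in (-Real.pi)..Real.pi, fourierTerm x y z w l θ =
      64 * Real.pi ^ 2 * (ker v₁ (fun _ _ _ _ => True) l.1 l.2.1 l.2.2.1 l.2.2.2 *
        (co x l.1 * co y l.2.1 * co z l.2.2.1 * co w l.2.2.2)) := by
  have e1 : ∀ θ, fourierTerm x y z w l θ =
      (co x l.1 * co y l.2.1 * co z l.2.2.1 * co w l.2.2.2) *
      Complex.exp (Complex.I * (mom l.1 l.2.1 l.2.2.1 l.2.2.2 : ℤ) * θ) := fun θ => by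
    have : Complex.exp (Complex.I * (mom l.1 l.2.1 l.2.2.1 l.2.2.2 : ℤ) * θ) =
        Complex.exp (Complex.I * (sg l.1 * l.1.1 : ℤ) * θ) *
        Complex.exp (Complex.I * (sg l.2.1 * l.2.1.1 : ℤ) * θ) *
        Complex.exp (Complex.I * (sg l.2.2.1 * l.2.2.1.1 : ℤ) * θ) *
        Complex.exp (Complex.I * (sg l.2.2.2 * l.2.2.2.1 : ℤ) * θ) := by
      rw [← Complex.exp_add, ← Complex.exp_add, ← Complex.exp_add]
      congr 1
      unfold mom
      push_cast; ring
    rw [this, fourierTerm]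
    ring
  simp only [e1]
  rw [intervalIntegral.integral_const_mul, integral_exp_I]
  by_cases h : mom l.1 l.2.1 l.2.2.1 l.2.2.2 = 0
  · rw [if_pos h, ker_of h trivial]
    have := Real.pi_ne_zero
    push_cast
    field_simp
    ring
  · rw [if_neg h, ker_of_mom h]; ring

theorem integral_fourier (ha : 0 ≤ a) (hq : 1 / 2 < q) {x y z w : Pt} (hx : x ∈ phaseSub a q 0 1)
    (hy : y ∈ phaseSub a q 0 1) (hz : z ∈ phaseSub a q 0 1) (hw : w ∈ phaseSub a q 0 1) :
    ∫ θ in (-Real.pi)..Real.pi, fourier x θ * (fourier y θ * (fourier z θ * fourier w θ)) =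
      64 * Real.pi ^ 2 * quad (ker v₁ fun _ _ _ _ => True) x y z w := by
  have hs := summable_norm_fourierTerm ha hq hx hy hz hw
  have hcont : ∀ l, Continuous (fourierTerm x y z w l) := fun l => by
    unfold fourierTerm; fun_prop
  have hsum := intervalIntegral.hasSum_integral_of_dominated_convergence
    (μ := MeasureTheory.volume) (a := -Real.pi) (b := Real.pi) (F := fourierTerm x y z w)
    (f := fun θ => ∑' l, fourierTerm x y z w l θ)
    (fun l _ => ‖co x l.1‖ * (‖co y l.2.1‖ * (‖co z l.2.2.1‖ * ‖co w l.2.2.2‖)))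
    (fun l => (hcont l).aestronglyMeasurable)
    (fun l => Filter.Eventually.of_forall fun θ _ => (norm_fourierTerm x y z w l θ).le)
    (Filter.Eventually.of_forall fun θ _ => hs) (by simp)
    (Filter.Eventually.of_forall fun θ _ => Summable.hasSum (.of_norm (by
      simpa only [norm_fourierTerm] using hs)))
  simp only [fourier_mul ha hq hx hy hz hw]
  rw [← hsum.tsum_eq, quad, ← tsum_mul_left]
  exact tsum_congr fun l => integral_fourierTerm x y z w l

theorem smoothing_mem {β c c' : ℝ} {x : Pt} (hx : x ∈ phaseSub a q β c) :
    smoothing c' x ∈ phaseSub a q β c := by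
  have key : ∀ (z : ℂ) (j : ℤ), ‖((ww c' j ^ (-(1 / 2) : ℝ) : ℝ) : ℂ) * z‖ ≤ ‖z‖ := by
    intro z j
    change ‖((vc c' j : ℝ) : ℂ) * z‖ ≤ ‖z‖
    rw [norm_mul, Complex.norm_real, Real.norm_of_nonneg (vc_pos c' j).le]
    exact mul_le_of_le_one_left (norm_nonneg _) (vc_le_one c' j)
  constructor
  · refine hx.1.of_nonneg_of_le (fun j => by positivity) fun j => ?_
    have := key (x.1 j) j
    simp only [smoothing]
    gcongr
  · refine hx.2.of_nonneg_of_le (fun j => by positivity) fun j => ?_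
    have := key (x.2 j) j
    simp only [smoothing]
    gcongr

theorem co_smoothing (c : ℝ) (x : Pt) (k : Idx) : co (smoothing c x) k = (vc c k.1 : ℂ) * co x k := by
  unfold co smoothing vc
  split_ifs <;> rfl

theorem HKG_eq (ha : 0 ≤ a) (hq : 1 / 2 < q) (c : ℝ) {x : Pt} (hx : x ∈ phaseSub a q 0 1) :
    HKG c x = Lam c x + poly (ker (vc c) fun _ _ _ _ => True) x := by
  have hs := smoothing_mem (c' := c) hx
  have e1 : ∀ θ, (psi (smoothing c x) θ + psibar (smoothing c x) θ) ^ 4 =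
      (1 / (4 * Real.pi ^ 2) : ℂ) * (fourier (smoothing c x) θ * (fourier (smoothing c x) θ *
        (fourier (smoothing c x) θ * fourier (smoothing c x) θ))) := fun θ => by
    rw [psi_eq, psibar_eq, ← add_div, ← fourier_add ha hq (posPart_mem hs) (negPart_mem hs),
      posPart_add_negPart, div_pow]
    have : ((√(2 * Real.pi) : ℝ) : ℂ) ^ 4 = 4 * Real.pi ^ 2 := by
      rw [show (4 : ℕ) = 2 * 2 from rfl, pow_mul, ← Complex.ofReal_pow,
        Real.sq_sqrt (by positivity)]
      push_cast; ring
    rw [this]; ring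
  have e2 : poly (ker (vc c) fun _ _ _ _ => True) x =
      poly (ker v₁ fun _ _ _ _ => True) (smoothing c x) := by
    refine tsum_congr fun l => ?_
    simp only [co_smoothing]
    by_cases h : mom l.1 l.2.1 l.2.2.1 l.2.2.2 = 0
    · rw [ker_of h trivial, ker_of h trivial]
      push_cast; ring
    · rw [ker_of_mom h, ker_of_mom h]; ring
  rw [HKG, e2, poly]
  simp only [e1]
  rw [intervalIntegral.integral_const_mul, integral_fourier ha hq hs hs hs hs]
  have := Real.pi_ne_zero
  congr 1
  field_simp
  ring

/-- The six ways to distribute two `z` and two `z̄` over four places contribute equally. Since `6/16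
= 3/8`, the NLS nonlinearity is the charge-zero part of the Klein-Gordon one with coefficients
replaced by one. -/
theorem poly_neutral (ha : 0 ≤ a) (hq : 1 / 2 < q) {x : Pt} (hx : x ∈ phaseSub a q 0 1) :
    poly (ker v₁ (neutral fun _ _ _ _ => True)) x =
      6 * quad (ker v₁ fun _ _ _ _ => True) (posPart x) (posPart x) (negPart x) (negPart x) := by
  have hK := goodKernel_ker_one symmPred_true
  have hS := hK.symm
  set K := ker v₁ fun _ _ _ _ => True
  have hp := posPart_mem hx
  have hn := negPart_mem hx
  set y := posPart x with hy
  set z := negPart x with hz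
  have S := fun {u v w t : Pt} (hu : u ∈ phaseSub a q 0 1) (hv : v ∈ phaseSub a q 0 1)
    (hw : w ∈ phaseSub a q 0 1) (ht : t ∈ phaseSub a q 0 1) =>
      (hK.summable_quad le_rfl ha hq hv hw ht hu).hasSum
  have e2 : quad K y z y z = quad K y y z z := quad_symm₂ hS _ _ _ _
  have e3 : quad K y z z y = quad K y y z z := by rw [quad_symm₃ hS, e2]
  have e4 : quad K z y y z = quad K y y z z := by rw [quad_symm₁ hS, e2]
  have e5 : quad K z y z y = quad K y y z z := by rw [quad_symm₃ hS, e4]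
  have e6 : quad K z z y y = quad K y y z z := by rw [quad_symm₂ hS, e5]
  have hsum := (((((S hp hp hn hn).add (S hp hn hp hn)).add (S hp hn hn hp)).add
    (S hn hp hp hn)).add (S hn hp hn hp)).add (S hn hn hp hp)
  have e7 : 6 * quad K y y z z = quad K y y z z + quad K y z y z + quad K y z z y +
      quad K z y y z + quad K z y z y + quad K z z y y := by
    rw [e2, e3, e4, e5, e6]; ring
  rw [e7]
  refine Eq.trans ?_ hsum.tsum_eq
  refine tsum_congr fun l => ?_
  obtain ⟨⟨j₁, b₁⟩, ⟨j₂, b₂⟩, ⟨j₃, b₃⟩, ⟨j₄, b₄⟩⟩ := l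
  by_cases hm : mom (j₁, b₁) (j₂, b₂) (j₃, b₃) (j₄, b₄) = 0
  · by_cases hc : charge (j₁, b₁) (j₂, b₂) (j₃, b₃) (j₄, b₄) = 0
    · rw [ker_of hm ⟨hc, trivial⟩, ← ker_of (v := v₁) (P := fun _ _ _ _ => True) hm trivial]
      cases b₁ <;> cases b₂ <;> cases b₃ <;> cases b₄ <;>
        simp [charge, sg] at hc <;> simp [hy, hz, posPart, negPart, co, K]
    · rw [ker_of_not fun h => hc h.2.1]
      cases b₁ <;> cases b₂ <;> cases b₃ <;> cases b₄ <;>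
        simp [charge, sg] at hc <;> simp [hy, hz, posPart, negPart, co, K]
  · simp only [K, ker_of_mom hm]; ring

theorem HNLS_eq (ha : 0 ≤ a) (hq : 1 / 2 < q) {x : Pt} (hx : x ∈ phaseSub a q 0 1) :
    HNLS x = LamNLS x + poly (ker v₁ (neutral fun _ _ _ _ => True)) x := by
  have e1 : ∀ θ, psi x θ ^ 2 * psibar x θ ^ 2 =
      (1 / (4 * Real.pi ^ 2) : ℂ) * (fourier (posPart x) θ * (fourier (posPart x) θ *
        (fourier (negPart x) θ * fourier (negPart x) θ))) := fun θ => by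
    rw [psi_eq, psibar_eq, div_pow, div_pow]
    have : ((√(2 * Real.pi) : ℝ) : ℂ) ^ 2 = 2 * Real.pi := by
      rw [← Complex.ofReal_pow, Real.sq_sqrt (by positivity)]
      push_cast; ring
    rw [this]
    have := Real.pi_ne_zero
    field_simp
    ring
  have hp := posPart_mem hx
  have hn := negPart_mem hx
  rw [HNLS, poly_neutral ha hq hx]
  simp only [e1]
  rw [intervalIntegral.integral_const_mul, integral_fourier ha hq hp hp hn hn]
  have := Real.pi_ne_zero
  congr 1
  field_simp
  ring

end KGNormalForm
end

noncomputable section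
namespace KGNormalForm
open scoped ENNReal

/-! ### The resonant part -/

/-- The resonant quadruples that meet `J`. -/
def res (J : Finset ℤ) : QuadPred := fun k₁ k₂ k₃ k₄ => meets J k₁ k₂ k₃ k₄ ∧ paired k₁ k₂ k₃ k₄

theorem symmPred_res (J : Finset ℤ) : SymmPred (res J) := (symmPred_meets J).and symmPred_paired

/-- The conjugate variable. -/
def cj (k : Idx) : Idx := (k.1, !k.2)

theorem opp_iff (k l : Idx) : opp k l ↔ l = cj k := by
  obtain ⟨i, b⟩ := k
  obtain ⟨j, d⟩ := l
  simp only [opp, cj, Prod.mk.injEq]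
  constructor
  · rintro ⟨rfl, rfl⟩; simp
  · rintro ⟨rfl, rfl⟩; simp

open Classical in
/-- Indicator function. -/
def ind (p : Prop) : ℂ := if p then 1 else 0

theorem norm_ind_le (p : Prop) : ‖ind p‖ ≤ 1 := by
  unfold ind; split_ifs <;> simp

/-- The weight that compensates for quadruples which can be paired in two ways. -/
def half (i j : ℤ) : ℂ := 1 - ind (i = j) / 2

theorem norm_half_le (i j : ℤ) : ‖half i j‖ ≤ 1 := by
  unfold half ind; split_ifs <;> norm_num

/-- A quadruple `z_i z̄_i z_j z̄_j` is paired in exactly one way if `i ≠ j` and in exactly two ways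
if `i = j`, each then counted with weight `1/2`. -/
theorem paired_count {k₁ k₂ k₃ k₄ : Idx} (h : paired k₁ k₂ k₃ k₄) :
    ind (opp k₁ k₂ ∧ opp k₃ k₄) * half k₁.1 k₃.1 + ind (opp k₁ k₃ ∧ opp k₂ k₄) * half k₁.1 k₂.1 +
      ind (opp k₁ k₄ ∧ opp k₂ k₃) * half k₁.1 k₂.1 = 1 := by
  obtain ⟨j₁, b₁⟩ := k₁
  obtain ⟨j₂, b₂⟩ := k₂
  obtain ⟨j₃, b₃⟩ := k₃
  obtain ⟨j₄, b₄⟩ := k₄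
  unfold paired opp at h
  unfold half ind opp
  simp only at h ⊢
  rcases h with ⟨⟨rfl, rfl⟩, ⟨rfl, rfl⟩⟩ | ⟨⟨rfl, rfl⟩, ⟨rfl, rfl⟩⟩ | ⟨⟨rfl, rfl⟩, ⟨rfl, rfl⟩⟩
  · by_cases e : j₁ = j₃
    · subst e
      cases b₂ <;> cases b₄ <;> norm_num
    · simp [e]
  · by_cases e : j₁ = j₂
    · subst e
      cases b₃ <;> cases b₄ <;> norm_num
    · simp [e, Ne.symm e]
  · by_cases e : j₁ = j₂
    · subst e
      cases b₃ <;> cases b₄ <;> norm_num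
    · simp [e, Ne.symm e]

variable {a q : ℝ}

theorem tsum_idx_sq {g : ℤ × ℤ → ℂ} (h : Summable fun p : Idx × Idx => g (p.1.1, p.2.1)) :
    ∑' p : Idx × Idx, g (p.1.1, p.2.1) = 4 * ∑' ij, g ij := by
  set e : (ℤ × ℤ) × (Bool × Bool) ≃ Idx × Idx := Equiv.prodProdProdComm ℤ ℤ Bool Bool with he
  have h' := e.summable_iff.2 h
  simp only [Function.comp_def] at h'
  rw [← e.tsum_eq, h'.tsum_prod, ← tsum_mul_left]
  refine tsum_congr fun ij => ?_
  rw [tsum_fintype]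
  simp [he, Equiv.prodProdProdComm]

theorem co_mul_co_cj (x : Pt) (k : Idx) : co x k * co x (cj k) = x.1 k.1 * x.2 k.1 := by
  obtain ⟨j, b⟩ := k
  cases b <;> simp [co, cj]; ring

-- By `paired_count` the sum splits over the three pairing patterns. Each is a sum over pairs of
-- indices with four choices of types, so the coefficient of the pair is `12 · (1/(32π)) · (1 -
-- δ_{ij}/2) = N_{ij}/2`, times the factors `v`.
open Classical in
theorem poly_res {c b M : ℝ} {v : ℤ → ℝ} {J : Finset ℤ} (hK : GoodKernel c b M (ker v (res J)))
    (hb : 0 ≤ b) (ha : 0 ≤ a) (hq : 1 / 2 < q) {x : Pt} (hx : x ∈ phaseSub a q 0 1) :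
    poly (ker v (res J)) x = 1 / 2 * ∑' ij : ℤ × ℤ, if ij.1 ∈ J ∨ ij.2 ∈ J then
      ((Ncoef ij.1 ij.2 * (v ij.2 ^ 2 * v ij.1 ^ 2) : ℝ) : ℂ) *
      (x.1 ij.1 * x.2 ij.1 * x.1 ij.2 * x.2 ij.2) else 0 := by
  set t : Idx × Idx × Idx × Idx → ℂ := fun l => ker v (res J) l.1 l.2.1 l.2.2.1 l.2.2.2 *
    (co x l.1 * co x l.2.1 * co x l.2.2.1 * co x l.2.2.2) with ht
  have hs : Summable t := hK.summable_quad hb ha hq hx hx hx hx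
  set g : ℤ × ℤ → ℂ := fun ij => half ij.1 ij.2 * (if ij.1 ∈ J ∨ ij.2 ∈ J then
    ((1 / (32 * Real.pi) * (v ij.1 ^ 2 * v ij.2 ^ 2) : ℝ) : ℂ) *
      (x.1 ij.1 * x.2 ij.1 * (x.1 ij.2 * x.2 ij.2)) else 0) with hg
  have key : ∀ e : Idx × Idx → Idx × Idx × Idx × Idx, Function.Injective e →
      ∀ f : Idx × Idx × Idx × Idx → ℂ, (∀ l, ‖f l‖ ≤ 1) → (∀ l, f l ≠ 0 → l ∈ Set.range e) →
      (∀ p, f (e p) * t (e p) = g (p.1.1, p.2.1)) →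
      HasSum (fun l => f l * t l) (4 * ∑' ij, g ij) := by
    intro e he f hf hr hfe
    have h1 : Summable fun l => f l * t l := by
      refine Summable.of_norm_bounded hs.norm fun l => ?_
      rw [norm_mul]
      exact mul_le_of_le_one_left (norm_nonneg _) (hf l)
    have h2 : (∑' p, f (e p) * t (e p)) = ∑' l, f l * t l :=
      he.tsum_eq (f := fun l => f l * t l) fun l hl => hr l (left_ne_zero_of_mul hl)
    have h3 := h1.comp_injective he
    simp only [Function.comp_def, hfe] at h3
    simp only [hfe] at h2
    rw [← tsum_idx_sq h3, h2]
    exact h1.hasSum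
  have nrm : ∀ (p : Prop) (i j : ℤ), ‖ind p * half i j‖ ≤ 1 := fun p i j => by
    rw [norm_mul]
    exact mul_le_one₀ (norm_ind_le p) (norm_nonneg _) (norm_half_le i j)
  have hind : ∀ {p : Prop} {z : ℂ}, ind p * z ≠ 0 → p := fun {p z} h => by
    by_contra hp
    simp [ind, hp] at h
  have momcj : ∀ k l, mom k (cj k) l (cj l) = 0 := fun k l => by
    have := sg_flip k
    have := sg_flip l
    simp only [mom, cj, sg_flip]; ring
  have tval : ∀ {k₁ k₂ k₃ k₄ k l : Idx}, mom k₁ k₂ k₃ k₄ = 0 → paired k₁ k₂ k₃ k₄ →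
      (meets J k₁ k₂ k₃ k₄ ↔ k.1 ∈ J ∨ l.1 ∈ J) →
      v k₁.1 * v k₂.1 * v k₃.1 * v k₄.1 = v k.1 ^ 2 * v l.1 ^ 2 →
      co x k₁ * co x k₂ * co x k₃ * co x k₄ =
        co x k * co x (cj k) * (co x l * co x (cj l)) →
      half k.1 l.1 * t (k₁, k₂, k₃, k₄) = g (k.1, l.1) := by
    intro k₁ k₂ k₃ k₄ k l hm hp hmeet hv hco
    simp only [ht, hg]
    congr 1
    by_cases h : k.1 ∈ J ∨ l.1 ∈ J
    · rw [if_pos h, ker_of hm ⟨hmeet.2 h, hp⟩, hco, hv, co_mul_co_cj, co_mul_co_cj]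
    · rw [if_neg h, ker_of_not fun h' => h (hmeet.1 h'.2.1), zero_mul]
  have ind1 : ∀ {p : Prop}, p → ind p = 1 := fun hp => if_pos hp
  have ocj : ∀ k, opp k (cj k) := fun k => (opp_iff _ _).2 rfl
  have S1 := key (fun p => (p.1, cj p.1, p.2, cj p.2))
    (fun p p' h => by simp only [Prod.mk.injEq] at h; exact Prod.ext h.1 h.2.2.1)
    (fun l => ind (opp l.1 l.2.1 ∧ opp l.2.2.1 l.2.2.2) * half l.1.1 l.2.2.1.1)
    (fun l => nrm _ _ _)
    (fun ⟨k₁, k₂, k₃, k₄⟩ hl => by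
      obtain ⟨h1, h2⟩ := hind hl
      obtain rfl : k₂ = cj k₁ := (opp_iff _ _).1 h1
      obtain rfl : k₄ = cj k₃ := (opp_iff _ _).1 h2
      exact ⟨(k₁, k₃), rfl⟩)
    (fun p => by
      rw [ind1 ⟨ocj _, ocj _⟩, one_mul]
      refine tval (momcj _ _) (Or.inl ⟨ocj _, ocj _⟩) ?_ ?_ ?_
      · simp only [meets, cj]; tauto
      · simp only [cj]; ring
      · ring)
  have S2 := key (fun p => (p.1, p.2, cj p.1, cj p.2))
    (fun p p' h => by simp only [Prod.mk.injEq] at h; exact Prod.ext h.1 h.2.1)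
    (fun l => ind (opp l.1 l.2.2.1 ∧ opp l.2.1 l.2.2.2) * half l.1.1 l.2.1.1)
    (fun l => nrm _ _ _)
    (fun ⟨k₁, k₂, k₃, k₄⟩ hl => by
      obtain ⟨h1, h2⟩ := hind hl
      obtain rfl : k₃ = cj k₁ := (opp_iff _ _).1 h1
      obtain rfl : k₄ = cj k₂ := (opp_iff _ _).1 h2
      exact ⟨(k₁, k₂), rfl⟩)
    (fun p => by
      rw [ind1 ⟨ocj _, ocj _⟩, one_mul]
      refine tval ?_ (Or.inr (Or.inl ⟨ocj _, ocj _⟩)) ?_ ?_ ?_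
      · have := momcj p.1 p.2
        simp only [mom] at this ⊢; linarith
      · simp only [meets, cj]; tauto
      · simp only [cj]; ring
      · ring)
  have S3 := key (fun p => (p.1, p.2, cj p.2, cj p.1))
    (fun p p' h => by simp only [Prod.mk.injEq] at h; exact Prod.ext h.1 h.2.1)
    (fun l => ind (opp l.1 l.2.2.2 ∧ opp l.2.1 l.2.2.1) * half l.1.1 l.2.1.1)
    (fun l => nrm _ _ _)
    (fun ⟨k₁, k₂, k₃, k₄⟩ hl => by
      obtain ⟨h1, h2⟩ := hind hl
      obtain rfl : k₄ = cj k₁ := (opp_iff _ _).1 h1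
      obtain rfl : k₃ = cj k₂ := (opp_iff _ _).1 h2
      exact ⟨(k₁, k₂), rfl⟩)
    (fun p => by
      rw [ind1 ⟨ocj _, ocj _⟩, one_mul]
      refine tval ?_ (Or.inr (Or.inr ⟨ocj _, ocj _⟩)) ?_ ?_ ?_
      · have := momcj p.1 p.2
        simp only [mom] at this ⊢; linarith
      · simp only [meets, cj]; tauto
      · simp only [cj]; ring
      · ring)
  have htot : ∀ l, ind (opp l.1 l.2.1 ∧ opp l.2.2.1 l.2.2.2) * half l.1.1 l.2.2.1.1 * t l +
      ind (opp l.1 l.2.2.1 ∧ opp l.2.1 l.2.2.2) * half l.1.1 l.2.1.1 * t l +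
      ind (opp l.1 l.2.2.2 ∧ opp l.2.1 l.2.2.1) * half l.1.1 l.2.1.1 * t l = t l := fun l => by
    by_cases hp : paired l.1 l.2.1 l.2.2.1 l.2.2.2
    · rw [← add_mul, ← add_mul, paired_count hp, one_mul]
    · simp only [ht]
      rw [ker_of_not fun h => hp h.2.2]; ring
  have hfin := ((S1.add S2).add S3).tsum_eq
  simp only [htot] at hfin
  refine hfin.trans ?_
  have h12 : ∀ S : ℂ, 4 * S + 4 * S + 4 * S = 12 * S := fun S => by ring
  rw [h12, ← tsum_mul_left, ← tsum_mul_left]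
  refine tsum_congr fun ij => ?_
  simp only [hg]
  split_ifs with h
  · unfold half ind Ncoef
    have := Real.pi_ne_zero
    split_ifs <;> push_cast <;> field_simp <;> ring
  · simp

/-- `h j² = 𝚠² - 1 = (𝚠 - 1)(𝚠 + 1)`. Hence the denominators in `Λ₊` are the squares of the factors
`𝚠^{-1/2}`, inverted. -/
theorem one_add_nu (c : ℝ) (j : ℤ) : 1 + (c ^ 2)⁻¹ * nu (c ^ 2)⁻¹ j = ww c j := by
  have h := ww_sq c j
  have h1 := ww_pos c j
  have e : √(1 + (c ^ 2)⁻¹ * (j : ℝ) ^ 2) = ww c j := by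
    rw [← h, Real.sqrt_sq h1.le]
  rw [nu, e]
  field_simp at h ⊢
  nlinarith

theorem LamPlus_eq {c : ℝ} (J : Finset ℤ) (ha : 0 ≤ a) (hq : 1 / 2 < q) {x : Pt}
    (hx : x ∈ phaseSub a q 0 1) : LamPlus J (c ^ 2)⁻¹ x = poly (ker (vc c) (res J)) x := by
  classical
  rw [poly_res (goodKernel_ker_vc c (symmPred_res J)) zero_le_one ha hq hx, LamPlus]
  congr 1
  refine tsum_congr fun ij => ?_
  split_ifs with h1
  · rw [one_add_nu, one_add_nu, vc_sq, vc_sq, div_eq_mul_inv, mul_inv]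
  · rfl

theorem LamPlusNLS_eq (J : Finset ℤ) (ha : 0 ≤ a) (hq : 1 / 2 < q) {x : Pt}
    (hx : x ∈ phaseSub a q 0 1) : LamPlusNLS J x = poly (ker v₁ (res J)) x := by
  classical
  rw [poly_res (goodKernel_ker_one (symmPred_res J)) le_rfl ha hq hx, LamPlusNLS]
  congr 1
  refine tsum_congr fun ij => ?_
  split_ifs with h1
  · simp
  · rfl

end KGNormalForm
end

noncomputable section
namespace KGNormalForm
open scoped ENNReal

/-! ### The homological equation -/

variable {a q : ℝ}

/-- The quadratic Hamiltonian with frequencies `φ`. -/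
def diagHam (φ : ℤ → ℝ) (x : Pt) : ℂ := ∑' j, (φ j : ℂ) * (x.1 j * x.2 j)

theorem summable_diagHam (ha : 0 ≤ a) {φ : ℤ → ℝ} {C : ℝ} (hC : 0 ≤ C)
    (hφ : ∀ j, |φ j| ≤ C * jap j ^ (2 * q)) {x : Pt} (hx : x ∈ phaseSub a q 0 1) :
    Summable fun j => (φ j : ℂ) * (x.1 j * x.2 j) := by
  refine Summable.of_norm_bounded ((hx.1.add hx.2).mul_left C) fun j => ?_
  have h0 := jap_pos j
  have h1 : jap j ^ (2 * q) ≤ wt a q 0 1 j ^ 2 := by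
    have : 1 ≤ Real.exp (a * |(j : ℝ)|) := Real.one_le_exp (by positivity)
    rw [wt, Real.rpow_zero, mul_one, mul_pow, ← Real.rpow_natCast (jap j ^ q), ← Real.rpow_mul h0.le]
    rw [mul_comm q]
    exact le_mul_of_one_le_left (by positivity) (one_le_pow₀ this)
  rw [norm_mul, norm_mul, Complex.norm_real, Real.norm_eq_abs]
  have h2 : ‖x.1 j‖ * ‖x.2 j‖ ≤ ‖x.1 j‖ ^ 2 + ‖x.2 j‖ ^ 2 := by
    nlinarith [sq_nonneg (‖x.1 j‖ - ‖x.2 j‖), sq_nonneg ‖x.1 j‖, sq_nonneg ‖x.2 j‖]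
  calc _ ≤ C * wt a q 0 1 j ^ 2 * (‖x.1 j‖ ^ 2 + ‖x.2 j‖ ^ 2) := by
        gcongr
        exact (hφ j).trans (by gcongr)
    _ = _ := by ring

/-- Symmetrization of `mulFst`. -/
theorem four_mul_quad_mulFst {φ : ℤ → ℝ} {K : Kernel} (hK : SymmKernel K) {x : Pt}
    (hs : Summable fun l : Idx × Idx × Idx × Idx => mulFst φ K l.1 l.2.1 l.2.2.1 l.2.2.2 *
      (co x l.1 * co x l.2.1 * co x l.2.2.1 * co x l.2.2.2)) :
    4 * quad (mulFst φ K) x x x x = ∑' l : Idx × Idx × Idx × Idx,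
      ((divisor φ l.1 l.2.1 l.2.2.1 l.2.2.2 : ℝ) : ℂ) * K l.1 l.2.1 l.2.2.1 l.2.2.2 *
      (co x l.1 * co x l.2.1 * co x l.2.2.1 * co x l.2.2.2) := by
  set f : Idx × Idx × Idx × Idx → ℂ := fun l => mulFst φ K l.1 l.2.1 l.2.2.1 l.2.2.2 *
      (co x l.1 * co x l.2.1 * co x l.2.2.1 * co x l.2.2.2) with hf
  have h1 : HasSum f (quad (mulFst φ K) x x x x) := hs.hasSum
  have h2 := swapFirst₄.hasSum_iff.2 h1
  have h3 := swapMiddle₄.hasSum_iff.2 h2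
  have h4 := swapLast₄.hasSum_iff.2 h3
  have h := ((h1.add h2).add h3).add h4
  have e : ∀ S : ℂ, 4 * S = S + S + S + S := fun S => by ring
  rw [e, ← h.tsum_eq]
  refine tsum_congr fun l => ?_
  obtain ⟨k₁, k₂, k₃, k₄⟩ := l
  simp only [Function.comp_apply, swapFirst₄, swapMiddle₄, swapLast₄, Equiv.coe_fn_mk, hf, mulFst]
  have e1 : K k₂ k₁ k₃ k₄ = K k₁ k₂ k₃ k₄ := hK.s₁₂ _ _ _ _
  have e2 : K k₃ k₁ k₂ k₄ = K k₁ k₂ k₃ k₄ := by rw [hK.s₁₂, hK.s₂₃]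
  have e3 : K k₄ k₁ k₂ k₃ = K k₁ k₂ k₃ k₄ := by rw [hK.s₁₂, hK.s₂₃, hK.s₃₄]
  rw [e1, e2, e3, divisor]
  push_cast
  ring

theorem tri_mulFst (φ : ℤ → ℝ) (K : Kernel) (x y z : Pt) (k : Idx) :
    tri (mulFst φ K) x y z k = ((sg k * φ k.1 : ℝ) : ℂ) * tri K x y z k := by
  unfold tri
  rw [← tsum_mul_left]
  exact tsum_congr fun l => by rw [mulFst]; ring

/-- The change of a quadratic Hamiltonian under the implicit midpoint map. -/
theorem diagHam_midpoint {φ : ℤ → ℝ} {v : ℤ → ℝ} {P : QuadPred} {M : ℝ} (hP : SymmPred P)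
    (hd : ∀ k₁ k₂ k₃ k₄, mom k₁ k₂ k₃ k₄ = 0 → P k₁ k₂ k₃ k₄ → divisor φ k₁ k₂ k₃ k₄ ≠ 0)
    (hM : 0 ≤ M) (hK : KernelBound (fun j => jap j ^ (-(1 / 2) : ℝ)) (1 / 2) M
      (mulFst φ (chi v P φ))) (ha : 0 ≤ a) (hq : 1 / 2 < q) {m : Pt} (hm : m ∈ phaseSub a q 0 1)
    (hs₁ : Summable fun j => (φ j : ℂ) *
      ((m + (1 / 2 : ℂ) • vf (chi v P φ) m m m).1 j * (m + (1 / 2 : ℂ) • vf (chi v P φ) m m m).2 j))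
    (hs₂ : Summable fun j => (φ j : ℂ) *
      ((m - (1 / 2 : ℂ) • vf (chi v P φ) m m m).1 j * (m - (1 / 2 : ℂ) • vf (chi v P φ) m m m).2 j)) :
    diagHam φ (m + (1 / 2 : ℂ) • vf (chi v P φ) m m m) =
      diagHam φ (m - (1 / 2 : ℂ) • vf (chi v P φ) m m m) - poly (ker v P) m := by
  have hg : ∀ j, 0 < jap j ^ (-(1 / 2) : ℝ) := fun j => Real.rpow_pos_of_pos (jap_pos j) _
  -- The exponents add up to `2q - 1`, which is nonnegative because `q > 1/2`.
  have hgq : ∀ j, 1 ≤ jap j ^ (q - 1 / 2) * jap j ^ (-(1 / 2) : ℝ) * jap j ^ q := fun j => by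
    rw [← Real.rpow_add (jap_pos j), ← Real.rpow_add (jap_pos j)]
    exact Real.one_le_rpow (one_le_jap j) (by linarith)
  obtain ⟨h1, h2⟩ := quad_eq_tsum hK hg hM ha (by norm_num) hq.le hq hgq hm hm hm hm
  have h3 := summable_quad hK hg hM ha (by norm_num) hq.le hq hgq hm hm hm hm
  have h4 := four_mul_quad_mulFst (symmKernel_chi hP) h3
  -- Symmetrizing turns multiplication by one frequency into multiplication by the divisor, which
  -- cancels the denominator of `chi`.
  have h5 : 4 * quad (mulFst φ (chi v P φ)) m m m m = Complex.I * poly (ker v P) m := by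
    rw [h4, poly, quad, ← tsum_mul_left]
    refine tsum_congr fun l => ?_
    by_cases h : mom l.1 l.2.1 l.2.2.1 l.2.2.2 = 0 ∧ P l.1 l.2.1 l.2.2.1 l.2.2.2
    · have h0 : ((divisor φ l.1 l.2.1 l.2.2.1 l.2.2.2 : ℝ) : ℂ) ≠ 0 :=
        Complex.ofReal_ne_zero.2 (hd _ _ _ _ h.1 h.2)
      rw [chi]
      field_simp
    · rw [chi, ker_of_not h]; simp
  -- In the difference of the quadratic form at `m + X/2` and `m - X/2` only the terms linear in `X`
  -- survive. Both series must converge for this subtraction, and nothing else about `Λ` is used.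
  rw [sub_eq_add_neg _ (poly (ker v P) m), ← sub_eq_iff_eq_add', diagHam, diagHam,
    ← hs₁.tsum_sub hs₂]
  have h6 : -poly (ker v P) m = 4 * Complex.I * quad (mulFst φ (chi v P φ)) m m m m := by
    linear_combination -poly (ker v P) m * Complex.I_sq - Complex.I * h5
  rw [h6, h2, h1.tsum_prod, ← tsum_mul_left]
  refine tsum_congr fun j => ?_
  rw [tsum_bool]
  simp only [tri_mulFst, co, vf, sg, Bool.false_eq_true, if_true, if_false, Prod.fst_add,
    Prod.snd_add, Prod.fst_sub, Prod.snd_sub, Prod.smul_fst, Prod.smul_snd, Pi.add_apply,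
    Pi.sub_apply, Pi.smul_apply, smul_eq_mul]
  push_cast
  ring

end KGNormalForm
end

noncomputable section
namespace KGNormalForm
open scoped ENNReal

/-! ### Linearity in the kernel -/

section
variable {a q c c' b b' M M' : ℝ} {K K' : Kernel}

theorem poly_add_kernel (hK : GoodKernel c b M K) (hK' : GoodKernel c' b' M' K') (hb : 0 ≤ b)
    (hb' : 0 ≤ b') (ha : 0 ≤ a) (hq : 1 / 2 < q) {x : Pt} (hx : x ∈ phaseSub a q 0 1) :
    poly (K + K') x = poly K x + poly K' x := by
  unfold poly quad
  rw [← (hK.summable_quad hb ha hq hx hx hx hx).tsum_add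
    (hK'.summable_quad hb' ha hq hx hx hx hx)]
  exact tsum_congr fun l => by simp only [Pi.add_apply]; ring

theorem vf_sub_kernel (hK : GoodKernel c b M K) (hK' : GoodKernel c' b' M' K')
    (ha : 0 ≤ a) (hq : 1 / 2 < q) {x y z : Pt} (hx : x ∈ phaseSub a q 0 1)
    (hy : y ∈ phaseSub a q 0 1) (hz : z ∈ phaseSub a q 0 1) :
    vf (K - K') x y z = vf K x y z - vf K' x y z := by
  have h : ∀ k, tri (K - K') x y z k = tri K x y z k - tri K' x y z k := fun k => by
    unfold tri
    rw [← (hK.summable_tri ha hq hx hy hz k).tsum_sub (hK'.summable_tri ha hq hx hy hz k)]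
    exact tsum_congr fun l => by simp only [Pi.sub_apply]; ring
  refine Prod.ext (funext fun j => ?_) (funext fun j => ?_)
  · simp only [vf, h, Prod.fst_sub, Pi.sub_apply]; ring
  · simp only [vf, h, Prod.snd_sub, Pi.sub_apply]; ring

end

variable {v : ℤ → ℝ} {P P₁ P₂ : QuadPred}

theorem ker_add (h : ∀ k₁ k₂ k₃ k₄, P k₁ k₂ k₃ k₄ ↔ (P₁ k₁ k₂ k₃ k₄ ∨ P₂ k₁ k₂ k₃ k₄))
    (h' : ∀ k₁ k₂ k₃ k₄, P₁ k₁ k₂ k₃ k₄ → ¬P₂ k₁ k₂ k₃ k₄) : ker v P = ker v P₁ + ker v P₂ := by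
  funext k₁ k₂ k₃ k₄
  have h1 := h k₁ k₂ k₃ k₄
  have h2 := h' k₁ k₂ k₃ k₄
  simp only [Pi.add_apply, ker]
  by_cases hm : mom k₁ k₂ k₃ k₄ = 0 <;> by_cases hp₁ : P₁ k₁ k₂ k₃ k₄ <;>
    by_cases hp₂ : P₂ k₁ k₂ k₃ k₄ <;> simp_all

theorem ker_eq_neutral_add_charged : ker v P = ker v (neutral P) + ker v (charged P) :=
  ker_add (fun _ _ _ _ => by unfold neutral charged; tauto)
    fun _ _ _ _ h h' => h'.1 h.1

/-- The quadruples that do not meet `J`. -/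
def avoids (J : Finset ℤ) : QuadPred := fun k₁ k₂ k₃ k₄ => ¬meets J k₁ k₂ k₃ k₄

theorem symmPred_avoids (J : Finset ℤ) : SymmPred (avoids J) := (symmPred_meets J).not

/-- All quadruples. -/
abbrev every : QuadPred := fun _ _ _ _ => True

theorem charge_of_paired {k₁ k₂ k₃ k₄ : Idx} (h : paired k₁ k₂ k₃ k₄) :
    charge k₁ k₂ k₃ k₄ = 0 := by
  have key : ∀ {k l : Idx}, opp k l → sg l = -sg k := fun {k l} h => by
    rw [(opp_iff _ _).1 h]; exact sg_flip k
  unfold charge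
  rcases h with ⟨h, h'⟩ | ⟨h, h'⟩ | ⟨h, h'⟩ <;> rw [key h, key h'] <;> ring

theorem co_projPerp (J : Finset ℤ) (x : Pt) (k : Idx) :
    co (projPerp J x) k = if k.1 ∈ J then 0 else co x k := by
  obtain ⟨j, b⟩ := k
  cases b <;> simp [co, projPerp]

theorem poly_projPerp {J : Finset ℤ} (hP : ∀ k₁ k₂ k₃ k₄, P k₁ k₂ k₃ k₄ → ¬meets J k₁ k₂ k₃ k₄)
    (x : Pt) : poly (ker v P) (projPerp J x) = poly (ker v P) x := by
  refine tsum_congr fun l => ?_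
  by_cases h : P l.1 l.2.1 l.2.2.1 l.2.2.2
  · have := hP _ _ _ _ h
    unfold meets at this
    push Not at this
    obtain ⟨h1, h2, h3, h4⟩ := this
    simp only [co_projPerp, if_neg h1, if_neg h2, if_neg h3, if_neg h4]
  · rw [ker_of_not fun h' => h h'.2, zero_mul, zero_mul]

theorem projPerp_normLE {a q β c : ℝ} {x : Pt} (J : Finset ℤ) (hx : x ∈ phaseSub a q β c) :
    NormLE a q β c (projPerp J x) (phaseNorm a q β c (projPerp J x)) := by
  refine normLE_self ⟨hx.1.of_nonneg_of_le (fun j => by positivity) fun j => ?_,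
    hx.2.of_nonneg_of_le (fun j => by positivity) fun j => ?_⟩
  · simp only [projPerp]
    split_ifs
    · simp; positivity
    · exact le_rfl
  · simp only [projPerp]
    split_ifs
    · simp; positivity
    · exact le_rfl

/-! ### Invariance -/

/-- The diagonal action with angles `θ`. -/
def act (θ : ℤ → ℝ) (x : Pt) : Pt :=
  (fun j => Complex.exp (-(Complex.I * θ j)) * x.1 j, fun j => Complex.exp (Complex.I * θ j) * x.2 j)

theorem gaugeFlow_eq (α : ℝ) (x : Pt) : gaugeFlow α x = act (fun _ => α) x := rfl

theorem translFlow_eq (α : ℝ) (x : Pt) : translFlow α x = act (fun j => j * α) x := by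
  unfold translFlow act
  push_cast
  simp only [mul_assoc]

theorem co_act (θ : ℤ → ℝ) (x : Pt) (k : Idx) :
    co (act θ x) k = Complex.exp (-(Complex.I * (sg k * θ k.1 : ℝ))) * co x k := by
  obtain ⟨j, b⟩ := k
  cases b <;> simp [co, act, sg]

theorem norm_exp_neg_I (t : ℝ) : ‖Complex.exp (-(Complex.I * t))‖ = 1 := by
  rw [show -(Complex.I * t) = ((-t : ℝ) : ℂ) * Complex.I by push_cast; ring]
  exact Complex.norm_exp_ofReal_mul_I _

theorem norm_exp_pos_I (t : ℝ) : ‖Complex.exp (Complex.I * t)‖ = 1 := by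
  rw [mul_comm]; exact Complex.norm_exp_ofReal_mul_I _

theorem act_mem_phaseSub {a q β c : ℝ} (θ : ℤ → ℝ) {x : Pt} (hx : x ∈ phaseSub a q β c) :
    act θ x ∈ phaseSub a q β c := by
  constructor
  · simpa [act, norm_exp_neg_I] using hx.1
  · simpa [act, norm_exp_pos_I] using hx.2

theorem act_mem_Ball {a q β c R : ℝ} (θ : ℤ → ℝ) {x : Pt} (hx : x ∈ Ball a q β c R) :
    act θ x ∈ Ball a q β c R := by
  refine ⟨act_mem_phaseSub θ hx.1, ?_⟩
  have : phaseNorm a q β c (act θ x) = phaseNorm a q β c x := by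
    simp only [phaseNorm, act, norm_mul, norm_exp_neg_I, norm_exp_pos_I, one_mul]
  rw [this]
  exact hx.2

/-- The kernel is supported on quadruples on which the action with angles `θ` is trivial. -/
def Commutes (θ : ℤ → ℝ) (K : Kernel) : Prop :=
  ∀ k₁ k₂ k₃ k₄, K k₁ k₂ k₃ k₄ ≠ 0 → divisor θ k₁ k₂ k₃ k₄ = 0

theorem exp_divisor (θ : ℤ → ℝ) (k₁ k₂ k₃ k₄ : Idx) :
    Complex.exp (-(Complex.I * (sg k₁ * θ k₁.1 : ℝ))) *
      Complex.exp (-(Complex.I * (sg k₂ * θ k₂.1 : ℝ))) *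
      Complex.exp (-(Complex.I * (sg k₃ * θ k₃.1 : ℝ))) *
      Complex.exp (-(Complex.I * (sg k₄ * θ k₄.1 : ℝ))) =
      Complex.exp (-(Complex.I * (divisor θ k₁ k₂ k₃ k₄ : ℝ))) := by
  rw [← Complex.exp_add, ← Complex.exp_add, ← Complex.exp_add, divisor]
  congr 1
  push_cast; ring

theorem term_act (θ : ℤ → ℝ) (x : Pt) (k₁ k₂ k₃ k₄ : Idx) :
    co (act θ x) k₁ * co (act θ x) k₂ * co (act θ x) k₃ * co (act θ x) k₄ =
      Complex.exp (-(Complex.I * (divisor θ k₁ k₂ k₃ k₄ : ℝ))) *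
        (co x k₁ * co x k₂ * co x k₃ * co x k₄) := by
  rw [← exp_divisor]
  simp only [co_act]; ring

theorem poly_act {θ : ℤ → ℝ} {K : Kernel} (hK : Commutes θ K) (x : Pt) :
    poly K (act θ x) = poly K x := by
  refine tsum_congr fun l => ?_
  by_cases h : K l.1 l.2.1 l.2.2.1 l.2.2.2 = 0
  · rw [h, zero_mul, zero_mul]
  · rw [term_act, hK _ _ _ _ h]; simp

theorem tri_act {θ : ℤ → ℝ} {K : Kernel} (hK : Commutes θ K) (x y z : Pt) (k : Idx) :
    tri K (act θ x) (act θ y) (act θ z) k =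
      Complex.exp (Complex.I * (sg k * θ k.1 : ℝ)) * tri K x y z k := by
  unfold tri
  rw [← tsum_mul_left]
  refine tsum_congr fun l => ?_
  by_cases h : K k l.1 l.2.1 l.2.2 = 0
  · simp [h]
  · have h1 := exp_divisor θ k l.1 l.2.1 l.2.2
    rw [hK _ _ _ _ h] at h1
    have h2 : Complex.exp (Complex.I * (sg k * θ k.1 : ℝ)) *
        Complex.exp (-(Complex.I * (sg k * θ k.1 : ℝ))) = 1 := by
      rw [← Complex.exp_add, add_neg_cancel, Complex.exp_zero]
    simp only [Complex.ofReal_zero, mul_zero, neg_zero, Complex.exp_zero] at h1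
    simp only [co_act]
    set e := Complex.exp (-(Complex.I * (sg k * θ k.1 : ℝ)))
    set e' := Complex.exp (Complex.I * (sg k * θ k.1 : ℝ))
    set e₁ := Complex.exp (-(Complex.I * (sg l.1 * θ l.1.1 : ℝ)))
    set e₂ := Complex.exp (-(Complex.I * (sg l.2.1 * θ l.2.1.1 : ℝ)))
    set e₃ := Complex.exp (-(Complex.I * (sg l.2.2 * θ l.2.2.1 : ℝ)))
    have h3 : e₁ * e₂ * e₃ = e' := by
      linear_combination e' * h1 - e₁ * e₂ * e₃ * h2
    linear_combination (K k l.1 l.2.1 l.2.2 * co x l.1 * co y l.2.1 * co z l.2.2) * h3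

theorem vf_act {θ : ℤ → ℝ} {K : Kernel} (hK : Commutes θ K) (x y z : Pt) :
    vf K (act θ x) (act θ y) (act θ z) = act θ (vf K x y z) := by
  refine Prod.ext (funext fun j => ?_) (funext fun j => ?_)
  · simp only [vf, act]
    rw [show (fun j => Complex.exp (-(Complex.I * θ j)) * x.1 j, fun j =>
      Complex.exp (Complex.I * θ j) * x.2 j) = act θ x from rfl]
    have := tri_act hK x y z (j, false)
    simp only [act] at this
    simp only [act, this, sg]
    simp
    ring
  · have := tri_act hK x y z (j, true)
    simp only [act] at this
    simp only [vf, act, this, sg]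
    simp
    ring

theorem commutes_transl {K : Kernel} (h : ∀ k₁ k₂ k₃ k₄, K k₁ k₂ k₃ k₄ ≠ 0 → mom k₁ k₂ k₃ k₄ = 0)
    (α : ℝ) : Commutes (fun j => j * α) K := fun k₁ k₂ k₃ k₄ hk => by
  have : (mom k₁ k₂ k₃ k₄ : ℝ) = 0 := by exact_mod_cast h _ _ _ _ hk
  unfold mom at this
  push_cast at this
  unfold divisor
  linear_combination α * this

theorem divisor_const (α : ℝ) (k₁ k₂ k₃ k₄ : Idx) :
    divisor (fun _ => α) k₁ k₂ k₃ k₄ = α * charge k₁ k₂ k₃ k₄ := by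
  unfold divisor charge
  push_cast; ring

theorem commutes_gauge {K : Kernel}
    (h : ∀ k₁ k₂ k₃ k₄, K k₁ k₂ k₃ k₄ ≠ 0 → charge k₁ k₂ k₃ k₄ = 0)
    (α : ℝ) : Commutes (fun _ => α) K := fun k₁ k₂ k₃ k₄ hk => by
  rw [divisor_const, h _ _ _ _ hk]; simp

theorem mid_act {a q₀ c b M R₁ : ℝ} {K : Kernel} (hK : GoodKernel c b M K) (hb : 0 ≤ b)
    (ha : 0 ≤ a) (hq₀ : 1 / 2 < q₀) (hR₀ : triConst q₀ * M * R₁ ^ 2 ≤ 1 / 64) {θ : ℤ → ℝ}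
    (hθ : Commutes θ K) {x : Pt} (hx : x ∈ Ball₀ a q₀ R₁) :
    midPt a q₀ R₁ K (act θ x) = act θ (midPt a q₀ R₁ K x) ∧
      midMap a q₀ R₁ K (act θ x) = act θ (midMap a q₀ R₁ K x) :=
  midPt_equivariant hK hb ha hq₀ hR₀ (fun _ hx => act_mem_Ball θ hx)
    (fun x y => by simp [act, Prod.ext_iff, funext_iff, mul_add])
    (fun r x => by simp [act, Prod.ext_iff, funext_iff, mul_left_comm])
    (fun x => (vf_act hθ x x x).symm) hx

/-- Along the Gauge orbit of `x`, the function `F` is a trigonometric polynomial without constant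
term. -/
def GaugeMeanZero (F : Pt → ℂ) (x : Pt) : Prop :=
  ∃ A : ℤ → ℂ, ∀ α : ℝ, F (gaugeFlow α x) =
    ∑ n ∈ ({-4, -2, 2, 4} : Finset ℤ), A n * Complex.exp (-(Complex.I * (α * n : ℝ)))

theorem GaugeMeanZero.sub {F F' : Pt → ℂ} {x : Pt} (h : GaugeMeanZero F x)
    (h' : GaugeMeanZero F' x) : GaugeMeanZero (fun u => F u - F' u) x := by
  obtain ⟨A, hA⟩ := h
  obtain ⟨A', hA'⟩ := h'
  refine ⟨fun n => A n - A' n, fun α => ?_⟩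
  simp only [hA, hA', sub_mul, Finset.sum_sub_distrib]

theorem GaugeMeanZero.gaugePart_eq {F : Pt → ℂ} {x : Pt} (h : GaugeMeanZero F x) :
    gaugePart F x = 0 := by
  obtain ⟨A, hA⟩ := h
  rw [gaugePart]
  simp only [hA]
  rw [intervalIntegral.integral_finsetSum]
  · have key : ∀ n : ℤ, n ≠ 0 → ∫ α in (0 : ℝ)..(2 * Real.pi),
        A n * Complex.exp (-(Complex.I * (α * n : ℝ))) = 0 := by
      intro n hn
      have hc : -(Complex.I * n) ≠ 0 :=
        neg_ne_zero.2 (mul_ne_zero Complex.I_ne_zero (by exact_mod_cast hn))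
      have e : ∀ α : ℝ, Complex.exp (-(Complex.I * (α * n : ℝ))) =
          Complex.exp (-(Complex.I * n) * α) := fun α => by
        congr 1; push_cast; ring
      simp only [e]
      rw [intervalIntegral.integral_const_mul, integral_exp_mul_complex hc]
      have : Complex.exp (-(Complex.I * n) * ((2 * Real.pi : ℝ) : ℂ)) =
          Complex.exp (-(Complex.I * n) * ((0 : ℝ) : ℂ)) := by
        rw [Complex.exp_eq_exp_iff_exists_int]
        exact ⟨-n, by push_cast; ring⟩
      rw [this, sub_self, zero_div, mul_zero]
    rw [Finset.sum_eq_zero, mul_zero]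
    intro n hn
    refine key n ?_
    rintro rfl
    simp at hn
  · intro n _
    apply Continuous.intervalIntegrable
    fun_prop

/-- A monomial of charge `n` picks up the phase `e^{-inα}`. The charge of four variables is even and
at most 4 in size, so if it is nonzero it is `±2` or `±4`. -/
theorem gaugeMeanZero_poly {a q c b M : ℝ} {K : Kernel} (hK : GoodKernel c b M K) (hb : 0 ≤ b)
    (ha : 0 ≤ a) (hq : 1 / 2 < q)
    (h : ∀ k₁ k₂ k₃ k₄, K k₁ k₂ k₃ k₄ ≠ 0 → charge k₁ k₂ k₃ k₄ ≠ 0) {x : Pt}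
    (hx : x ∈ phaseSub a q 0 1) : GaugeMeanZero (poly K) x := by
  set t : Idx × Idx × Idx × Idx → ℂ := fun l => K l.1 l.2.1 l.2.2.1 l.2.2.2 *
    (co x l.1 * co x l.2.1 * co x l.2.2.1 * co x l.2.2.2) with ht
  have hs : Summable t := hK.summable_quad hb ha hq hx hx hx hx
  set ch : Idx × Idx × Idx × Idx → ℤ := fun l => charge l.1 l.2.1 l.2.2.1 l.2.2.2 with hch
  have hsn : ∀ n, Summable fun l => if ch l = n then t l else 0 := fun n =>
    Summable.of_norm_bounded hs.norm fun l => by split_ifs <;> simp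
  refine ⟨fun n => ∑' l, if ch l = n then t l else 0, fun α => ?_⟩
  have h1 : HasSum (fun l => ∑ n ∈ ({-4, -2, 2, 4} : Finset ℤ), (if ch l = n then t l else 0) *
      Complex.exp (-(Complex.I * (α * n : ℝ))))
      (∑ n ∈ ({-4, -2, 2, 4} : Finset ℤ), (∑' l, if ch l = n then t l else 0) *
        Complex.exp (-(Complex.I * (α * n : ℝ)))) :=
    hasSum_sum fun n _ => (hsn n).hasSum.mul_right _
  rw [← h1.tsum_eq, poly, quad]
  refine tsum_congr fun l => ?_
  rw [gaugeFlow_eq, term_act, divisor_const]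
  by_cases hl : K l.1 l.2.1 l.2.2.1 l.2.2.2 = 0
  · simp [ht, hl]
  · have h2 := h _ _ _ _ hl
    have h3 : ch l ∈ ({-4, -2, 2, 4} : Finset ℤ) := by
      simp only [hch, charge, sg] at h2 ⊢
      split_ifs at h2 ⊢ <;> simp at h2 ⊢
    rw [Finset.sum_eq_single_of_mem _ h3 fun n _ hn => by rw [if_neg (Ne.symm hn), zero_mul],
      if_pos rfl]
    simp only [ht, hch]
    ring

theorem GaugeMeanZero.comp {F : Pt → ℂ} {T : Pt → Pt} {x : Pt} (h : GaugeMeanZero F (T x))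
    (hT : ∀ α, T (gaugeFlow α x) = gaugeFlow α (T x)) : GaugeMeanZero (fun u => F (T u)) x := by
  obtain ⟨A, hA⟩ := h
  exact ⟨A, fun α => by simp only [hT, hA]⟩

end KGNormalForm
end

noncomputable section
namespace KGNormalForm
open scoped ENNReal

/-! ### Estimates -/

section
variable {a q c b D R r M : ℝ} {K χ : Kernel}

theorem normLE_vf (hK : GoodKernel c b M K) (ha : 0 ≤ a) (hq : 1 / 2 < q) (hD : triConst q ≤ D)
    {x y z : Pt} {r₁ r₂ r₃ : ℝ} (hx : NormLE₀ a q x r₁) (hy : NormLE₀ a q y r₂)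
    (hz : NormLE₀ a q z r₃) : NormLE a q b c (vf K x y z) (D * M * (r₁ * r₂ * r₃)) := by
  refine (hK.vf_normLE ha hq hx hy hz).mono ?_
  have := hx.nonneg
  have := hy.nonneg
  have := hz.nonneg
  have := hK.M_nonneg
  gcongr

theorem normLE_vf_diff (hK : GoodKernel c b M K) (ha : 0 ≤ a) (hq : 1 / 2 < q)
    (hD : triConst q ≤ D) {x y : Pt} {r d : ℝ} (hx : NormLE₀ a q x r) (hy : NormLE₀ a q y r)
    (hd : NormLE₀ a q (x - y) d) :
    NormLE a q b c (vf K x x x - vf K y y y) (3 * (D * M * (r * r * d))) := by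
  rw [vf_diff hK ha hq hx.1 hy.1]
  exact (((normLE_vf hK ha hq hD hx hx hd).add (normLE_vf hK ha hq hD hx hy hd)).add
    (normLE_vf hK ha hq hD hy hy hd)).mono (le_of_eq (by ring))

/-- A bound that improves itself. -/
theorem NormLE.absorb {β : ℝ} {Z : Pt} {w : ℝ} (hZ : Z ∈ phaseSub a q β c)
    (h : ∀ r, NormLE a q β c Z r → NormLE a q β c Z (w + r / 2)) : NormLE a q β c Z (2 * w) := by
  have h1 := (h _ (normLE_self hZ)).2
  exact ⟨hZ, by linarith⟩

/-- The linear map that occurs in the derivative of the implicit midpoint map. -/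
def linA (χ : Kernel) (m V : Pt) : Pt := (3 / 2 : ℂ) • vf χ m m V

theorem linA_sub (hχ : GoodKernel c b M χ) (ha : 0 ≤ a) (hq : 1 / 2 < q) {m V W : Pt}
    (hm : m ∈ phaseSub a q 0 1) (hV : V ∈ phaseSub a q 0 1) (hW : W ∈ phaseSub a q 0 1) :
    linA χ m (V - W) = linA χ m V - linA χ m W := by
  rw [linA, vf_sub_left hχ ha hq hm hm hV hW, smul_sub]; rfl

theorem linA_normLE (hχ : GoodKernel c b 4 χ) (ha : 0 ≤ a) (hq : 1 / 2 < q) (hD : triConst q ≤ D)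
    {m V : Pt} {v : ℝ} (hm : NormLE₀ a q m (2 * r)) (hV : NormLE₀ a q V v) :
    NormLE a q b c (linA χ m V) (24 * D * r ^ 2 * v) := by
  refine ((normLE_vf hχ ha hq hD hm hm hV).smul _).mono (le_of_eq ?_)
  norm_num; ring

theorem smul_normLE {β : ℝ} {s : ℂ} (hs : ‖s‖ ≤ 1) {V : Pt} {v : ℝ} (hV : NormLE a q β c V v) :
    NormLE a q β c (s • V) v :=
  (hV.smul s).mono (mul_le_of_le_one_left hV.nonneg hs)

/-- `τ` transforms vector fields at `x` by the Cayley transform (`s = 1`) or the resolvent (`s = 0`)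
of `linA χ m`. -/
def Transforms (a q : ℝ) (s : ℂ) (χ : Kernel) (m : Pt) (τ : Pt → Pt) (x : Pt) : Prop :=
  ∀ (F : Pt → ℂ) (Y : Pt), HasHVF a q F (τ x) Y →
    ∃ Z, HasHVF a q (fun u => F (τ u)) x Z ∧ Z + linA χ m Z = Y - s • linA χ m Y

/-- `A = linA χ m` has norm at most `24 D r² ≤ 24/256`, so `Z` is bounded by `3 y` after absorption.
Then `Z - Y = -(sAY + AZ)` lies in the range of the smoothing operator `A` and inherits the weight
`𝚠^b`, with the constant `24 (1 + 3) = 96`. -/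
theorem resolvent_normLE (hχ : GoodKernel c b 4 χ) (hb : 0 ≤ b) (ha : 0 ≤ a) (hq : 1 / 2 < q)
    (hD : triConst q ≤ D) (hR : 256 * D * r ^ 2 ≤ 1) {m Z Y : Pt} {s : ℂ} (hs : ‖s‖ ≤ 1)
    {y : ℝ} (hm : NormLE₀ a q m (2 * r)) (hZ : Z ∈ phaseSub a q 0 1) (hY : NormLE₀ a q Y y)
    (h : Z + linA χ m Z = Y - s • linA χ m Y) :
    NormLE₀ a q Z (3 * y) ∧ NormLE a q b c (Z - Y) (96 * D * r ^ 2 * y) := by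
  have hy := hY.nonneg
  have hAY := smul_normLE hs (linA_normLE hχ ha hq hD hm hY)
  have e : Z = Y - s • linA χ m Y - linA χ m Z := by rw [← h]; abel
  have h1 : NormLE₀ a q Z (2 * (y + y / 2)) := by
    refine NormLE.absorb hZ fun z hz => ?_
    have hAZ := linA_normLE hχ ha hq hD hm hz
    rw [e]
    refine ((hY.sub (hAY.beta_zero 1 hb)).sub (hAZ.beta_zero 1 hb)).mono ?_
    have := hz.nonneg
    nlinarith
  have h2 : NormLE₀ a q Z (3 * y) := h1.mono (by linarith)
  refine ⟨h2, ?_⟩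
  have e2 : Z - Y = -(s • linA χ m Y + linA χ m Z) := by
    nth_rw 1 [e]; abel
  rw [e2]
  exact ((hAY.add (linA_normLE hχ ha hq hD hm h2)).neg).mono (le_of_eq (by ring))

/-- The vector field of `poly K ∘ τ - poly K`. -/
theorem hvf_comp_sub {τ : Pt → Pt} {m x : Pt} {s : ℂ} (hχ : GoodKernel c b 4 χ)
    (hK : GoodKernel c b 1 K) (hb : 0 ≤ b) (ha : 0 ≤ a) (hq : 1 / 2 < q) (hD : triConst q ≤ D)
    (hr : 0 ≤ r) (hR : 256 * D * r ^ 2 ≤ 1) (hs : ‖s‖ ≤ 1) (hτ : Transforms a q s χ m τ x)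
    (hm : NormLE₀ a q m (2 * r)) (hy : NormLE₀ a q (τ x) (2 * r)) (hx : NormLE₀ a q x r)
    (hd : NormLE₀ a q (τ x - x) (32 * D * r ^ 3)) :
    ∃ V, HasHVF a q (fun u => poly K (τ u) - poly K u) x V ∧
      NormLE a q b c V (1152 * D ^ 2 * r ^ 5) := by
  obtain ⟨Z, hZ, e⟩ := hτ _ _ (hasHVF_poly hK hb ha hq hy.1)
  have hY := normLE_vf hK ha hq hD hy hy hy
  have hx2 := hx.mono (show r ≤ 2 * r by linarith)
  obtain ⟨-, h1⟩ := resolvent_normLE hχ hb ha hq hD hR hs hm hZ.mem (hY.beta_zero 1 hb) e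
  have h2 := normLE_vf_diff hK ha hq hD hy hx2 hd
  refine ⟨_, hZ.sub ha (by linarith) (hasHVF_poly hK hb ha hq hx.1), ?_⟩
  -- The first difference is the effect of the derivative of `τ`, bounded by `96 D r² · 8 D r³`. The
  -- second is the displacement of the point, bounded by `3 · D (2r)² · 32 D r³`. Together they give
  -- 1152.
  have e2 : Z - vf K x x x = (Z - vf K (τ x) (τ x) (τ x)) +
      (vf K (τ x) (τ x) (τ x) - vf K x x x) := by abel
  rw [e2]
  exact (h1.add h2).mono (le_of_eq (by ring))

end

/-! ### Comparison of fields with a loss of four derivatives -/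

section
variable {a p D r h : ℝ} {K K' χ χ' : Kernel}

theorem normLE_vf_small (hK : KernelBound (fun j => ww 1 j ^ (0 : ℝ)) 4 h K) (hh : 0 ≤ h)
    (ha : 0 ≤ a) (hp : 4 ≤ p) (hD : triConst p ≤ D) {x y z : Pt} {r₁ r₂ r₃ : ℝ}
    (hx : NormLE₀ a p x r₁) (hy : NormLE₀ a p y r₂) (hz : NormLE₀ a p z r₃) :
    NormLE₀ a (p - 4) (vf K x y z) (D * h * (r₁ * r₂ * r₃)) := by
  refine (vf_normLE hK hh ha (by norm_num) hp (by linarith) hx hy hz).mono ?_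
  have := hx.nonneg
  have := hy.nonneg
  have := hz.nonneg
  gcongr

/-- The vector field of `poly K ∘ τ - poly K ∘ τ'`. -/
theorem hvf_comp_sub_comp {τ τ' : Pt → Pt} {m m' x : Pt} {s : ℂ} (hχ : GoodKernel 1 0 4 χ)
    (hχ' : GoodKernel 1 0 4 χ') (hK : GoodKernel 1 0 1 K)
    (hΔ : KernelBound (fun j => ww 1 j ^ (0 : ℝ)) 4 h (χ - χ')) (hh : 0 ≤ h)
    (ha : 0 ≤ a) (hp : 9 / 2 < p) (hD₀ : 0 ≤ D) (hD : triConst p ≤ D) (hD' : triConst (p - 4) ≤ D)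
    (hr : 0 ≤ r) (hR : 256 * D * r ^ 2 ≤ 1) (hs : ‖s‖ ≤ 1) (hτ : Transforms a p s χ m τ x)
    (hτ' : Transforms a p s χ' m' τ' x) (hm : NormLE₀ a p m (2 * r))
    (hm' : NormLE₀ a p m' (2 * r)) (hy : NormLE₀ a p (τ x) (2 * r))
    (hy' : NormLE₀ a p (τ' x) (2 * r)) (hdm : NormLE₀ a (p - 4) (m - m') (16 * D * h * r ^ 3))
    (hdy : NormLE₀ a (p - 4) (τ x - τ' x) (16 * D * h * r ^ 3)) :
    ∃ V, HasHVF a p (fun u => poly K (τ u) - poly K (τ' u)) x V ∧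
      NormLE₀ a (p - 4) V (1280 * D ^ 2 * h * r ^ 5) := by
  have hq : 1 / 2 < p - 4 := by linarith
  have hq' : 1 / 2 < p := by linarith
  have hpq : p - 4 ≤ p := by linarith
  obtain ⟨Z, hZ, e⟩ := hτ _ _ (hasHVF_poly hK le_rfl ha hq' hy.1)
  obtain ⟨Z', hZ', e'⟩ := hτ' _ _ (hasHVF_poly hK le_rfl ha hq' hy'.1)
  refine ⟨_, hZ.sub ha (by linarith) hZ', ?_⟩
  have hY := normLE_vf hK ha hq' hD hy hy hy
  have hY' := normLE_vf hK ha hq' hD hy' hy' hy'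
  obtain ⟨hZn, -⟩ := resolvent_normLE hχ le_rfl ha hq' hD hR hs hm hZ.mem hY e
  obtain ⟨hZn', -⟩ := resolvent_normLE hχ' le_rfl ha hq' hD hR hs hm' hZ'.mem hY' e'
  have hYd := normLE_vf_diff hK ha hq hD' (hy.q_mono hpq) (hy'.q_mono hpq) hdy
  set Y := vf K (τ x) (τ x) (τ x)
  set Y' := vf K (τ' x) (τ' x) (τ' x)
  have hmq := hm.q_mono hpq
  have hmq' := hm'.q_mono hpq
  -- The operators for the two kernels are close only as maps from regularity `p` to `p - 4`,
  -- because the kernels are close in that sense. Hence `V` is taken at regularity `p`.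
  have hB : ∀ {V : Pt} {v : ℝ}, NormLE₀ a p V v →
      NormLE₀ a (p - 4) (linA χ m V - linA χ' m' V) (8 * D * h * r ^ 2 * v) := by
    intro V v hV
    have hv := hV.nonneg
    have hVq := hV.q_mono hpq
    have e1 : vf χ m m V - vf χ' m' m' V = vf χ m V (m - m') + vf χ V m' (m - m') +
        vf (χ - χ') m' m' V := by
      rw [vf_sub_kernel hχ hχ' ha hq' hm'.1 hm'.1 hV.1,
        vf_sub_left hχ ha hq hmq.1 hVq.1 hmq.1 hmq'.1,
        vf_sub_left hχ ha hq hVq.1 hmq'.1 hmq.1 hmq'.1]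
      have f1 : vf χ m V m = vf χ m m V := vf_symm₂ hχ.symm _ _ _
      have f2 : vf χ V m' m = vf χ m V m' := by rw [vf_symm₂ hχ.symm, vf_symm₁ hχ.symm,
        vf_symm₂ hχ.symm, vf_symm₁ hχ.symm, vf_symm₂ hχ.symm, vf_symm₁ hχ.symm,
        vf_symm₂ hχ.symm]
      have f3 : vf χ V m' m' = vf χ m' m' V := by rw [vf_symm₁ hχ.symm, vf_symm₂ hχ.symm]
      rw [f1, f2, f3]; abel
    have h1 := ((normLE_vf hχ ha hq hD' hmq hVq hdm).add
      (normLE_vf hχ ha hq hD' hVq hmq' hdm)).add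
      (normLE_vf_small hΔ hh ha (by linarith) hD hm' hm' hV)
    rw [← e1] at h1
    rw [linA, linA, ← smul_sub]
    refine (h1.smul _).mono ?_
    have h2 : ‖(3 / 2 : ℂ)‖ = 3 / 2 := by norm_num
    rw [h2]
    have h3 : 0 ≤ D * h * r ^ 2 * v := by positivity
    nlinarith
  -- Subtracting the two resolvent equations gives an equation for `Z - Z'` at regularity `p - 4`,
  -- with small data and the same small operator `linA χ m`, so that absorption applies there.
  have e2 : Z - Z' = (Y - Y') - s • linA χ m (Y - Y') - s • (linA χ m Y' - linA χ' m' Y') -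
      (linA χ m Z' - linA χ' m' Z') - linA χ m (Z - Z') := by
    rw [linA_sub hχ ha hq' hm.1 hY.1 hY'.1, linA_sub hχ ha hq' hm.1 hZn.1 hZn'.1]
    have f1 : Z = Y - s • linA χ m Y - linA χ m Z := by rw [← e]; abel
    have f2 : Z' = Y' - s • linA χ' m' Y' - linA χ' m' Z' := by rw [← e']; abel
    have f3 : Z - Z' = (Y - s • linA χ m Y - linA χ m Z) -
        (Y' - s • linA χ' m' Y' - linA χ' m' Z') := by rw [← f1, ← f2]
    rw [f3]
    module
  have hfin : NormLE₀ a (p - 4) (Z - Z') (2 * (640 * D ^ 2 * h * r ^ 5)) := by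
    refine NormLE.absorb (hZn.sub hZn' |>.q_mono hpq).1 fun z hz => ?_
    rw [e2]
    refine ((((hYd.sub (smul_normLE hs (linA_normLE hχ ha hq hD' hmq hYd))).sub
      (smul_normLE hs (hB hY'))).sub (hB hZn')).sub (linA_normLE hχ ha hq hD' hmq hz)).mono ?_
    have hz0 := hz.nonneg
    have h3 : 0 ≤ D ^ 2 * h * r ^ 5 := by positivity
    nlinarith
  exact hfin.mono (le_of_eq (by ring))

/-- The vector field of `(poly K ∘ τ - poly K) - (poly K' ∘ τ - poly K')` for kernels which are
close to each other. -/
theorem hvf_comp_sub_of_close {τ : Pt → Pt} {m x : Pt} {s : ℂ} (hχ : GoodKernel 1 0 4 χ)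
    (hK : GoodKernel 1 0 1 K) (hK' : GoodKernel 1 0 1 K')
    (hΔ : KernelBound (fun j => ww 1 j ^ (0 : ℝ)) 4 h (K - K')) (hh : 0 ≤ h)
    (ha : 0 ≤ a) (hp : 9 / 2 < p) (hD : triConst p ≤ D) (hD' : triConst (p - 4) ≤ D)
    (hr : 0 ≤ r) (hR : 256 * D * r ^ 2 ≤ 1) (hs : ‖s‖ ≤ 1) (hτ : Transforms a p s χ m τ x)
    (hm : NormLE₀ a p m (2 * r)) (hy : NormLE₀ a p (τ x) (2 * r)) (hx : NormLE₀ a p x r)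
    (hd : NormLE₀ a p (τ x - x) (32 * D * r ^ 3)) :
    ∃ V, HasHVF a p (fun u => (poly K (τ u) - poly K u) - (poly K' (τ u) - poly K' u)) x V ∧
      NormLE₀ a (p - 4) V (1152 * D ^ 2 * h * r ^ 5) := by
  have hq : 1 / 2 < p - 4 := by linarith
  have hq' : 1 / 2 < p := by linarith
  have hpq : p - 4 ≤ p := by linarith
  obtain ⟨Z, hZ, e⟩ := hτ _ _ (hasHVF_poly hK le_rfl ha hq' hy.1)
  obtain ⟨Z', hZ', e'⟩ := hτ _ _ (hasHVF_poly hK' le_rfl ha hq' hy.1)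
  refine ⟨_, (hZ.sub ha (by linarith) (hasHVF_poly hK le_rfl ha hq' hx.1)).sub ha (by linarith)
    (hZ'.sub ha (by linarith) (hasHVF_poly hK' le_rfl ha hq' hx.1)), ?_⟩
  have hY := normLE_vf hK ha hq' hD hy hy hy
  have hY' := normLE_vf hK' ha hq' hD hy hy hy
  have hx2 := hx.mono (show r ≤ 2 * r by linarith)
  have hYd := normLE_vf_small hΔ hh ha (by linarith) hD hy hy hy
  rw [vf_sub_kernel hK hK' ha hq' hy.1 hy.1 hy.1] at hYd
  -- For a fixed map `τ` the resolvent equation is linear, so `Z - Z'` solves it with the field of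
  -- `K - K'` as datum.
  have e2 : (Z - Z') + linA χ m (Z - Z') =
      (vf K (τ x) (τ x) (τ x) - vf K' (τ x) (τ x) (τ x)) -
      s • linA χ m (vf K (τ x) (τ x) (τ x) - vf K' (τ x) (τ x) (τ x)) := by
    rw [linA_sub hχ ha hq' hm.1 hY.1 hY'.1, linA_sub hχ ha hq' hm.1 hZ.mem hZ'.mem]
    have f : (Z - Z') + (linA χ m Z - linA χ m Z') = (Z + linA χ m Z) - (Z' + linA χ m Z') := by
      abel
    rw [f, e, e', smul_sub]; abel
  have hmem : Z - Z' ∈ phaseSub a (p - 4) 0 1 :=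
    ((normLE_self (sub_mem hZ.mem hZ'.mem)).q_mono hpq).1
  obtain ⟨-, h1⟩ := resolvent_normLE hχ le_rfl ha hq hD' hR hs (hm.q_mono hpq) hmem hYd e2
  have h2 := ((normLE_vf_small hΔ hh ha (by linarith) hD hy hy hd).add
    (normLE_vf_small hΔ hh ha (by linarith) hD hy hx2 hd)).add
    (normLE_vf_small hΔ hh ha (by linarith) hD hx2 hx2 hd)
  -- The displacement terms for `K` and `K'` are expanded by `vf_diff`, so that their difference
  -- involves `K - K'` alone, applied to arguments of full regularity.
  have e3 : Z - vf K x x x - (Z' - vf K' x x x) =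
      (Z - Z' - (vf K (τ x) (τ x) (τ x) - vf K' (τ x) (τ x) (τ x))) +
      (vf (K - K') (τ x) (τ x) (τ x - x) + vf (K - K') (τ x) x (τ x - x) +
        vf (K - K') x x (τ x - x)) := by
    rw [vf_sub_kernel hK hK' ha hq' hy.1 hy.1 hd.1, vf_sub_kernel hK hK' ha hq' hy.1 hx.1 hd.1,
      vf_sub_kernel hK hK' ha hq' hx.1 hx.1 hd.1]
    have d1 := vf_diff hK ha hq' hy.1 hx.1
    have d2 := vf_diff hK' ha hq' hy.1 hx.1
    have d3 : vf K x x x = vf K (τ x) (τ x) (τ x) - (vf K (τ x) (τ x) (τ x) - vf K x x x) := by abel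
    have d4 : vf K' x x x = vf K' (τ x) (τ x) (τ x) -
        (vf K' (τ x) (τ x) (τ x) - vf K' x x x) := by abel
    rw [d1] at d3
    rw [d2] at d4
    rw [d3, d4]; abel
  rw [e3]
  exact (h1.add h2).mono (le_of_eq (by ring))

end

end KGNormalForm
end

/-! ### The midpoint map and the remainder under the standing smallness conditions -/

noncomputable section
namespace KGNormalForm
open scoped ENNReal

/-- The standing assumptions on the parameters. -/
structure Level (a q₀ q D R₁ : ℝ) : Prop where
  ha : 0 ≤ a
  hq₀ : 1 / 2 < q₀
  hq : q₀ ≤ q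
  hD₀ : triConst q₀ ≤ D
  hD : triConst q ≤ D
  one_le : 1 ≤ D
  -- `256 = 4 · 64`: with generating kernels of size 4 this is the condition `B R₁² ≤ 1/64` of the
  -- midpoint map.
  hR₁ : 256 * D * R₁ ^ 2 ≤ 1

section
variable {a q₀ q c b D R R₁ r : ℝ} {χ K KQ : Kernel}

theorem Level.hq' (L : Level a q₀ q D R₁) : 1 / 2 < q := L.hq₀.trans_le L.hq

theorem Level.small₀ (L : Level a q₀ q D R₁) : triConst q₀ * 4 * R₁ ^ 2 ≤ 1 / 64 := by
  have h1 := mul_le_mul_of_nonneg_right L.hD₀ (sq_nonneg R₁)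
  have h2 := L.hR₁
  linarith

theorem Level.small (L : Level a q₀ q D R₁) : triConst q * 4 * R₁ ^ 2 ≤ 1 / 64 := by
  have h1 := mul_le_mul_of_nonneg_right L.hD (sq_nonneg R₁)
  have h2 := L.hR₁
  linarith

theorem Level.of_le (L : Level a q₀ q D R₁) (hr : 0 ≤ r) (hr' : r ≤ R₁) : 256 * D * r ^ 2 ≤ 1 := by
  refine le_trans ?_ L.hR₁
  have := L.one_le
  gcongr

theorem mid_eq (L : Level a q₀ q D R₁) (hχ : GoodKernel c b 4 χ) (hb : 0 ≤ b) {x : Pt}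
    (hx : x ∈ Ball₀ a q R₁) :
    x = midPt a q₀ R₁ χ x - (1 / 2 : ℂ) •
      vf χ (midPt a q₀ R₁ χ x) (midPt a q₀ R₁ χ x) (midPt a q₀ R₁ χ x) :=
  (midPt_mem (hχ.weaken hb) le_rfl L.ha L.hq₀ L.hq le_rfl le_rfl le_rfl L.small₀ L.small hx).2.symm

/-- `T x - x = X(m)` and `m - x = X(m)/2` with `‖m‖ ≤ 2r`, so `‖X(m)‖ ≤ 4D(2r)³ = 32 D r³`, even in
the norm with the gained weight. -/
theorem mid_bounds (L : Level a q₀ q D R₁) (hχ : GoodKernel c b 4 χ) (hb : 0 ≤ b) (hrR : r ≤ R₁)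
    {x : Pt} (hx : x ∈ Ball₀ a q R₁) (hxr : NormLE₀ a q x r) :
    NormLE₀ a q (midPt a q₀ R₁ χ x) (2 * r) ∧ NormLE₀ a q (midMap a q₀ R₁ χ x) (2 * r) ∧
    NormLE a q b c (midMap a q₀ R₁ χ x - x) (32 * D * r ^ 3) ∧
    NormLE a q b c (midPt a q₀ R₁ χ x - x) (32 * D * r ^ 3) := by
  have hr := hxr.nonneg
  have hR := L.of_le hr hrR
  have h1 : NormLE₀ a q (midPt a q₀ R₁ χ x) (2 * r) :=
    (midPt_normLE (hχ.weaken hb) le_rfl L.ha L.hq₀ L.hq le_rfl le_rfl L.small₀ L.small hx).mono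
      (by linarith [hxr.2])
  have e := mid_eq L hχ hb hx
  have h2 := normLE_vf hχ L.ha L.hq' L.hD h1 h1 h1
  have h3 : NormLE a q b c (midMap a q₀ R₁ χ x - x) (32 * D * r ^ 3) := by
    have e1 : midMap a q₀ R₁ χ x - x =
        vf χ (midPt a q₀ R₁ χ x) (midPt a q₀ R₁ χ x) (midPt a q₀ R₁ χ x) := by
      nth_rw 2 [e]
      rw [midMap]; module
    rw [e1]
    exact h2.mono (le_of_eq (by ring))
  have h4 : NormLE a q b c (midPt a q₀ R₁ χ x - x) (32 * D * r ^ 3) := by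
    have e1 : midPt a q₀ R₁ χ x - x = (1 / 2 : ℂ) •
        vf χ (midPt a q₀ R₁ χ x) (midPt a q₀ R₁ χ x) (midPt a q₀ R₁ χ x) := by
      nth_rw 2 [e]; abel
    rw [e1]
    refine (h2.smul _).mono ?_
    have : 0 ≤ D * r ^ 3 := by
      have := L.one_le
      positivity
    norm_num
    nlinarith
  refine ⟨h1, ?_, h3, h4⟩
  have h5 := hxr.add (h3.beta_zero 1 hb)
  rw [add_sub_cancel] at h5
  refine h5.mono ?_
  nlinarith

theorem transforms_midMap (L : Level a q₀ q D R₁) (hχ : GoodKernel c b 4 χ) (hb : 0 ≤ b)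
    {x : Pt} (hx : x ∈ Ball₀ a q R₁) :
    Transforms a q 1 χ (midPt a q₀ R₁ χ x) (midMap a q₀ R₁ χ) x := fun F Y hF => by
  rw [one_smul]
  exact (hasHVF_comp hχ hb L.ha L.hq₀ L.hq le_rfl L.small₀ L.small hx F Y).1 hF

theorem transforms_midPt (L : Level a q₀ q D R₁) (hχ : GoodKernel c b 4 χ) (hb : 0 ≤ b)
    {x : Pt} (hx : x ∈ Ball₀ a q R₁) :
    Transforms a q 0 χ (midPt a q₀ R₁ χ x) (midPt a q₀ R₁ χ) x := fun F Y hF => by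
  rw [zero_smul, sub_zero]
  exact (hasHVF_comp hχ hb L.ha L.hq₀ L.hq le_rfl L.small₀ L.small hx F Y).2 hF

/-! ### The remainder of degree six -/

/-- The function `(F ∘ T - F) - (G ∘ m - G)`, where `F`, `G` have kernels `K`, `KQ`, and `m`, `T` are
the implicit midpoint maps with kernel `χ`. -/
def remd (a q₀ R₁ : ℝ) (χ K KQ : Kernel) (x : Pt) : ℂ :=
  (poly K (midMap a q₀ R₁ χ x) - poly K x) - (poly KQ (midPt a q₀ R₁ χ x) - poly KQ x)

theorem isHamiltonian_sub {F F' : Pt → ℂ} (h : IsHamiltonian a q R F)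
    (h' : IsHamiltonian a q R F') : IsHamiltonian a q R fun u => F u - F' u :=
  fun x hx => (h x hx).sub (h' x hx)

theorem isHamiltonian_congr {F F' : Pt → ℂ} (h : IsHamiltonian a q R F)
    (hF : ∀ x ∈ phaseSub a q 0 1, F' x = F x) : IsHamiltonian a q R F' := by
  have : (fun x : Phase a q 0 1 => F' x.val) = fun x => F x.val := funext fun x => hF _ x.val_mem
  unfold IsHamiltonian
  rw [this]
  exact h

theorem isHamiltonian_remd {c' b' : ℝ} (L : Level a q₀ q D R₁) (hχ : GoodKernel c b 4 χ)
    (hb : 0 ≤ b) (hK : GoodKernel c' b' 1 K) (hKQ : GoodKernel c' b' 1 KQ) (hb' : 0 ≤ b')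
    (hR : 0 < R) (hRR : R ≤ R₁) : IsHamiltonian a q R (remd a q₀ R₁ χ K KQ) := by
  have h1 := (isHamiltonian_comp hχ hb L.ha L.hq₀ L.hq hR hRR L.small₀ L.small
    (analyticAt_poly hK hb' L.ha L.hq')).1
  have h2 := (isHamiltonian_comp hχ hb L.ha L.hq₀ L.hq hR hRR L.small₀ L.small
    (analyticAt_poly hKQ hb' L.ha L.hq')).2
  exact isHamiltonian_sub (isHamiltonian_sub h1 (isHamiltonian_poly hK hb' L.ha L.hq' R))
    (isHamiltonian_sub h2 (isHamiltonian_poly hKQ hb' L.ha L.hq' R))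

theorem remd_act (L : Level a q₀ q D R₁) (hχ : GoodKernel c b 4 χ) (hb : 0 ≤ b) {θ : ℤ → ℝ}
    (hθ : Commutes θ χ) (hK : Commutes θ K) (hKQ : Commutes θ KQ) {x : Pt}
    (hx : x ∈ Ball₀ a q R₁) : remd a q₀ R₁ χ K KQ (act θ x) = remd a q₀ R₁ χ K KQ x := by
  have hx₀ : x ∈ Ball₀ a q₀ R₁ := Ball_subset L.hq le_rfl le_rfl hx
  obtain ⟨h1, h2⟩ := mid_act hχ hb L.ha L.hq₀ L.small₀ hθ hx₀
  rw [remd, h1, h2, poly_act hK, poly_act hK, poly_act hKQ, poly_act hKQ, remd]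

theorem gaugeMeanZero_remd {c' b' : ℝ} (L : Level a q₀ q D R₁) (hχ : GoodKernel c b 4 χ)
    (hb : 0 ≤ b) (hK : GoodKernel c' b' 1 K) (hKQ : GoodKernel c' b' 1 KQ) (hb' : 0 ≤ b')
    (hθ : ∀ α, Commutes (fun _ => α) χ)
    (h : ∀ k₁ k₂ k₃ k₄, K k₁ k₂ k₃ k₄ ≠ 0 → charge k₁ k₂ k₃ k₄ ≠ 0)
    (hQ : ∀ k₁ k₂ k₃ k₄, KQ k₁ k₂ k₃ k₄ ≠ 0 → charge k₁ k₂ k₃ k₄ ≠ 0) {x : Pt}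
    (hx : x ∈ Ball₀ a q R₁) : GaugeMeanZero (remd a q₀ R₁ χ K KQ) x := by
  have hx₀ : x ∈ Ball₀ a q₀ R₁ := Ball_subset L.hq le_rfl le_rfl hx
  have hm := fun α => mid_act hχ hb L.ha L.hq₀ L.small₀ (hθ α) hx₀
  obtain ⟨b1, b2, -, -⟩ := mid_bounds L hχ hb le_rfl hx ⟨hx.1, hx.2.le⟩
  have g1 := fun {y : Pt} (hy : y ∈ phaseSub a q 0 1) => gaugeMeanZero_poly hK hb' L.ha L.hq' h hy
  have g2 := fun {y : Pt} (hy : y ∈ phaseSub a q 0 1) => gaugeMeanZero_poly hKQ hb' L.ha L.hq' hQ hy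
  exact (((g1 b2.1).comp fun α => (hm α).2).sub (g1 hx.1)).sub
    (((g2 b1.1).comp fun α => (hm α).1).sub (g2 hx.1))

theorem hvf_remd (L : Level a q₀ q D R₁) (hχ : GoodKernel c b 4 χ) (hb : 0 ≤ b)
    (hK : GoodKernel c b 1 K) (hKQ : GoodKernel c b 1 KQ) (hRR : R ≤ R₁) {x : Pt}
    (hx : x ∈ Ball₀ a q R) :
    NormLE a q b c (hamVF (remd a q₀ R₁ χ K KQ) x) (2304 * D ^ 2 * R ^ 5) := by
  have hx₁ : x ∈ Ball₀ a q R₁ := ⟨hx.1, hx.2.trans_le hRR⟩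
  have hxR : NormLE₀ a q x R := ⟨hx.1, hx.2.le⟩
  have hR := L.of_le hxR.nonneg hRR
  obtain ⟨b1, b2, b3, b4⟩ := mid_bounds L hχ hb hRR hx₁ hxR
  obtain ⟨V, hV, hVn⟩ := hvf_comp_sub hχ hK hb L.ha L.hq' L.hD hxR.nonneg hR (by simp)
    (transforms_midMap L hχ hb hx₁) b1 b2 hxR (b3.beta_zero 1 hb)
  obtain ⟨V', hV', hVn'⟩ := hvf_comp_sub hχ hKQ hb L.ha L.hq' L.hD hxR.nonneg hR (by simp)
    (transforms_midPt L hχ hb hx₁) b1 b1 hxR (b4.beta_zero 1 hb)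
  have h := hV.sub L.ha (by linarith [L.hq']) hV'
  have e : hamVF (remd a q₀ R₁ χ K KQ) x = V - V' := h.hamVF_eq
  rw [e]
  exact (hVn.sub hVn').mono (le_of_eq (by ring))

/-- Both `T` and `m` move `x` by `O(‖x‖³)`, and a quartic polynomial changes by `O(‖x‖³)` times the
displacement. The estimates are used with `r` equal to the norm of `x` rather than the radius of the
ball. -/
theorem norm_remd_le (L : Level a q₀ q D R₁) (hχ : GoodKernel c b 4 χ) (hb : 0 ≤ b)
    (hK : GoodKernel c b 1 K) (hKQ : GoodKernel c b 1 KQ) {x : Pt} (hx : x ∈ Ball₀ a q R₁) :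
    ‖remd a q₀ R₁ χ K KQ x‖ ≤ 512 * D ^ 2 * phaseNorm₀ a q x ^ 6 := by
  have hxn := normLE_self hx.1
  set r := phaseNorm₀ a q x with hr
  have hr0 : 0 ≤ r := hxn.nonneg
  obtain ⟨b1, b2, b3, b4⟩ := mid_bounds L hχ hb hx.2.le hx hxn
  have hx2 := hxn.mono (show r ≤ 2 * r by linarith)
  have h1 := norm_poly_sub_le hK hb L.ha L.hq' b2 hx2 (b3.beta_zero 1 hb)
  have h2 := norm_poly_sub_le hKQ hb L.ha L.hq' b1 hx2 (b4.beta_zero 1 hb)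
  have hD := L.hD
  have h0 := L.one_le
  have e : triConst q * 1 * (2 * r) ^ 3 * (32 * D * r ^ 3) ≤
      D * 1 * (2 * r) ^ 3 * (32 * D * r ^ 3) := by gcongr
  rw [remd]
  calc _ ≤ _ + _ := norm_sub_le _ _
    _ ≤ D * 1 * (2 * r) ^ 3 * (32 * D * r ^ 3) + D * 1 * (2 * r) ^ 3 * (32 * D * r ^ 3) :=
      add_le_add (h1.trans e) (h2.trans e)
    _ = _ := by ring

end

/-! ### Comparison of the Klein-Gordon and NLS maps and remainders -/

section
variable {a p D R R₁ r h : ℝ} {χ χ' : Kernel}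

/-- Subtracting the midpoint equations, `2(m - m')` is `X_χ(m) - X_χ(m')`, which is absorbed at
regularity `p - 4`, plus the field of `χ - χ'` at `m'`, which is `O(h)` there. Since `T x = 2m - x`,
the maps differ by twice as much as the midpoints. -/
theorem mid_sub_mid (L : Level a (p - 4) p D R₁) (hχ : GoodKernel 1 0 4 χ)
    (hχ' : GoodKernel 1 0 4 χ')
    (hΔ : KernelBound (fun j => ww 1 j ^ (0 : ℝ)) 4 h (χ - χ')) (hh : 0 ≤ h) (hrR : r ≤ R₁) {x : Pt}
    (hx : x ∈ Ball₀ a p R₁) (hxr : NormLE₀ a p x r) :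
    NormLE₀ a (p - 4) (midPt a (p - 4) R₁ χ x - midPt a (p - 4) R₁ χ' x) (16 * D * h * r ^ 3) ∧
    NormLE₀ a (p - 4) (midMap a (p - 4) R₁ χ x - midMap a (p - 4) R₁ χ' x)
      (16 * D * h * r ^ 3) := by
  have hr := hxr.nonneg
  have hR := L.of_le hr hrR
  have hpq := L.hq
  obtain ⟨b1, -, -, -⟩ := mid_bounds L hχ le_rfl hrR hx hxr
  obtain ⟨b1', -, -, -⟩ := mid_bounds L hχ' le_rfl hrR hx hxr
  have e := mid_eq L hχ le_rfl hx
  have e' := mid_eq L hχ' le_rfl hx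
  set m := midPt a (p - 4) R₁ χ x
  set m' := midPt a (p - 4) R₁ χ' x
  have eT : midMap a (p - 4) R₁ χ x = m + (1 / 2 : ℂ) • vf χ m m m := rfl
  have eT' : midMap a (p - 4) R₁ χ' x = m' + (1 / 2 : ℂ) • vf χ' m' m' m' := rfl
  have e2 : m = x + (1 / 2 : ℂ) • vf χ m m m := eq_add_of_sub_eq e.symm
  have e3 : m' = x + (1 / 2 : ℂ) • vf χ' m' m' m' := eq_add_of_sub_eq e'.symm
  have e1 : m - m' = (1 / 2 : ℂ) • ((vf χ m m m - vf χ m' m' m') + vf (χ - χ') m' m' m') := by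
    rw [vf_sub_kernel hχ hχ' L.ha L.hq' b1'.1 b1'.1 b1'.1]
    have e4 : m - m' = (x + (1 / 2 : ℂ) • vf χ m m m) - (x + (1 / 2 : ℂ) • vf χ' m' m' m') := by
      rw [← e2, ← e3]
    rw [e4]; module
  have hs := normLE_vf_small hΔ hh L.ha (by linarith [L.hq₀]) L.hD b1' b1' b1'
  have h2 : ‖(1 / 2 : ℂ)‖ = 1 / 2 := by norm_num
  have key : NormLE₀ a (p - 4) (m - m') (2 * (4 * D * h * r ^ 3)) := by
    refine NormLE.absorb ((b1.sub b1').q_mono hpq).1 fun z hz => ?_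
    have h1 := normLE_vf_diff hχ L.ha L.hq₀ L.hD₀ (b1.q_mono hpq) (b1'.q_mono hpq) hz
    rw [e1]
    refine ((h1.add hs).smul _).mono ?_
    rw [h2]
    have := hz.nonneg
    nlinarith
  have hpos : 0 ≤ D * h * r ^ 3 := by
    have := L.one_le
    positivity
  refine ⟨key.mono (by linarith), ?_⟩
  have e5 : midMap a (p - 4) R₁ χ x - midMap a (p - 4) R₁ χ' x = (2 : ℂ) • (m - m') := by
    rw [eT, eT']
    have f2 : (1 / 2 : ℂ) • vf χ m m m = m - x := (sub_eq_iff_eq_add'.2 e2).symm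
    have f3 : (1 / 2 : ℂ) • vf χ' m' m' m' = m' - x := (sub_eq_iff_eq_add'.2 e3).symm
    rw [f2, f3]; module
  rw [e5]
  refine (key.smul _).mono ?_
  norm_num
  linarith

/-- The difference of two remainders. -/
theorem hvf_remd_sub (L : Level a (p - 4) p D R₁) (hχ : GoodKernel 1 0 4 χ)
    (hχ' : GoodKernel 1 0 4 χ')
    (hΔ : KernelBound (fun j => ww 1 j ^ (0 : ℝ)) 4 h (χ - χ')) (hh : 0 ≤ h)
    {K K₁ K₂ K₃ Q Q₁ Q₂ Q₃ : Kernel} (hK : GoodKernel 1 0 1 K) (hK₁ : GoodKernel 1 0 1 K₁)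
    (hK₂ : GoodKernel 1 0 1 K₂) (hK₃ : GoodKernel 1 0 1 K₃)
    (hQ : GoodKernel 1 0 1 Q) (hQ₁ : GoodKernel 1 0 1 Q₁)
    (hQ₂ : GoodKernel 1 0 1 Q₂) (hQ₃ : GoodKernel 1 0 1 Q₃) (hKs : K = K₁ + K₃) (hQs : Q = Q₁ + Q₃)
    (hKΔ : KernelBound (fun j => ww 1 j ^ (0 : ℝ)) 4 h (K₁ - K₂))
    (hQΔ : KernelBound (fun j => ww 1 j ^ (0 : ℝ)) 4 h (Q₁ - Q₂)) (hRR : R ≤ R₁) {x : Pt}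
    (hx : x ∈ Ball₀ a p R) :
    NormLE₀ a (p - 4) (hamVF (fun u => remd a (p - 4) R₁ χ K Q u - remd a (p - 4) R₁ χ' K₂ Q₂ u -
      remd a (p - 4) R₁ χ' K₃ Q₃ u) x) (4864 * D ^ 2 * h * R ^ 5) := by
  have hx₁ : x ∈ Ball₀ a p R₁ := ⟨hx.1, hx.2.trans_le hRR⟩
  have hxR : NormLE₀ a p x R := ⟨hx.1, hx.2.le⟩
  have hR := L.of_le hxR.nonneg hRR
  have hp : 9 / 2 < p := by linarith [L.hq₀]
  have hD0 : 0 ≤ D := by linarith [L.one_le]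
  have hp0 : 0 ≤ p := by linarith
  obtain ⟨b1, b2, b3, b4⟩ := mid_bounds L hχ le_rfl hRR hx₁ hxR
  obtain ⟨b1', b2', b3', b4'⟩ := mid_bounds L hχ' le_rfl hRR hx₁ hxR
  obtain ⟨d1, d2⟩ := mid_sub_mid L hχ hχ' hΔ hh hRR hx₁ hxR
  have t := transforms_midMap L hχ le_rfl hx₁
  have t' := transforms_midMap L hχ' le_rfl hx₁
  have u := transforms_midPt L hχ le_rfl hx₁
  have u' := transforms_midPt L hχ' le_rfl hx₁
  -- As `K = K₁ + K₃`, the difference is a change of generator `χ → χ'` for `K` (`V₁`) plus a change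
  -- of polynomial `K₁ → K₂` for the fixed generator `χ'` (`V₂`). The same is done for `Q` with the
  -- midpoints (`W₁`, `W₂`). The constants add up to `2 (1280 + 1152)`.
  obtain ⟨V₁, hV₁, n₁⟩ := hvf_comp_sub_comp hχ hχ' hK hΔ hh L.ha hp hD0 L.hD L.hD₀ hxR.nonneg hR
    (by simp) t t' b1 b1' b2 b2' d1 d2
  obtain ⟨V₂, hV₂, n₂⟩ := hvf_comp_sub_of_close hχ' hK₁ hK₂ hKΔ hh L.ha hp L.hD L.hD₀ hxR.nonneg hR
    (by simp) t' b1' b2' hxR b3'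
  obtain ⟨W₁, hW₁, o₁⟩ := hvf_comp_sub_comp hχ hχ' hQ hΔ hh L.ha hp hD0 L.hD L.hD₀ hxR.nonneg hR
    (by simp) u u' b1 b1' b1 b1' d1 d1
  obtain ⟨W₂, hW₂, o₂⟩ := hvf_comp_sub_of_close hχ' hQ₁ hQ₂ hQΔ hh L.ha hp L.hD L.hD₀ hxR.nonneg hR
    (by simp) u' b1' b1' hxR b4'
  have hsum := (hV₁.add L.ha hp0 hV₂).sub L.ha hp0 (hW₁.add L.ha hp0 hW₂)
  have hsum' := hsum.congr_ball (F' := fun u => remd a (p - 4) R₁ χ K Q u -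
    remd a (p - 4) R₁ χ' K₂ Q₂ u - remd a (p - 4) R₁ χ' K₃ Q₃ u) hx fun y hy => by
      have hy₁ : y ∈ Ball₀ a p R₁ := ⟨hy.1, hy.2.trans_le hRR⟩
      obtain ⟨c1, c2, -, -⟩ := mid_bounds L hχ' le_rfl hRR hy₁ ⟨hy.1, hy.2.le⟩
      have f1 : ∀ {w : Pt}, w ∈ phaseSub a p 0 1 → poly K w = poly K₁ w + poly K₃ w := fun hw => by
        rw [hKs]; exact poly_add_kernel hK₁ hK₃ le_rfl le_rfl L.ha L.hq' hw
      have f2 : ∀ {w : Pt}, w ∈ phaseSub a p 0 1 → poly Q w = poly Q₁ w + poly Q₃ w := fun hw => by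
        rw [hQs]; exact poly_add_kernel hQ₁ hQ₃ le_rfl le_rfl L.ha L.hq' hw
      simp only [remd]
      rw [f1 hy.1, f1 c2.1, f2 hy.1, f2 c1.1]
      ring
  rw [hsum'.hamVF_eq]
  exact ((n₁.add n₂).sub (o₁.add o₂)).mono (le_of_eq (by ring))

end

end KGNormalForm
end

noncomputable section
namespace KGNormalForm
open scoped ENNReal

section
variable {a q₀ q b c D N R R₁ : ℝ} {J : Finset ℤ} {P : QuadPred} {v : ℤ → ℝ}

/-! ### The normal form identities -/

theorem diagHam_midMap {φ : ℤ → ℝ} {M : ℝ} (L : Level a q₀ q D R₁) (hP : SymmPred P)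
    (hχ : GoodKernel c b 4 (chi v P φ)) (hb : 0 ≤ b)
    (hd : ∀ k₁ k₂ k₃ k₄, mom k₁ k₂ k₃ k₄ = 0 → P k₁ k₂ k₃ k₄ → divisor φ k₁ k₂ k₃ k₄ ≠ 0)
    (hM : 0 ≤ M) (hK : KernelBound (fun j => jap j ^ (-(1 / 2) : ℝ)) (1 / 2) M
      (mulFst φ (chi v P φ))) {x : Pt} (hx : x ∈ Ball₀ a q R₁)
    (hs₁ : Summable fun j => (φ j : ℂ) * (x.1 j * x.2 j))
    (hs₂ : Summable fun j => (φ j : ℂ) * ((midMap a q₀ R₁ (chi v P φ) x).1 j *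
      (midMap a q₀ R₁ (chi v P φ) x).2 j)) :
    diagHam φ (midMap a q₀ R₁ (chi v P φ) x) =
      diagHam φ x - poly (ker v P) (midPt a q₀ R₁ (chi v P φ) x) := by
  obtain ⟨b1, -, -, -⟩ := mid_bounds L hχ hb hx.2.le hx (normLE_self hx.1)
  have e := mid_eq L hχ hb hx
  set m := midPt a q₀ R₁ (chi v P φ) x
  have eT : midMap a q₀ R₁ (chi v P φ) x = m + (1 / 2 : ℂ) • vf (chi v P φ) m m m := rfl
  rw [eT] at hs₂ ⊢
  rw [e] at hs₁
  have := diagHam_midpoint hP hd hM hK L.ha L.hq' b1.1 hs₂ hs₁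
  rw [this, ← e]

theorem abs_lam_le (hc : 1 ≤ c) (j : ℤ) : |lam c j| ≤ c * (c + 1) * jap j := by
  have h1 : 1 ≤ jap j := le_max_left _ _
  have h2 : |(j : ℝ)| ≤ jap j := le_max_right _ _
  have h3 : √((j : ℝ) ^ 2 + c ^ 2) ≤ |(j : ℝ)| + c := by
    refine Real.sqrt_le_iff.2 ⟨by positivity, ?_⟩
    have := abs_nonneg (j : ℝ)
    nlinarith [sq_abs (j : ℝ)]
  rw [lam, abs_of_nonneg (by positivity), mul_assoc]
  gcongr
  nlinarith

theorem summable_Lam (hc : 1 ≤ c) (ha : 0 ≤ a) (hq : 1 / 2 < q) {x : Pt}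
    (hx : x ∈ phaseSub a q 0 1) : Summable fun j => (lam c j : ℂ) * (x.1 j * x.2 j) := by
  refine summable_diagHam ha (C := c * (c + 1)) (by positivity) (fun j => ?_) hx
  refine (abs_lam_le hc j).trans ?_
  have h1 : 1 ≤ jap j := le_max_left _ _
  have h2 := Real.rpow_le_rpow_of_exponent_le h1 (show (1 : ℝ) ≤ 2 * q by linarith)
  rw [Real.rpow_one] at h2
  gcongr

theorem nlsDefined_of_mem (ha : 0 ≤ a) (hq : 1 ≤ q) {x : Pt} (hx : x ∈ phaseSub a q 0 1) :
    NLSDefined x := by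
  refine summable_diagHam ha (C := 1) zero_le_one (fun j => ?_) hx
  have h1 : 1 ≤ jap j := le_max_left _ _
  have h2 : |(j : ℝ)| ≤ jap j := le_max_right _ _
  have h3 := Real.rpow_le_rpow_of_exponent_le h1 (show (2 : ℝ) ≤ 2 * q by linarith)
  rw [Real.rpow_two] at h3
  rw [lamNLS, abs_of_nonneg (by positivity), one_mul]
  refine le_trans ?_ h3
  nlinarith [sq_abs (j : ℝ), abs_nonneg (j : ℝ)]

theorem nlsDefined_midMap (L : Level a q₀ q D R₁) (hN : 0 ≤ N) (hJ : ∀ j ∈ J, |(j : ℝ)| ≤ N)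
    (hq : 1 ≤ q) {x : Pt} (hx : x ∈ Ball₀ a q R₁) :
    NLSDefined (midMap a q₀ R₁ (chiNLS J) x) :=
  nlsDefined_of_mem L.ha hq
    (mid_bounds L (goodKernel_chiNLS hN hJ) le_rfl hx.2.le hx (normLE_self hx.1)).2.1.1

theorem poly_ker_add {P₁ P₂ : QuadPred} (hv : ∀ P : QuadPred, SymmPred P → GoodKernel c b 1 (ker v P))
    (hb : 0 ≤ b) (ha : 0 ≤ a) (hq : 1 / 2 < q) (hP₁ : SymmPred P₁) (hP₂ : SymmPred P₂)
    (h : ∀ k₁ k₂ k₃ k₄, P k₁ k₂ k₃ k₄ ↔ (P₁ k₁ k₂ k₃ k₄ ∨ P₂ k₁ k₂ k₃ k₄))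
    (h' : ∀ k₁ k₂ k₃ k₄, P₁ k₁ k₂ k₃ k₄ → ¬P₂ k₁ k₂ k₃ k₄) {x : Pt} (hx : x ∈ phaseSub a q 0 1) :
    poly (ker v P) x = poly (ker v P₁) x + poly (ker v P₂) x := by
  rw [ker_add h h', poly_add_kernel (hv _ hP₁) (hv _ hP₂) hb hb ha hq hx]

theorem poly_split (hv : ∀ P : QuadPred, SymmPred P → GoodKernel c b 1 (ker v P)) (hb : 0 ≤ b)
    (ha : 0 ≤ a) (hq : 1 / 2 < q) (J : Finset ℤ) {x : Pt} (hx : x ∈ phaseSub a q 0 1) :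
    poly (ker v every) x =
      poly (ker v (res J)) x + poly (ker v (nonres J)) x + poly (ker v (avoids J)) x := by
  rw [poly_ker_add hv hb ha hq (symmPred_meets J) (symmPred_avoids J)
    (fun _ _ _ _ => by unfold avoids every; tauto) (fun _ _ _ _ h h' => h' h) hx,
    poly_ker_add hv hb ha hq (symmPred_res J) (symmPred_nonres J)
    (fun _ _ _ _ => by unfold res nonres; rw [← and_or_left]; simp only [em, and_true]) (fun _ _ _ _ h h' => h'.2 h.2) hx]

/-- Paired quadruples have charge zero, so the resonant part is the same before and after
restriction to zero charge. -/
theorem poly_neutral_split (hv : ∀ P : QuadPred, SymmPred P → GoodKernel c b 1 (ker v P))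
    (hb : 0 ≤ b) (ha : 0 ≤ a) (hq : 1 / 2 < q) (J : Finset ℤ) {x : Pt}
    (hx : x ∈ phaseSub a q 0 1) :
    poly (ker v (neutral every)) x = poly (ker v (res J)) x +
      poly (ker v (neutral (nonres J))) x + poly (ker v (neutral (avoids J))) x := by
  rw [poly_ker_add hv hb ha hq (symmPred_meets J).neutral (symmPred_avoids J).neutral
    (fun _ _ _ _ => by unfold neutral avoids every; tauto) (fun _ _ _ _ h h' => h'.2 h.2) hx,
    poly_ker_add hv hb ha hq (symmPred_res J) (symmPred_nonres J).neutral
    (fun k₁ k₂ k₃ k₄ => by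
      have := @charge_of_paired k₁ k₂ k₃ k₄
      unfold neutral res nonres; tauto) (fun _ _ _ _ h h' => h'.2.2 h.2) hx]

/-- With `P` the whole quartic part and `Q` the nonresonant one, `P(T x) - Q(m) = (P - Q)(x) +
remd(x)`. By `poly_split`, `P - Q` is the resonant part plus the part avoiding `J`. -/
theorem HKG_midMap (L : Level a q₀ q D R₁) (hN : 0 ≤ N) (hJ : ∀ j ∈ J, |(j : ℝ)| ≤ N)
    (hc : 2 * (N + 2) ≤ c) {x : Pt} (hx : x ∈ Ball₀ a q R₁) :
    HKG c (midMap a q₀ R₁ (chiKG J c) x) = Lam c x + LamPlus J (c ^ 2)⁻¹ x +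
      poly (ker (vc c) (avoids J)) x +
      remd a q₀ R₁ (chiKG J c) (ker (vc c) every) (ker (vc c) (nonres J)) x := by
  have hχ := goodKernel_chiKG hN hJ hc
  have hc1 : 1 ≤ c := by linarith
  obtain ⟨-, b2, -, -⟩ := mid_bounds L hχ zero_le_one hx.2.le hx (normLE_self hx.1)
  have h := diagHam_midMap (v := vc c) L (symmPred_nonres J) hχ zero_le_one
    (fun k₁ k₂ k₃ k₄ hm h h0 => by
      have := quarter_le_divisor hN hJ hc hm h
      rw [h0, abs_zero] at this
      linarith) (by positivity) (kernelBound_mulFst_chiKG hN hJ hc) hx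
    (summable_Lam hc1 L.ha L.hq' hx.1) (summable_Lam hc1 L.ha L.hq' b2.1)
  have e := LamPlus_eq (c := c) J L.ha L.hq' hx.1
  have e1 : poly (ker (vc c) every) x = poly (ker (vc c) (res J)) x +
      poly (ker (vc c) (nonres J)) x + poly (ker (vc c) (avoids J)) x :=
    poly_split (fun P => goodKernel_ker_vc c) zero_le_one L.ha L.hq' J hx.1
  rw [HKG_eq L.ha L.hq' c b2.1, e, remd]
  change diagHam (lam c) _ + _ = diagHam (lam c) x + _ + _ + _
  rw [show diagHam (lam c) (midMap a q₀ R₁ (chiKG J c) x) = _ from h, e1]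
  unfold chiKG
  ring

theorem HNLS_midMap (L : Level a q₀ q D R₁) (hN : 0 ≤ N) (hJ : ∀ j ∈ J, |(j : ℝ)| ≤ N)
    {x : Pt} (hx : x ∈ Ball₀ a q R₁) (hs₁ : NLSDefined x)
    (hs₂ : NLSDefined (midMap a q₀ R₁ (chiNLS J) x)) :
    HNLS (midMap a q₀ R₁ (chiNLS J) x) = LamNLS x + LamPlusNLS J x +
      poly (ker v₁ (neutral (avoids J))) x +
      remd a q₀ R₁ (chiNLS J) (ker v₁ (neutral every)) (ker v₁ (neutral (nonres J))) x := by
  have hχ := goodKernel_chiNLS hN hJ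
  obtain ⟨-, b2, -, -⟩ := mid_bounds L hχ le_rfl hx.2.le hx (normLE_self hx.1)
  have h := diagHam_midMap (v := v₁) L (symmPred_nonres J).neutral hχ le_rfl
    (fun k₁ k₂ k₃ k₄ hm h h0 => by
      have := (divisor_lamNLS hN hJ (neutral_of hm h.1 h.2.1 h.2.2)).1
      rw [h0, abs_zero] at this
      linarith) (by positivity) (kernelBound_mulFst_chiNLS hN hJ) hx hs₁ hs₂
  have e := LamPlusNLS_eq J L.ha L.hq' hx.1
  have e1 := poly_neutral_split (v := v₁) (fun P => goodKernel_ker_one) le_rfl L.ha L.hq' J hx.1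
  rw [HNLS_eq L.ha L.hq' b2.1, e, remd]
  change diagHam lamNLS _ + _ = diagHam lamNLS x + _ + _ + _
  rw [show diagHam lamNLS (midMap a q₀ R₁ (chiNLS J) x) = _ from h, e1]
  unfold chiNLS
  ring

end

end KGNormalForm
end

noncomputable section
namespace KGNormalForm
open scoped ENNReal

section
variable {a q₀ q b c D R R₁ : ℝ} {P : QuadPred} {v : ℤ → ℝ} {K K' : Kernel}

/-! ### Symmetries of the kernels -/

theorem of_ker_ne_zero {k₁ k₂ k₃ k₄ : Idx} (h : ker v P k₁ k₂ k₃ k₄ ≠ 0) :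
    mom k₁ k₂ k₃ k₄ = 0 ∧ P k₁ k₂ k₃ k₄ := by
  by_contra h'
  exact h (ker_of_not h')

theorem of_chi_ne_zero {φ : ℤ → ℝ} {k₁ k₂ k₃ k₄ : Idx} (h : chi v P φ k₁ k₂ k₃ k₄ ≠ 0) :
    mom k₁ k₂ k₃ k₄ = 0 ∧ P k₁ k₂ k₃ k₄ := by
  refine of_ker_ne_zero (v := v) fun h' => h ?_
  rw [chi, h', mul_zero, zero_div]

theorem commutes_transl_ker (v : ℤ → ℝ) (P : QuadPred) (α : ℝ) :
    Commutes (fun j => j * α) (ker v P) :=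
  commutes_transl (fun _ _ _ _ h => (of_ker_ne_zero h).1) α

theorem commutes_transl_chi (v : ℤ → ℝ) (P : QuadPred) (φ : ℤ → ℝ) (α : ℝ) :
    Commutes (fun j => j * α) (chi v P φ) :=
  commutes_transl (fun _ _ _ _ h => (of_chi_ne_zero h).1) α

theorem commutes_gauge_ker (v : ℤ → ℝ) (hP : ∀ k₁ k₂ k₃ k₄, P k₁ k₂ k₃ k₄ → charge k₁ k₂ k₃ k₄ = 0)
    (α : ℝ) : Commutes (fun _ => α) (ker v P) :=
  commutes_gauge (fun _ _ _ _ h => hP _ _ _ _ (of_ker_ne_zero h).2) α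

theorem commutes_gauge_chi (v : ℤ → ℝ) (φ : ℤ → ℝ)
    (hP : ∀ k₁ k₂ k₃ k₄, P k₁ k₂ k₃ k₄ → charge k₁ k₂ k₃ k₄ = 0) (α : ℝ) :
    Commutes (fun _ => α) (chi v P φ) :=
  commutes_gauge (fun _ _ _ _ h => hP _ _ _ _ (of_chi_ne_zero h).2) α

theorem translInvariantOn_of_poly {F : Pt → ℂ} (hF : ∀ x ∈ phaseSub a q 0 1, F x = poly K x)
    (hK : ∀ α : ℝ, Commutes (fun j => j * α) K) : TranslInvariantOn (Ball₀ a q R) F :=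
  fun α x hx => by
    rw [translFlow_eq, hF _ (act_mem_phaseSub _ hx.1), poly_act (hK α), hF _ hx.1]

theorem gaugeInvariantOn_of_poly {F : Pt → ℂ} (hF : ∀ x ∈ phaseSub a q 0 1, F x = poly K x)
    (hK : ∀ α : ℝ, Commutes (fun _ => α) K) : GaugeInvariantOn (Ball₀ a q R) F :=
  fun α x hx => by
    rw [gaugeFlow_eq, hF _ (act_mem_phaseSub _ hx.1), poly_act (hK α), hF _ hx.1]

/-! ### Vector fields of quartic Hamiltonians -/

theorem hvf_of_poly {F : Pt → ℂ} (L : Level a q₀ q D R₁)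
    (hF : ∀ x ∈ phaseSub a q 0 1, F x = poly K x) (hK : GoodKernel c b 1 K) (hb : 0 ≤ b) {x : Pt}
    (hx : x ∈ Ball₀ a q R) : NormLE a q b c (hamVF F x) (D * R ^ 3) := by
  have h := (hasHVF_poly hK hb L.ha L.hq' hx.1).congr_ball hx fun u hu => hF u hu.1
  have hxR : NormLE₀ a q x R := ⟨hx.1, hx.2.le⟩
  rw [h.hamVF_eq]
  exact (normLE_vf hK L.ha L.hq' L.hD hxR hxR hxR).mono (le_of_eq (by ring))

theorem hvf_of_poly_sub {F : Pt → ℂ} {s h : ℝ} (L : Level a q₀ q D R₁)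
    (hF : ∀ x ∈ phaseSub a q 0 1, F x = poly K x - poly K' x) (hK : GoodKernel 1 0 1 K)
    (hK' : GoodKernel 1 0 1 K')
    (hΔ : KernelBound (fun j => ww 1 j ^ (0 : ℝ)) s h (K - K')) (hh : 0 ≤ h) (hs : 0 ≤ s)
    (hsq : s ≤ q) {x : Pt} (hx : x ∈ Ball₀ a q R) :
    NormLE₀ a (q - s) (hamVF F x) (D * h * R ^ 3) := by
  have hxR : NormLE₀ a q x R := ⟨hx.1, hx.2.le⟩
  have hq := L.hq'
  have e := ((hasHVF_poly hK le_rfl L.ha hq hx.1).sub L.ha (by linarith)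
    (hasHVF_poly hK' le_rfl L.ha hq hx.1)).congr_ball hx fun u hu => hF u hu.1
  rw [e.hamVF_eq, ← vf_sub_kernel hK hK' L.ha hq hx.1 hx.1 hx.1]
  refine (vf_normLE hΔ hh L.ha hs hsq hq hxR hxR hxR).mono ?_
  have hR : 0 ≤ R := hxR.nonneg
  calc triConst q * h * (R * R * R) ≤ D * h * (R * R * R) := by
        gcongr
        exact L.hD
    _ = _ := by ring

theorem norm_poly_le_projPerp {J : Finset ℤ} (L : Level a q₀ q D R₁)
    (hK : GoodKernel c b 1 (ker v P)) (hb : 0 ≤ b)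
    (hP : ∀ k₁ k₂ k₃ k₄, P k₁ k₂ k₃ k₄ → ¬meets J k₁ k₂ k₃ k₄) {x : Pt}
    (hx : x ∈ phaseSub a q 0 1) :
    ‖poly (ker v P) x‖ ≤ D * phaseNorm₀ a q (projPerp J x) ^ 4 := by
  rw [← poly_projPerp hP x]
  have h := norm_poly_le hK hb L.ha L.hq' (projPerp_normLE J hx)
  rw [mul_one] at h
  exact h.trans (mul_le_mul_of_nonneg_right L.hD (by positivity))

end

/-! ### The parameters -/

/-- An admissible common constant for the two levels of regularity. -/
def levelConst (p : ℝ) : ℝ := triConst p + triConst (p - 4) + 1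

theorem one_le_levelConst (p : ℝ) : 1 ≤ levelConst p := by
  have h1 := triConst_nonneg p
  have h2 := triConst_nonneg (p - 4)
  unfold levelConst
  linarith

theorem level_of_mem {p a : ℝ} (hp : 9 / 2 < p) (ha : 0 ≤ a) :
    ∀ q ∈ ({p, p - 4} : Set ℝ),
      Level a (p - 4) q (levelConst p) (1 / (16 * levelConst p)) := by
  have h1 := triConst_nonneg p
  have h2 := triConst_nonneg (p - 4)
  have h3 := one_le_levelConst p
  have h4 : 256 * levelConst p * (1 / (16 * levelConst p)) ^ 2 ≤ 1 := by
    have : 256 * levelConst p * (1 / (16 * levelConst p)) ^ 2 = 1 / levelConst p := by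
      field_simp; norm_num
    rw [this, div_le_one (by linarith)]
    exact h3
  have h5 : triConst (p - 4) ≤ levelConst p := by unfold levelConst; linarith
  have h6 : triConst p ≤ levelConst p := by unfold levelConst; linarith
  rintro q (rfl | rfl)
  · exact ⟨ha, by linarith, by linarith, h5, h6, h3, h4⟩
  · exact ⟨ha, by linarith, le_rfl, h5, h5, h3, h4⟩

theorem exists_bound (J : Finset ℤ) : ∃ N : ℝ, 0 ≤ N ∧ ∀ j ∈ J, |(j : ℝ)| ≤ N :=
  ⟨∑ j ∈ J, |(j : ℝ)|, by positivity, fun j hj =>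
    Finset.single_le_sum (f := fun j : ℤ => |(j : ℝ)|) (fun _ _ => abs_nonneg _) hj⟩

/-- The threshold for `h` keeps the indices of `J` below `c/2`, as the lower bounds on the
Klein-Gordon divisors require. -/
theorem le_of_inv_sq_lt {c N : ℝ} (hN : 0 ≤ N) (hc : 0 < c)
    (h : (c ^ 2)⁻¹ < 1 / (4 * (N + 2) ^ 2)) : 2 * (N + 2) ≤ c := by
  rw [← one_div, one_div_lt_one_div (by positivity) (by positivity)] at h
  nlinarith

end KGNormalForm
end

/-! ### Assembly of the normal forms -/

theorem mainTheorem4 (p a : ℝ) (hp : 9 / 2 < p) (ha : 0 ≤ a) (J : Finset ℤ) (hJ : 3 ≤ J.card) :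
    -- the constant `C` is independent of `h`, `R` and `β`
    ∃ hstar ∈ Set.Ioo (0 : ℝ) 1, ∃ Rstar > (0 : ℝ), ∃ C > (0 : ℝ),
    ∀ R ∈ Set.Ioo (0 : ℝ) Rstar,
    -- the NLS objects do not depend on `h`
    ∃ (TNLS : Pt → Pt) (PhatNLS P0NLS : Pt → ℂ),
      (∀ q ∈ ({p, p - 4} : Set ℝ),
        IsCanonicalMap a q 0 1 R TNLS ∧
        (∀ F ∈ ({LamPlusNLS J, PhatNLS, P0NLS} : Set (Pt → ℂ)),
          IsHamiltonian a q R F ∧ TranslInvariantOn (Ball₀ a q R) F ∧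
          GaugeInvariantOn (Ball₀ a q R) F) ∧
        (∀ x ∈ Ball₀ a q R, NormLE₀ a q (TNLS x - x) (C * R ^ 3)) ∧
        (∀ x ∈ Ball₀ a q R, NormLE₀ a q (hamVF (LamPlusNLS J) x) (C * R ^ 3)) ∧
        (∀ x ∈ Ball₀ a q R, NormLE₀ a q (hamVF P0NLS x) (C * R ^ 5)) ∧
        (∀ x ∈ Ball₀ a q R, NormLE₀ a q (hamVF PhatNLS x) (C * R ^ 3)) ∧
        -- the normal form of NLS, wherever both sides are defined
        (∀ x ∈ Ball₀ a q R, NLSDefined x → NLSDefined (TNLS x) →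
          HNLS (TNLS x) = LamNLS x + LamPlusNLS J x + PhatNLS x + P0NLS x)) ∧
      -- on the ball of `𝒫^{a,p}` both sides are defined
      (∀ x ∈ Ball₀ a p R, NLSDefined x ∧ NLSDefined (TNLS x)) ∧
      ∀ c h : ℝ, 0 < c → h = (c ^ 2)⁻¹ → h < hstar →
      ∃ (T : Pt → Pt) (Phat P0 PhatNG P0NG PhatR P0R : Pt → ℂ),
        (∀ q ∈ ({p, p - 4} : Set ℝ),
          (∀ β ∈ Set.Icc (0 : ℝ) 1, IsCanonicalMap a q β c R T) ∧
          (∀ F ∈ ({LamPlus J h, Phat, P0} : Set (Pt → ℂ)),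
            IsHamiltonian a q R F ∧ TranslInvariantOn (Ball₀ a q R) F) ∧
          (∀ F ∈ ({PhatNG, P0NG, PhatR, P0R} : Set (Pt → ℂ)), IsHamiltonian a q R F) ∧
          -- the normal form of KG
          (∀ x ∈ Ball₀ a q R, HKG c (T x) = Lam c x + LamPlus J h x + Phat x + P0 x) ∧
          -- (a)
          (∀ x ∈ Ball₀ a q R, NormLE a q 1 c (T x - x) (C * R ^ 3)) ∧
          -- (b)
          (∀ x ∈ Ball₀ a q R, NormLE a q 1 c (hamVF (LamPlus J h) x) (C * R ^ 3)) ∧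
          -- (c)
          (∀ x ∈ Ball₀ a q R, ‖Phat x‖ ≤ C * phaseNorm₀ a q (projPerp J x) ^ 4) ∧
          (∀ x ∈ Ball₀ a q R, ‖P0 x‖ ≤ C * phaseNorm₀ a q x ^ 6) ∧
          (∀ x ∈ Ball₀ a q R, Phat x = PhatNLS x + PhatNG x + PhatR x) ∧
          (∀ x ∈ Ball₀ a q R, P0 x = P0NLS x + P0NG x + P0R x) ∧
          (∀ x ∈ Ball₀ a q R, gaugePart PhatNG x = 0) ∧
          (∀ x ∈ Ball₀ a q R, gaugePart P0NG x = 0) ∧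
          (∀ x ∈ Ball₀ a q R, NormLE a q 1 c (hamVF P0 x) (C * R ^ 5)) ∧
          (∀ x ∈ Ball₀ a q R, NormLE₀ a q (hamVF P0NG x) (C * R ^ 5)) ∧
          (∀ x ∈ Ball₀ a q R, NormLE a q 1 c (hamVF Phat x) (C * R ^ 3)) ∧
          (∀ x ∈ Ball₀ a q R, NormLE₀ a q (hamVF PhatNG x) (C * R ^ 3))) ∧
        -- the remainders are `O(h)` from `𝒫^{a,p}` to spaces of lower regularity
        (∀ x ∈ Ball₀ a p R, NormLE₀ a (p - 4) (T x - TNLS x) (C * h * R ^ 3)) ∧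
        (∀ x ∈ Ball₀ a p R,
          NormLE₀ a (p - 2) (hamVF (LamPlus J h - LamPlusNLS J) x) (C * h * R ^ 3)) ∧
        (∀ x ∈ Ball₀ a p R, NormLE₀ a (p - 4) (hamVF P0R x) (C * h * R ^ 5)) ∧
        (∀ x ∈ Ball₀ a p R, NormLE₀ a (p - 4) (hamVF PhatR x) (C * h * R ^ 3)) := by
  obtain ⟨N, hN, hJN⟩ := exists_bound J
  have hL := level_of_mem hp ha
  have hD := one_le_levelConst p
  set D := levelConst p
  set R₁ := 1 / (16 * D) with hR₁
  have hR₁0 : 0 < R₁ := by positivity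
  have hDD : D ≤ D ^ 2 := by nlinarith
  have hp' : p ∈ ({p, p - 4} : Set ℝ) := Set.mem_insert _ _
  have hLp := hL p hp'
  have hχN := goodKernel_chiNLS hN hJN
  have hevery : SymmPred every := symmPred_true
  have hav := symmPred_avoids J
  have hnr := symmPred_nonres J
  have kN : ∀ {P : QuadPred}, SymmPred P → GoodKernel 1 0 1 (ker v₁ P) := goodKernel_ker_one
  -- 5000 exceeds all the constants that occur, the largest being the 4864 of `hvf_remd_sub`.
  refine ⟨1 / (4 * (N + 2) ^ 2), ⟨by positivity, ?_⟩, R₁, hR₁0, 5000 * D ^ 2, by positivity, ?_⟩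
  · rw [div_lt_one (by positivity)]
    nlinarith
  intro R hR
  have hRR : R ≤ R₁ := hR.2.le
  have hR0 := hR.1
  have up : ∀ {q : ℝ} {x : Pt}, x ∈ Ball₀ a q R → x ∈ Ball₀ a q R₁ := fun hx =>
    ⟨hx.1, hx.2.trans hR.2⟩
  have w : ∀ {k y : ℝ}, k ≤ 5000 * D ^ 2 → 0 ≤ y → k * y ≤ 5000 * D ^ 2 * y := fun hk hy =>
    mul_le_mul_of_nonneg_right hk hy
  have hR3 : 0 ≤ R ^ 3 := by positivity
  have hR5 : 0 ≤ R ^ 5 := by positivity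
  have c1 : D ≤ 5000 * D ^ 2 := by linarith
  have c32 : 32 * D ≤ 5000 * D ^ 2 := by linarith
  have c2304 : 2304 * D ^ 2 ≤ 5000 * D ^ 2 := by nlinarith
  -- The maps are built at regularity `p - 4` and with the fixed radius `R₁`, so they do not depend
  -- on `R`, `q` or `β`.
  refine ⟨midMap a (p - 4) R₁ (chiNLS J), poly (ker v₁ (neutral (avoids J))),
    remd a (p - 4) R₁ (chiNLS J) (ker v₁ (neutral every)) (ker v₁ (neutral (nonres J))),
    ?_, ?_, ?_⟩
  · intro q hq
    have L := hL q hq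
    have hLam : ∀ x ∈ phaseSub a q 0 1, LamPlusNLS J x = poly (ker v₁ (res J)) x := fun x hx =>
      LamPlusNLS_eq J ha L.hq' hx
    refine ⟨isCanonicalMap_midMap hχN (realKernel_chi hnr.neutral) le_rfl ha L.hq₀ L.hq le_rfl
      le_rfl hR0 hRR L.small₀ L.small, ?_, fun x hx => ?_, fun x hx => ?_, fun x hx => ?_,
      fun x hx => ?_, fun x hx h1 h2 => HNLS_midMap L hN hJN (up hx) h1 h2⟩
    · rintro F (rfl | rfl | rfl)
      · exact ⟨isHamiltonian_congr (isHamiltonian_poly (kN (symmPred_res J)) le_rfl ha L.hq' R) hLam,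
          translInvariantOn_of_poly hLam (commutes_transl_ker _ _),
          gaugeInvariantOn_of_poly hLam (commutes_gauge_ker _ fun _ _ _ _ h => charge_of_paired h.2)⟩
      · exact ⟨isHamiltonian_poly (kN hav.neutral) le_rfl ha L.hq' R,
          translInvariantOn_of_poly (fun _ _ => rfl) (commutes_transl_ker _ _),
          gaugeInvariantOn_of_poly (fun _ _ => rfl) (commutes_gauge_ker _ fun _ _ _ _ h => h.1)⟩
      · refine ⟨isHamiltonian_remd L hχN le_rfl (kN hevery.neutral) (kN hnr.neutral) le_rfl hR0 hRR,
          fun α x hx => ?_, fun α x hx => ?_⟩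
        · rw [translFlow_eq]
          exact remd_act L hχN le_rfl (commutes_transl_chi _ _ _ α) (commutes_transl_ker _ _ α)
            (commutes_transl_ker _ _ α) (up hx)
        · rw [gaugeFlow_eq]
          exact remd_act L hχN le_rfl (commutes_gauge_chi _ _ (fun _ _ _ _ h => h.1) α)
            (commutes_gauge_ker _ (fun _ _ _ _ h => h.1) α)
            (commutes_gauge_ker _ (fun _ _ _ _ h => h.1) α) (up hx)
    · exact (mid_bounds L hχN le_rfl hRR (up hx) ⟨hx.1, hx.2.le⟩).2.2.1.mono (w c32 hR3)
    · exact (hvf_of_poly L hLam (kN (symmPred_res J)) le_rfl hx).mono (w c1 hR3)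
    · exact (hvf_remd L hχN le_rfl (kN hevery.neutral) (kN hnr.neutral) hRR hx).mono (w c2304 hR5)
    · exact (hvf_of_poly L (fun _ _ => rfl) (kN hav.neutral) le_rfl hx).mono (w c1 hR3)
  · exact fun x hx => ⟨nlsDefined_of_mem ha (by linarith) hx.1,
      nlsDefined_midMap hLp hN hJN (by linarith) (up hx)⟩
  rintro c h hc rfl hh
  have hcN := le_of_inv_sq_lt hN hc hh
  have hh0 : 0 ≤ (c ^ 2)⁻¹ := by positivity
  have hχ := goodKernel_chiKG hN hJN hcN
  have hχ' := hχ.weaken zero_le_one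
  have k : ∀ {P : QuadPred}, SymmPred P → GoodKernel c 1 1 (ker (vc c) P) := goodKernel_ker_vc c
  have k' : ∀ {P : QuadPred}, SymmPred P → GoodKernel 1 0 1 (ker (vc c) P) := fun hP =>
    (k hP).weaken zero_le_one
  have hΔ := kernelBound_chi_sub hN hJN hcN
  have hR3h : 0 ≤ (c ^ 2)⁻¹ * R ^ 3 := by positivity
  have hR5h : 0 ≤ (c ^ 2)⁻¹ * R ^ 5 := by positivity
  have w' : ∀ {k y : ℝ}, k ≤ 5000 * D ^ 2 → 0 ≤ y →
      k * (c ^ 2)⁻¹ * y ≤ 5000 * D ^ 2 * (c ^ 2)⁻¹ * y := fun hk hy => by gcongr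
  -- The non-Gauge parts use the charged Klein-Gordon kernels. In the non-Gauge part of `P₀` they
  -- are composed with the NLS map, which commutes with the Gauge flow, so the Gauge average
  -- vanishes exactly. The parts `P̂^R` and `P₀^R` are defined as what is left.
  refine ⟨midMap a (p - 4) R₁ (chiKG J c), poly (ker (vc c) (avoids J)),
    remd a (p - 4) R₁ (chiKG J c) (ker (vc c) every) (ker (vc c) (nonres J)),
    poly (ker (vc c) (charged (avoids J))),
    remd a (p - 4) R₁ (chiNLS J) (ker (vc c) (charged every)) (ker (vc c) (charged (nonres J))),
    fun u => poly (ker (vc c) (avoids J)) u - poly (ker v₁ (neutral (avoids J))) u -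
      poly (ker (vc c) (charged (avoids J))) u,
    fun u => remd a (p - 4) R₁ (chiKG J c) (ker (vc c) every) (ker (vc c) (nonres J)) u -
      remd a (p - 4) R₁ (chiNLS J) (ker v₁ (neutral every)) (ker v₁ (neutral (nonres J))) u -
      remd a (p - 4) R₁ (chiNLS J) (ker (vc c) (charged every)) (ker (vc c) (charged (nonres J))) u,
    ?_, ?_, ?_, ?_, ?_⟩
  · intro q hq
    have L := hL q hq
    have hLam : ∀ x ∈ phaseSub a q 0 1, LamPlus J (c ^ 2)⁻¹ x = poly (ker (vc c) (res J)) x :=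
      fun x hx => LamPlus_eq J ha L.hq' hx
    have iP := isHamiltonian_poly (k hav) zero_le_one ha L.hq' R
    have iPN := isHamiltonian_poly (kN hav.neutral) le_rfl ha L.hq' R
    have iPG := isHamiltonian_poly (k hav.charged) zero_le_one ha L.hq' R
    have i0 := isHamiltonian_remd L hχ zero_le_one (k hevery) (k hnr) zero_le_one hR0 hRR
    have i0N := isHamiltonian_remd L hχN le_rfl (kN hevery.neutral) (kN hnr.neutral) le_rfl hR0 hRR
    have i0G := isHamiltonian_remd L hχN le_rfl (k hevery.charged) (k hnr.charged) zero_le_one hR0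
      hRR
    refine ⟨fun β hβ => isCanonicalMap_midMap hχ (realKernel_chi hnr) zero_le_one ha L.hq₀ L.hq hβ.1
      hβ.2 hR0 hRR L.small₀ L.small, ?_, ?_, fun x hx => HKG_midMap L hN hJN hcN (up hx),
      fun x hx => ?_, fun x hx => ?_, fun x hx => ?_, fun x hx => ?_, fun x _ => by ring,
      fun x _ => by ring, fun x hx => ?_, fun x hx => ?_, fun x hx => ?_, fun x hx => ?_,
      fun x hx => ?_, fun x hx => ?_⟩
    · rintro F (rfl | rfl | rfl)
      · exact ⟨isHamiltonian_congr (isHamiltonian_poly (k (symmPred_res J)) zero_le_one ha L.hq' R)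
          hLam, translInvariantOn_of_poly hLam (commutes_transl_ker _ _)⟩
      · exact ⟨iP, translInvariantOn_of_poly (fun _ _ => rfl) (commutes_transl_ker _ _)⟩
      · refine ⟨i0, fun α x hx => ?_⟩
        rw [translFlow_eq]
        exact remd_act L hχ zero_le_one (commutes_transl_chi _ _ _ α) (commutes_transl_ker _ _ α)
            (commutes_transl_ker _ _ α) (up hx)
    · rintro F (rfl | rfl | rfl | rfl)
      · exact iPG
      · exact i0G
      · exact isHamiltonian_sub (isHamiltonian_sub iP iPN) iPG
      · exact isHamiltonian_sub (isHamiltonian_sub i0 i0N) i0G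
    · exact (mid_bounds L hχ zero_le_one hRR (up hx) ⟨hx.1, hx.2.le⟩).2.2.1.mono (w c32 hR3)
    · exact (hvf_of_poly L hLam (k (symmPred_res J)) zero_le_one hx).mono (w c1 hR3)
    · exact (norm_poly_le_projPerp L (k hav) zero_le_one (fun _ _ _ _ h => h) hx.1).trans
        (w c1 (by positivity))
    · exact (norm_remd_le L hχ zero_le_one (k hevery) (k hnr) (up hx)).trans
        (w (by nlinarith) (by positivity))
    · exact (gaugeMeanZero_poly (k hav.charged) zero_le_one ha L.hq'
        (fun _ _ _ _ h => (of_ker_ne_zero h).2.1) hx.1).gaugePart_eq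
    · exact (gaugeMeanZero_remd L hχN le_rfl (k hevery.charged) (k hnr.charged) zero_le_one
        (commutes_gauge_chi _ _ fun _ _ _ _ h => h.1) (fun _ _ _ _ h => (of_ker_ne_zero h).2.1)
        (fun _ _ _ _ h => (of_ker_ne_zero h).2.1) (up hx)).gaugePart_eq
    · exact (hvf_remd L hχ zero_le_one (k hevery) (k hnr) hRR hx).mono (w c2304 hR5)
    · exact (hvf_remd L hχN le_rfl (k' hevery.charged) (k' hnr.charged) hRR hx).mono (w c2304 hR5)
    · exact (hvf_of_poly L (fun _ _ => rfl) (k hav) zero_le_one hx).mono (w c1 hR3)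
    · exact (hvf_of_poly L (fun _ _ => rfl) (k' hav.charged) le_rfl hx).mono (w c1 hR3)
  · intro x hx
    exact (mid_sub_mid hLp hχ' hχN hΔ hh0 hRR (up hx) ⟨hx.1, hx.2.le⟩).2.mono
      (w' (by linarith) hR3)
  · intro x hx
    -- No divisors enter `Λ₊`, so only the change `O(h j²)` of the coefficients counts, and two
    -- derivatives suffice.
    refine (hvf_of_poly_sub hLp (fun u hu => ?_) (k' (symmPred_res J)) (kN (symmPred_res J))
      (kernelBound_ker_sub c (res J) le_rfl) hh0 zero_le_two (by linarith) hx).mono (w' c1 hR3)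
    rw [Pi.sub_apply, LamPlus_eq J ha hLp.hq' hu, LamPlusNLS_eq J ha hLp.hq' hu]
  · intro x hx
    exact (hvf_remd_sub hLp hχ' hχN hΔ hh0 (k' hevery) (k' hevery.neutral) (kN hevery.neutral)
      (k' hevery.charged) (k' hnr) (k' hnr.neutral) (kN hnr.neutral) (k' hnr.charged)
      ker_eq_neutral_add_charged ker_eq_neutral_add_charged
      (kernelBound_ker_sub c _ (by norm_num)) (kernelBound_ker_sub c _ (by norm_num)) hRR hx).mono
      (w' (by nlinarith) hR5)
  · intro x hx
    refine (hvf_of_poly_sub hLp (fun u hu => ?_) (k' hav.neutral) (kN hav.neutral)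
      (kernelBound_ker_sub c _ (by norm_num)) hh0 (by norm_num) (by linarith) hx).mono (w' c1 hR3)
    -- The charged part cancels, and what is left is the difference of the zero-charge Klein-Gordon
    -- and NLS polynomials.
    rw [ker_eq_neutral_add_charged (P := avoids J),
      poly_add_kernel (k hav.neutral) (k hav.charged) zero_le_one zero_le_one ha hLp.hq' hu]
    ring
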